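/- **Conventions.** Let $k$ be a field. An $\mathbb S$-module $M$ is a functor from finite sets and bijections to differential $\mathbb Z$-graded $k$-vector spaces, with $d$ of degree $-1$; Koszul signs are used throughout. The composition product is $$(M\circ N)(X)=\bigoplus_{r\ge 0}M(\{1,\dots,r\})\otimes_{\mathbb S_r}\Big(\bigoplus_{X=X_1\amalg\dots\amalg X_r}N(X_1)\otimes\dots\otimes N(X_r)\Big),$$ with unit $I$, and the infinitesimal composite is $(M\circ_1 N)(X)=\bigoplus_{U\subseteq X}M((X\setminus U)\amalg\{*\})\otimes N(U)$. An operad is a monoid for $\circ$, and an algebra over an operad $\mathcal O$ is a dg $\mathbb S$-module $A$ concentrated on the empty set with an associative and unital action $\mathcal O\circ A\to A$. Quadratic data $(V,R)$ consist of a dg $\mathbb S$-module $V$ and a dg sub-$\mathbb S$-module $R\subseteq V\circ_1V$. The quadratic operad is $\mathcal O=F(V)/(R)$, where $F(V)$ is the free operad. Its Koszul dual cooperad $\mathcal O^¡$ is the largest sub-cooperad of the cofree conilpotent cooperad on the suspension $sV$ whose part of weight $2$ lies in $s^2R$. The natural twisting morphism $\kappa:\mathcal O^¡\to\mathcal O$,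 of degree $-1$, is $sV\cong V$ in weight $1$ and zero in the other weights. For a right $\mathcal O^¡$-comodule $M$ (used through its infinitesimal coaction $M\to M\circ_1\mathcal O^¡$) and an $\mathbb S$-module $A$ with a left action of $\mathcal O$, the twisted composite $M\circ_\kappa A$ is $M\circ A$ with the differential $d_{M\circ A}+d_\kappa$, where $d_\kappa$ is the composite $$M\circ A\to(M\circ_1\mathcal O^¡)\circ A\xrightarrow{\ \kappa\ }(M\circ_1\mathcal O)\circ A\cong M\circ(A;\mathcal O\circ A)\to M\circ A .$$ The operad $\mathcal O$ is Koszul if the Koszul complex $\mathcal O^¡\circ_\kappa\mathcal O$ is quasi-isomorphic to $I$. The bar complex of an $\mathcal O$-algebra $A$ is $B_{\mathcal O}(A)=\mathcal O^¡\circ_\kappa A$. For a cooperad $\mathcal D$ and an $\mathbb S$-module $\mathcal B$, the free right $\mathcal D$-comodule on $\mathcal B$ is $\mathcal B\circ\mathcal D$, with the coaction induced by the decomposition of $\mathcal D$. **Theorem.** Let $\mathcal O=F(V)/(R)$ and $\mathcal P=F(V')/(R')$ be Koszul quadratic operads, with $\mathcal C=\mathcal O^¡$, $\mathcal D=\mathcal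 P^¡$ and natural twisting morphisms $\kappa:\mathcal C\to\mathcal O$, $\kappa':\mathcal D\to\mathcal P$. Let $f:\mathcal O\to\mathcal P$ be the map of operads induced by a map of dg $\mathbb S$-modules $V\to V'$ that carries $R$ into $R'$, and let $g:\mathcal C\to\mathcal D$ be the induced map of Koszul dual cooperads. Let $A$ be a $\mathcal P$-algebra and let $f^*A$ be $A$ regarded as an $\mathcal O$-algebra along $f$. 1. There is an isomorphism of $\mathbb S$-modules with differential $$B_{\mathcal O}(f^*A)\;\cong\;g^*\mathcal C\circ_{\kappa'}A,$$ where $g^*\mathcal C$ is $\mathcal C$ regarded as a right $\mathcal D$-comodule along $g$. 2. Let $\mathcal B$ be a dg $\mathbb S$-module such that $g^*\mathcal C\cong\mathcal B\circ\mathcal D$ as right $\mathcal D$-comodules, that is, $g^*\mathcal C$ is free with generating $\mathbb S$-module $\mathcal B$. Then there is an isomorphism of $\mathbb S$-modules with differential $$B_{\mathcal O}(f^*A)\;\cong\;\mathcal B\circ B_{\mathcal P}(A).$$ -/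

import Mathlib

open scoped TensorProduct DirectSum

universe u v w u' v' u'' v''

set_option linter.unusedVariables false
set_option linter.unusedSectionVars false

noncomputable section

namespace KoszulBar

/-- The sign `(-1)^n` as an element of `k`. -/
def sg (k : Type*) [Field k] (n : ℤ) : k := ((Int.negOnePow n : ℤ) : k)

/-- A `ℤ`-graded `k`-module together with an endomorphism `d` of degree `-1`. -/
structure GrMod (k : Type w) [Field k] where
  C : ℤ → Type u
  [acg : ∀ n, AddCommGroup (C n)]
  [mod : ∀ n, Module k (C n)]
  d : ∀ {i j : ℤ}, j + 1 = i → C i →ₗ[k] C j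

attribute [instance] GrMod.acg GrMod.mod

instance {k : Type w} [Field k] : CoeFun (GrMod.{u} k) (fun _ => ℤ → Type u) := ⟨GrMod.C⟩

variable {k : Type w} [Field k]

section Signs

theorem sg_add (m n : ℤ) : sg k (m + n) = sg k m * sg k n := by
  simp [sg, Int.negOnePow_add]

theorem sg_congr {m n : ℤ} (h : Even (m - n)) : sg k m = sg k n := by
  unfold sg
  rw [Int.negOnePow_eq_iff m n |>.2 h]

theorem sg_zero : sg k 0 = 1 := by simp [sg]

/-- The sum of `q i * q j` over the pairs that the bijection `e` of ordered sets inverts; its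
parity is the Koszul sign of reordering homogeneous elements of degrees `q i` along `e`. -/
def inv {I J : Type} [Fintype I] [LinearOrder I] [LinearOrder J] (e : I ≃ J) (q : I → ℤ) : ℤ :=
  ∑ i, ∑ j, if i < j ∧ e j < e i then q i * q j else 0

end Signs

namespace GrMod

/-- The condition `d² = 0`: a differential graded module. -/
def IsDG (M : GrMod.{u} k) : Prop :=
  ∀ {i j l : ℤ} (h : j + 1 = i) (h' : l + 1 = j) (x : M i), M.d h' (M.d h x) = 0

/-- Homogeneous elements, with their degree. -/
structure El (M : GrMod.{u} k) where
  deg : ℤ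
  val : M deg

/-- The differential of a homogeneous element. -/
def El.d {M : GrMod.{u} k} (x : M.El) : M.El := ⟨x.deg - 1, M.d (by omega) x.val⟩

/-- Transport along an equality of degrees. -/
def cast (M : GrMod.{u} k) {i j : ℤ} (h : i = j) : M i →ₗ[k] M j := by
  subst h; exact LinearMap.id

end GrMod

/-- An `𝕊`-module: a functor from finite sets and bijections to graded modules with `d`.  It is
a dg `𝕊`-module if `SMod.IsDG` holds. -/
structure SMod (k : Type w) [Field k] where
  obj : (X : Type) → [Finite X] → GrMod.{u} k
  map : ∀ {X Y : Type} [Finite X] [Finite Y], (X ≃ Y) → ∀ {n : ℤ}, obj X n →ₗ[k] obj Y n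
  map_refl : ∀ {X : Type} [Finite X] {n : ℤ} (x : obj X n), map (Equiv.refl X) x = x
  map_trans : ∀ {X Y Z : Type} [Finite X] [Finite Y] [Finite Z] (e : X ≃ Y) (f : Y ≃ Z) {n : ℤ}
    (x : obj X n), map (e.trans f) x = map f (map e x)
  map_d : ∀ {X Y : Type} [Finite X] [Finite Y] (e : X ≃ Y) {i j : ℤ} (h : j + 1 = i)
    (x : obj X i), map e ((obj X).d h x) = (obj Y).d h (map e x)

namespace SMod

/-- A dg `𝕊`-module: `d² = 0`. -/
def IsDG (A : SMod.{u} k) : Prop := ∀ (X : Type) [Finite X], (A.obj X).IsDG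

/-- The action of a bijection on a homogeneous element. -/
def mapEl (A : SMod.{u} k) {X Y : Type} [Finite X] [Finite Y] (e : X ≃ Y) (x : (A.obj X).El) :
    (A.obj Y).El := ⟨x.deg, A.map e x.val⟩

theorem mapEl_d (A : SMod.{u} k) {X Y : Type} [Finite X] [Finite Y] (e : X ≃ Y)
    (x : (A.obj X).El) : (A.mapEl e x).d = A.mapEl e x.d := by
  exact congrArg (GrMod.El.mk _) (A.map_d e _ x.val).symm

/-- Morphisms of `𝕊`-modules. -/
structure Hom (A : SMod.{u} k) (B : SMod.{v} k) where
  app : ∀ (X : Type) [Finite X] {n : ℤ}, A.obj X n →ₗ[k] B.obj X n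
  app_map : ∀ {X Y : Type} [Finite X] [Finite Y] (e : X ≃ Y) {n : ℤ} (x : A.obj X n),
    app Y (A.map e x) = B.map e (app X x)
  app_d : ∀ {X : Type} [Finite X] {i j : ℤ} (h : j + 1 = i) (x : A.obj X i),
    app X ((A.obj X).d h x) = (B.obj X).d h (app X x)

/-- Isomorphisms of `𝕊`-modules. -/
structure Iso (A : SMod.{u} k) (B : SMod.{v} k) extends Hom A B where
  bijective : ∀ (X : Type) [Finite X] {n : ℤ}, Function.Bijective (app X (n := n))

end SMod

/-! ### The composition product -/

/-- A generator `a ⊗ (b_i)_{i ∈ I}` of `(A ∘ B)(X)` in degree `n`: a finite ordered set `I`, a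
decomposition `φ` of `X` into parts `Z i`, and homogeneous `a ∈ A(I)`, `b i ∈ B(Z i)`, the tensor
factors being ordered by the order of `I`. -/
structure Sym (A : SMod.{u} k) (B : SMod.{v} k) (X : Type) (n : ℤ) where
  I : Type
  [fin : Fintype I]
  [ord : LinearOrder I]
  Z : I → Type
  [finZ : ∀ i, Finite (Z i)]
  φ : (Σ i, Z i) ≃ X
  a : (A.obj I).El
  b : ∀ i, (B.obj (Z i)).El
  deg : a.deg + ∑ i, (b i).deg = n

attribute [instance] Sym.fin Sym.ord Sym.finZ

namespace Sym

variable {A : SMod.{u} k} {B : SMod.{v} k} {X : Type} {n : ℤ}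

/-- `t = s + c • s'` in the factor `a`, the other data being equal. -/
inductive LinA (c : k) : Sym A B X n → Sym A B X n → Sym A B X n → Prop
  | mk {I : Type} [Fintype I] [LinearOrder I] {Z : I → Type} [∀ i, Finite (Z i)]
      (φ : (Σ i, Z i) ≃ X) (p : ℤ) (x y : A.obj I p) (b : ∀ i, (B.obj (Z i)).El)
      (h : p + ∑ i, (b i).deg = n) :
      LinA c ⟨I, Z, φ, ⟨p, x⟩, b, h⟩ ⟨I, Z, φ, ⟨p, y⟩, b, h⟩ ⟨I, Z, φ, ⟨p, x + c • y⟩, b, h⟩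

/-- `t = s + c • s'` in one of the factors `b i`, the other data being equal. -/
inductive LinB (c : k) : Sym A B X n → Sym A B X n → Sym A B X n → Prop
  | mk {I : Type} [Fintype I] [LinearOrder I] {Z : I → Type} [∀ i, Finite (Z i)]
      (φ : (Σ i, Z i) ≃ X) (a : (A.obj I).El) (b b' b'' : ∀ i, (B.obj (Z i)).El)
      (i : I) (q : ℤ) (x y : B.obj (Z i) q) (hb : b i = ⟨q, x⟩) (hb' : b' i = ⟨q, y⟩)
      (hb'' : b'' i = ⟨q, x + c • y⟩) (h' : ∀ j, j ≠ i → b' j = b j)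
      (h'' : ∀ j, j ≠ i → b'' j = b j) (hd hd' hd'') :
      LinB c ⟨I, Z, φ, a, b, hd⟩ ⟨I, Z, φ, a, b', hd'⟩ ⟨I, Z, φ, a, b'', hd''⟩

/-- A bijection of index sets, with bijections of the parts, that carries `s` to `t`. -/
structure Move (s t : Sym A B X n) : Type where
  e : s.I ≃ t.I
  h : ∀ i, s.Z i ≃ t.Z (e i)
  hφ : ∀ i z, t.φ ⟨e i, h i z⟩ = s.φ ⟨i, z⟩
  ha : t.a = A.mapEl e s.a
  hb : ∀ i, t.b (e i) = B.mapEl (h i) (s.b i)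

/-- The relations of the composition product: multilinearity and equivariance. -/
inductive Rel : (Sym A B X n →₀ k) → Prop
  | linA (c : k) (s s' t : Sym A B X n) (h : LinA c s s' t) :
      Rel (Finsupp.single t 1 - Finsupp.single s 1 - Finsupp.single s' c)
  | linB (c : k) (s s' t : Sym A B X n) (h : LinB c s s' t) :
      Rel (Finsupp.single t 1 - Finsupp.single s 1 - Finsupp.single s' c)
  | move (s t : Sym A B X n) (m : Move s t) :
      Rel (Finsupp.single t 1 - Finsupp.single s (sg k (inv m.e fun i => (s.b i).deg)))

end Sym

/-- The degree `n` part of `(A ∘ B)(X)`. -/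
def CompMod (A : SMod.{u} k) (B : SMod.{v} k) (X : Type) (n : ℤ) : Type (max 1 u v w) :=
  (Sym A B X n →₀ k) ⧸ Submodule.span k {r | Sym.Rel (A := A) (B := B) (X := X) (n := n) r}

namespace CompMod

variable {A : SMod.{u} k} {B : SMod.{v} k} {X : Type} {n : ℤ}

instance : AddCommGroup (CompMod A B X n) := by unfold CompMod; infer_instance
instance : Module k (CompMod A B X n) := by unfold CompMod; infer_instance

/-- The quotient map. -/
def proj : (Sym A B X n →₀ k) →ₗ[k] CompMod A B X n := Submodule.mkQ _

theorem proj_rel {r : Sym A B X n →₀ k} (h : Sym.Rel r) : proj r = 0 :=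
  (Submodule.Quotient.mk_eq_zero _).2 (Submodule.subset_span h)

/-- The class of a generator. -/
def mk (s : Sym A B X n) : CompMod A B X n := proj (Finsupp.single s 1)

theorem proj_single (s : Sym A B X n) (c : k) : proj (Finsupp.single s c) = c • mk s := by
  rw [mk, ← map_smul]; simp

theorem mk_linA {c : k} {s s' t : Sym A B X n} (h : Sym.LinA c s s' t) :
    mk t = mk s + c • mk s' := by
  have := proj_rel (Sym.Rel.linA c s s' t h)
  rw [map_sub, map_sub, sub_sub, sub_eq_zero] at this
  simpa [proj_single] using this

theorem mk_linB {c : k} {s s' t : Sym A B X n} (h : Sym.LinB c s s' t) :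
    mk t = mk s + c • mk s' := by
  have := proj_rel (Sym.Rel.linB c s s' t h)
  rw [map_sub, map_sub, sub_sub, sub_eq_zero] at this
  simpa [proj_single] using this

theorem mk_move {s t : Sym A B X n} (m : Sym.Move s t) :
    mk t = sg k (inv m.e fun i => (s.b i).deg) • mk s := by
  have := proj_rel (Sym.Rel.move s t m)
  rw [map_sub, sub_eq_zero] at this
  simpa [proj_single] using this

/-- Linear maps out of `(A ∘ B)(X)`. -/
def lift {W : Type*} [AddCommGroup W] [Module k W] (F : Sym A B X n → W)
    (hA : ∀ {c : k} {s s' t}, Sym.LinA c s s' t → F t = F s + c • F s')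
    (hB : ∀ {c : k} {s s' t}, Sym.LinB c s s' t → F t = F s + c • F s')
    (hM : ∀ (s t) (m : Sym.Move s t), F t = sg k (inv m.e fun i => (s.b i).deg) • F s) :
    CompMod A B X n →ₗ[k] W :=
  Submodule.liftQ _ (Finsupp.linearCombination k F) (by
    rw [Submodule.span_le]
    rintro r (⟨c, s, s', t, h⟩ | ⟨c, s, s', t, h⟩ | ⟨s, t, m⟩)
    · simp [hA h, sub_sub]
    · simp [hB h, sub_sub]
    · simp [hM s t m])

theorem lift_mk {W : Type*} [AddCommGroup W] [Module k W] (F : Sym A B X n → W) (hA hB hM)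
    (s : Sym A B X n) : lift F hA hB hM (mk s) = F s := by
  refine (Submodule.liftQ_apply _ _ _).trans ?_
  simp

theorem hom_ext {W : Type*} [AddCommGroup W] [Module k W] {f g : CompMod A B X n →ₗ[k] W}
    (h : ∀ s, f (mk s) = g (mk s)) : f = g := by
  refine Submodule.linearMap_qext _ (Finsupp.lhom_ext' fun s => LinearMap.ext_ring ?_)
  exact h s

end CompMod

namespace Sym

variable {A : SMod.{u} k} {B : SMod.{v} k} {X : Type} {n m : ℤ}

/-- The total degree of the factors `b j` with `j < i`. -/
def pre (s : Sym A B X n) (i : s.I) : ℤ := ∑ j, if j < i then (s.b j).deg else 0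

/-- Apply `d` to `a`. -/
def dA (h : m + 1 = n) (s : Sym A B X n) : Sym A B X m :=
  { s with a := s.a.d, deg := by have := s.deg; simp only [GrMod.El.d]; omega }

/-- Apply `d` to `b i`. -/
def dB (h : m + 1 = n) (s : Sym A B X n) (i : s.I) : Sym A B X m :=
  { s with
    b := fun j => if j = i then (s.b j).d else s.b j
    deg := by
      have hs := s.deg
      have : ∀ j, (if j = i then (s.b j).d else s.b j).deg
          = (s.b j).deg + if j = i then -1 else 0 := by
        intro j; split_ifs <;> simp [GrMod.El.d, sub_eq_add_neg]
      simp only [this, Finset.sum_add_distrib, Finset.sum_ite_eq', Finset.mem_univ, if_true]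
      omega }

/-- Relabel along a bijection of `X`. -/
def map {Y : Type} (e : X ≃ Y) (s : Sym A B X n) : Sym A B Y n := { s with φ := s.φ.trans e }

theorem inv_update {I J : Type} [Fintype I] [LinearOrder I] [LinearOrder J] (e : I ≃ J)
    (q q' : I → ℤ) (i : I) (h : ∀ j, q' j = q j + if j = i then -1 else 0) :
    Even ((∑ j, if e j < e i then q j else 0) + inv e q'
      - (inv e q + ∑ j, if j < i then q j else 0)) := by
  have key : inv e q' = inv e q - ((∑ j, if i < j ∧ e j < e i then q j else 0)
      + ∑ j, if j < i ∧ e i < e j then q j else 0) := by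
    have h1 : ∀ a b : I, (if a < b ∧ e b < e a then q' a * q' b else 0)
        = (if a < b ∧ e b < e a then q a * q b else 0)
          - ((if a = i then (if i < b ∧ e b < e i then q b else 0) else 0)
            + (if b = i then (if a < i ∧ e i < e a then q a else 0) else 0)) := by
      intro a b
      rw [h, h]
      by_cases ha : a = i <;> by_cases hb : b = i <;> simp [ha, hb] <;> split_ifs <;> ring
    unfold inv
    simp only [h1, Finset.sum_sub_distrib, Finset.sum_add_distrib, Finset.sum_ite_eq',
      Finset.mem_univ, if_true]
    congr 2
    rw [Finset.sum_comm]
    simp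
  rw [key]
  have h2 : (∑ j, if e j < e i then q j else 0) + (inv e q
      - ((∑ j, if i < j ∧ e j < e i then q j else 0)
      + ∑ j, if j < i ∧ e i < e j then q j else 0))
      - (inv e q + ∑ j, if j < i then q j else 0)
      = ∑ j, ((if e j < e i then q j else 0) - (if i < j ∧ e j < e i then q j else 0)
        - (if j < i ∧ e i < e j then q j else 0) - if j < i then q j else 0) := by
    simp only [Finset.sum_sub_distrib]; ring
  rw [h2]
  refine Finset.even_sum _ fun j _ => ?_
  rcases lt_trichotomy i j with hij | rfl | hij
  · simp [hij, hij.not_gt]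
  · simp
  · have : e j ≠ e i := fun hh => hij.ne (e.injective hh)
    rcases lt_or_gt_of_ne this with h3 | h3
    · simp [hij, h3, hij.not_gt, h3.not_gt]
    · simp only [hij, h3, hij.not_gt, h3.not_gt, and_self, if_true, if_false]
      exact ⟨-q j, by ring⟩

end Sym

namespace CompMod

variable {A : SMod.{u} k} {B : SMod.{v} k} {X : Type} {n m : ℤ}

/-- The differential `d_A ∘ id + id ∘' d_B` of the composition product. -/
def d (h : m + 1 = n) : CompMod A B X n →ₗ[k] CompMod A B X m :=
  lift (fun s => mk (s.dA h) + ∑ i, sg k (s.a.deg + s.pre i) • mk (s.dB h i))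
    (by
      rintro c _ _ _ ⟨φ, p, x, y, b, hd⟩
      have h1 : ∀ i, _ := fun i => mk_linA (Sym.LinA.mk (c := c) φ p x y _
        (Sym.dB h ⟨_, _, φ, ⟨p, x⟩, b, hd⟩ i).deg)
      have h2 := mk_linA (Sym.LinA.mk (c := c) φ (p - 1) ((A.obj _).d (by omega) x)
        ((A.obj _).d (by omega) y) b (Sym.dA h ⟨_, _, φ, ⟨p, x⟩, b, hd⟩).deg)
      simp only [← map_smul, ← map_add] at h2
      refine (congrArg₂ _ h2 (Finset.sum_congr rfl fun i _ => congrArg _ (h1 i))).trans ?_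
      simp only [smul_add, Finset.sum_add_distrib, Finset.smul_sum, smul_comm c]
      exact add_add_add_comm _ _ _ _)
    (by
      rintro c _ _ _ ⟨φ, a, b, b', b'', i, q, x, y, hb, hb', hb'', h', h'', hd, hd', hd''⟩
      have e' : ∀ j, (b' j).deg = (b j).deg := fun j => by
        by_cases hj : j = i
        · subst hj; rw [hb, hb']
        · rw [h' j hj]
      have e'' : ∀ j, (b'' j).deg = (b j).deg := fun j => by
        by_cases hj : j = i
        · subst hj; rw [hb, hb'']
        · rw [h'' j hj]
      simp only [Sym.pre, e', e'']
      have h2 := mk_linB (Sym.LinB.mk (c := c) φ a.d b b' b'' i q x y hb hb' hb'' h' h''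
        (Sym.dA h ⟨_, _, φ, a, b, hd⟩).deg (Sym.dA h ⟨_, _, φ, a, b', hd'⟩).deg
        (Sym.dA h ⟨_, _, φ, a, b'', hd''⟩).deg)
      have h1 : ∀ j, mk (Sym.dB h ⟨_, _, φ, a, b'', hd''⟩ j)
          = mk (Sym.dB h ⟨_, _, φ, a, b, hd⟩ j) + c • mk (Sym.dB h ⟨_, _, φ, a, b', hd'⟩ j) := by
        intro j
        refine mk_linB ?_
        by_cases hj : i = j
        · subst hj
          refine Sym.LinB.mk φ a _ _ _ i (q - 1) ((B.obj _).d (by omega) x)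
            ((B.obj _).d (by omega) y) ?_ ?_ ?_ ?_ ?_ _ _ _
          · simp only [hb, if_true]; rfl
          · simp only [hb', if_true]; rfl
          · simp only [hb'', if_true, ← map_smul, ← map_add]; rfl
          · intro l hl; simp [hl, h' l hl]
          · intro l hl; simp [hl, h'' l hl]
        · refine Sym.LinB.mk φ a _ _ _ i q x y ?_ ?_ ?_ ?_ ?_ _ _ _
          · simp [hb, hj]
          · simp [hb', hj]
          · simp [hb'', hj]
          · intro l hl; simp [h' l hl]
          · intro l hl; simp [h'' l hl]
      refine (congrArg₂ _ h2 (Finset.sum_congr rfl fun i _ => congrArg _ (h1 i))).trans ?_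
      simp only [smul_add, Finset.sum_add_distrib, Finset.smul_sum, smul_comm c]
      exact add_add_add_comm _ _ _ _)
    (by
      rintro s t ⟨e, g, hφ, ha, hb⟩
      have hdeg : ∀ i, (t.b (e i)).deg = (s.b i).deg := fun i => by rw [hb]; rfl
      rw [smul_add, Finset.smul_sum, ← Equiv.sum_comp e]
      refine congrArg₂ _ ?_ (Finset.sum_congr rfl fun i _ => ?_)
      · exact mk_move (s := s.dA h) (t := t.dA h) ⟨e, g, hφ, by
          change t.a.d = A.mapEl e s.a.d
          rw [ha, SMod.mapEl_d], hb⟩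
      · have hbj : ∀ j : s.I, (if e j = e i then (t.b (e j)).d else t.b (e j))
            = B.mapEl (g j) (if j = i then (s.b j).d else s.b j) := by
          intro j
          simp only [e.injective.eq_iff, hb]
          split_ifs
          · rw [SMod.mapEl_d]
          · rfl
        rw [mk_move (s := s.dB h i) (t := t.dB h (e i)) ⟨e, g, hφ, ha, hbj⟩, smul_smul, smul_smul,
          ← sg_add, ← sg_add]
        refine congrArg₂ _ (sg_congr ?_) rfl
        have hp : t.pre (e i) = ∑ j, if e j < e i then (s.b j).deg else 0 := by
          rw [Sym.pre, ← Equiv.sum_comp e]; simp only [hdeg]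
        have ha' : t.a.deg = s.a.deg := by rw [ha]; rfl
        have key := Sym.inv_update e (fun j => (s.b j).deg) (fun j => ((s.dB h i).b j).deg) i
          (fun j => by
            dsimp only [Sym.dB]; split_ifs <;> simp [GrMod.El.d, sub_eq_add_neg])
        rw [hp, ha']
        have gen : ∀ a P Q R S : ℤ, Even (P + Q - (R + S)) → Even (a + P + Q - (R + (a + S))) := by
          intro a P Q R S hh
          have : a + P + Q - (R + (a + S)) = P + Q - (R + S) := by ring
          rwa [this]
        exact gen _ _ _ _ _ key)

theorem d_mk (h : m + 1 = n) (s : Sym A B X n) :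
    d h (mk s) = mk (s.dA h) + ∑ i, sg k (s.a.deg + s.pre i) • mk (s.dB h i) := lift_mk _ _ _ _ s

/-- Relabelling. -/
def map {Y : Type} (e : X ≃ Y) : CompMod A B X n →ₗ[k] CompMod A B Y n :=
  lift (fun s => mk (s.map e))
    (by rintro c _ _ _ ⟨φ, p, x, y, b, hd⟩; exact mk_linA ⟨φ.trans e, p, x, y, b, hd⟩)
    (by
      rintro c _ _ _ ⟨φ, a, b, b', b'', i, q, x, y, hb, hb', hb'', h', h'', hd, hd', hd''⟩
      exact mk_linB ⟨φ.trans e, a, b, b', b'', i, q, x, y, hb, hb', hb'', h', h'', hd, hd', hd''⟩)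
    (by
      rintro s t ⟨f, g, hφ, ha, hb⟩
      exact mk_move (s := s.map e) (t := t.map e)
        ⟨f, g, fun i z => congrArg e (hφ i z), ha, hb⟩)

theorem map_mk {Y : Type} (e : X ≃ Y) (s : Sym A B X n) : map e (mk s) = mk (s.map e) :=
  lift_mk _ _ _ _ s

end CompMod

/-- The composition product `A ∘ B` of `𝕊`-modules. -/
def comp (A : SMod.{u} k) (B : SMod.{v} k) : SMod.{max 1 u v w} k where
  obj X _ := { C := CompMod A B X, d := CompMod.d }
  map e := CompMod.map e
  map_refl x := LinearMap.congr_fun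
    (CompMod.hom_ext (g := LinearMap.id) fun s => CompMod.map_mk _ s) x
  map_trans e f _ x := LinearMap.congr_fun
    (CompMod.hom_ext (g := CompMod.map f ∘ₗ CompMod.map e) fun s => by
      rw [LinearMap.comp_apply, CompMod.map_mk, CompMod.map_mk, CompMod.map_mk]; rfl) x
  map_d e _ _ h x := LinearMap.congr_fun
    (CompMod.hom_ext (f := CompMod.map e ∘ₗ CompMod.d h) (g := CompMod.d h ∘ₗ CompMod.map e)
      fun s => by
        rw [LinearMap.comp_apply, LinearMap.comp_apply, CompMod.map_mk, CompMod.d_mk,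
          CompMod.d_mk, map_add, map_sum]
        simp only [map_smul, CompMod.map_mk]
        rfl) x

/-! ### Tensor products and the infinitesimal composition product -/

section Tensor

variable {A : GrMod.{u} k} {B : GrMod.{v} k} {A' : GrMod.{u'} k} {B' : GrMod.{v'} k}
  {n m : ℤ} {W : Type*} [AddCommGroup W] [Module k W]

/-- The degree `n` part of the tensor product of two graded modules. -/
abbrev Tens (A : GrMod.{u} k) (B : GrMod.{v} k) (n : ℤ) : Type (max u v) :=
  ⨁ p : {p : ℤ × ℤ // p.1 + p.2 = n}, A p.1.1 ⊗[k] B p.1.2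

/-- The bilinear map `a, b ↦ a ⊗ b`. -/
def tmk {i j : ℤ} (h : i + j = n) : A i →ₗ[k] B j →ₗ[k] Tens A B n :=
  (TensorProduct.mk k (A i) (B j)).compr₂
    (DirectSum.lof k {p : ℤ × ℤ // p.1 + p.2 = n} (fun p => A p.1.1 ⊗[k] B p.1.2) ⟨(i, j), h⟩)

/-- Linear maps out of the tensor product, from bilinear maps. -/
def tlift (f : ∀ i j : ℤ, i + j = n → A i →ₗ[k] B j →ₗ[k] W) : Tens A B n →ₗ[k] W :=
  DirectSum.toModule k _ W fun p => TensorProduct.lift (f p.1.1 p.1.2 p.2)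

@[simp] theorem tlift_tmk (f : ∀ i j : ℤ, i + j = n → A i →ₗ[k] B j →ₗ[k] W) {i j : ℤ}
    (h : i + j = n) (a : A i) (b : B j) : tlift f (tmk h a b) = f i j h a b := by
  simp [tlift, tmk]

theorem tens_ext {f g : Tens A B n →ₗ[k] W}
    (H : ∀ (i j : ℤ) (h : i + j = n) (a : A i) (b : B j), f (tmk h a b) = g (tmk h a b)) :
    f = g := by
  refine DirectSum.linearMap_ext k fun p => TensorProduct.ext' fun a b => ?_
  exact H p.1.1 p.1.2 p.2 a b

/-- The map `f ⊗ g` for `f`, `g` of degree `0`. -/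
def tmap (f : ∀ i, A i →ₗ[k] A' i) (g : ∀ j, B j →ₗ[k] B' j) : Tens A B n →ₗ[k] Tens A' B' n :=
  tlift fun i j h => (tmk h).compl₁₂ (f i) (g j)

@[simp] theorem tmap_tmk (f : ∀ i, A i →ₗ[k] A' i) (g : ∀ j, B j →ₗ[k] B' j) {i j : ℤ}
    (h : i + j = n) (a : A i) (b : B j) : tmap f g (tmk h a b) = tmk h (f i a) (g j b) := by
  simp [tmap]

theorem tmap_id {f : ∀ i, A i →ₗ[k] A i} {g : ∀ j, B j →ₗ[k] B j} (hf : ∀ i a, f i a = a)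
    (hg : ∀ j b, g j b = b) (x : Tens A B n) : tmap f g x = x := by
  refine LinearMap.congr_fun (g := LinearMap.id) (tens_ext fun i j h a b => ?_) x
  simp [hf, hg]

theorem tmap_comp {A'' : GrMod.{u''} k} {B'' : GrMod.{v''} k} {f : ∀ i, A i →ₗ[k] A' i}
    {g : ∀ j, B j →ₗ[k] B' j} {f' : ∀ i, A' i →ₗ[k] A'' i} {g' : ∀ j, B' j →ₗ[k] B'' j}
    {f'' : ∀ i, A i →ₗ[k] A'' i} {g'' : ∀ j, B j →ₗ[k] B'' j}
    (hf : ∀ i a, f'' i a = f' i (f i a)) (hg : ∀ j b, g'' j b = g' j (g j b)) (x : Tens A B n) :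
    tmap f'' g'' x = tmap f' g' (tmap f g x) := by
  refine LinearMap.congr_fun (g := tmap f' g' ∘ₗ tmap f g) (tens_ext fun i j h a b => ?_) x
  simp [hf, hg]

/-- The differential `d ⊗ 1 + 1 ⊗ d` (with the Koszul sign) of the tensor product. -/
def Tens.d (A : GrMod.{u} k) (B : GrMod.{v} k) (h : m + 1 = n) : Tens A B n →ₗ[k] Tens A B m :=
  tlift fun i j hij =>
    (tmk (show (i - 1) + j = m by omega)).comp (A.d (by omega))
      + sg k i • (tmk (show i + (j - 1) = m by omega)).compl₂ (B.d (by omega))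

theorem tmap_d {f : ∀ i, A i →ₗ[k] A' i} {g : ∀ j, B j →ₗ[k] B' j}
    (hf : ∀ {i j} (h : j + 1 = i) a, f j (A.d h a) = A'.d h (f i a))
    (hg : ∀ {i j} (h : j + 1 = i) b, g j (B.d h b) = B'.d h (g i b)) (h : m + 1 = n)
    (x : Tens A B n) : tmap f g (Tens.d A B h x) = Tens.d A' B' h (tmap f g x) := by
  refine LinearMap.congr_fun (f := tmap f g ∘ₗ Tens.d A B h) (g := Tens.d A' B' h ∘ₗ tmap f g)
    (tens_ext fun i j h a b => ?_) x
  simp [Tens.d, hf, hg]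

/-- The tensor product of two graded modules with `d`. -/
abbrev tens (A : GrMod.{u} k) (B : GrMod.{v} k) : GrMod.{max u v} k where
  C n := Tens A B n
  d h := Tens.d A B h

end Tensor

/-- Restriction of a bijection to the complements of the points satisfying a predicate, with an
extra point that is fixed. -/
def cplEquiv {X Y : Type} (e : X ≃ Y) (U : Set Y) :
    Option {x // x ∉ e ⁻¹' U} ≃ Option {y // y ∉ U} :=
  Equiv.optionCongr (e.subtypeEquiv fun _ => Iff.rfl)

/-- Restriction of a bijection to a preimage. -/
def preEquiv {X Y : Type} (e : X ≃ Y) (U : Set Y) : {x // x ∈ e ⁻¹' U} ≃ {y // y ∈ U} :=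
  e.subtypeEquiv fun _ => Iff.rfl

/-- The infinitesimal (bilinear) composition product
`(A ∘₁ B)(X) = ⨁_{U ⊆ X} A(X/U) ⊗ B(U)`, where `X/U` is `X ∖ U` with one extra point. -/
def infComp (A : SMod.{u} k) (B : SMod.{v} k) : SMod.{max u v} k where
  obj X _ :=
    { C := fun n => ∀ U : Set X, Tens (A.obj (Option {x // x ∉ U})) (B.obj {x // x ∈ U}) n
      d := fun h => LinearMap.pi fun U => Tens.d _ _ h ∘ₗ LinearMap.proj U }
  map {X Y} _ _ e n := LinearMap.pi fun U : Set Y =>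
    tmap (fun _ => A.map (cplEquiv e U)) (fun _ => B.map (preEquiv e U)) ∘ₗ
      LinearMap.proj (e ⁻¹' U)
  map_refl {X} _ {n} x := by
    funext U
    have h1 : cplEquiv (Equiv.refl X) U = Equiv.refl _ := by ext (_ | _) <;> simp [cplEquiv] <;> rfl
    exact tmap_id (fun i a => (congrArg (fun e => A.map e a) h1).trans (A.map_refl a))
      (fun i b => B.map_refl b) _
  map_trans {X Y Z} _ _ _ e f {n} x := by
    funext U
    have h1 : cplEquiv (e.trans f) U = (cplEquiv e (f ⁻¹' U)).trans (cplEquiv f U) := by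
      ext (_ | _) <;> simp [cplEquiv] <;> rfl
    exact tmap_comp (fun i a => (congrArg (fun e => A.map e a) h1).trans (A.map_trans _ _ a))
      (fun i b => B.map_trans (preEquiv e _) (preEquiv f U) b) _
  map_d {X Y} _ _ e i j h x := by
    funext U
    exact tmap_d (fun h a => A.map_d _ h a) (fun h b => B.map_d _ h b) h _

/-- The component of an element of `(A ∘₁ B)(X)` at `U ⊆ X`. -/
def infProj (A : SMod.{u} k) (B : SMod.{v} k) {X : Type} [Finite X] (U : Set X) (n : ℤ) :
    (infComp A B).obj X n →ₗ[k] Tens (A.obj (Option {x // x ∉ U})) (B.obj {x // x ∈ U}) n :=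
  LinearMap.proj U

theorem infComp_ext {A : SMod.{u} k} {B : SMod.{v} k} {X : Type} [Finite X] {n : ℤ}
    {x y : (infComp A B).obj X n} (h : ∀ U, infProj A B U n x = infProj A B U n y) : x = y :=
  funext h

/-! ### Operads and their algebras -/

namespace SMod

/-- A morphism applied to a homogeneous element. -/
def Hom.el {A : SMod.{u} k} {B : SMod.{v} k} (f : Hom A B) {X : Type} [Finite X]
    (x : (A.obj X).El) : (B.obj X).El := ⟨x.deg, f.app X x.val⟩

/-- The identity morphism. -/
def Hom.id (A : SMod.{u} k) : Hom A A := ⟨fun _ _ _ => LinearMap.id, fun _ _ _ => rfl, fun _ _ => rfl⟩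

/-- Composition of morphisms. -/
def Hom.after {A : SMod.{u} k} {B : SMod.{v} k} {C : SMod.{u'} k} (g : Hom B C) (f : Hom A B) :
    Hom A C where
  app X _ _ := g.app X ∘ₗ f.app X
  app_map e _ x := by
    rw [LinearMap.comp_apply, f.app_map, g.app_map]; rfl
  app_d h x := by
    rw [LinearMap.comp_apply, f.app_d, g.app_d]; rfl

end SMod

theorem Sym.eq_of {A : SMod.{u} k} {B : SMod.{v} k} {X : Type} {n : ℤ} {I : Type} [Fintype I]
    [LinearOrder I] {Z : I → Type} [∀ i, Finite (Z i)] (φ : (Σ i, Z i) ≃ X) {a a' : (A.obj I).El}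
    {b b' : ∀ i, (B.obj (Z i)).El} (ha : a = a') (hb : ∀ i, b i = b' i) (h h') :
    (⟨I, Z, φ, a, b, h⟩ : Sym A B X n) = ⟨I, Z, φ, a', b', h'⟩ := by
  obtain rfl := funext hb
  subst ha
  rfl

section CompMap

variable {A : SMod.{u} k} {B : SMod.{v} k} {A' : SMod.{u'} k} {B' : SMod.{v'} k}

/-- Apply morphisms to the factors of a generator. -/
def Sym.hom (f : A.Hom A') (g : B.Hom B') {X : Type} {n : ℤ} (s : Sym A B X n) : Sym A' B' X n :=
  { s with a := f.el s.a, b := fun i => g.el (s.b i), deg := s.deg }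

/-- Functoriality of the composition product. -/
def CompMod.hom (f : A.Hom A') (g : B.Hom B') {X : Type} {n : ℤ} :
    CompMod A B X n →ₗ[k] CompMod A' B' X n :=
  lift (fun s => mk (s.hom f g))
    (by
      rintro c _ _ _ ⟨φ, p, x, y, b, hd⟩
      refine mk_linA ?_
      have := Sym.LinA.mk (A := A') (B := B') (n := n) (c := c) φ p (f.app _ x) (f.app _ y)
        (fun i => g.el (b i)) hd
      rw [← map_smul, ← map_add] at this
      exact this)
    (by
      rintro c _ _ _ ⟨φ, a, b, b', b'', i, q, x, y, hb, hb', hb'', h', h'', hd, hd', hd''⟩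
      refine mk_linB ?_
      refine Sym.LinB.mk φ (f.el a) (fun i => g.el (b i)) (fun i => g.el (b' i))
        (fun i => g.el (b'' i)) i q (g.app _ x) (g.app _ y) ?_ ?_ ?_ ?_ ?_ hd hd' hd''
      · rw [hb]; rfl
      · rw [hb']; rfl
      · rw [hb'', ← map_smul, ← map_add]; rfl
      · intro j hj; rw [h' j hj]
      · intro j hj; rw [h'' j hj])
    (by
      rintro s t ⟨e, z, hφ, ha, hb⟩
      have hbi : ∀ i : s.I, g.el (t.b (e i)) = B'.mapEl (z i) (g.el (s.b i)) := fun i => by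
        rw [hb]; exact congrArg (GrMod.El.mk _) (g.app_map _ _)
      refine mk_move (s := s.hom f g) (t := t.hom f g) ⟨e, z, hφ, ?_, hbi⟩
      change f.el t.a = A'.mapEl e (f.el s.a)
      rw [ha]; exact congrArg (GrMod.El.mk _) (f.app_map _ _))

theorem CompMod.hom_mk (f : A.Hom A') (g : B.Hom B') {X : Type} {n : ℤ} (s : Sym A B X n) :
    hom f g (mk s) = mk (s.hom f g) := lift_mk _ _ _ _ s

/-- Functoriality of the composition product. -/
def compMap (f : A.Hom A') (g : B.Hom B') : (comp A B).Hom (comp A' B') where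
  app X _ n := CompMod.hom f g
  app_map e _ x := LinearMap.congr_fun (CompMod.hom_ext (f := CompMod.hom f g ∘ₗ CompMod.map e)
    (g := CompMod.map e ∘ₗ CompMod.hom f g) fun s => by
      rw [LinearMap.comp_apply, LinearMap.comp_apply, CompMod.map_mk, CompMod.hom_mk,
        CompMod.hom_mk, CompMod.map_mk]; rfl) x
  app_d {X} _ i j h x := LinearMap.congr_fun
    (CompMod.hom_ext (f := CompMod.hom f g ∘ₗ CompMod.d h)
    (g := CompMod.d h ∘ₗ CompMod.hom f g) fun s => by
      rw [LinearMap.comp_apply, LinearMap.comp_apply, CompMod.hom_mk, CompMod.d_mk,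
        CompMod.d_mk, map_add, map_sum]
      simp only [map_smul, CompMod.hom_mk]
      have h1 : (s.dA h).hom f g = (s.hom f g).dA h := by
        exact Sym.eq_of _ (congrArg (GrMod.El.mk _) (f.app_d _ _)) (fun _ => rfl) _ _
      have h2 : ∀ i, (s.dB h i).hom f g = (s.hom f g).dB h i := fun i => by
        have : ∀ j : s.I, g.el (if j = i then (s.b j).d else s.b j)
            = if j = i then (g.el (s.b j)).d else g.el (s.b j) := by
          intro j
          split_ifs
          · exact congrArg (GrMod.El.mk _) (g.app_d _ _)
          · rfl
        exact Sym.eq_of _ rfl this _ _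
      rw [h1]
      simp only [h2]
      rfl) x

end CompMap

/-- The lexicographic order. -/
@[reducible] def sigmaOrd {I : Type} [LinearOrder I] (T : I → Type) [∀ i, LinearOrder (T i)] :
    LinearOrder (Σ i, T i) := inferInstanceAs (LinearOrder (Σₗ i, T i))

/-- The order on `Option α` with `none` as least element. -/
@[reducible] def optOrd (α : Type) [LinearOrder α] : LinearOrder (Option α) :=
  inferInstanceAs (LinearOrder (WithBot α))

/-- Some linear order on a finite set. -/
@[reducible] def someOrd (X : Type) [Finite X] : LinearOrder X :=
  LinearOrder.lift' (Finite.equivFin X) (Finite.equivFin X).injective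

section Laws

variable {O : SMod.{u} k} {A : SMod.{v} k}

/-- The value `μ(a; b)` of `μ : O ∘ A → C` on homogeneous elements. -/
def SMod.Hom.act {C : SMod.{u'} k} (μ : (comp O A).Hom C) {I : Type} [Fintype I] [LinearOrder I]
    (Z : I → Type) [∀ i, Finite (Z i)] (a : (O.obj I).El) (b : ∀ i, (A.obj (Z i)).El) :
    (C.obj (Σ i, Z i)).El :=
  ⟨a.deg + ∑ i, (b i).deg, μ.app _ (n := a.deg + ∑ i, (b i).deg)
    (CompMod.mk ⟨I, Z, Equiv.refl _, a, b, rfl⟩)⟩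

/-- The generator `1 ⊗ x` of `O ∘ A`. -/
def Sym.unitL (one : O.obj Unit 0) {X : Type} [Finite X] {n : ℤ} (x : A.obj X n) : Sym O A X n :=
  ⟨Unit, fun _ => X, Equiv.uniqueSigma fun _ => X, ⟨0, one⟩, fun _ => ⟨n, x⟩, by simp⟩

/-- The generator `x ⊗ (1, …, 1)` of `O ∘ A`. -/
def Sym.unitR (one : A.obj Unit 0) {X : Type} [Fintype X] [LinearOrder X] {n : ℤ} (x : O.obj X n) :
    Sym O A X n :=
  ⟨X, fun _ => Unit, Equiv.sigmaPUnit X, ⟨n, x⟩, fun _ => ⟨0, one⟩, by simp⟩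

/-- The exponent of the sign `(a; b; c) ↦ (a; (b; c))` of moving each `b i` past the `c i' t` with
`i' < i`. -/
def assocExp {I : Type} [Fintype I] [LinearOrder I] {T : I → Type} [∀ i, Fintype (T i)]
    (b : I → ℤ) (c : ∀ i, T i → ℤ) : ℤ :=
  ∑ i, b i * ∑ i', if i' < i then ∑ t, c i' t else 0

/-- The associativity square `μ (m (a; b); c) = ± μ (a; μ (b; c))` on generators. -/
def AssocLaw (m : (comp O O).Hom O) (μ : (comp O A).Hom A) : Prop :=
  ∀ {I : Type} [Fintype I] [LinearOrder I] (T : I → Type) [∀ i, Fintype (T i)]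
    [∀ i, LinearOrder (T i)] (Z : ∀ i, T i → Type) [∀ i t, Finite (Z i t)]
    (a : (O.obj I).El) (b : ∀ i, (O.obj (T i)).El) (c : ∀ i t, (A.obj (Z i t)).El) {n : ℤ}
    (h : (m.act T a b).deg + ∑ j : Σ i, T i, (c j.1 j.2).deg = n)
    (h' : a.deg + ∑ i, (μ.act (Z i) (b i) (c i)).deg = n),
    μ.app _ (CompMod.mk (@Sym.mk k _ O A _ n (Σ i, T i) _ (sigmaOrd T) (fun j => Z j.1 j.2) _
        (Equiv.sigmaAssoc Z) (m.act T a b) (fun j => c j.1 j.2) h))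
      = sg k (assocExp (fun i => (b i).deg) fun i t => (c i t).deg) •
        μ.app _ (CompMod.mk ⟨I, fun i => Σ t, Z i t, Equiv.refl _, a,
          fun i => μ.act (Z i) (b i) (c i), h'⟩)

end Laws

/-- A (dg symmetric) operad: a monoid for the composition product. -/
structure Operad (k : Type w) [Field k] where
  S : SMod.{u} k
  dg : S.IsDG
  one : S.obj Unit 0
  mul : (comp S S).Hom S
  d_one : ∀ {j : ℤ} (h : j + 1 = 0), (S.obj Unit).d h one = 0
  one_mul : ∀ {X : Type} [Finite X] {n : ℤ} (x : S.obj X n),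
    mul.app X (CompMod.mk (Sym.unitL one x)) = x
  mul_one : ∀ {X : Type} [Fintype X] [LinearOrder X] {n : ℤ} (x : S.obj X n),
    mul.app X (CompMod.mk (Sym.unitR one x)) = x
  assoc : AssocLaw mul mul

/-- Morphisms of operads. -/
structure Operad.Hom (O : Operad.{u} k) (P : Operad.{v} k) extends O.S.Hom P.S where
  map_one : app Unit O.one = P.one
  map_mul : ∀ {X : Type} [Finite X] {n : ℤ} (x : (comp O.S O.S).obj X n),
    app X (O.mul.app X x) = P.mul.app X ((compMap toHom toHom).app X x)

/-- An `𝕊`-module-algebra over the operad `O`. -/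
structure SAlg (O : Operad.{u} k) where
  A : SMod.{v} k
  dg : A.IsDG
  act : (comp O.S A).Hom A
  one_act : ∀ {X : Type} [Finite X] {n : ℤ} (x : A.obj X n),
    act.app X (CompMod.mk (Sym.unitL O.one x)) = x
  assoc : AssocLaw O.mul act

/-- An `O`-algebra: an `𝕊`-module-algebra that vanishes on nonempty sets. -/
structure Alg (O : Operad.{u} k) extends SAlg.{u, v} O where
  arity_zero : ∀ (X : Type) [Finite X] [Nonempty X] (n : ℤ), Subsingleton (A.obj X n)

/-- An operad as an `𝕊`-module-algebra over itself. -/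
def Operad.self (O : Operad.{u} k) : SAlg.{u, u} O := ⟨O.S, O.dg, O.mul, O.one_mul, O.assoc⟩

/-- Restriction of an `𝕊`-module-algebra along a morphism of operads. -/
def SAlg.pullback {O : Operad.{u} k} {P : Operad.{v} k} (f : O.Hom P) (A : SAlg.{v, v'} P) :
    SAlg.{u, v'} O where
  A := A.A
  dg := A.dg
  act := A.act.after (compMap f.toHom (SMod.Hom.id _))
  one_act {X} _ n x := by
    change A.act.app _ (CompMod.hom _ _ (CompMod.mk _)) = _
    rw [CompMod.hom_mk]
    refine Eq.trans (congrArg _ (congrArg CompMod.mk ?_)) (A.one_act x)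
    refine Sym.eq_of (I := Unit) (Z := fun _ => X) _ (congrArg (GrMod.El.mk _) f.map_one)
      (fun _ => rfl) _ _
  assoc := by
    unfold AssocLaw
    intro I _ _ T _ _ Z _ a b c n h h'
    have key := A.assoc T Z (f.el a) (fun i => f.el (b i)) c h h'
    change A.act.app _ (CompMod.hom _ _ (CompMod.mk _))
      = _ • A.act.app _ (CompMod.hom _ _ (CompMod.mk _))
    rw [CompMod.hom_mk, CompMod.hom_mk]
    refine Eq.trans (congrArg _ (congrArg CompMod.mk ?_))
      (key.trans (congrArg _ (congrArg _ (congrArg CompMod.mk ?_))))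
    · have : f.el (O.mul.act T a b) = P.mul.act T (f.el a) fun i => f.el (b i) := by
        exact congrArg (GrMod.El.mk _)
          ((f.map_mul _).trans (congrArg (P.mul.app _) (CompMod.hom_mk _ _ _)))
      exact @Sym.eq_of k _ P.S A.A _ n _ _ (sigmaOrd T) _ _ (Equiv.sigmaAssoc Z) _ _ _ _ this
        (fun _ => rfl) _ _
    · have : ∀ i, A.act.act (Z i) (f.el (b i)) (c i)
          = (A.act.after (compMap f.toHom (SMod.Hom.id _))).act (Z i) (b i) (c i) := fun i => by
        exact congrArg (GrMod.El.mk _) (congrArg (A.act.app _)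
          (CompMod.hom_mk f.toHom (SMod.Hom.id _) ⟨_, Z i, Equiv.refl _, b i, c i, rfl⟩).symm)
      exact Sym.eq_of _ rfl this _ _

/-- Restriction of an algebra along a morphism of operads. -/
def Alg.pullback {O : Operad.{u} k} {P : Operad.{v} k} (f : O.Hom P) (A : Alg.{v, v'} P) :
    Alg.{u, v'} O := { A.toSAlg.pullback f with arity_zero := A.arity_zero }

/-! ### Partial composition and quadratic relations -/

/-- A function that respects `x + c • y` as a linear map. -/
def linOf {M N : Type*} [AddCommGroup M] [Module k M] [AddCommGroup N] [Module k N] (F : M → N)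
    (h : ∀ (c : k) (x y : M), F (x + c • y) = F x + c • F y) : M →ₗ[k] N :=
  have h0 : F 0 = 0 := by
    have := h 1 0 0
    simpa using this
  { toFun := F
    map_add' := fun x y => by simpa using h 1 x y
    map_smul' := fun c y => by simpa [h0] using h c 0 y }

/-- The arities of the factors of a partial composition: `R` at the point `none`, one point at the
others. -/
def PartFib (P R : Type) : Option P → Type
  | none => R
  | some _ => Unit

instance (P R : Type) [Finite R] : ∀ o : Option P, Finite (PartFib P R o)
  | none => inferInstanceAs (Finite R)
  | some _ => inferInstanceAs (Finite Unit)

/-- The leaves of a partial composition. -/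
def partEquiv (P R : Type) : (Σ o, PartFib P R o) ≃ P ⊕ R where
  toFun
    | ⟨none, r⟩ => Sum.inr r
    | ⟨some p, _⟩ => Sum.inl p
  invFun
    | Sum.inl p => ⟨some p, ()⟩
    | Sum.inr r => ⟨none, r⟩
  left_inv := by rintro ⟨_ | p, r⟩ <;> rfl
  right_inv := by rintro (p | r) <;> rfl

namespace Operad

variable (Q : Operad.{u} k) {P R : Type} [Finite P] [Finite R]

/-- The factors `b` at `none` and `1` at the other points. -/
def partB (b : (Q.S.obj R).El) : ∀ o : Option P, (Q.S.obj (PartFib P R o)).El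
  | none => b
  | some _ => ⟨0, Q.one⟩

/-- The generator `a ⊗ (b, 1, …, 1)`. -/
def partSym {i j n : ℤ} (h : i + j = n) (a : Q.S.obj (Option P) i) (b : Q.S.obj R j) :
    Sym Q.S Q.S (P ⊕ R) n :=
  letI := Fintype.ofFinite P
  @Sym.mk k _ Q.S Q.S (P ⊕ R) n (Option P) _ (@optOrd P (someOrd P)) (PartFib P R) _
    (partEquiv P R) ⟨i, a⟩ (Q.partB ⟨j, b⟩) (by
      rw [Fintype.sum_option]
      simpa [partB] using h)

/-- The partial composition `a ∘ b`, inserting `b` at the point `none`. -/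
def pcomp {i j n : ℤ} (h : i + j = n) :
    Q.S.obj (Option P) i →ₗ[k] Q.S.obj R j →ₗ[k] Q.S.obj (P ⊕ R) n :=
  linOf (fun a => linOf (fun b => Q.mul.app _ (CompMod.mk (Q.partSym h a b))) fun c x y =>
      ((congrArg (Q.mul.app _) (CompMod.mk_linB (c := c) (s := Q.partSym h a x)
        (s' := Q.partSym h a y) (by
          refine @Sym.LinB.mk k _ Q.S Q.S (P ⊕ R) n c (Option P)
            (@instFintypeOption P (Fintype.ofFinite P)) (@optOrd P (someOrd P)) (PartFib P R) _
            (partEquiv P R) ⟨i, a⟩ _ _ _ none j x y rfl rfl rfl ?_ ?_ _ _ _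
          all_goals
            rintro (_ | p) hp
            · exact absurd rfl hp
            · rfl))).trans (map_add _ _ _)).trans (congrArg _ (map_smul _ _ _)))
    fun c x y => LinearMap.ext fun b =>
      ((congrArg (Q.mul.app _) (CompMod.mk_linA (c := c) (s := Q.partSym h x b)
        (s' := Q.partSym h y b) (by
          exact @Sym.LinA.mk k _ Q.S Q.S (P ⊕ R) n c (Option P)
            (@instFintypeOption P (Fintype.ofFinite P)) (@optOrd P (someOrd P)) (PartFib P R) _
            (partEquiv P R) i x y _ _))).trans (map_add _ _ _)).trans
        (congrArg _ (map_smul _ _ _))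

end Operad

/-- The decomposition of `X` into the complement of `U` and `U`. -/
def cutEquiv {X : Type} (U : Set X) : {x // x ∉ U} ⊕ {x // x ∈ U} ≃ X :=
  haveI := Classical.decPred (· ∈ U)
  (Equiv.sumComm _ _).trans (Equiv.sumCompl (· ∈ U))

/-- The map `a ⊗ b ↦ φ(a) ∘ φ(b)` into an operad `Q`, inserting at the extra point. -/
def relAt {V : SMod.{u} k} {Q : Operad.{v} k} (φ : V.Hom Q.S) {X : Type} [Finite X] (U : Set X)
    (n : ℤ) : Tens (V.obj (Option {x // x ∉ U})) (V.obj {x // x ∈ U}) n →ₗ[k] Q.S.obj X n :=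
  Q.S.map (cutEquiv U) ∘ₗ tlift (fun _ _ h => (Q.pcomp h).compl₁₂ (φ.app _) (φ.app _))

/-- The map `V ∘₁ V → Q`, `a ⊗ b ↦ φ(a) ∘ φ(b)`, given by a morphism `φ` from `V` to an
operad `Q`. -/
def relMap {V : SMod.{u} k} {Q : Operad.{v} k} (φ : V.Hom Q.S) (X : Type) [Finite X] (n : ℤ) :
    (infComp V V).obj X n →ₗ[k] Q.S.obj X n :=
  letI := Fintype.ofFinite (Set X)
  ∑ U : Set X, relAt φ U n ∘ₗ infProj V V U n

/-- The map `f ∘₁ g` of infinitesimal composition products. -/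
def infMap {A : SMod.{u} k} {B : SMod.{v} k} {A' : SMod.{u'} k} {B' : SMod.{v'} k} (f : A.Hom A')
    (g : B.Hom B') : (infComp A B).Hom (infComp A' B') where
  app X _ n := LinearMap.pi fun U => tmap (fun _ => f.app _) (fun _ => g.app _) ∘ₗ LinearMap.proj U
  app_map e n x := by
    funext U
    exact (tmap_comp (f'' := fun _ => f.app _ ∘ₗ A.map _) (g'' := fun _ => g.app _ ∘ₗ B.map _)
      (fun _ _ => rfl) (fun _ _ => rfl) _).symm.trans
      (tmap_comp (fun _ _ => f.app_map _ _) (fun _ _ => g.app_map _ _) _)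
  app_d h x := by
    funext U
    exact tmap_d (fun h a => f.app_d h a) (fun h b => g.app_d h b) h _

theorem tlift_tmap {A : GrMod.{u} k} {B : GrMod.{v} k} {A' : GrMod.{u'} k} {B' : GrMod.{v'} k}
    {n : ℤ} {W : Type*} [AddCommGroup W] [Module k W]
    (F : ∀ i j : ℤ, i + j = n → A' i →ₗ[k] B' j →ₗ[k] W)
    (G : ∀ i j : ℤ, i + j = n → A i →ₗ[k] B j →ₗ[k] W)
    (f : ∀ i, A i →ₗ[k] A' i) (g : ∀ j, B j →ₗ[k] B' j)
    (h : ∀ i j h a b, G i j h a b = F i j h (f i a) (g j b)) (y : Tens A B n) :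
    tlift G y = tlift F (tmap f g y) := by
  refine LinearMap.congr_fun (f := tlift G) (g := tlift F ∘ₗ tmap f g) ?_ y
  exact tens_ext fun i j hij a b => by
    rw [LinearMap.comp_apply, tmap_tmk, tlift_tmk, tlift_tmk, h]

theorem tlift_post {A : GrMod.{u} k} {B : GrMod.{v} k}
    {n : ℤ} {W W' : Type*} [AddCommGroup W] [Module k W] [AddCommGroup W'] [Module k W']
    (F : ∀ i j : ℤ, i + j = n → A i →ₗ[k] B j →ₗ[k] W)
    (G : ∀ i j : ℤ, i + j = n → A i →ₗ[k] B j →ₗ[k] W') (L : W →ₗ[k] W')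
    (h : ∀ i j h a b, L (F i j h a b) = G i j h a b) (y : Tens A B n) :
    L (tlift F y) = tlift G y := by
  refine LinearMap.congr_fun (f := L ∘ₗ tlift F) (g := tlift G) ?_ y
  exact tens_ext fun i j hij a b => by
    rw [LinearMap.comp_apply, tlift_tmk, tlift_tmk, h]

theorem relMap_infMap {V : SMod.{u} k} {W : SMod.{u'} k} {Q : Operad.{v} k} (g : W.Hom Q.S)
    (φ : V.Hom W) {X : Type} [Finite X] {n : ℤ} (x : (infComp V V).obj X n) :
    relMap (g.after φ) X n x = relMap g X n ((infMap φ φ).app X x) := by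
  unfold relMap
  rw [LinearMap.sum_apply, LinearMap.sum_apply]
  refine Finset.sum_congr rfl fun U _ => ?_
  exact congrArg (Q.S.map (cutEquiv U)) (tlift_tmap _ _ _ _ (fun _ _ _ _ _ => rfl) _)

theorem Operad.Hom.map_pcomp {P : Operad.{u} k} {Q : Operad.{v} k} (f : P.Hom Q) {X Y : Type}
    [Finite X] [Finite Y] {i j n : ℤ} (h : i + j = n) (a : P.S.obj (Option X) i) (b : P.S.obj Y j) :
    f.app _ (P.pcomp h a b) = Q.pcomp h (f.app _ a) (f.app _ b) := by
  refine (f.map_mul _).trans (congrArg (Q.mul.app _) ?_)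
  refine (CompMod.hom_mk _ _ _).trans (congrArg CompMod.mk ?_)
  refine @Sym.eq_of k _ Q.S Q.S (X ⊕ Y) n (Option X) (@instFintypeOption X (Fintype.ofFinite X))
    (@optOrd X (someOrd X)) (PartFib X Y) _ (partEquiv X Y) _ _ _ _ rfl ?_ _ _
  rintro (_ | p)
  · rfl
  · exact congrArg (GrMod.El.mk _) f.map_one

theorem relMap_hom {V : SMod.{u} k} {P : Operad.{v} k} {Q : Operad.{v'} k} (f : P.Hom Q)
    (φ : V.Hom P.S) {X : Type} [Finite X] {n : ℤ} (x : (infComp V V).obj X n) :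
    f.app X (relMap φ X n x) = relMap (f.toHom.after φ) X n x := by
  unfold relMap
  rw [LinearMap.sum_apply, LinearMap.sum_apply, map_sum]
  refine Finset.sum_congr rfl fun U _ => ?_
  refine (f.app_map _ _).trans (congrArg (Q.S.map (cutEquiv U)) ?_)
  exact tlift_post _ _ _ (fun _ _ h _ _ => f.map_pcomp h _ _) _

/-! ### Quadratic data and quadratic operads -/

/-- Quadratic data: a dg `𝕊`-module `V` of generators and a dg sub-`𝕊`-module `R` of
`V ∘₁ V` of relations. -/
structure QuadData (k : Type w) [Field k] where
  V : SMod.{u} k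
  dg : V.IsDG
  R : ∀ (X : Type) [Finite X] (n : ℤ), Submodule k ((infComp V V).obj X n)
  map_mem : ∀ {X Y : Type} [Finite X] [Finite Y] (e : X ≃ Y) {n : ℤ} {x}, x ∈ R X n →
    (infComp V V).map e x ∈ R Y n
  d_mem : ∀ {X : Type} [Finite X] {i j : ℤ} (h : j + 1 = i) {x}, x ∈ R X i →
    ((infComp V V).obj X).d h x ∈ R X j

/-- A morphism of quadratic data: a map of generators that carries relations to relations. -/
structure QuadData.Hom (q q' : QuadData.{u} k) extends q.V.Hom q'.V where
  rel : ∀ {X : Type} [Finite X] {n : ℤ} {x}, x ∈ q.R X n →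
    (infMap toHom toHom).app X x ∈ q'.R X n

namespace QuadData

/-- Formal operadic expressions in the generators `V`, of given arity and degree. -/
inductive Pre (V : SMod.{u} k) : (X : Type) → [Finite X] → ℤ → Type (max 1 u w)
  | zero {X : Type} [Finite X] {n : ℤ} : Pre V X n
  | add {X : Type} [Finite X] {n : ℤ} (x y : Pre V X n) : Pre V X n
  | smul {X : Type} [Finite X] {n : ℤ} (c : k) (x : Pre V X n) : Pre V X n
  | d {X : Type} [Finite X] {i j : ℤ} (h : j + 1 = i) (x : Pre V X i) : Pre V X j
  | map {X Y : Type} [Finite X] [Finite Y] (e : X ≃ Y) {n : ℤ} (x : Pre V X n) : Pre V Y n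
  | gen {X : Type} [Finite X] {n : ℤ} (x : V.obj X n) : Pre V X n
  | one : Pre V Unit 0
  | mul {X I : Type} [Finite X] [Fintype I] [LinearOrder I] (Z : I → Type) [∀ i, Finite (Z i)]
      (φ : (Σ i, Z i) ≃ X) (p : ℤ) (a : Pre V I p) (q : I → ℤ) (b : ∀ i, Pre V (Z i) (q i))
      {n : ℤ} (h : p + ∑ i, q i = n) : Pre V X n

/-- The operads under `V` in which the relations `R` hold. -/
structure Target (q : QuadData.{u} k) where
  Q : Operad.{max 1 u w} k
  φ : q.V.Hom Q.S
  rel : ∀ {X : Type} [Finite X] {n : ℤ} {x}, x ∈ q.R X n → relMap φ X n x = 0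

/-- The value of an expression in an operad under `V`. -/
def Target.eval {q : QuadData.{u} k} (T : q.Target) :
    {X : Type} → [Finite X] → {n : ℤ} → Pre q.V X n → T.Q.S.obj X n
  | _, _, _, @Pre.zero _ _ _ _ _ _ => 0
  | _, _, _, @Pre.add _ _ _ _ _ _ x y => T.eval x + T.eval y
  | _, _, _, @Pre.smul _ _ _ _ _ _ c x => c • T.eval x
  | _, _, _, @Pre.d _ _ _ _ _ _ _ h x => (T.Q.S.obj _).d h (T.eval x)
  | _, _, _, @Pre.map _ _ _ _ _ _ _ e _ x => T.Q.S.map e (T.eval x)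
  | _, _, _, @Pre.gen _ _ _ _ _ _ x => T.φ.app _ x
  | _, _, _, .one => T.Q.one
  | X, _, _, @Pre.mul _ _ _ _ _ _ _ _ Z _ φ p a r b _ h => T.Q.mul.app X
      (CompMod.mk ⟨_, Z, φ, ⟨p, T.eval a⟩, fun i => ⟨r i, T.eval (b i)⟩, h⟩)

variable (q : QuadData.{u} k)

/-- Expressions are identified if they agree in every operad under `V` in which the relations
hold. -/
def setoid (X : Type) [Finite X] (n : ℤ) : Setoid (Pre q.V X n) where
  r x y := ∀ T : q.Target, T.eval x = T.eval y
  iseqv := ⟨fun _ _ => rfl, fun h T => (h T).symm, fun h h' T => (h T).trans (h' T)⟩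

/-- The degree `n` part of `(F(V)/(R))(X)`. -/
def Quo (X : Type) [Finite X] (n : ℤ) : Type (max 1 u w) := Quotient (q.setoid X n)

variable {q} {X : Type} [Finite X] {n : ℤ}

/-- The class of an expression. -/
def cls (x : Pre q.V X n) : q.Quo X n := Quotient.mk (q.setoid X n) x

/-- The value of a class. -/
def Target.ev (T : q.Target) (x : q.Quo X n) : T.Q.S.obj X n :=
  Quotient.lift (s := q.setoid X n) (fun y => T.eval y) (fun _ _ h => h T) x

theorem Target.ev_cls (T : q.Target) (x : Pre q.V X n) : T.ev (cls x) = T.eval x := rfl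

theorem Target.eval_out (T : q.Target) (x : q.Quo X n) :
    T.eval (Quotient.out (s := q.setoid X n) x) = T.ev x :=
  (T.ev_cls _).symm.trans (congrArg T.ev (Quotient.out_eq (s := q.setoid X n) x))

theorem quo_ext {x y : q.Quo X n} (h : ∀ T : q.Target, T.ev x = T.ev y) : x = y := by
  induction x using Quotient.inductionOn
  induction y using Quotient.inductionOn
  exact Quotient.sound (s := q.setoid X n) h

/-- A representing expression. -/
def rep (x : q.Quo X n) : Pre q.V X n := Quotient.out (s := q.setoid X n) x

theorem Target.eval_rep (T : q.Target) (x : q.Quo X n) : T.eval (rep x) = T.ev x := T.eval_out x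

instance : Add (q.Quo X n) := ⟨fun x y => cls (.add (rep x) (rep y))⟩

instance : Zero (q.Quo X n) := ⟨cls .zero⟩

instance : SMul k (q.Quo X n) := ⟨fun c x => cls (.smul c (rep x))⟩

theorem Target.ev_add (T : q.Target) (x y : q.Quo X n) : T.ev (x + y) = T.ev x + T.ev y :=
  congrArg₂ _ (T.eval_rep x) (T.eval_rep y)

theorem Target.ev_smul (T : q.Target) (c : k) (x : q.Quo X n) : T.ev (c • x) = c • T.ev x :=
  congrArg _ (T.eval_rep x)

theorem Target.ev_zero (T : q.Target) : T.ev (0 : q.Quo X n) = 0 := rfl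

instance : Neg (q.Quo X n) := ⟨fun x => (-1 : k) • x⟩

instance : AddCommGroup (q.Quo X n) where
  nsmul := nsmulRec
  zsmul := zsmulRec
  add_assoc x y z := quo_ext fun T => by simp only [T.ev_add, add_assoc]
  zero_add x := quo_ext fun T => by rw [T.ev_add, T.ev_zero, zero_add]
  add_zero x := quo_ext fun T => by rw [T.ev_add, T.ev_zero, add_zero]
  neg_add_cancel x := quo_ext fun T => by
    refine (T.ev_add _ _).trans ?_
    refine (congrArg (· + _) (T.ev_smul (-1) x)).trans ?_
    change (-1 : k) • T.ev x + T.ev x = 0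
    rw [neg_one_smul, neg_add_cancel]
  add_comm x y := quo_ext fun T => by rw [T.ev_add, T.ev_add, add_comm]

instance : Module k (q.Quo X n) where
  one_smul x := quo_ext fun T => by rw [T.ev_smul, one_smul]
  mul_smul a b x := quo_ext fun T => by simp only [T.ev_smul, mul_smul]
  smul_zero a := quo_ext fun T => by rw [T.ev_smul, T.ev_zero, smul_zero]
  smul_add a x y := quo_ext fun T => by simp only [T.ev_smul, T.ev_add, smul_add]
  add_smul a b x := quo_ext fun T => by simp only [T.ev_smul, T.ev_add, add_smul]
  zero_smul x := quo_ext fun T => by rw [T.ev_smul, T.ev_zero, zero_smul]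

end QuadData

namespace QuadData

variable (q : QuadData.{u} k)

variable {q}

/-- Evaluation as a linear map. -/
def Target.evL (T : q.Target) (X : Type) [Finite X] (n : ℤ) : q.Quo X n →ₗ[k] T.Q.S.obj X n :=
  linOf (fun x => T.ev x) fun c x y => by rw [T.ev_add, T.ev_smul]

theorem evL_ext {X : Type} [Finite X] {n : ℤ} {x y : q.Quo X n}
    (h : ∀ T : q.Target, T.evL X n x = T.evL X n y) : x = y := quo_ext h

/-- A linear map into the quotient, from its values in all targets. -/
def quoLin {M : Type*} [AddCommGroup M] [Module k M] {X : Type} [Finite X] {n : ℤ}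
    (F : M → Pre q.V X n) (G : ∀ T : q.Target, M →ₗ[k] T.Q.S.obj X n)
    (h : ∀ T x, T.eval (F x) = G T x) : M →ₗ[k] q.Quo X n :=
  linOf (fun x => cls (F x)) fun c x y => evL_ext fun T => by
    rw [map_add, map_smul]
    have := (G T).map_add x (c • y)
    rw [map_smul, ← h, ← h, ← h] at this
    exact this

variable (q)

/-- The underlying `𝕊`-module of `F(V)/(R)`. -/
def quoS : SMod.{max 1 u w} k where
  obj X _ :=
    { C := q.Quo X
      d := fun {i j} h => quoLin (fun x => .d h (rep x))
        (fun T => (T.Q.S.obj X).d h ∘ₗ T.evL X i)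
        fun T x => congrArg ((T.Q.S.obj X).d h) (T.eval_rep x) }
  map {X Y} _ _ e n := quoLin (fun x => .map e (rep x)) (fun T => T.Q.S.map e ∘ₗ T.evL X n)
    fun T x => congrArg (T.Q.S.map e) (T.eval_rep x)
  map_refl x := quo_ext fun T => (T.Q.S.map_refl _).trans (T.eval_rep x)
  map_trans e f n x := quo_ext fun T => (T.Q.S.map_trans e f _).trans
    (congrArg (T.Q.S.map f) (T.eval_rep (q := q) (cls (.map e (rep x))))).symm
  map_d e i j h x := quo_ext fun T =>
    (congrArg (T.Q.S.map e) (T.eval_rep (q := q) (cls (.d h (rep x))))).trans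
    ((T.Q.S.map_d e h _).trans
      (congrArg ((T.Q.S.obj _).d h) (T.eval_rep (q := q) (cls (.map e (rep x))))).symm)

variable {q}

/-- Evaluation as a morphism of `𝕊`-modules. -/
def Target.evS (T : q.Target) : q.quoS.Hom T.Q.S where
  app X _ n := T.evL X n
  app_map e n x := congrArg (T.Q.S.map e) (T.eval_rep x)
  app_d h x := congrArg ((T.Q.S.obj _).d h) (T.eval_rep x)

theorem quoS_ext {X : Type} [Finite X] {n : ℤ} {x y : q.quoS.obj X n}
    (h : ∀ T : q.Target, T.evS.app X x = T.evS.app X y) : x = y := quo_ext h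

/-- The class of a composite. -/
def quoMul {X : Type} [Finite X] {n : ℤ} (s : Sym q.quoS q.quoS X n) : q.quoS.obj X n :=
  cls (.mul s.Z s.φ s.a.deg (rep s.a.val) (fun i => (s.b i).deg) (fun i => rep (s.b i).val) s.deg)

theorem Target.ev_quoMul (T : q.Target) {X : Type} [Finite X] {n : ℤ}
    (s : Sym q.quoS q.quoS X n) :
    T.evS.app X (quoMul s) = T.Q.mul.app X (CompMod.hom T.evS T.evS (CompMod.mk s)) := by
  refine Eq.trans ?_ (congrArg (T.Q.mul.app X) (CompMod.hom_mk T.evS T.evS s).symm)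
  obtain ⟨I, Z, φ, a, b, h⟩ := s
  refine congrArg (T.Q.mul.app X) (congrArg CompMod.mk ?_)
  exact Sym.eq_of φ (congrArg (GrMod.El.mk _) (T.eval_rep a.val))
    (fun i => congrArg (GrMod.El.mk _) (T.eval_rep (b i).val)) _ _

/-- The composition of `F(V)/(R)` on a given set. -/
def quoMulMod (X : Type) [Finite X] (n : ℤ) :
    CompMod q.quoS q.quoS X n →ₗ[k] q.quoS.obj X n :=
  CompMod.lift quoMul
    (fun {c s s' t} h => quoS_ext fun T => by
      rw [map_add, map_smul, T.ev_quoMul, T.ev_quoMul, T.ev_quoMul, CompMod.mk_linA h, map_add,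
        map_smul]
      exact (map_add _ _ _).trans (congrArg _ (map_smul _ _ _)))
    (fun {c s s' t} h => quoS_ext fun T => by
      rw [map_add, map_smul, T.ev_quoMul, T.ev_quoMul, T.ev_quoMul, CompMod.mk_linB h, map_add,
        map_smul]
      exact (map_add _ _ _).trans (congrArg _ (map_smul _ _ _)))
    (fun s t m => quoS_ext fun T => by
      rw [map_smul, T.ev_quoMul, T.ev_quoMul, CompMod.mk_move m, map_smul]
      exact map_smul _ _ _)

theorem Target.ev_quoMulMod (T : q.Target) {X : Type} [Finite X] {n : ℤ}
    (x : CompMod q.quoS q.quoS X n) :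
    T.evS.app X (quoMulMod X n x) = T.Q.mul.app X (CompMod.hom T.evS T.evS x) := by
  refine LinearMap.congr_fun (f := T.evS.app X ∘ₗ quoMulMod X n)
    (g := (T.Q.mul.app X ∘ₗ CompMod.hom T.evS T.evS : CompMod q.quoS q.quoS X n →ₗ[k] _))
    (CompMod.hom_ext fun s => ?_) x
  exact (congrArg (T.evS.app X) (CompMod.lift_mk _ _ _ _ s)).trans (T.ev_quoMul s)

/-- The composition of `F(V)/(R)`. -/
def quoComp : (comp q.quoS q.quoS).Hom q.quoS where
  app X _ n := quoMulMod X n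
  app_map e n x := quoS_ext fun T => by
    refine (T.ev_quoMulMod _).trans (Eq.trans ?_ (T.evS.app_map e _).symm)
    refine (congrArg (T.Q.mul.app _) ((compMap T.evS T.evS).app_map e x)).trans ?_
    exact (T.Q.mul.app_map e _).trans (congrArg (T.Q.S.map e) (T.ev_quoMulMod x).symm)
  app_d h x := quoS_ext fun T => by
    refine (T.ev_quoMulMod _).trans (Eq.trans ?_ (T.evS.app_d h _).symm)
    refine (congrArg (T.Q.mul.app _) ((compMap T.evS T.evS).app_d h x)).trans ?_
    exact (T.Q.mul.app_d h _).trans (congrArg ((T.Q.S.obj _).d h) (T.ev_quoMulMod x).symm)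

theorem Target.ev_act (T : q.Target) {I : Type} [Fintype I] [LinearOrder I] (Z : I → Type)
    [∀ i, Finite (Z i)] (a : (q.quoS.obj I).El) (b : ∀ i, (q.quoS.obj (Z i)).El) :
    T.evS.el (quoComp.act Z a b) = T.Q.mul.act Z (T.evS.el a) fun i => T.evS.el (b i) :=
  congrArg (GrMod.El.mk _) ((T.ev_quoMulMod _).trans
    (congrArg (T.Q.mul.app _) (CompMod.hom_mk T.evS T.evS ⟨_, Z, Equiv.refl _, a, b, rfl⟩)))

variable (q)

/-- The quadratic operad `F(V)/(R)`: the universal operad under `V` in which the relations hold. -/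
def operad : Operad.{max 1 u w} k where
  S := q.quoS
  dg X _ i j l h h' x := quoS_ext fun T => by
    rw [T.evS.app_d, T.evS.app_d, T.Q.dg]
    exact (map_zero _).symm
  one := cls .one
  mul := quoComp
  d_one h := quoS_ext fun T => by
    exact (T.evS.app_d h _).trans ((T.Q.d_one h).trans (map_zero _).symm)
  one_mul {X} _ n x := quoS_ext fun T => by
    refine (T.ev_quoMulMod _).trans (Eq.trans ?_ (T.Q.one_mul _))
    exact congrArg (T.Q.mul.app _) (CompMod.hom_mk _ _ _)
  mul_one {X} _ _ n x := quoS_ext fun T => by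
    refine (T.ev_quoMulMod _).trans (Eq.trans ?_ (T.Q.mul_one _))
    exact congrArg (T.Q.mul.app _) (CompMod.hom_mk _ _ _)
  assoc := by
    unfold AssocLaw
    intro I _ _ T _ _ Z _ a b c n h h'
    refine quoS_ext fun E => ?_
    rw [map_smul]
    have key := E.Q.assoc T Z (E.evS.el a) (fun i => E.evS.el (b i))
      (fun i t => E.evS.el (c i t)) h h'
    refine (E.ev_quoMulMod _).trans (Eq.trans ?_ (key.trans (congrArg _
      (Eq.trans ?_ (E.ev_quoMulMod _).symm))))
    · refine congrArg (E.Q.mul.app _) ((CompMod.hom_mk _ _ _).trans (congrArg CompMod.mk ?_))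
      exact @Sym.eq_of k _ E.Q.S E.Q.S _ n _ _ (sigmaOrd T) _ _ (Equiv.sigmaAssoc Z) _ _ _ _
        (E.ev_act T a b) (fun _ => rfl) _ _
    · refine congrArg (E.Q.mul.app _) (Eq.trans (congrArg CompMod.mk ?_)
        (CompMod.hom_mk _ _ _).symm)
      exact Sym.eq_of _ rfl (fun i => (E.ev_act (Z i) (b i) (c i)).symm) _ _

/-- The inclusion of the generators. -/
def genL (X : Type) [Finite X] (n : ℤ) : q.V.obj X n →ₗ[k] q.operad.S.obj X n :=
  quoLin (fun x => .gen x) (fun T => T.φ.app X) fun _ _ => rfl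

/-- The inclusion of the generators. -/
def gen : q.V.Hom q.operad.S where
  app X _ n := q.genL X n
  app_map e n x := quoS_ext fun T => (T.φ.app_map e x).trans (T.evS.app_map e (q.genL _ _ x)).symm
  app_d h x := quoS_ext fun T => (T.φ.app_d h x).trans (T.evS.app_d h (q.genL _ _ x)).symm

variable {q}

/-- Evaluation as a morphism of operads. -/
def Target.evHom (T : q.Target) : q.operad.Hom T.Q where
  toHom := T.evS
  map_one := rfl
  map_mul x := T.ev_quoMulMod x

theorem Target.after_gen (T : q.Target) : SMod.Hom.after T.evHom.toHom q.gen = T.φ := rfl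

theorem gen_rel {X : Type} [Finite X] {n : ℤ} {x : (infComp q.V q.V).obj X n}
    (h : x ∈ q.R X n) : relMap q.gen X n x = 0 := by
  refine quoS_ext fun T => ?_
  have h1 := relMap_hom T.evHom q.gen x
  rw [T.after_gen] at h1
  exact (h1.trans (T.rel h)).trans (map_zero _).symm

/-- The operad morphism induced by a morphism of quadratic data. -/
def Hom.operadHom {q q' : QuadData.{u} k} (φ : q.Hom q') : q.operad.Hom q'.operad :=
  Target.evHom ⟨q'.operad, q'.gen.after φ.toHom, fun h =>
    (relMap_infMap q'.gen φ.toHom _).trans (gen_rel (φ.rel h))⟩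

end QuadData

/-! ### Threefold tensor products -/

section Tensor3

variable {A : GrMod.{u} k} {B : GrMod.{v} k} {C : GrMod.{u'} k} {A' : GrMod.{u} k}
  {B' : GrMod.{v} k} {C' : GrMod.{u'} k} {n : ℤ} {W : Type*} [AddCommGroup W] [Module k W]

theorem tens_ext3 {f g : Tens (tens A B) C n →ₗ[k] W}
    (H : ∀ (i j l m : ℤ) (h : i + j = m) (h' : m + l = n) (a : A i) (b : B j) (c : C l),
      f (tmk (A := tens A B) h' (tmk h a b) c) = g (tmk (A := tens A B) h' (tmk h a b) c)) :
    f = g :=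
  tens_ext fun m l h' x c => LinearMap.congr_fun
    (f := (f ∘ₗ (tmk (A := tens A B) h').flip c : Tens A B m →ₗ[k] W))
    (g := g ∘ₗ (tmk (A := tens A B) h').flip c)
    (tens_ext fun i j h a b => H i j l m h h' a b c) x

/-- Linear maps out of a threefold tensor product. -/
def tlift3 (F : ∀ i j l : ℤ, i + j + l = n → A i →ₗ[k] B j →ₗ[k] C l →ₗ[k] W) :
    Tens (tens A B) C n →ₗ[k] W :=
  tlift (A := tens A B) fun m l h =>
    tlift fun i j h' => F i j l (by omega)

theorem tlift3_tmk (F : ∀ i j l : ℤ, i + j + l = n → A i →ₗ[k] B j →ₗ[k] C l →ₗ[k] W)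
    {i j l m : ℤ} (h : i + j = m) (h' : m + l = n) (a : A i) (b : B j) (c : C l) :
    tlift3 F (tmk (A := tens A B) h' (tmk h a b) c) = F i j l (by omega) a b c := by
  refine (tlift_tmk (A := tens A B) _ h' (tmk h a b) c).trans ?_
  rw [tlift_tmk]

/-- Trilinear maps from functions. -/
def trilin {M N L : Type*} [AddCommGroup M] [Module k M] [AddCommGroup N] [Module k N]
    [AddCommGroup L] [Module k L] (F : M → N → L →ₗ[k] W)
    (h : ∀ (c : k) x y b z, F (x + c • y) b z = F x b z + c • F y b z)
    (h' : ∀ (c : k) a x y z, F a (x + c • y) z = F a x z + c • F a y z) :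
    M →ₗ[k] N →ₗ[k] L →ₗ[k] W :=
  linOf (fun a => linOf (fun b => F a b) fun c x y => LinearMap.ext fun z => h' c a x y z)
    fun c x y => LinearMap.ext fun b => LinearMap.ext fun z => h c x y b z

/-- The associativity `(a ⊗ b) ⊗ c ↦ a ⊗ (b ⊗ c)`. -/
def tassoc : Tens (tens A B) C n →ₗ[k] Tens A (tens B C) n :=
  tlift3 fun i j l h => trilin
    (fun a b => tmk (B := tens B C) (show i + (j + l) = n by omega) a ∘ₗ tmk rfl b)
    (fun c x y b z => by simp [map_add, map_smul]) (fun c a x y z => by simp [map_add, map_smul])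

theorem tassoc_tmk {i j l m : ℤ} (h : i + j = m) (h' : m + l = n) (a : A i) (b : B j) (c : C l) :
    tassoc (tmk (A := tens A B) h' (tmk h a b) c)
      = tmk (B := tens B C) (show i + (j + l) = n by omega) a (tmk rfl b c) :=
  tlift3_tmk _ h h' a b c

/-- The exchange `(a ⊗ b) ⊗ c ↦ ± (a ⊗ c) ⊗ b`. -/
def tswap : Tens (tens A B) C n →ₗ[k] Tens (tens A C) B n :=
  tlift3 fun i j l h => trilin
    (fun a b => sg k (j * l) •
      ((tmk (A := tens A C) (show (i + l) + j = n by omega)).flip b ∘ₗ tmk rfl a))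
    (fun c x y b z => by simp [map_add, map_smul, smul_comm c])
    (fun c a x y z => by simp [map_add, map_smul, smul_comm c])

theorem tswap_tmk {i j l m : ℤ} (h : i + j = m) (h' : m + l = n) (a : A i) (b : B j) (c : C l) :
    tswap (tmk (A := tens A B) h' (tmk h a b) c)
      = sg k (j * l) • tmk (A := tens A C) (show (i + l) + j = n by omega) (tmk rfl a c) b :=
  tlift3_tmk _ h h' a b c

theorem tassoc_tmap (f : ∀ i, A i →ₗ[k] A' i) (g : ∀ i, B i →ₗ[k] B' i)
    (h : ∀ i, C i →ₗ[k] C' i) (x : Tens (tens A B) C n) :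
    tassoc (tmap (A' := tens A' B') (fun _ => tmap f g) h x)
      = tmap (B' := tens B' C') f (fun _ => tmap g h) (tassoc x) := by
  refine LinearMap.congr_fun (f := tassoc ∘ₗ tmap (A := tens A B) (A' := tens A' B')
    (fun _ => tmap f g) h) (g := tmap (B := tens B C) (B' := tens B' C') f (fun _ => tmap g h)
    ∘ₗ tassoc) (tens_ext3 fun i j l m hm hn a b c => ?_) x
  have h1 := (tmap_tmk (A := tens A B) (A' := tens A' B') (fun _ => tmap f g) h hn
    (tmk hm a b) c).trans (congrArg (fun t => tmk (A := tens A' B') hn t (h l c))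
    (tmap_tmk f g hm a b))
  have h2 := (tmap_tmk (B := tens B C) (B' := tens B' C') f (fun _ => tmap g h)
    (show i + (j + l) = n by omega) a (tmk rfl b c)).trans
    (congrArg (tmk (B := tens B' C') _ (f i a)) (tmap_tmk g h rfl b c))
  exact ((congrArg tassoc h1).trans (tassoc_tmk hm hn _ _ _)).trans
    ((congrArg (tmap (B := tens B C) (B' := tens B' C') f fun _ => tmap g h)
      (tassoc_tmk hm hn a b c)).trans h2).symm

theorem tswap_tmap (f : ∀ i, A i →ₗ[k] A' i) (g : ∀ i, B i →ₗ[k] B' i)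
    (h : ∀ i, C i →ₗ[k] C' i) (x : Tens (tens A B) C n) :
    tswap (tmap (A' := tens A' B') (fun _ => tmap f g) h x)
      = tmap (A' := tens A' C') (fun _ => tmap f h) g (tswap x) := by
  refine LinearMap.congr_fun (f := tswap ∘ₗ tmap (A := tens A B) (A' := tens A' B')
    (fun _ => tmap f g) h) (g := tmap (A := tens A C) (A' := tens A' C') (fun _ => tmap f h) g
    ∘ₗ tswap) (tens_ext3 fun i j l m hm hn a b c => ?_) x
  have h1 := (tmap_tmk (A := tens A B) (A' := tens A' B') (fun _ => tmap f g) h hn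
    (tmk hm a b) c).trans (congrArg (fun t => tmk (A := tens A' B') hn t (h l c))
    (tmap_tmk f g hm a b))
  have h2 := (tmap_tmk (A := tens A C) (A' := tens A' C') (fun _ => tmap f h) g
    (show (i + l) + j = n by omega) (tmk rfl a c) b).trans
    (congrArg (fun t => tmk (A := tens A' C') _ t (g j b)) (tmap_tmk f h rfl a c))
  exact ((congrArg tswap h1).trans (tswap_tmk hm hn _ _ _)).trans
    ((congrArg (tmap (A := tens A C) (A' := tens A' C') (fun _ => tmap f h) g)
      (tswap_tmk hm hn a b c)).trans ((map_smul _ _ _).trans (congrArg _ h2))).symm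

/-- The submodule of `A ⊗ B` spanned by the tensors with factors in given submodules. -/
def tensSub (G : ∀ n, Submodule k (A n)) (H : ∀ n, Submodule k (B n)) (n : ℤ) :
    Submodule k (Tens A B n) :=
  Submodule.span k {t | ∃ (i j : ℤ) (h : i + j = n) (a : A i) (b : B j),
    a ∈ G i ∧ b ∈ H j ∧ t = tmk h a b}

theorem tensSub_mono {G G' : ∀ n, Submodule k (A n)} {H H' : ∀ n, Submodule k (B n)}
    (h : ∀ n, G n ≤ G' n) (h' : ∀ n, H n ≤ H' n) (n : ℤ) : tensSub G H n ≤ tensSub G' H' n :=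
  Submodule.span_mono fun _ ⟨i, j, hn, a, b, ha, hb, ht⟩ => ⟨i, j, hn, a, b, h _ ha, h' _ hb, ht⟩

theorem tmap_tensSub {G : ∀ n, Submodule k (A n)} {G' : ∀ n, Submodule k (A' n)}
    {H : ∀ n, Submodule k (B n)} {H' : ∀ n, Submodule k (B' n)} {f : ∀ i, A i →ₗ[k] A' i}
    {g : ∀ i, B i →ₗ[k] B' i} (hf : ∀ i a, a ∈ G i → f i a ∈ G' i)
    (hg : ∀ i b, b ∈ H i → g i b ∈ H' i) {x : Tens A B n} (hx : x ∈ tensSub G H n) :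
    tmap f g x ∈ tensSub G' H' n := by
  have : tensSub G H n ≤ (tensSub G' H' n).comap (tmap f g) := by
    refine Submodule.span_le.2 ?_
    rintro _ ⟨i, j, h, a, b, ha, hb, rfl⟩
    refine Submodule.subset_span ⟨i, j, h, _, _, hf _ _ ha, hg _ _ hb, ?_⟩
    exact tmap_tmk f g h a b
  exact this hx

end Tensor3

/-! ### Trees -/

/-- The suspension `sV`. -/
def susp (V : SMod.{u} k) : SMod.{u} k where
  obj X _ :=
    { C := fun n => V.obj X (n - 1)
      d := fun {i j} h => -(V.obj X).d (show j - 1 + 1 = i - 1 by omega) }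
  map e n := V.map e
  map_refl x := V.map_refl x
  map_trans e f n x := V.map_trans e f x
  map_d e i j h x := by
    rw [LinearMap.neg_apply, LinearMap.neg_apply, map_neg, V.map_d]

/-- The unit `𝕊`-module `I`: the field in degree `0` on one-point sets, zero otherwise. -/
def unitS (k : Type w) [Field k] : SMod.{max u w} k where
  obj X _ :=
    { C := fun n => PLift (n = 0 ∧ Nat.card X = 1) → ULift.{u} k
      d := fun _ => 0 }
  map {X Y} _ _ e n := LinearMap.funLeft k _ fun h => ⟨h.down.1, (Nat.card_congr e).trans h.down.2⟩
  map_refl x := rfl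
  map_trans e f n x := rfl
  map_d e i j h x := rfl

/-- The generator of `I`. -/
def unitOne (k : Type w) [Field k] (X : Type) [Finite X] : (unitS.{u} k).obj X 0 :=
  fun (_ : PLift ((0 : ℤ) = 0 ∧ Nat.card X = 1)) => (⟨1⟩ : ULift.{u} k)

/-- Trees with `w` vertices decorated by `E`, together with a linear order of the vertices in which
every vertex comes after the one that it is attached to: iterated infinitesimal composites. -/
def heap (E : SMod.{u} k) : ℕ → SMod.{max u w} k
  | 0 => unitS.{u} k
  | m + 1 => infComp (heap E m) E

/-- Functoriality of `heap`. -/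
def heapMap {E : SMod.{u} k} {E' : SMod.{u} k} (f : E.Hom E') :
    ∀ m, (heap E m).Hom (heap E' m)
  | 0 => SMod.Hom.id _
  | m + 1 => infMap (heapMap f m) f

/-- The sum over all weights of the modules of ordered trees. -/
def trees (E : SMod.{u} k) : SMod.{max u w} k where
  obj X _ :=
    { C := fun n => ⨁ m : ℕ, (heap E m).obj X n
      d := fun h => DirectSum.lmap fun m => ((heap E m).obj X).d h }
  map e n := DirectSum.lmap fun m => (heap E m).map e
  map_refl x := by
    refine LinearMap.congr_fun (g := LinearMap.id) (DirectSum.linearMap_ext k fun m => ?_) x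
    ext1 y
    simp [SMod.map_refl]
  map_trans {X Y Z} _ _ _ e f n x := by
    refine LinearMap.congr_fun (g := (DirectSum.lmap fun m => (heap E m).map f) ∘ₗ
      DirectSum.lmap fun m => (heap E m).map e) (DirectSum.linearMap_ext k fun m => ?_) x
    ext1 y
    simp [SMod.map_trans]
  map_d {X Y} _ _ e i j h x := by
    refine LinearMap.congr_fun (f := (DirectSum.lmap fun m => (heap E m).map e) ∘ₗ
      DirectSum.lmap fun m => ((heap E m).obj X).d h)
      (g := (DirectSum.lmap fun m => ((heap E m).obj Y).d h) ∘ₗ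
      DirectSum.lmap fun m => (heap E m).map e) (DirectSum.linearMap_ext k fun m => ?_) x
    ext1 y
    simp [SMod.map_d]

/-- The inclusion of the part of weight `m`. -/
def trIn (E : SMod.{u} k) (m : ℕ) {X : Type} [Finite X] {n : ℤ} :
    (heap E m).obj X n →ₗ[k] (trees E).obj X n :=
  DirectSum.lof k ℕ (fun m => (heap E m).obj X n) m

/-- The projection to the part of weight `m`. -/
def trOut (E : SMod.{u} k) (m : ℕ) {X : Type} [Finite X] {n : ℤ} :
    (trees E).obj X n →ₗ[k] (heap E m).obj X n :=
  DirectSum.component k ℕ (fun m => (heap E m).obj X n) m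

theorem trees_ext {E : SMod.{u} k} {X : Type} [Finite X] {n : ℤ} {W : Type*} [AddCommGroup W]
    [Module k W] {f g : (trees E).obj X n →ₗ[k] W}
    (h : ∀ m (x : (heap E m).obj X n), f (trIn E m x) = g (trIn E m x)) : f = g :=
  DirectSum.linearMap_ext k fun m => LinearMap.ext fun x => h m x

theorem trees_map_trIn (E : SMod.{u} k) {X Y : Type} [Finite X] [Finite Y] (e : X ≃ Y) (m : ℕ)
    {n : ℤ} (x : (heap E m).obj X n) :
    (trees E).map e (trIn E m x) = trIn E m ((heap E m).map e x) :=
  DirectSum.lmap_lof _ _ _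

/-- Functoriality of `trees`. -/
def treesMap {E : SMod.{u} k} {E' : SMod.{u} k} (f : E.Hom E') : (trees E).Hom (trees E') where
  app X _ n := DirectSum.lmap fun m => (heapMap f m).app X
  app_map {X Y} _ _ e n x := by
    refine LinearMap.congr_fun (f := (DirectSum.lmap fun m => (heapMap f m).app Y) ∘ₗ
      DirectSum.lmap fun m => (heap E m).map e)
      (g := (DirectSum.lmap fun m => (heap E' m).map e) ∘ₗ
      DirectSum.lmap fun m => (heapMap f m).app X) (DirectSum.linearMap_ext k fun m => ?_) x
    ext1 y
    simp [SMod.Hom.app_map]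
  app_d {X} _ i j h x := by
    refine LinearMap.congr_fun (f := (DirectSum.lmap fun m => (heapMap f m).app X) ∘ₗ
      DirectSum.lmap fun m => ((heap E m).obj X).d h)
      (g := (DirectSum.lmap fun m => ((heap E' m).obj X).d h) ∘ₗ
      DirectSum.lmap fun m => (heapMap f m).app X) (DirectSum.linearMap_ext k fun m => ?_) x
    ext1 y
    simp [SMod.Hom.app_d]

theorem treesMap_trIn {E : SMod.{u} k} {E' : SMod.{u} k} (f : E.Hom E') {X : Type} [Finite X]
    (m : ℕ) {n : ℤ} (x : (heap E m).obj X n) :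
    (treesMap f).app X (trIn E m x) = trIn E' m ((heapMap f m).app X x) :=
  DirectSum.lmap_lof _ _ _

/-! ### Decomposition of trees -/

section Cuts

variable {P Q P' Q' : Type}

/-- Contracting a set of points of `Q` in `P ⊕ Q`. -/
def cutL (U : Set (P ⊕ Q)) (h : ∀ p, Sum.inl p ∉ U) :
    Option {y // y ∉ U} ≃ P ⊕ Option {q // q ∉ Sum.inr ⁻¹' U} where
  toFun
    | none => Sum.inr none
    | some ⟨Sum.inl p, _⟩ => Sum.inl p
    | some ⟨Sum.inr q, hq⟩ => Sum.inr (some ⟨q, hq⟩)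
  invFun
    | Sum.inl p => some ⟨Sum.inl p, h p⟩
    | Sum.inr none => none
    | Sum.inr (some ⟨q, hq⟩) => some ⟨Sum.inr q, hq⟩
  left_inv := by rintro (_ | ⟨_ | _, _⟩) <;> rfl
  right_inv := by rintro (_ | _ | ⟨_, _⟩) <;> rfl

/-- A subset of `P ⊕ Q` contained in `Q`. -/
def cutR (U : Set (P ⊕ Q)) (h : ∀ p, Sum.inl p ∉ U) :
    {y // y ∈ U} ≃ {q // q ∈ Sum.inr ⁻¹' U} where
  toFun
    | ⟨Sum.inl p, hp⟩ => absurd hp (h p)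
    | ⟨Sum.inr q, hq⟩ => ⟨q, hq⟩
  invFun q := ⟨Sum.inr q.1, q.2⟩
  left_inv := by
    rintro ⟨p | q, hp⟩
    · exact absurd hp (h p)
    · rfl
  right_inv _ := rfl

theorem cutL_trans (e : P ≃ P') (f : Q ≃ Q') (U : Set (P' ⊕ Q')) (h : ∀ p, Sum.inl p ∉ U)
    (h' : ∀ p, Sum.inl p ∉ Equiv.sumCongr e f ⁻¹' U) :
    (cplEquiv (Equiv.sumCongr e f) U).trans (cutL U h)
      = (cutL (Equiv.sumCongr e f ⁻¹' U) h').trans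
        (Equiv.sumCongr e (cplEquiv f (Sum.inr ⁻¹' U))) := by
  ext (_ | ⟨_ | _, _⟩) <;> rfl

theorem cutR_trans (e : P ≃ P') (f : Q ≃ Q') (U : Set (P' ⊕ Q')) (h : ∀ p, Sum.inl p ∉ U)
    (h' : ∀ p, Sum.inl p ∉ Equiv.sumCongr e f ⁻¹' U) :
    (preEquiv (Equiv.sumCongr e f) U).trans (cutR U h)
      = (cutR (Equiv.sumCongr e f ⁻¹' U) h').trans (preEquiv f (Sum.inr ⁻¹' U)) := by
  ext ⟨p | q, hp⟩
  · exact absurd hp (h' p)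
  · rfl

/-- Adding one point. -/
def onePt (P : Type) {Q : Type} (h : Nat.card Q = 1) : P ⊕ Q ≃ Option P where
  toFun := Sum.elim some fun _ => none
  invFun := fun o => o.elim (Sum.inr (Nat.card_eq_one_iff_unique.1 h).2.some) Sum.inl
  left_inv := by
    have := (Nat.card_eq_one_iff_unique.1 h).1
    rintro (p | q)
    · rfl
    · exact congrArg Sum.inr (Subsingleton.elim _ _)
  right_inv := by rintro (_ | _) <;> rfl

theorem onePt_trans (e : P ≃ P') (f : Q ≃ Q') (h : Nat.card Q = 1) (h' : Nat.card Q' = 1) :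
    (Equiv.sumCongr e f).trans (onePt P' h') = (onePt P h).trans (Equiv.optionCongr e) := by
  ext (_ | _) <;> rfl

end Cuts

section Delta

variable (E : SMod.{u} k) {P Q P' Q' : Type} [Finite P] [Finite Q] [Finite P'] [Finite Q']
  {n : ℤ}

/-- The inclusion of the summand of `(A ∘₁ B)(Q)` at `Z ⊆ Q`. -/
def infIn (A : SMod.{u} k) (B : SMod.{v} k) {Q : Type} [Finite Q] (Z : Set Q) (n : ℤ) :
    Tens (A.obj (Option {x // x ∉ Z})) (B.obj {x // x ∈ Z}) n →ₗ[k] (infComp A B).obj Q n :=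
  haveI := Classical.decEq (Set Q)
  LinearMap.single k (fun U : Set Q => Tens (A.obj (Option {x // x ∉ U})) (B.obj {x // x ∈ U}) n) Z

theorem infIn_same (A : SMod.{u} k) (B : SMod.{v} k) (Z : Set Q)
    (x : Tens (A.obj (Option {x // x ∉ Z})) (B.obj {x // x ∈ Z}) n) :
    infProj A B Z n (infIn A B Z n x) = x :=
  @Pi.single_eq_same (Set Q) (fun U => Tens (A.obj (Option {x // x ∉ U})) (B.obj {x // x ∈ U}) n)
    _ (Classical.decEq _) Z x

theorem infIn_ne (A : SMod.{u} k) (B : SMod.{v} k) {U Z : Set Q} (h : U ≠ Z)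
    (x : Tens (A.obj (Option {x // x ∉ Z})) (B.obj {x // x ∈ Z}) n) :
    infProj A B U n (infIn A B Z n x) = 0 :=
  @Pi.single_eq_of_ne (Set Q) (fun U => Tens (A.obj (Option {x // x ∉ U})) (B.obj {x // x ∈ U}) n)
    _ (Classical.decEq _) _ _ h x

theorem infProj_map (A : SMod.{u} k) (B : SMod.{v} k) (f : Q ≃ Q') (U : Set Q')
    (x : (infComp A B).obj Q n) : infProj A B U n ((infComp A B).map f x)
      = tmap (fun _ => A.map (cplEquiv f U)) (fun _ => B.map (preEquiv f U))
        (infProj A B (f ⁻¹' U) n x) := rfl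

theorem infProj_hom {A A' : SMod.{u} k} {B B' : SMod.{v} k} (f : A.Hom A') (g : B.Hom B')
    (U : Set Q) (x : (infComp A B).obj Q n) : infProj A' B' U n ((infMap f g).app Q x)
      = tmap (fun _ => f.app _) (fun _ => g.app _) (infProj A B U n x) := rfl

theorem infIn_map (A : SMod.{u} k) (B : SMod.{v} k) (f : Q ≃ Q') (Z : Set Q')
    (x : Tens (A.obj (Option {x // x ∉ f ⁻¹' Z})) (B.obj {x // x ∈ f ⁻¹' Z}) n) :
    (infComp A B).map f (infIn A B (f ⁻¹' Z) n x)
      = infIn A B Z n (tmap (fun _ => A.map (cplEquiv f Z)) (fun _ => B.map (preEquiv f Z)) x) := by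
  refine infComp_ext fun U => ?_
  rw [infProj_map]
  by_cases hU : U = Z
  · subst hU
    rw [infIn_same, infIn_same]
  · rw [infIn_ne A B hU, infIn_ne A B fun h => hU (f.surjective.preimage_injective h), map_zero]

theorem infIn_hom {A A' : SMod.{u} k} {B B' : SMod.{v} k} (f : A.Hom A') (g : B.Hom B') (Z : Set Q)
    (x : Tens (A.obj (Option {x // x ∉ Z})) (B.obj {x // x ∈ Z}) n) :
    (infMap f g).app Q (infIn A B Z n x)
      = infIn A' B' Z n (tmap (fun _ => f.app _) (fun _ => g.app _) x) := by
  refine infComp_ext fun U => ?_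
  rw [infProj_hom]
  by_cases hU : U = Z
  · subst hU
    rw [infIn_same, infIn_same]
  · rw [infIn_ne A B hU, infIn_ne A' B' hU, map_zero]

/-- The inclusion of `heap E m ∘₁ E` as the part of weight `m + 1`. -/
def trCons (m : ℕ) (Q : Type) [Finite Q] (n : ℤ) :
    (infComp (heap E m) E).obj Q n →ₗ[k] (trees E).obj Q n := trIn E (m + 1)

theorem trCons_map (f : Q ≃ Q') (m : ℕ) (x : (infComp (heap E m) E).obj Q n) :
    (trees E).map f (trCons E m Q n x) = trCons E m Q' n ((infComp (heap E m) E).map f x) :=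
  trees_map_trIn E f (m + 1) x

theorem trCons_hom {E E' : SMod.{u} k} (φ : E.Hom E') (m : ℕ) (x : (infComp (heap E m) E).obj Q n) :
    (treesMap φ).app Q (trCons E m Q n x)
      = trCons E' m Q n ((infMap (heapMap φ m) φ).app Q x) :=
  treesMap_trIn φ (m + 1) x

/-- The trivial tree. -/
def trOne (Q : Type) [Finite Q] : (trees E).obj Q 0 := trIn E 0 (unitOne.{u} k Q)

theorem trOne_map (f : Q ≃ Q') : (trees E).map f (trOne E Q) = trOne E Q' :=
  trees_map_trIn E f 0 (unitOne.{u} k Q)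

theorem trOne_hom {E E' : SMod.{u} k} (φ : E.Hom E') :
    (treesMap φ).app Q (trOne E Q) = trOne E' Q := treesMap_trIn φ 0 (unitOne.{u} k Q)

/-- The component at `U` of a tree of weight `m + 1`: the last vertex has inputs `U`. -/
def lastAt (m : ℕ) (U : Set Q) (n : ℤ) : (heap E (m + 1)).obj Q n →ₗ[k]
    Tens ((heap E m).obj (Option {x // x ∉ U})) (E.obj {x // x ∈ U}) n := infProj (heap E m) E U n

theorem lastAt_map (f : Q ≃ Q') (m : ℕ) (U : Set Q') (x : (heap E (m + 1)).obj Q n) :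
    lastAt E m U n ((heap E (m + 1)).map f x)
      = tmap (fun _ => (heap E m).map (cplEquiv f U)) (fun _ => E.map (preEquiv f U))
        (lastAt E m (f ⁻¹' U) n x) := rfl

theorem lastAt_hom {E E' : SMod.{u} k} (φ : E.Hom E') (m : ℕ) (U : Set Q)
    (x : (heap E (m + 1)).obj Q n) :
    lastAt E' m U n ((heapMap φ (m + 1)).app Q x)
      = tmap (fun _ => (heapMap φ m).app _) (fun _ => φ.app _) (lastAt E m U n x) := rfl

/-- Attaching one more vertex with set of inputs `Z` to a tree with inputs `Q/Z`. -/
def attach (Z : Set Q) (n : ℤ) :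
    Tens ((trees E).obj (Option {x // x ∉ Z})) (E.obj {x // x ∈ Z}) n →ₗ[k] (trees E).obj Q n :=
  tlift fun _ _ h => DirectSum.toModule k ℕ _ fun m =>
    (tmk h).compr₂ (trCons E m Q n ∘ₗ infIn (heap E m) E Z n)

theorem attach_tmk (Z : Set Q) (m : ℕ) {i j : ℤ} (h : i + j = n)
    (x : (heap E m).obj (Option {x // x ∉ Z}) i) (b : E.obj {x // x ∈ Z} j) :
    attach E Z n (tmk h (trIn E m x) b)
      = trCons E m Q n (infIn (heap E m) E Z n (tmk h x b)) := by
  refine (tlift_tmk _ h _ b).trans ?_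
  refine (LinearMap.congr_fun (DirectSum.toModule_lof (M := fun m => (heap E m).obj _ i)
    k m x) b).trans ?_
  rfl

theorem attach_ext {W : Type*} [AddCommGroup W] [Module k W] {Z : Set Q} {f g :
    Tens ((trees E).obj (Option {x // x ∉ Z})) (E.obj {x // x ∈ Z}) n →ₗ[k] W}
    (H : ∀ (m : ℕ) (i j : ℤ) (h : i + j = n) (x : (heap E m).obj (Option {x // x ∉ Z}) i)
      (b : E.obj {x // x ∈ Z} j), f (tmk h (trIn E m x) b) = g (tmk h (trIn E m x) b)) :
    f = g :=
  tens_ext fun i j h a b => LinearMap.congr_fun (f := f ∘ₗ (tmk h).flip b)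
    (g := g ∘ₗ (tmk h).flip b) (trees_ext fun m x => H m i j h x b) a

theorem attach_map (f : Q ≃ Q') (Z : Set Q')
    (x : Tens ((trees E).obj (Option {x // x ∉ f ⁻¹' Z})) (E.obj {x // x ∈ f ⁻¹' Z}) n) :
    attach E Z n (tmap (fun _ => (trees E).map (cplEquiv f Z)) (fun _ => E.map (preEquiv f Z)) x)
      = (trees E).map f (attach E (f ⁻¹' Z) n x) := by
  refine LinearMap.congr_fun (f := attach E Z n ∘ₗ tmap (fun _ => (trees E).map (cplEquiv f Z))
    (fun _ => E.map (preEquiv f Z))) (g := (trees E).map f ∘ₗ attach E (f ⁻¹' Z) n)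
    (attach_ext E fun m i j h x b => ?_) x
  rw [LinearMap.comp_apply, LinearMap.comp_apply, tmap_tmk, trees_map_trIn, attach_tmk,
    attach_tmk, trCons_map]
  refine congrArg _ (Eq.trans ?_ (infIn_map (heap E m) E f Z (tmk h x b)).symm)
  exact congrArg _ (tmap_tmk _ _ h x b).symm

theorem attach_hom {E E' : SMod.{u} k} (φ : E.Hom E') (Z : Set Q)
    (x : Tens ((trees E).obj (Option {x // x ∉ Z})) (E.obj {x // x ∈ Z}) n) :
    attach E' Z n (tmap (fun _ => (treesMap φ).app _) (fun _ => φ.app _) x)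
      = (treesMap φ).app Q (attach E Z n x) := by
  refine LinearMap.congr_fun (f := attach E' Z n ∘ₗ tmap (fun _ => (treesMap φ).app _)
    (fun _ => φ.app _)) (g := (treesMap φ).app Q ∘ₗ attach E Z n)
    (attach_ext E fun m i j h x b => ?_) x
  rw [LinearMap.comp_apply, LinearMap.comp_apply, tmap_tmk, treesMap_trIn, attach_tmk,
    attach_tmk, trCons_hom]
  refine congrArg _ (Eq.trans ?_ (infIn_hom (heapMap φ m) φ Z (tmk h x b)).symm)
  exact congrArg _ (tmap_tmk _ _ h x b).symm

/-- The decomposition `x ↦ x ⊗ 1` of a tree in which the upper tree is trivial. -/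
def rtriv (P Q : Type) [Finite P] [Finite Q] (n : ℤ) : (trees E).obj (P ⊕ Q) n →ₗ[k]
    Tens ((trees E).obj (Option P)) ((trees E).obj Q) n :=
  if h : Nat.card Q = 1 then
    (tmk (add_zero n)).flip (trOne E Q) ∘ₗ (trees E).map (onePt P h)
  else 0

theorem rtriv_map (e : P ≃ P') (f : Q ≃ Q') (x : (trees E).obj (P ⊕ Q) n) :
    rtriv E P' Q' n ((trees E).map (Equiv.sumCongr e f) x)
      = tmap (fun _ => (trees E).map (Equiv.optionCongr e)) (fun _ => (trees E).map f)
        (rtriv E P Q n x) := by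
  unfold rtriv
  by_cases h : Nat.card Q = 1
  · have h' : Nat.card Q' = 1 := (Nat.card_congr f.symm).trans h
    rw [dif_pos h, dif_pos h']
    refine Eq.trans ?_ (tmap_tmk _ _ _ _ _).symm
    refine congrArg₂ (fun s t => tmk (add_zero n) s t) ?_ ?_
    · rw [← SMod.map_trans, ← SMod.map_trans, onePt_trans e f h h']
    · exact (trOne_map E f).symm
  · have h' : ¬ Nat.card Q' = 1 := fun h' => h ((Nat.card_congr f).trans h')
    rw [dif_neg h, dif_neg h', LinearMap.zero_apply, LinearMap.zero_apply, map_zero]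

theorem rtriv_hom {E E' : SMod.{u} k} (φ : E.Hom E') (x : (trees E).obj (P ⊕ Q) n) :
    rtriv E' P Q n ((treesMap φ).app _ x)
      = tmap (fun _ => (treesMap φ).app _) (fun _ => (treesMap φ).app _) (rtriv E P Q n x) := by
  unfold rtriv
  by_cases h : Nat.card Q = 1
  · rw [dif_pos h, dif_pos h]
    refine Eq.trans ?_ (tmap_tmk _ _ _ _ _).symm
    refine congrArg₂ (fun s t => tmk (add_zero n) s t) ?_ ?_
    · exact ((treesMap φ).app_map _ _).symm
    · exact (trOne_hom φ).symm
  · rw [dif_neg h, dif_neg h, LinearMap.zero_apply, LinearMap.zero_apply, map_zero]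

/-- The composite `A ⊗ B → (T₁ ⊗ T₂) ⊗ B₁ ≅ T₁ ⊗ (T₂ ⊗ B₁) → T₁ ⊗ T₃`. -/
def regroup {A : GrMod.{u'} k} {B B₁ : GrMod.{u} k} {T₁ T₂ T₃ : GrMod.{v} k}
    (F : ∀ i, A i →ₗ[k] Tens T₁ T₂ i) (G : ∀ i, B i →ₗ[k] B₁ i)
    (H : ∀ i, Tens T₂ B₁ i →ₗ[k] T₃ i) (n : ℤ) : Tens A B n →ₗ[k] Tens T₁ T₃ n :=
  tmap (B := tens T₂ B₁) (fun _ => LinearMap.id) H ∘ₗ tassoc ∘ₗ tmap (A' := tens T₁ T₂) F G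

theorem regroup_nat {A A' : GrMod.{u'} k} {B B₁ B' B₁' : GrMod.{u} k}
    {T₁ T₂ T₃ T₁' T₂' T₃' : GrMod.{v} k}
    {F : ∀ i, A i →ₗ[k] Tens T₁ T₂ i} {G : ∀ i, B i →ₗ[k] B₁ i}
    {H : ∀ i, Tens T₂ B₁ i →ₗ[k] T₃ i} {F' : ∀ i, A' i →ₗ[k] Tens T₁' T₂' i}
    {G' : ∀ i, B' i →ₗ[k] B₁' i} {H' : ∀ i, Tens T₂' B₁' i →ₗ[k] T₃' i}
    (a : ∀ i, A i →ₗ[k] A' i) (b : ∀ i, B i →ₗ[k] B' i) (b₁ : ∀ i, B₁ i →ₗ[k] B₁' i)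
    (t₁ : ∀ i, T₁ i →ₗ[k] T₁' i) (t₂ : ∀ i, T₂ i →ₗ[k] T₂' i) (t₃ : ∀ i, T₃ i →ₗ[k] T₃' i)
    (hF : ∀ i x, F' i (a i x) = tmap t₁ t₂ (F i x)) (hG : ∀ i x, G' i (b i x) = b₁ i (G i x))
    (hH : ∀ i x, H' i (tmap t₂ b₁ x) = t₃ i (H i x)) {n : ℤ} (x : Tens A B n) :
    regroup F' G' H' n (tmap a b x) = tmap t₁ t₃ (regroup F G H n x) := by
  unfold regroup
  rw [LinearMap.comp_apply, LinearMap.comp_apply, LinearMap.comp_apply, LinearMap.comp_apply]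
  have h1 := (tmap_comp (A'' := tens T₁' T₂') (f'' := fun i => F' i ∘ₗ a i)
    (g'' := fun i => G' i ∘ₗ b i) (f := a) (g := b) (f' := F') (g' := G')
    (fun _ _ => rfl) (fun _ _ => rfl) x).symm.trans
    (tmap_comp (A' := tens T₁ T₂) (A'' := tens T₁' T₂') (f := F) (g := G)
      (f' := fun _ => tmap t₁ t₂) (g' := b₁) hF hG x)
  have h3 := (tmap_comp (B := tens T₂ B₁) (B' := tens T₂' B₁') (f'' := t₁)
    (g'' := fun j => t₃ j ∘ₗ H j) (f := t₁) (g := fun _ => tmap t₂ b₁)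
    (f' := fun _ => LinearMap.id) (g' := H')
    (fun _ _ => rfl) (fun j b => (hH j b).symm) (tassoc (tmap (A' := tens T₁ T₂) F G x))).symm.trans
    (tmap_comp (B := tens T₂ B₁) (f := fun _ => LinearMap.id) (g := H) (f' := t₁) (g' := t₃)
      (fun _ _ => rfl) (fun _ _ => rfl) _)
  rw [h1, tassoc_tmap]
  exact h3

/-- Decompose a tree with last vertex `b ∈ E(U)`, `U ⊆ Q`, where `F` decomposes the tree without
its last vertex: the last vertex belongs to the upper tree. -/
def step {A : SMod.{max u w} k} (F : ∀ (R : Type) [Finite R] (i : ℤ), A.obj (P ⊕ R) i →ₗ[k]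
      Tens ((trees E).obj (Option P)) ((trees E).obj R) i)
    (U : Set (P ⊕ Q)) (h : ∀ p, Sum.inl p ∉ U) (n : ℤ) :
    Tens (A.obj (Option {y // y ∉ U})) (E.obj {y // y ∈ U}) n →ₗ[k]
      Tens ((trees E).obj (Option P)) ((trees E).obj Q) n :=
  regroup (fun i => F _ i ∘ₗ A.map (cutL U h)) (fun _ => E.map (cutR U h))
    (fun j => attach E (Sum.inr ⁻¹' U) j) n

/-- The decomposition of ordered trees with leaves `P ⊕ Q` into a lower tree with leaves
`P` and one extra leaf, and an upper tree with leaves `Q`, such that the vertices of the upper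
tree come last. -/
def heapDelta (P : Type) [Finite P] : ∀ (m : ℕ) (Q : Type) [Finite Q] (n : ℤ),
    (heap E m).obj (P ⊕ Q) n →ₗ[k] Tens ((trees E).obj (Option P)) ((trees E).obj Q) n
  | 0, Q, _, n => rtriv E P Q n ∘ₗ trIn E 0
  | m + 1, Q, _, n =>
    letI := Fintype.ofFinite {U : Set (P ⊕ Q) // ∀ p, Sum.inl p ∉ U}
    rtriv E P Q n ∘ₗ trIn E (m + 1) + ∑ U : {U : Set (P ⊕ Q) // ∀ p, Sum.inl p ∉ U},
      step E (fun R _ i => heapDelta P m R i) U.1 U.2 n ∘ₗ lastAt E m U.1 n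

/-- The decomposition map of the `𝕊`-module of ordered trees. -/
def delta (P Q : Type) [Finite P] [Finite Q] (n : ℤ) : (trees E).obj (P ⊕ Q) n →ₗ[k]
    Tens ((trees E).obj (Option P)) ((trees E).obj Q) n :=
  DirectSum.toModule k ℕ _ fun m => heapDelta E P m Q n

theorem delta_trIn (m : ℕ) (x : (heap E m).obj (P ⊕ Q) n) :
    delta E P Q n (trIn E m x) = heapDelta E P m Q n x :=
  DirectSum.toModule_lof (M := fun m => (heap E m).obj (P ⊕ Q) n) k m x

theorem step_map {A : SMod.{max u w} k}
    (F : ∀ (R : Type) [Finite R] (i : ℤ), A.obj (P ⊕ R) i →ₗ[k]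
      Tens ((trees E).obj (Option P)) ((trees E).obj R) i)
    (F' : ∀ (R : Type) [Finite R] (i : ℤ), A.obj (P' ⊕ R) i →ₗ[k]
      Tens ((trees E).obj (Option P')) ((trees E).obj R) i) (e : P ≃ P') (f : Q ≃ Q')
    (hF : ∀ (R R' : Type) [Finite R] [Finite R'] (i : ℤ) (g : R ≃ R') (x : A.obj (P ⊕ R) i),
      F' R' i (A.map (Equiv.sumCongr e g) x) = tmap (fun _ => (trees E).map (Equiv.optionCongr e))
        (fun _ => (trees E).map g) (F R i x))
    (U : Set (P' ⊕ Q')) (h : ∀ p, Sum.inl p ∉ U) (h' : ∀ p, Sum.inl p ∉ Equiv.sumCongr e f ⁻¹' U)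
    (x : Tens (A.obj (Option {y // y ∉ Equiv.sumCongr e f ⁻¹' U}))
      (E.obj {y // y ∈ Equiv.sumCongr e f ⁻¹' U}) n) :
    step E F' U h n (tmap (fun _ => A.map (cplEquiv (Equiv.sumCongr e f) U))
        (fun _ => E.map (preEquiv (Equiv.sumCongr e f) U)) x)
      = tmap (fun _ => (trees E).map (Equiv.optionCongr e)) (fun _ => (trees E).map f)
        (step E F (Equiv.sumCongr e f ⁻¹' U) h' n x) := by
  refine regroup_nat _ _ (fun _ => E.map (preEquiv f (Sum.inr ⁻¹' U))) _
    (fun _ => (trees E).map (cplEquiv f (Sum.inr ⁻¹' U))) _ (fun i a => ?_) (fun i b => ?_)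
    (fun i x => attach_map E f _ x) x
  · refine Eq.trans ?_ (hF _ _ i (cplEquiv f (Sum.inr ⁻¹' U))
      (A.map (cutL (Equiv.sumCongr e f ⁻¹' U) h') a))
    refine congrArg (F' _ i) ?_
    exact (A.map_trans _ _ _).symm.trans
      ((congrArg (fun t => A.map t a) (cutL_trans e f U h h')).trans (A.map_trans _ _ _))
  · exact (E.map_trans _ _ _).symm.trans
      ((congrArg (fun t => E.map t b) (cutR_trans e f U h h')).trans (E.map_trans _ _ _))

theorem heapDelta_map (e : P ≃ P') (m : ℕ) : ∀ {Q Q' : Type} [Finite Q] [Finite Q'] (f : Q ≃ Q')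
    {n : ℤ} (x : (heap E m).obj (P ⊕ Q) n),
    heapDelta E P' m Q' n ((heap E m).map (Equiv.sumCongr e f) x)
      = tmap (fun _ => (trees E).map (Equiv.optionCongr e)) (fun _ => (trees E).map f)
        (heapDelta E P m Q n x) := by
  have h0 : ∀ (m : ℕ) {Q Q' : Type} [Finite Q] [Finite Q'] (f : Q ≃ Q')
      {n : ℤ} (x : (heap E m).obj (P ⊕ Q) n),
      rtriv E P' Q' n (trIn E m ((heap E m).map (Equiv.sumCongr e f) x))
      = tmap (fun _ => (trees E).map (Equiv.optionCongr e)) (fun _ => (trees E).map f)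
        (rtriv E P Q n (trIn E m x)) := fun m Q Q' _ _ f n x => by
    rw [← trees_map_trIn, rtriv_map]
  induction m with
  | zero => exact fun f n x => h0 0 f x
  | succ m ih =>
    intro Q Q' _ _ f n x
    unfold heapDelta
    simp only [LinearMap.add_apply, LinearMap.sum_apply, LinearMap.comp_apply, map_add, map_sum]
    refine congrArg₂ _ (h0 (m + 1) f x) ?_
    let := Fintype.ofFinite {U : Set (P ⊕ Q) // ∀ p, Sum.inl p ∉ U}
    let := Fintype.ofFinite {U : Set (P' ⊕ Q') // ∀ p, Sum.inl p ∉ U}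
    let t : {U : Set (P' ⊕ Q') // ∀ p, Sum.inl p ∉ U} ≃ {U : Set (P ⊕ Q) // ∀ p, Sum.inl p ∉ U} :=
      { toFun := fun U => ⟨Equiv.sumCongr e f ⁻¹' U.1, fun p => U.2 (e p)⟩
        invFun := fun U => ⟨(Equiv.sumCongr e f).symm ⁻¹' U.1, fun p => U.2 (e.symm p)⟩
        left_inv := fun U => Subtype.ext ((Equiv.sumCongr e f).symm_preimage_preimage _)
        right_inv := fun U => Subtype.ext ((Equiv.sumCongr e f).preimage_symm_preimage _) }
    refine Fintype.sum_equiv t _ _ fun U => ?_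
    rw [lastAt_map]
    exact step_map E _ _ e f (fun R R' _ _ i g x => ih g x) U.1 U.2 (t U).2 _

theorem delta_map (e : P ≃ P') (f : Q ≃ Q') (x : (trees E).obj (P ⊕ Q) n) :
    delta E P' Q' n ((trees E).map (Equiv.sumCongr e f) x)
      = tmap (fun _ => (trees E).map (Equiv.optionCongr e)) (fun _ => (trees E).map f)
        (delta E P Q n x) := by
  refine LinearMap.congr_fun (f := delta E P' Q' n ∘ₗ (trees E).map (Equiv.sumCongr e f))
    (g := tmap (fun _ => (trees E).map (Equiv.optionCongr e)) (fun _ => (trees E).map f) ∘ₗ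
      delta E P Q n) (trees_ext fun m x => ?_) x
  rw [LinearMap.comp_apply, LinearMap.comp_apply, trees_map_trIn, delta_trIn, delta_trIn,
    heapDelta_map]

theorem step_hom {E E' : SMod.{u} k} (φ : E.Hom E') {A A' : SMod.{max u w} k} (ψ : A.Hom A')
    (F : ∀ (R : Type) [Finite R] (i : ℤ), A.obj (P ⊕ R) i →ₗ[k]
      Tens ((trees E).obj (Option P)) ((trees E).obj R) i)
    (F' : ∀ (R : Type) [Finite R] (i : ℤ), A'.obj (P ⊕ R) i →ₗ[k]
      Tens ((trees E').obj (Option P)) ((trees E').obj R) i)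
    (hF : ∀ (R : Type) [Finite R] (i : ℤ) (x : A.obj (P ⊕ R) i),
      F' R i (ψ.app _ x) = tmap (fun _ => (treesMap φ).app _)
        (fun _ => (treesMap φ).app _) (F R i x))
    (U : Set (P ⊕ Q)) (h : ∀ p, Sum.inl p ∉ U)
    (x : Tens (A.obj (Option {y // y ∉ U})) (E.obj {y // y ∈ U}) n) :
    step E' F' U h n (tmap (fun _ => ψ.app _) (fun _ => φ.app _) x)
      = tmap (fun _ => (treesMap φ).app _) (fun _ => (treesMap φ).app _) (step E F U h n x) := by
  refine regroup_nat _ _ (fun _ => φ.app _) _ (fun _ => (treesMap φ).app _) _ (fun i a => ?_)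
    (fun i b => (φ.app_map _ _).symm) (fun i x => attach_hom φ _ x) x
  exact (congrArg (F' _ i) (ψ.app_map _ _).symm).trans (hF _ i (A.map (cutL U h) a))

theorem heapDelta_hom {E E' : SMod.{u} k} (φ : E.Hom E') (m : ℕ) : ∀ {Q : Type} [Finite Q]
    {n : ℤ} (x : (heap E m).obj (P ⊕ Q) n),
    heapDelta E' P m Q n ((heapMap φ m).app _ x)
      = tmap (fun _ => (treesMap φ).app _) (fun _ => (treesMap φ).app _)
        (heapDelta E P m Q n x) := by
  have h0 : ∀ (m : ℕ) {Q : Type} [Finite Q] {n : ℤ} (x : (heap E m).obj (P ⊕ Q) n),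
      rtriv E' P Q n (trIn E' m ((heapMap φ m).app _ x))
      = tmap (fun _ => (treesMap φ).app _) (fun _ => (treesMap φ).app _)
        (rtriv E P Q n (trIn E m x)) := fun m Q _ n x => by
    rw [← treesMap_trIn, rtriv_hom]
  induction m with
  | zero => exact fun x => h0 0 x
  | succ m ih =>
    intro Q _ n x
    unfold heapDelta
    simp only [LinearMap.add_apply, LinearMap.sum_apply, LinearMap.comp_apply, map_add, map_sum]
    refine congrArg₂ _ (h0 (m + 1) x) (Finset.sum_congr rfl fun U _ => ?_)
    rw [lastAt_hom]
    exact step_hom φ (heapMap φ m) _ _ (fun R _ i x => ih x) U.1 U.2 _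

theorem delta_hom {E E' : SMod.{u} k} (φ : E.Hom E') (x : (trees E).obj (P ⊕ Q) n) :
    delta E' P Q n ((treesMap φ).app _ x)
      = tmap (fun _ => (treesMap φ).app _) (fun _ => (treesMap φ).app _) (delta E P Q n x) := by
  refine LinearMap.congr_fun (f := delta E' P Q n ∘ₗ (treesMap φ).app _)
    (g := tmap (fun _ => (treesMap φ).app _) (fun _ => (treesMap φ).app _) ∘ₗ
      delta E P Q n) (trees_ext fun m x => ?_) x
  rw [LinearMap.comp_apply, LinearMap.comp_apply, treesMap_trIn, delta_trIn, delta_trIn,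
    heapDelta_hom]

end Delta

/-! ### The Koszul dual cooperad -/

section Cap

variable (E : SMod.{u} k) {X Y : Type} [Finite X] [Finite Y] {n : ℤ}

/-- The canonical map from `I` to the base field. -/
def unitVal (k : Type w) [Field k] (X : Type) [Finite X] (i : ℤ) : (unitS.{u} k).obj X i →ₗ[k] k :=
  haveI := Classical.dec (i = 0 ∧ Nat.card X = 1)
  if h : i = 0 ∧ Nat.card X = 1 then
    { toFun := fun (s : PLift (i = 0 ∧ Nat.card X = 1) → ULift.{u} k) => (s ⟨h⟩).down
      map_add' := fun _ _ => rfl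
      map_smul' := fun _ _ => rfl }
  else 0

theorem unitVal_map (e : X ≃ Y) (i : ℤ) (s : (unitS.{u} k).obj X i) :
    unitVal k Y i ((unitS.{u} k).map e s) = unitVal k X i s := by
  unfold unitVal
  by_cases h : i = 0 ∧ Nat.card X = 1
  · have h' : i = 0 ∧ Nat.card Y = 1 := ⟨h.1, (Nat.card_congr e.symm).trans h.2⟩
    rw [dif_pos h, dif_pos h']
    rfl
  · have h' : ¬ (i = 0 ∧ Nat.card Y = 1) := fun h' => h ⟨h'.1, (Nat.card_congr e).trans h'.2⟩
    rw [dif_neg h, dif_neg h']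
    rfl

/-- The bilinear map `s, b ↦ s • b` for `s ∈ I(X)`. -/
def unitSmul (X Y : Type) [Finite X] [Finite Y] (i j : ℤ) (h : i + j = n) :
    (unitS.{u} k).obj X i →ₗ[k] E.obj Y j →ₗ[k] E.obj Y n :=
  if hi : i = 0 then
    ((LinearMap.lsmul k (E.obj Y n) : k →ₗ[k] _) ∘ₗ unitVal k X i).compl₂
      ((E.obj Y).cast (show j = n by omega))
  else 0

theorem GrMod.cast_apply (M : GrMod.{u} k) {i j : ℤ} (h : i = j) (x : M i) :
    M.cast h x = h ▸ x := by subst h; rfl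

theorem SMod.map_cast (e : X ≃ Y) {i j : ℤ} (h : i = j) (x : E.obj X i) :
    E.map e ((E.obj X).cast h x) = (E.obj Y).cast h (E.map e x) := by subst h; rfl

theorem SMod.Hom.app_cast {E : SMod.{u} k} {E' : SMod.{v} k} (φ : E.Hom E') {i j : ℤ} (h : i = j)
    (x : E.obj X i) :
    φ.app X ((E.obj X).cast h x) = (E'.obj X).cast h (φ.app X x) := by subst h; rfl

theorem unitSmul_map {X' Y' : Type} [Finite X'] [Finite Y'] (e : X ≃ X') (f : Y ≃ Y') (i j : ℤ)
    (h : i + j = n) (s : (unitS.{u} k).obj X i) (b : E.obj Y j) :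
    unitSmul E X' Y' i j h ((unitS.{u} k).map e s) (E.map f b)
      = E.map f (unitSmul E X Y i j h s b) := by
  unfold unitSmul
  by_cases hi : i = 0
  · rw [dif_pos hi, dif_pos hi]
    have hj : j = n := by omega
    change unitVal k X' i ((unitS.{u} k).map e s) • (E.obj Y').cast hj (E.map f b)
      = E.map f (unitVal k X i s • (E.obj Y).cast hj b)
    rw [unitVal_map, map_smul, SMod.map_cast]
  · rw [dif_neg hi, dif_neg hi]
    exact (map_zero _).symm

theorem unitSmul_hom {E E' : SMod.{u} k} (φ : E.Hom E') (i j : ℤ) (h : i + j = n)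
    (s : (unitS.{u} k).obj X i) (b : E.obj Y j) :
    unitSmul E' X Y i j h s (φ.app Y b) = φ.app Y (unitSmul E X Y i j h s b) := by
  unfold unitSmul
  by_cases hi : i = 0
  · rw [dif_pos hi, dif_pos hi]
    have hj : j = n := by omega
    change unitVal k X i s • (E'.obj Y).cast hj (φ.app Y b)
      = φ.app Y (unitVal k X i s • (E.obj Y).cast hj b)
    rw [map_smul, SMod.Hom.app_cast]
  · rw [dif_neg hi, dif_neg hi]
    exact (map_zero _).symm

/-- The identification of trees with one vertex with elements of `E`. -/
def cap (X : Type) [Finite X] (n : ℤ) : (heap E 1).obj X n →ₗ[k] E.obj X n :=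
  E.map (Equiv.Set.univ X) ∘ₗ tlift (fun i j h => unitSmul E _ _ i j h) ∘ₗ lastAt E 0 Set.univ n

theorem cap_map (e : X ≃ Y) (x : (heap E 1).obj X n) :
    cap E Y n ((heap E 1).map e x) = E.map e (cap E X n x) := by
  have h1 := (tlift_tmap (A := (unitS.{u} k).obj (Option {x // x ∉ e ⁻¹' Set.univ}))
    (B := E.obj {x // x ∈ e ⁻¹' Set.univ})
    (fun i j h => unitSmul E (Option {y // y ∉ (Set.univ : Set Y)}) {y // y ∈ (Set.univ : Set Y)}
      i j h)
    (fun i j h => (unitSmul E (Option {x // x ∉ e ⁻¹' Set.univ}) {x // x ∈ e ⁻¹' Set.univ}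
      i j h).compr₂ (E.map (preEquiv e Set.univ)))
    (fun _ => (unitS.{u} k).map (cplEquiv e Set.univ)) (fun _ => E.map (preEquiv e Set.univ))
    (fun i j h a b => (unitSmul_map E (cplEquiv e Set.univ) (preEquiv e Set.univ) i j h a b).symm)
    (lastAt E 0 (e ⁻¹' Set.univ) n x)).symm.trans
    (tlift_post _ _ (E.map (preEquiv e Set.univ)) (fun _ _ _ _ _ => rfl) _).symm
  refine (congrArg (E.map (Equiv.Set.univ Y)) h1).trans ?_
  exact (E.map_trans (preEquiv e Set.univ) (Equiv.Set.univ Y) _).symm.trans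
    (E.map_trans (Equiv.Set.univ X) e _)

theorem cap_hom {E E' : SMod.{u} k} (φ : E.Hom E') (x : (heap E 1).obj X n) :
    cap E' X n ((heapMap φ 1).app X x) = φ.app X (cap E X n x) := by
  have h1 := (tlift_tmap (A := (unitS.{u} k).obj (Option {x // x ∉ (Set.univ : Set X)}))
    (B := E.obj {x // x ∈ (Set.univ : Set X)})
    (fun i j h => unitSmul E' (Option {y // y ∉ (Set.univ : Set X)}) {y // y ∈ (Set.univ : Set X)}
      i j h)
    (fun i j h => (unitSmul E (Option {x // x ∉ (Set.univ : Set X)}) {x // x ∈ (Set.univ : Set X)}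
      i j h).compr₂ (φ.app _))
    (fun _ => (SMod.Hom.id _).app _) (fun _ => φ.app _)
    (fun i j h a b => (unitSmul_hom φ i j h a b).symm)
    (lastAt E 0 Set.univ n x)).symm.trans
    (tlift_post _ _ (φ.app _) (fun _ _ _ _ _ => rfl) _).symm
  exact (congrArg (E'.map (Equiv.Set.univ X)) h1).trans (φ.app_map _ _).symm

/-- The desuspension `sV ⊗ sV → V ⊗ V`, `sa ⊗ sb ↦ (-1)^|a| a ⊗ b`. -/
def desusp (V : SMod.{u} k) (X Y : Type) [Finite X] [Finite Y] (n : ℤ) :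
    Tens ((susp V).obj X) ((susp V).obj Y) n →ₗ[k] Tens (V.obj X) (V.obj Y) (n - 2) :=
  tlift fun i j h => sg k (i - 1) •
    (tmk (A := V.obj X) (B := V.obj Y) (show i - 1 + (j - 1) = n - 2 by omega))

theorem desusp_tmk (V : SMod.{u} k) {i j : ℤ} (h : i + j = n) (a : (susp V).obj X i)
    (b : (susp V).obj Y j) : desusp V X Y n (tmk h a b)
      = sg k (i - 1) • tmk (A := V.obj X) (B := V.obj Y) (show i - 1 + (j - 1) = n - 2 by omega) a b :=
  tlift_tmk _ h a b

/-- Functoriality of the suspension. -/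
def suspMap {V W : SMod.{u} k} (φ : V.Hom W) : (susp V).Hom (susp W) where
  app X _ n := φ.app X
  app_map e n x := φ.app_map e x
  app_d h x := by
    refine (map_neg _ _).trans (congrArg Neg.neg (φ.app_d _ x))

theorem desusp_hom {V W : SMod.{u} k} (φ : V.Hom W)
    (x : Tens ((susp V).obj X) ((susp V).obj Y) n) :
    desusp W X Y n (tmap (fun _ => (suspMap φ).app X) (fun _ => (suspMap φ).app Y) x)
      = tmap (fun _ => φ.app X) (fun _ => φ.app Y) (desusp V X Y n x) := by
  refine LinearMap.congr_fun (f := desusp W X Y n ∘ₗ tmap (fun _ => (suspMap φ).app X)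
    (fun _ => (suspMap φ).app Y)) (g := tmap (fun _ => φ.app X) (fun _ => φ.app Y) ∘ₗ
    desusp V X Y n) (tens_ext fun i j h a b => ?_) x
  rw [LinearMap.comp_apply, LinearMap.comp_apply, tmap_tmk, desusp_tmk, desusp_tmk, map_smul]
  exact congrArg _ (tmap_tmk (A := V.obj X) (B := V.obj Y) _ _ _ _ _).symm

/-- The map `cap ⊗ id` followed by the desuspension. -/
def capAt (V : SMod.{u} k) (X Y : Type) [Finite X] [Finite Y] (n : ℤ) :
    Tens ((heap (susp V) 1).obj X) ((susp V).obj Y) n →ₗ[k] Tens (V.obj X) (V.obj Y) (n - 2) :=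
  desusp V X Y n ∘ₗ tmap (fun i => cap (susp V) X i) (fun _ => LinearMap.id)

theorem capAt_hom {V W : SMod.{u} k} (φ : V.Hom W)
    (x : Tens ((heap (susp V) 1).obj X) ((susp V).obj Y) n) :
    capAt W X Y n (tmap (fun _ => (heapMap (suspMap φ) 1).app X) (fun _ => (suspMap φ).app Y) x)
      = tmap (fun _ => φ.app X) (fun _ => φ.app Y) (capAt V X Y n x) := by
  refine Eq.trans ?_ (desusp_hom φ _)
  refine congrArg (desusp W _ _ n) ?_
  refine (tmap_comp (f'' := fun i => cap (susp W) _ i ∘ₗ (heapMap (suspMap φ) 1).app _)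
    (g'' := fun _ => (suspMap φ).app _) (fun _ _ => rfl) (fun _ _ => rfl) _).symm.trans ?_
  exact tmap_comp (fun i a => cap_hom (suspMap φ) a) (fun _ _ => rfl) _

/-- The identification of trees with two vertices decorated by `sV` with elements of `V ∘₁ V`, up
to a degree shift by `2`. -/
def capTwo (V : SMod.{u} k) (X : Type) [Finite X] (n : ℤ) :
    (heap (susp V) 2).obj X n →ₗ[k] (infComp V V).obj X (n - 2) :=
  LinearMap.pi fun U => capAt V _ _ n ∘ₗ lastAt (susp V) 1 U n

theorem capTwo_hom {V W : SMod.{u} k} (φ : V.Hom W) (x : (heap (susp V) 2).obj X n) :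
    capTwo W X n ((heapMap (suspMap φ) 2).app X x) = (infMap φ φ).app X (capTwo V X n x) := by
  refine infComp_ext fun U => ?_
  exact capAt_hom φ (lastAt (susp V) 1 U n x)

end Cap
section Dual

variable {P Q R X : Type} [Finite P] [Finite Q] [Finite R] [Finite X] {n : ℤ}

/-- Separating a set of points of a sum with one extra point. -/
def optSum (P Q : Type) : Option (P ⊕ Q) ≃ Option P ⊕ Q where
  toFun
    | none => Sum.inl none
    | some (Sum.inl p) => Sum.inl (some p)
    | some (Sum.inr q) => Sum.inr q
  invFun
    | Sum.inl none => none
    | Sum.inl (some p) => some (Sum.inl p)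
    | Sum.inr q => some (Sum.inr q)
  left_inv := by rintro (_ | _ | _) <;> rfl
  right_inv := by rintro ((_ | _) | _) <;> rfl

/-- The exchange of two extra points. -/
def swapPt (P : Type) : Option (Option P) ≃ Option (Option P) where
  toFun
    | none => some none
    | some none => none
    | some (some p) => some (some p)
  invFun
    | none => some none
    | some none => none
    | some (some p) => some (some p)
  left_inv := by rintro (_ | _ | _) <;> rfl
  right_inv := by rintro (_ | _ | _) <;> rfl

/-- The exchange of two summands. -/
def sumSwap (P Q R : Type) : (P ⊕ Q) ⊕ R ≃ (P ⊕ R) ⊕ Q where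
  toFun
    | Sum.inl (Sum.inl p) => Sum.inl (Sum.inl p)
    | Sum.inl (Sum.inr q) => Sum.inr q
    | Sum.inr r => Sum.inl (Sum.inr r)
  invFun
    | Sum.inl (Sum.inl p) => Sum.inl (Sum.inl p)
    | Sum.inl (Sum.inr r) => Sum.inr r
    | Sum.inr q => Sum.inl (Sum.inr q)
  left_inv := by rintro ((_ | _) | _) <;> rfl
  right_inv := by rintro ((_ | _) | _) <;> rfl

/-- The iterated decomposition of a tree into a lower tree and two upper trees, with leaves `Q`
and `R`. -/
def deltaTwo (E : SMod.{u} k) (P Q R : Type) [Finite P] [Finite Q] [Finite R] (n : ℤ) :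
    (trees E).obj ((P ⊕ Q) ⊕ R) n →ₗ[k] Tens (tens ((trees E).obj (Option (Option P)))
      ((trees E).obj Q)) ((trees E).obj R) n :=
  tmap (A' := tens ((trees E).obj (Option (Option P))) ((trees E).obj Q))
    (fun i => delta E (Option P) Q i ∘ₗ (trees E).map (optSum P Q)) (fun _ => LinearMap.id) ∘ₗ
  delta E (P ⊕ Q) R n

/-- The map `(f ⊗ g) ⊗ h`. -/
def tmapThree {A A' : GrMod.{u} k} {B B' : GrMod.{v} k} {C C' : GrMod.{u'} k}
    (a : ∀ i, A i →ₗ[k] A' i) (b : ∀ i, B i →ₗ[k] B' i) (c : ∀ i, C i →ₗ[k] C' i) (n : ℤ) :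
    Tens (tens A B) C n →ₗ[k] Tens (tens A' B') C' n :=
  tmap (A := tens A B) (A' := tens A' B') (fun _ => tmap a b) c

theorem tmap_left_nat {A A' : GrMod.{u} k} {B B' : GrMod.{v} k} {C C' : GrMod.{u'} k}
    (p : ∀ i, A i →ₗ[k] A i) (p' : ∀ i, A' i →ₗ[k] A' i) (a : ∀ i, A i →ₗ[k] A' i)
    (b : ∀ i, B i →ₗ[k] B' i) (c : ∀ i, C i →ₗ[k] C' i)
    (h : ∀ i x, p' i (a i x) = a i (p i x)) (x : Tens (tens A B) C n) :
    tmap (A := tens A' B') (A' := tens A' B') (fun _ => tmap p' fun _ => LinearMap.id)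
        (fun _ => LinearMap.id) (tmap (A := tens A B) (A' := tens A' B') (fun _ => tmap a b) c x)
      = tmap (A := tens A B) (A' := tens A' B') (fun _ => tmap a b) c
        (tmap (A := tens A B) (A' := tens A B) (fun _ => tmap p fun _ => LinearMap.id)
          (fun _ => LinearMap.id) x) := by
  refine (tmap_comp (A := tens A B) (A' := tens A' B') (A'' := tens A' B')
    (f := fun _ => tmap a b) (g := c) (f' := fun _ => tmap p' fun _ => LinearMap.id)
    (g' := fun _ => LinearMap.id)
    (f'' := fun _ => tmap (p' : ∀ i, A' i →ₗ[k] A' i) (fun i => (LinearMap.id : B' i →ₗ[k] B' i)) ∘ₗ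
      tmap a b) (g'' := c)
    (fun _ _ => rfl) (fun _ _ => rfl) x).symm.trans ?_
  exact tmap_comp (A := tens A B) (A' := tens A B) (A'' := tens A' B')
    (f := fun _ => tmap p fun _ => LinearMap.id) (g := fun _ => LinearMap.id)
    (f' := fun _ => tmap a b) (g' := c)
    (fun i y => (tmap_comp (f'' := fun i => a i ∘ₗ p i) (g'' := b) (f := a) (g := b) (f' := p')
      (g' := fun _ => LinearMap.id) (fun i a => (h i a).symm) (fun _ _ => rfl) y).symm.trans
      (tmap_comp (fun _ _ => rfl) (fun _ _ => rfl) y)) (fun _ _ => rfl) x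

/-- The exchange `(a ⊗ c) ⊗ b ↦ ± (p(a) ⊗ b) ⊗ c`. -/
def texch {A : GrMod.{u} k} {B : GrMod.{v} k} {C : GrMod.{u'} k} (p : ∀ i, A i →ₗ[k] A i) (n : ℤ) :
    Tens (tens A C) B n →ₗ[k] Tens (tens A B) C n :=
  tmap (A := tens A B) (A' := tens A B) (fun _ => tmap p fun _ => LinearMap.id)
    (fun _ => LinearMap.id) ∘ₗ tswap

theorem texch_nat {A A' : GrMod.{u} k} {B B' : GrMod.{v} k} {C C' : GrMod.{u'} k}
    (p : ∀ i, A i →ₗ[k] A i) (p' : ∀ i, A' i →ₗ[k] A' i) (a : ∀ i, A i →ₗ[k] A' i)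
    (b : ∀ i, B i →ₗ[k] B' i) (c : ∀ i, C i →ₗ[k] C' i)
    (h : ∀ i x, p' i (a i x) = a i (p i x)) (x : Tens (tens A C) B n) :
    texch p' n (tmapThree a c b n x) = tmapThree a b c n (texch p n x) := by
  unfold texch tmapThree
  rw [LinearMap.comp_apply, LinearMap.comp_apply, tswap_tmap]
  exact tmap_left_nat p p' a b c h (tswap x)

/-- Exchange of the two upper factors, with the Koszul sign. -/
def exchange (T : SMod.{u} k) (P Q R : Type) [Finite P] [Finite Q] [Finite R] (n : ℤ) :
    Tens (tens (T.obj (Option (Option P))) (T.obj R)) (T.obj Q) n →ₗ[k]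
      Tens (tens (T.obj (Option (Option P))) (T.obj Q)) (T.obj R) n :=
  texch (fun _ => T.map (swapPt P)) n

theorem deltaTwo_hom {E E' : SMod.{u} k} (φ : E.Hom E') (P Q R : Type) [Finite P] [Finite Q]
    [Finite R] (x : (trees E).obj ((P ⊕ Q) ⊕ R) n) :
    deltaTwo E' P Q R n ((treesMap φ).app _ x)
      = tmapThree (fun _ => (treesMap φ).app (Option (Option P))) (fun _ => (treesMap φ).app Q)
        (fun _ => (treesMap φ).app R) n (deltaTwo E P Q R n x) := by
  unfold deltaTwo tmapThree
  rw [LinearMap.comp_apply, LinearMap.comp_apply, delta_hom]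
  refine (tmap_comp (A'' := tens ((trees E').obj (Option (Option P))) ((trees E').obj Q))
    (f := fun _ => (treesMap φ).app (Option (P ⊕ Q))) (g := fun _ => (treesMap φ).app R)
    (f' := fun i => delta E' (Option P) Q i ∘ₗ (trees E').map (optSum P Q))
    (g' := fun _ => LinearMap.id)
    (f'' := fun i => (delta E' (Option P) Q i ∘ₗ (trees E').map (optSum P Q)) ∘ₗ (treesMap φ).app _)
    (g'' := fun _ => (treesMap φ).app R) (fun _ _ => rfl) (fun _ _ => rfl) _).symm.trans ?_
  exact tmap_comp (A' := tens ((trees E).obj (Option (Option P))) ((trees E).obj Q))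
    (A'' := tens ((trees E').obj (Option (Option P))) ((trees E').obj Q))
    (f := fun i => delta E (Option P) Q i ∘ₗ (trees E).map (optSum P Q))
    (g := fun _ => LinearMap.id)
    (f' := fun _ => tmap (fun _ => (treesMap φ).app _) (fun _ => (treesMap φ).app _))
    (g' := fun _ => (treesMap φ).app R)
    (fun i a => (congrArg (delta E' (Option P) Q i) ((treesMap φ).app_map _ a).symm).trans
      (delta_hom φ _)) (fun _ _ => rfl) _

theorem exchange_hom {T T' : SMod.{u} k} (φ : T.Hom T') (P Q R : Type) [Finite P] [Finite Q]
    [Finite R] (x : Tens (tens (T.obj (Option (Option P))) (T.obj R)) (T.obj Q) n) :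
    exchange T' P Q R n (tmapThree (fun _ => φ.app (Option (Option P)))
        (fun _ => φ.app R) (fun _ => φ.app Q) n x)
      = tmapThree (fun _ => φ.app (Option (Option P))) (fun _ => φ.app Q)
        (fun _ => φ.app R) n (exchange T P Q R n x) :=
  texch_nat (fun _ => T.map (swapPt P)) (fun _ => T'.map (swapPt P))
    (fun _ => φ.app (Option (Option P))) (fun _ => φ.app Q)
    (fun _ => φ.app R) (fun _ a => (φ.app_map (swapPt P) a).symm) x

/-- A family of subspaces of the space of ordered trees decorated by `sV` is admissible if it is a
dg sub-`𝕊`-module closed under decomposition, on which the decompositions into two parallel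
upper trees do not depend on the order in which these are split off (so that the elements are
independent of the order of the vertices, that is, lie in the cofree cooperad on `sV`), and whose
components of weight `2` lie in `s²R`. -/
structure QuadData.Admissible (q : QuadData.{u} k)
    (G : ∀ (X : Type) [Finite X] (n : ℤ), Submodule k ((trees (susp q.V)).obj X n)) : Prop where
  map_mem : ∀ {X Y : Type} [Finite X] [Finite Y] (e : X ≃ Y) {n : ℤ} {x}, x ∈ G X n →
    (trees (susp q.V)).map e x ∈ G Y n
  d_mem : ∀ {X : Type} [Finite X] {i j : ℤ} (h : j + 1 = i) {x}, x ∈ G X i →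
    ((trees (susp q.V)).obj X).d h x ∈ G X j
  delta_mem : ∀ (P Q : Type) [Finite P] [Finite Q] {n : ℤ} {x}, x ∈ G (P ⊕ Q) n →
    delta (susp q.V) P Q n x ∈ tensSub (G (Option P)) (G Q) n
  exch : ∀ (P Q R : Type) [Finite P] [Finite Q] [Finite R] {n : ℤ} {x}, x ∈ G ((P ⊕ Q) ⊕ R) n →
    deltaTwo (susp q.V) P Q R n x = exchange (trees (susp q.V)) P Q R n
      (deltaTwo (susp q.V) P R Q n ((trees (susp q.V)).map (sumSwap P Q R) x))
  rel : ∀ {X : Type} [Finite X] {n : ℤ} {x}, x ∈ G X n →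
    capTwo q.V X n (trOut (susp q.V) 2 x) ∈ q.R X (n - 2)

variable (q : QuadData.{u} k)

/-- The underlying spaces of the Koszul dual cooperad: the largest sub-cooperad of the cofree
cooperad on `sV` whose part of weight `2` is contained in `s²R`. -/
def QuadData.dualSub (X : Type) [Finite X] (n : ℤ) : Submodule k ((trees (susp q.V)).obj X n) :=
  ⨆ G : {G : ∀ (X : Type) [Finite X] (n : ℤ), Submodule k ((trees (susp q.V)).obj X n) //
    q.Admissible G}, G.1 X n

theorem QuadData.dualSub_map {X Y : Type} [Finite X] [Finite Y] (e : X ≃ Y) {n : ℤ} {x}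
    (h : x ∈ q.dualSub X n) : (trees (susp q.V)).map e x ∈ q.dualSub Y n := by
  have : q.dualSub X n ≤ (q.dualSub Y n).comap ((trees (susp q.V)).map e) :=
    iSup_le fun G x hx => le_iSup (fun G : {G : ∀ (X : Type) [Finite X] (n : ℤ),
      Submodule k ((trees (susp q.V)).obj X n) // q.Admissible G} => G.1 Y n) G
      (G.2.map_mem e hx)
  exact this h

theorem QuadData.dualSub_d {X : Type} [Finite X] {i j : ℤ} (hij : j + 1 = i) {x}
    (h : x ∈ q.dualSub X i) : ((trees (susp q.V)).obj X).d hij x ∈ q.dualSub X j := by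
  have : q.dualSub X i ≤ (q.dualSub X j).comap (((trees (susp q.V)).obj X).d hij) :=
    iSup_le fun G x hx => le_iSup (fun G : {G : ∀ (X : Type) [Finite X] (n : ℤ),
      Submodule k ((trees (susp q.V)).obj X n) // q.Admissible G} => G.1 X j) G
      (G.2.d_mem hij hx)
  exact this h

theorem QuadData.dualSub_delta {x} (h : x ∈ q.dualSub (P ⊕ Q) n) :
    delta (susp q.V) P Q n x ∈ tensSub (q.dualSub (Option P)) (q.dualSub Q) n := by
  have : q.dualSub (P ⊕ Q) n ≤ (tensSub (q.dualSub (Option P)) (q.dualSub Q) n).comap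
      (delta (susp q.V) P Q n) :=
    iSup_le fun G x hx => tensSub_mono
      (fun n => le_iSup (fun G : {G : ∀ (X : Type) [Finite X] (n : ℤ),
        Submodule k ((trees (susp q.V)).obj X n) // q.Admissible G} => G.1 (Option P) n) G)
      (fun n => le_iSup (fun G : {G : ∀ (X : Type) [Finite X] (n : ℤ),
        Submodule k ((trees (susp q.V)).obj X n) // q.Admissible G} => G.1 Q n) G) n
      (G.2.delta_mem P Q hx)
  exact this h

/-- The underlying `𝕊`-module of the Koszul dual cooperad. -/
def QuadData.dual : SMod.{max u w} k where
  obj X _ :=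
    { C := fun n => q.dualSub X n
      d := fun {i j} h => (((trees (susp q.V)).obj X).d h).restrict fun x hx => q.dualSub_d h hx }
  map e n := ((trees (susp q.V)).map e).restrict fun x hx => q.dualSub_map e hx
  map_refl x := Subtype.ext ((trees (susp q.V)).map_refl x.1)
  map_trans e f n x := Subtype.ext ((trees (susp q.V)).map_trans e f x.1)
  map_d e i j h x := Subtype.ext ((trees (susp q.V)).map_d e h x.1)

/-- The inclusion of the Koszul dual cooperad into the `𝕊`-module of ordered trees. -/
def QuadData.incl : q.dual.Hom (trees (susp q.V)) where
  app X _ n := (q.dualSub X n).subtype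
  app_map _ _ _ := rfl
  app_d _ _ := rfl

theorem QuadData.incl_injective (X : Type) [Finite X] (n : ℤ) :
    Function.Injective (q.incl.app X (n := n)) := Subtype.val_injective

theorem tmap_injective {A : GrMod.{u} k} {B : GrMod.{v} k} {A' : GrMod.{u'} k} {B' : GrMod.{v'} k}
    {f : ∀ i, A i →ₗ[k] A' i} {g : ∀ j, B j →ₗ[k] B' j} (hf : ∀ i, Function.Injective (f i))
    (hg : ∀ j, Function.Injective (g j)) (n : ℤ) :
    Function.Injective (tmap f g : Tens A B n →ₗ[k] Tens A' B' n) := by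
  have h1 : (tmap f g : Tens A B n →ₗ[k] Tens A' B' n)
      = DirectSum.lmap fun p : {p : ℤ × ℤ // p.1 + p.2 = n} =>
        TensorProduct.map (f p.1.1) (g p.1.2) := by
    refine tens_ext fun i j h a b => ?_
    rw [tmap_tmk]
    simp [tmk]
  rw [h1]
  refine (DirectSum.lmap_injective _).2 fun p => ?_
  exact TensorProduct.map_injective_of_flat_flat _ _ (hf _) (hg _)

theorem QuadData.incl_tens_injective (X Y : Type) [Finite X] [Finite Y] (n : ℤ) :
    Function.Injective (tmap (fun _ => q.incl.app X) (fun _ => q.incl.app Y) :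
      Tens (q.dual.obj X) (q.dual.obj Y) n →ₗ[k] _) :=
  tmap_injective (fun _ => q.incl_injective X _) (fun _ => q.incl_injective Y _) n

theorem QuadData.delta_range (P Q : Type) [Finite P] [Finite Q] (n : ℤ) (x : q.dual.obj (P ⊕ Q) n) :
    delta (susp q.V) P Q n (q.incl.app _ x) ∈ LinearMap.range
      (tmap (fun _ => q.incl.app (Option P)) (fun _ => q.incl.app Q) :
      Tens (q.dual.obj (Option P)) (q.dual.obj Q) n →ₗ[k] _) := by
  have : tensSub (q.dualSub (Option P)) (q.dualSub Q) n ≤ LinearMap.range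
      (tmap (fun _ => q.incl.app (Option P)) (fun _ => q.incl.app Q) :
      Tens (q.dual.obj (Option P)) (q.dual.obj Q) n →ₗ[k] _) := by
    refine Submodule.span_le.2 ?_
    rintro _ ⟨i, j, h, a, b, ha, hb, rfl⟩
    exact ⟨tmk (A := q.dual.obj (Option P)) (B := q.dual.obj Q) h ⟨a, ha⟩ ⟨b, hb⟩,
      tmap_tmk _ _ h _ _⟩
  exact this (q.dualSub_delta x.2)

/-- The infinitesimal decomposition map `C → C ∘₁ C` of the Koszul dual cooperad. -/
def QuadData.dualDelta (P Q : Type) [Finite P] [Finite Q] (n : ℤ) :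
    q.dual.obj (P ⊕ Q) n →ₗ[k] Tens (q.dual.obj (Option P)) (q.dual.obj Q) n :=
  (LinearEquiv.ofInjective _ (q.incl_tens_injective (Option P) Q n)).symm.toLinearMap ∘ₗ
    (delta (susp q.V) P Q n ∘ₗ q.incl.app (P ⊕ Q)).codRestrict _ (q.delta_range P Q n)

theorem QuadData.incl_dualDelta (x : q.dual.obj (P ⊕ Q) n) :
    tmap (fun _ => q.incl.app (Option P)) (fun _ => q.incl.app Q) (q.dualDelta P Q n x)
      = delta (susp q.V) P Q n (q.incl.app (P ⊕ Q) x) :=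
  congrArg Subtype.val (LinearEquiv.apply_symm_apply
    (LinearEquiv.ofInjective _ (q.incl_tens_injective (Option P) Q n)) _)

theorem QuadData.dualDelta_map {P' Q' : Type} [Finite P'] [Finite Q'] (e : P ≃ P') (f : Q ≃ Q')
    (x : q.dual.obj (P ⊕ Q) n) :
    q.dualDelta P' Q' n (q.dual.map (Equiv.sumCongr e f) x)
      = tmap (fun _ => q.dual.map (Equiv.optionCongr e)) (fun _ => q.dual.map f)
        (q.dualDelta P Q n x) := by
  refine q.incl_tens_injective (Option P') Q' n ?_
  rw [incl_dualDelta]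
  refine (delta_map (susp q.V) e f _).trans ?_
  refine (congrArg _ (q.incl_dualDelta x).symm).trans ?_
  refine (tmap_comp (f'' := fun _ => (trees (susp q.V)).map (Equiv.optionCongr e) ∘ₗ q.incl.app _)
    (g'' := fun _ => (trees (susp q.V)).map f ∘ₗ q.incl.app _)
    (fun _ _ => rfl) (fun _ _ => rfl) _).symm.trans ?_
  exact tmap_comp (fun _ _ => rfl) (fun _ _ => rfl) _

theorem trOut_map (E : SMod.{u} k) {X Y : Type} [Finite X] [Finite Y] (e : X ≃ Y) (m : ℕ)
    (x : (trees E).obj X n) :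
    trOut E m ((trees E).map e x) = (heap E m).map e (trOut E m x) := rfl

theorem trOut_hom {E E' : SMod.{u} k} (φ : E.Hom E') (m : ℕ) (x : (trees E).obj X n) :
    trOut E' m ((treesMap φ).app X x) = (heapMap φ m).app X (trOut E m x) := rfl

/-- The twisting morphism from the Koszul dual cooperad to the operad, of degree `-1`: it sends
`sV` to `V` and all other elements to `0`. -/
def QuadData.kappa (X : Type) [Finite X] {i j : ℤ} (h : j + 1 = i) :
    q.dual.obj X i →ₗ[k] q.operad.S.obj X j :=
  q.gen.app X ∘ₗ (q.V.obj X).cast (show i - 1 = j by omega) ∘ₗ cap (susp q.V) X i ∘ₗ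
    trOut (susp q.V) 1 ∘ₗ q.incl.app X

theorem QuadData.kappa_map {X Y : Type} [Finite X] [Finite Y] (e : X ≃ Y) {i j : ℤ} (h : j + 1 = i)
    (x : q.dual.obj X i) :
    q.kappa Y h (q.dual.map e x) = q.operad.S.map e (q.kappa X h x) := by
  refine Eq.trans ?_ (q.gen.app_map e _)
  refine congrArg (q.gen.app Y) (Eq.trans ?_ (SMod.map_cast q.V e _ _).symm)
  exact congrArg _ (cap_map (susp q.V) e _)

variable {q}

/-- The image of an admissible family under a morphism of quadratic data. -/
theorem QuadData.Hom.admissible {q q' : QuadData.{u} k} (φ : q.Hom q')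
    {G : ∀ (X : Type) [Finite X] (n : ℤ), Submodule k ((trees (susp q.V)).obj X n)}
    (hG : q.Admissible G) : q'.Admissible fun X _ n =>
      (G X n).map ((treesMap (suspMap φ.toHom)).app X) where
  map_mem := by
    rintro X Y _ _ e n _ ⟨x, hx, rfl⟩
    exact ⟨_, hG.map_mem e hx, (treesMap _).app_map e x⟩
  d_mem := by
    rintro X _ i j h _ ⟨x, hx, rfl⟩
    exact ⟨_, hG.d_mem h hx, (treesMap _).app_d h x⟩
  delta_mem := by
    rintro P Q _ _ n _ ⟨x, hx, rfl⟩
    rw [delta_hom]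
    exact tmap_tensSub
      (G' := fun i => (G (Option P) i).map ((treesMap (suspMap φ.toHom)).app (Option P)))
      (H' := fun i => (G Q i).map ((treesMap (suspMap φ.toHom)).app Q))
      (fun i a ha => Submodule.mem_map_of_mem ha)
      (fun i a ha => Submodule.mem_map_of_mem ha) (hG.delta_mem P Q hx)
  exch := by
    rintro P Q R _ _ _ n _ ⟨x, hx, rfl⟩
    have h1 := deltaTwo_hom (suspMap φ.toHom) P Q R x
    rw [hG.exch P Q R hx] at h1
    refine h1.trans ?_
    refine (exchange_hom (treesMap (suspMap φ.toHom)) P Q R _).symm.trans (congrArg _ ?_)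
    refine (deltaTwo_hom (suspMap φ.toHom) P R Q _).symm.trans (congrArg _ ?_)
    exact (treesMap _).app_map _ x
  rel := by
    rintro X _ n _ ⟨x, hx, rfl⟩
    rw [trOut_hom, capTwo_hom]
    exact φ.rel (hG.rel hx)

end Dual

/-! ### The map of Koszul dual cooperads -/

namespace QuadData

theorem Hom.dual_mem {q q' : QuadData.{u} k} (φ : q.Hom q') {X : Type} [Finite X] {n : ℤ} {x}
    (h : x ∈ q.dualSub X n) : (treesMap (suspMap φ.toHom)).app X x ∈ q'.dualSub X n := by
  have : q.dualSub X n ≤ (q'.dualSub X n).comap ((treesMap (suspMap φ.toHom)).app X) :=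
    iSup_le fun G x hx => le_iSup (fun G : {G : ∀ (X : Type) [Finite X] (n : ℤ),
      Submodule k ((trees (susp q'.V)).obj X n) // q'.Admissible G} => G.1 X n)
      ⟨_, φ.admissible G.2⟩ (Submodule.mem_map_of_mem hx)
  exact this h

/-- The map of Koszul dual cooperads induced by a morphism of quadratic data. -/
def Hom.dualHom {q q' : QuadData.{u} k} (φ : q.Hom q') : q.dual.Hom q'.dual where
  app X _ n := ((treesMap (suspMap φ.toHom)).app X).restrict fun x hx => φ.dual_mem hx
  app_map e n x := Subtype.ext ((treesMap (suspMap φ.toHom)).app_map e x.1)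
  app_d h x := Subtype.ext ((treesMap (suspMap φ.toHom)).app_d h x.1)

end QuadData

/-! ### Right comodules -/

/-- A natural map `M → M ∘₁ C`, given by its components `M(P ⊔ Q) → M(P ⊔ *) ⊗ C(Q)`. -/
structure Coaction (M : SMod.{u} k) (C : SMod.{v} k) where
  δ : ∀ (P Q : Type) [Finite P] [Finite Q] (n : ℤ),
    M.obj (P ⊕ Q) n →ₗ[k] Tens (M.obj (Option P)) (C.obj Q) n
  nat : ∀ {P Q P' Q' : Type} [Finite P] [Finite Q] [Finite P'] [Finite Q'] (e : P ≃ P')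
    (f : Q ≃ Q') {n : ℤ} (x : M.obj (P ⊕ Q) n),
    δ P' Q' n (M.map (Equiv.sumCongr e f) x)
      = tmap (fun _ => M.map (Equiv.optionCongr e)) (fun _ => C.map f) (δ P Q n x)

/-- The Koszul dual cooperad as a right comodule over itself. -/
def QuadData.coself (q : QuadData.{u} k) : Coaction q.dual q.dual where
  δ P Q _ _ n := q.dualDelta P Q n
  nat e f n x := q.dualDelta_map e f x

/-- The right comodule `g^* M` along a map `g` of cooperads. -/
def Coaction.push {M : SMod.{u} k} {C : SMod.{v} k} {D : SMod.{u'} k} (c : Coaction M C)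
    (g : C.Hom D) : Coaction M D where
  δ P Q _ _ n := tmap (fun _ => LinearMap.id) (fun _ => g.app Q) ∘ₗ c.δ P Q n
  nat {P Q P' Q'} _ _ _ _ e f n x := by
    rw [LinearMap.comp_apply, LinearMap.comp_apply, c.nat]
    exact (tmap_comp (f'' := fun _ => M.map (Equiv.optionCongr e))
      (g'' := fun _ => g.app Q' ∘ₗ C.map f) (fun _ _ => rfl) (fun _ _ => rfl) _).symm.trans
      (tmap_comp (fun _ _ => rfl) (fun _ _ => g.app_map _ _) _)

section Fibres

variable {A : SMod.{u} k} {B : SMod.{v} k} {X : Type} {n : ℤ}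

/-- The index of the part that contains a given point. -/
def Sym.fib (s : Sym A B X n) (x : X) : s.I := (s.φ.symm x).1

theorem Sym.fib_φ (s : Sym A B X n) (i : s.I) (z : s.Z i) : s.fib (s.φ ⟨i, z⟩) = i := by
  simp [Sym.fib]

/-- The parts as fibres. -/
def Sym.fibEquiv (s : Sym A B X n) (i : s.I) : s.Z i ≃ {x // s.fib x = i} :=
  Equiv.ofBijective (fun z => ⟨s.φ ⟨i, z⟩, s.fib_φ i z⟩) ⟨fun z z' h => by
    have := s.φ.injective (congrArg Subtype.val h)
    simpa using this, by
    rintro ⟨x, rfl⟩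
    exact ⟨(s.φ.symm x).2, Subtype.ext (s.φ.apply_symm_apply x)⟩⟩

variable [Finite X]

/-- The elements `b i`, with the parts regarded as fibres. -/
def Sym.nb (s : Sym A B X n) (i : s.I) : (B.obj {x // s.fib x = i}).El :=
  B.mapEl (s.fibEquiv i) (s.b i)

theorem Sym.Move.fib {s t : Sym A B X n} (m : Sym.Move s t) (x : X) : t.fib x = m.e (s.fib x) := by
  obtain ⟨⟨i, z⟩, rfl⟩ := s.φ.surjective x
  rw [s.fib_φ, ← m.hφ, t.fib_φ]

/-- The bijection of fibres. -/
def Sym.Move.fibMove {s t : Sym A B X n} (m : Sym.Move s t) (i : s.I) :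
    {x // s.fib x = i} ≃ {x // t.fib x = m.e i} :=
  Equiv.subtypeEquivRight fun x => by rw [m.fib, m.e.injective.eq_iff]

theorem SMod.mapEl_trans {X Y Z : Type} [Finite X] [Finite Y] [Finite Z] (e : X ≃ Y) (f : Y ≃ Z)
    (x : (B.obj X).El) : B.mapEl f (B.mapEl e x) = B.mapEl (e.trans f) x :=
  congrArg (GrMod.El.mk _) (B.map_trans e f x.val).symm

theorem Sym.Move.nb {s t : Sym A B X n} (m : Sym.Move s t) (i : s.I) :
    t.nb (m.e i) = B.mapEl (m.fibMove i) (s.nb i) := by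
  unfold Sym.nb
  rw [m.hb, SMod.mapEl_trans, SMod.mapEl_trans]
  refine congrArg (fun e => B.mapEl e (s.b i)) (Equiv.ext fun z => Subtype.ext ?_)
  exact m.hφ i z

end Fibres

section FreeEquivs

variable {P Q I : Type}

/-- The fibre of `r` over `i`, if it contains `Q`. -/
def eqI (r : P ⊕ Q → I) (i : I) (h : ∀ q, r (Sum.inr q) = i) :
    {x // r x = i} ≃ {p // r (Sum.inl p) = i} ⊕ Q where
  toFun
    | ⟨Sum.inl p, hp⟩ => Sum.inl ⟨p, hp⟩
    | ⟨Sum.inr q, _⟩ => Sum.inr q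
  invFun
    | Sum.inl p => ⟨Sum.inl p.1, p.2⟩
    | Sum.inr q => ⟨Sum.inr q, h q⟩
  left_inv := by rintro ⟨_ | _, _⟩ <;> rfl
  right_inv := by rintro (_ | _) <;> rfl

/-- The extension of `r` to `P` with one extra point, sent to `i`. -/
def rO (r : P ⊕ Q → I) (i : I) : Option P → I
  | none => i
  | some p => r (Sum.inl p)

/-- The fibre of `rO r i` over `i`. -/
def eqN (r : P ⊕ Q → I) (i j : I) (hj : j = i) :
    Option {p // r (Sum.inl p) = i} ≃ {o // rO r i o = j} where
  toFun
    | none => ⟨none, hj.symm⟩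
    | some p => ⟨some p.1, p.2.trans hj.symm⟩
  invFun
    | ⟨none, _⟩ => none
    | ⟨some p, hp⟩ => some ⟨p, hp.trans hj⟩
  left_inv := by rintro (_ | _) <;> rfl
  right_inv := by rintro ⟨_ | _, _⟩ <;> rfl

/-- The other fibres of `rO r i`. -/
def eqJ (r : P ⊕ Q → I) (i : I) (h : ∀ q, r (Sum.inr q) = i) (j : I) (hj : j ≠ i) :
    {x // r x = j} ≃ {o // rO r i o = j} where
  toFun
    | ⟨Sum.inl p, hp⟩ => ⟨some p, hp⟩
    | ⟨Sum.inr q, hq⟩ => absurd (hq.symm.trans (h q)) hj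
  invFun
    | ⟨none, h0⟩ => absurd h0.symm hj
    | ⟨some p, hp⟩ => ⟨Sum.inl p, hp⟩
  left_inv := by
    rintro ⟨_ | q, hq⟩
    · rfl
    · exact absurd (hq.symm.trans (h q)) hj
  right_inv := by
    rintro ⟨_ | _, h0⟩
    · exact absurd h0.symm hj
    · rfl

end FreeEquivs

section Free

variable {B : SMod.{u} k} {D : SMod.{v} k} {P Q : Type} [Finite P] [Finite Q]
  {I : Type} [Fintype I] [LinearOrder I]

/-- The total degree after `i`. -/
def post (q : I → ℤ) (i : I) : ℤ := ∑ j, if i < j then q j else 0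

/-- Replace the factor `y i` by `β`. -/
def freeB (r : P ⊕ Q → I) (y : ∀ j, (D.obj {x // r x = j}).El) (i : I)
    (h : ∀ q, r (Sum.inr q) = i) {p : ℤ} (β : D.obj (Option {p // r (Sum.inl p) = i}) p) (j : I) :
    (D.obj {o // rO r i o = j}).El :=
  if hj : j = i then ⟨p, D.map (eqN r i j hj) β⟩ else D.mapEl (eqJ r i h j hj) (y j)

theorem freeB_self (r : P ⊕ Q → I) (y : ∀ j, (D.obj {x // r x = j}).El) (i : I)
    (h : ∀ q, r (Sum.inr q) = i) {p : ℤ} (β : D.obj (Option {p // r (Sum.inl p) = i}) p) :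
    freeB r y i h β i = ⟨p, D.map (eqN r i i rfl) β⟩ := dif_pos rfl

theorem freeB_ne (r : P ⊕ Q → I) (y : ∀ j, (D.obj {x // r x = j}).El) (i : I)
    (h : ∀ q, r (Sum.inr q) = i) {p : ℤ} (β : D.obj (Option {p // r (Sum.inl p) = i}) p) (j : I)
    (hj : j ≠ i) : freeB r y i h β j = D.mapEl (eqJ r i h j hj) (y j) := dif_neg hj

theorem freeB_deg (r : P ⊕ Q → I) (y : ∀ j, (D.obj {x // r x = j}).El) (i : I)
    (h : ∀ q, r (Sum.inr q) = i) {p : ℤ} (β : D.obj (Option {p // r (Sum.inl p) = i}) p) (j : I) :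
    (freeB r y i h β j).deg = (y j).deg + if j = i then p - (y i).deg else 0 := by
  unfold freeB
  split_ifs with hj
  · subst hj; simp
  · simp [SMod.mapEl]

/-- The generator of `(B ∘ D)(P ⊔ *)` with the factor `y i` replaced by `β`. -/
def freeSym (r : P ⊕ Q → I) (a : (B.obj I).El) (y : ∀ j, (D.obj {x // r x = j}).El) (i : I)
    (h : ∀ q, r (Sum.inr q) = i) {p m : ℤ} (hp : a.deg + ∑ j, (y j).deg + p = m + (y i).deg)
    (β : D.obj (Option {p // r (Sum.inl p) = i}) p) : Sym B D (Option P) m where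
  I := I
  Z j := {o // rO r i o = j}
  φ := Equiv.sigmaFiberEquiv (rO r i)
  a := a
  b := freeB r y i h β
  deg := by
    simp only [freeB_deg, Finset.sum_add_distrib, Finset.sum_ite_eq', Finset.mem_univ, if_true]
    omega

/-- The map `β ⊗ γ ↦ ± (a; y_1, …, β, …, y_r) ⊗ γ`. -/
def freeTerm (r : P ⊕ Q → I) (a : (B.obj I).El) (y : ∀ j, (D.obj {x // r x = j}).El) (i : I)
    (h : ∀ q, r (Sum.inr q) = i) {n N : ℤ} (hn : a.deg + ∑ j, (y j).deg = n)
    (hN : N = (y i).deg) :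
    Tens (D.obj (Option {p // r (Sum.inl p) = i})) (D.obj Q) N →ₗ[k]
      Tens ((comp B D).obj (Option P)) (D.obj Q) n :=
  tlift fun p c hpc => sg k (c * post (fun j => (y j).deg) i) •
    (tmk (A := (comp B D).obj (Option P)) (show n - c + c = n by omega)) ∘ₗ
    linOf (fun β => (CompMod.mk (freeSym r a y i h (p := p) (m := n - c) (by omega) β) :
      CompMod B D (Option P) (n - c))) fun e x x' => CompMod.mk_linB (by
        refine Sym.LinB.mk _ a _ _ _ i p (D.map (eqN r i i rfl) x)
          (D.map (eqN r i i rfl) x') ?_ ?_ ?_ ?_ ?_ _ _ _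
        · exact freeB_self r y i h x
        · exact freeB_self r y i h x'
        · exact (freeB_self r y i h _).trans (congrArg (GrMod.El.mk p)
            ((map_add _ _ _).trans (congrArg _ (map_smul _ _ _))))
        · intro j hj
          exact (freeB_ne r y i h x' j hj).trans (freeB_ne r y i h x j hj).symm
        · intro j hj
          exact (freeB_ne r y i h _ j hj).trans (freeB_ne r y i h x j hj).symm)

theorem freeTerm_tmk (r : P ⊕ Q → I) (a : (B.obj I).El) (y : ∀ j, (D.obj {x // r x = j}).El)
    (i : I) (h : ∀ q, r (Sum.inr q) = i) {n N : ℤ} (hn : a.deg + ∑ j, (y j).deg = n)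
    (hN : N = (y i).deg) {p c : ℤ} (hpc : p + c = N)
    (β : D.obj (Option {p // r (Sum.inl p) = i}) p) (γ : D.obj Q c) :
    freeTerm r a y i h hn hN (tmk hpc β γ) = sg k (c * post (fun j => (y j).deg) i) •
      tmk (A := (comp B D).obj (Option P)) (show n - c + c = n by omega)
        (CompMod.mk (freeSym r a y i h (p := p) (m := n - c) (by omega) β)) γ :=
  tlift_tmk _ hpc β γ

/-- The summand at `i` of the coaction on `B ∘ D`: decompose `y i`, if its part contains `Q`. -/
def freeVal (c : Coaction D D) (r : P ⊕ Q → I) (a : (B.obj I).El)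
    (y : ∀ j, (D.obj {x // r x = j}).El) {n : ℤ} (hn : a.deg + ∑ j, (y j).deg = n) (i : I) :
    Tens ((comp B D).obj (Option P)) (D.obj Q) n :=
  haveI := Classical.dec (∀ q, r (Sum.inr q) = i)
  if h : ∀ q, r (Sum.inr q) = i then
    freeTerm r a y i h hn rfl (c.δ _ Q _ (D.map (eqI r i h) (y i).val)) else 0

theorem freeVal_pos (c : Coaction D D) (r : P ⊕ Q → I) (a : (B.obj I).El)
    (y : ∀ j, (D.obj {x // r x = j}).El) {n : ℤ} (hn : a.deg + ∑ j, (y j).deg = n) (i : I)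
    (h : ∀ q, r (Sum.inr q) = i) {x : (D.obj {x // r x = i}).El} (hx : y i = x)
    (hN : x.deg = (y i).deg) : freeVal c r a y hn i =
    freeTerm r a y i h hn hN (c.δ _ Q _ (D.map (eqI r i h) x.val)) := by
  subst hx; exact dif_pos h

theorem freeVal_neg (c : Coaction D D) (r : P ⊕ Q → I) (a : (B.obj I).El)
    (y : ∀ j, (D.obj {x // r x = j}).El) {n : ℤ} (hn : a.deg + ∑ j, (y j).deg = n) (i : I)
    (h : ¬ ∀ q, r (Sum.inr q) = i) : freeVal c r a y hn i = 0 := dif_neg h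

theorem lin_aux {A : GrMod.{u} k} {C : GrMod.{v} k} {m c n : ℤ} (h : m + c = n) (ε e : k)
    {x x' x'' : A m} (hx : x'' = x + e • x') (γ : C c) :
    ε • tmk h x'' γ = ε • tmk h x γ + e • (ε • tmk h x' γ) := by
  subst hx
  rw [map_add, map_smul, LinearMap.add_apply, LinearMap.smul_apply, smul_add, smul_comm]

theorem freeVal_linA (c : Coaction D D) (r : P ⊕ Q → I) (e : k) (p : ℤ) (x x' : B.obj I p)
    (y : ∀ j, (D.obj {x // r x = j}).El) {n : ℤ} (hn : p + ∑ j, (y j).deg = n) (i : I) :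
    freeVal c r ⟨p, x + e • x'⟩ y hn i
      = freeVal c r ⟨p, x⟩ y hn i + e • freeVal c r ⟨p, x'⟩ y hn i := by
  by_cases h : ∀ q, r (Sum.inr q) = i
  · rw [freeVal_pos c r _ y hn i h rfl rfl, freeVal_pos c r _ y hn i h rfl rfl,
      freeVal_pos c r _ y hn i h rfl rfl]
    generalize c.δ _ Q _ (D.map (eqI r i h) (y i).val) = z
    refine LinearMap.congr_fun (g := freeTerm r ⟨p, x⟩ y i h hn rfl
      + e • freeTerm r ⟨p, x'⟩ y i h hn rfl) (tens_ext fun p' q hpc β γ => ?_) z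
    rw [LinearMap.add_apply, LinearMap.smul_apply, freeTerm_tmk, freeTerm_tmk, freeTerm_tmk]
    refine lin_aux (A := (comp B D).obj (Option P)) _ _ e ?_ γ
    exact CompMod.mk_linA (Sym.LinA.mk (c := e) _ p x x' _ _)
  · rw [freeVal_neg c r _ y hn i h, freeVal_neg c r _ y hn i h, freeVal_neg c r _ y hn i h]
    simp

theorem freeVal_linB (c : Coaction D D) (r : P ⊕ Q → I) (e : k) (a : (B.obj I).El)
    (y y' y'' : ∀ j, (D.obj {x // r x = j}).El) (l : I) (q : ℤ) (x x' : D.obj {x // r x = l} q)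
    (hy : y l = ⟨q, x⟩) (hy' : y' l = ⟨q, x'⟩) (hy'' : y'' l = ⟨q, x + e • x'⟩)
    (h' : ∀ j, j ≠ l → y' j = y j) (h'' : ∀ j, j ≠ l → y'' j = y j) {n : ℤ}
    (hn : a.deg + ∑ j, (y j).deg = n) (hn' : a.deg + ∑ j, (y' j).deg = n)
    (hn'' : a.deg + ∑ j, (y'' j).deg = n) (i : I) :
    freeVal c r a y'' hn'' i = freeVal c r a y hn i + e • freeVal c r a y' hn' i := by
  have e' : ∀ j, (y' j).deg = (y j).deg := fun j => by
    by_cases hj : j = l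
    · subst hj; rw [hy, hy']
    · rw [h' j hj]
  have e'' : ∀ j, (y'' j).deg = (y j).deg := fun j => by
    by_cases hj : j = l
    · subst hj; rw [hy, hy'']
    · rw [h'' j hj]
  by_cases h : ∀ q, r (Sum.inr q) = i
  · by_cases hil : i = l
    · subst hil
      have hi : q = (y i).deg := by rw [hy]
      rw [freeVal_pos c r a y hn i h hy hi,
        freeVal_pos c r a y' hn' i h hy' (hi.trans (e' i).symm),
        freeVal_pos c r a y'' hn'' i h hy'' (hi.trans (e'' i).symm)]
      have hB : ∀ {p : ℤ} (β : D.obj (Option {p // r (Sum.inl p) = i}) p) j,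
          freeB r y' i h β j = freeB r y i h β j ∧ freeB r y'' i h β j = freeB r y i h β j := by
        intro p β j
        by_cases hj : j = i
        · subst hj; simp only [freeB_self, and_self]
        · simp only [freeB_ne _ _ _ _ _ _ hj, h' j hj, h'' j hj, and_self]
      have k1 : freeTerm r a y' i h hn' (hi.trans (e' i).symm) = freeTerm r a y i h hn hi := by
        refine tens_ext fun p' q hpc β γ => ?_
        rw [freeTerm_tmk, freeTerm_tmk]
        simp only [e']
        refine congrArg (fun z => sg k _ • tmk (A := (comp B D).obj (Option P)) _ z γ) ?_
        exact congrArg CompMod.mk (Sym.eq_of _ rfl (fun j => (hB β j).1) _ _)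
      have k2 : freeTerm r a y'' i h hn'' (hi.trans (e'' i).symm) = freeTerm r a y i h hn hi := by
        refine tens_ext fun p' q hpc β γ => ?_
        rw [freeTerm_tmk, freeTerm_tmk]
        simp only [e'']
        refine congrArg (fun z => sg k _ • tmk (A := (comp B D).obj (Option P)) _ z γ) ?_
        exact congrArg CompMod.mk (Sym.eq_of _ rfl (fun j => (hB β j).2) _ _)
      rw [k1, k2, ← map_smul, ← map_add, ← map_smul, ← map_add, ← map_smul, ← map_add]
    · rw [freeVal_pos c r a y hn i h rfl rfl, freeVal_pos c r a y' hn' i h (h' i hil) (e' i).symm,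
        freeVal_pos c r a y'' hn'' i h (h'' i hil) (e'' i).symm]
      generalize c.δ _ Q _ (D.map (eqI r i h) (y i).val) = z
      refine LinearMap.congr_fun (g := freeTerm r a y i h hn rfl
        + e • freeTerm r a y' i h hn' (e' i).symm) (tens_ext fun p' q' hpc β γ => ?_) z
      rw [LinearMap.add_apply, LinearMap.smul_apply, freeTerm_tmk, freeTerm_tmk, freeTerm_tmk]
      simp only [e', e'']
      refine lin_aux (A := (comp B D).obj (Option P)) _ _ e ?_ γ
      have hli : l ≠ i := Ne.symm hil
      refine CompMod.mk_linB (Sym.LinB.mk (c := e) _ a _ _ _ l q (D.map (eqJ r i h l hli) x)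
        (D.map (eqJ r i h l hli) x') ?_ ?_ ?_ ?_ ?_ _ _ _)
      · rw [freeB_ne _ _ _ _ _ _ hli, hy]; rfl
      · rw [freeB_ne _ _ _ _ _ _ hli, hy']; rfl
      · rw [freeB_ne _ _ _ _ _ _ hli, hy'', ← map_smul, ← map_add]; rfl
      · intro j hj
        by_cases hji : j = i
        · subst hji; simp only [freeB_self]
        · simp only [freeB_ne _ _ _ _ _ _ hji, h' j hj]
      · intro j hj
        by_cases hji : j = i
        · subst hji; simp only [freeB_self]
        · simp only [freeB_ne _ _ _ _ _ _ hji, h'' j hj]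
  · rw [freeVal_neg c r a _ _ i h, freeVal_neg c r a _ _ i h, freeVal_neg c r a _ _ i h]
    simp

theorem inv_post {J : Type} [Fintype J] [LinearOrder J] (e : I ≃ J) (q q' : I → ℤ)
    (q'' : J → ℤ) (i : I) (c : ℤ) (h : ∀ j, q' j = q j + if j = i then -c else 0)
    (h'' : ∀ j, q'' (e j) = q j) :
    Even (c * post q'' (e i) + inv e q' - (inv e q + c * post q i)) := by
  have hp : post q'' (e i) = ∑ j, if e i < e j then q j else 0 := by
    rw [post, ← Equiv.sum_comp e]; simp only [h'']
  have key : inv e q' = inv e q - c * ((∑ j, if i < j ∧ e j < e i then q j else 0)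
      + ∑ j, if j < i ∧ e i < e j then q j else 0) := by
    have h1 : ∀ a b : I, (if a < b ∧ e b < e a then q' a * q' b else 0)
        = (if a < b ∧ e b < e a then q a * q b else 0)
          - c * ((if a = i then (if i < b ∧ e b < e i then q b else 0) else 0)
            + (if b = i then (if a < i ∧ e i < e a then q a else 0) else 0)) := by
      intro a b
      rw [h, h]
      by_cases ha : a = i <;> by_cases hb : b = i <;> simp [ha, hb] <;> split_ifs <;> ring
    unfold inv
    simp only [h1, Finset.sum_sub_distrib, ← Finset.mul_sum, Finset.sum_add_distrib,
      Finset.sum_ite_eq', Finset.mem_univ, if_true]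
    congr 3
    rw [Finset.sum_comm]
    simp
  rw [key, hp, post]
  have h2 : c * (∑ j, if e i < e j then q j else 0) + (inv e q
      - c * ((∑ j, if i < j ∧ e j < e i then q j else 0)
      + ∑ j, if j < i ∧ e i < e j then q j else 0))
      - (inv e q + c * ∑ j, if i < j then q j else 0)
      = c * ∑ j, ((if e i < e j then q j else 0) - (if i < j ∧ e j < e i then q j else 0)
        - (if j < i ∧ e i < e j then q j else 0) - if i < j then q j else 0) := by
    simp only [Finset.sum_sub_distrib]; ring
  rw [h2]
  refine Even.mul_left (Finset.even_sum _ fun j _ => ?_) c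
  rcases lt_trichotomy i j with hij | rfl | hij
  · have : e j ≠ e i := fun hh => hij.ne' (e.injective hh)
    rcases lt_or_gt_of_ne this with h3 | h3
    · simp only [hij, h3, hij.not_gt, h3.not_gt, and_self, if_true, if_false]
      exact ⟨-q j, by ring⟩
    · simp [hij, h3, hij.not_gt, h3.not_gt]
  · simp
  · simp [hij, hij.not_gt]

theorem inv_refl (q : I → ℤ) : inv (Equiv.refl I) q = 0 :=
  Finset.sum_eq_zero fun i _ => Finset.sum_eq_zero fun j _ =>
    if_neg fun hij => lt_asymm hij.1 hij.2

/-- The bijection of fibres of two maps that correspond to each other. -/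
def fibCongr {X X' J : Type} (r : X → I) (r' : X' → J) (e : X ≃ X') (g : I ≃ J)
    (h : ∀ x, r' (e x) = g (r x)) (i : I) : {x // r x = i} ≃ {x // r' x = g i} :=
  e.subtypeEquiv fun x => by rw [h, g.injective.eq_iff]

theorem freeVal_move (c : Coaction D D) {P' Q' J : Type} [Finite P'] [Finite Q'] [Fintype J]
    [LinearOrder J] (r : P ⊕ Q → I) (r' : P' ⊕ Q' → J) (e : P ≃ P') (f : Q ≃ Q') (g : I ≃ J)
    (hr : ∀ x, r' (Equiv.sumCongr e f x) = g (r x)) (a : (B.obj I).El) (a' : (B.obj J).El)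
    (ha : a' = B.mapEl g a) (y : ∀ j, (D.obj {x // r x = j}).El)
    (y' : ∀ j, (D.obj {x // r' x = j}).El)
    (hy : ∀ i, y' (g i) = D.mapEl (fibCongr r r' (Equiv.sumCongr e f) g hr i) (y i)) {n : ℤ}
    (hn : a.deg + ∑ j, (y j).deg = n) (hn' : a'.deg + ∑ j, (y' j).deg = n) (i : I) :
    freeVal c r' a' y' hn' (g i) = sg k (inv g fun j => (y j).deg) •
      tmap (fun _ => (comp B D).map (Equiv.optionCongr e)) (fun _ => D.map f)
        (freeVal c r a y hn i) := by
  have hh : (∀ q, r' (Sum.inr q) = g i) ↔ ∀ q, r (Sum.inr q) = i := by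
    rw [← f.forall_congr_right]
    refine forall_congr' fun q => ?_
    rw [← g.injective.eq_iff, ← hr]
    rfl
  by_cases h : ∀ q, r (Sum.inr q) = i
  · have h0 := hh.2 h
    have hdeg : ∀ j, (y' (g j)).deg = (y j).deg := fun j => by rw [hy]; rfl
    rw [freeVal_pos c r a y hn i h rfl rfl,
      freeVal_pos c r' a' y' hn' (g i) h0 (hy i) (hdeg i).symm]
    let σ : {p // r (Sum.inl p) = i} ≃ {p // r' (Sum.inl p) = g i} :=
      fibCongr (fun p => r (Sum.inl p)) (fun p => r' (Sum.inl p)) e g (fun p => hr (Sum.inl p)) i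
    have h1 : (fibCongr r r' (Equiv.sumCongr e f) g hr i).trans (eqI r' (g i) h0)
        = (eqI r i h).trans (Equiv.sumCongr σ f) := by
      ext ⟨_ | _, _⟩ <;> rfl
    have h2 : D.map (eqI r' (g i) h0) (D.map (fibCongr r r' (Equiv.sumCongr e f) g hr i) (y i).val)
        = D.map (Equiv.sumCongr σ f) (D.map (eqI r i h) (y i).val) := by
      rw [← D.map_trans, ← D.map_trans, h1]
    refine (congrArg _ (congrArg _ h2)).trans ((congrArg _ (c.nat σ f _)).trans ?_)
    refine LinearMap.congr_fun
      (f := freeTerm r' a' y' (g i) h0 hn' (hdeg i).symm ∘ₗ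
        tmap (fun _ => D.map (Equiv.optionCongr σ)) (fun _ => D.map f))
      (g := sg k (inv g fun j => (y j).deg) •
        (tmap (fun _ => (comp B D).map (Equiv.optionCongr e)) (fun _ => D.map f) ∘ₗ
          freeTerm r a y i h hn rfl)) (tens_ext fun p q hpc β γ => ?_)
      (c.δ _ Q _ (D.map (eqI r i h) (y i).val))
    rw [LinearMap.comp_apply, LinearMap.smul_apply, LinearMap.comp_apply, tmap_tmk, freeTerm_tmk,
      freeTerm_tmk, map_smul]
    have hR : ∀ x, rO r' (g i) (Equiv.optionCongr e x) = g (rO r i x) := by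
      rintro (_ | p)
      · rfl
      · exact hr (Sum.inl p)
    have hb : ∀ j : I, freeB r' y' (g i) h0 (D.map (Equiv.optionCongr σ) β) (g j)
        = D.mapEl (fibCongr (rO r i) (rO r' (g i)) (Equiv.optionCongr e) g hR j)
          (freeB r y i h β j) := by
      intro j
      rcases eq_or_ne i j with rfl | hj
      · rw [freeB_self, freeB_self]
        refine congrArg (GrMod.El.mk p) ?_
        rw [← D.map_trans, ← D.map_trans]
        refine congrArg (fun e => D.map e β) ?_
        ext (_ | _) <;> rfl
      · rw [freeB_ne _ _ _ _ _ _ hj.symm,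
          freeB_ne _ _ _ _ _ _ (fun hgj => hj.symm (g.injective hgj)), hy,
          SMod.mapEl_trans, SMod.mapEl_trans]
        refine congrArg (fun e => D.mapEl e (y j)) ?_
        ext ⟨_ | q, hq⟩
        · rfl
        · exact absurd (hq.symm.trans (h q)) hj.symm
    have h3 := CompMod.mk_move (s := (freeSym r a y i h (p := p) (m := n - q) (by omega) β).map
        (Equiv.optionCongr e)) (t := freeSym r' a' y' (g i) h0 (p := p) (m := n - q)
        (by have := hdeg i; omega) (D.map (Equiv.optionCongr σ) β))
        ⟨g, fibCongr (rO r i) (rO r' (g i)) (Equiv.optionCongr e) g hR, fun _ _ => rfl, ha, hb⟩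
    have h4 := inv_post g (fun j => (y j).deg) (fun j => (freeB r y i h β j).deg)
      (fun j => (y' j).deg) i q (fun j => by
        rw [freeB_deg]
        split_ifs
        · omega
        · rfl) hdeg
    have h5 : ∀ (ε ε' η η' : k) (x : (comp B D).obj (Option P) (n - q))
        (x' : (comp B D).obj (Option P') (n - q)),
        x' = ε • (comp B D).map (Equiv.optionCongr e) x →
        η' * ε = η * ε' → η' • tmk (show n - q + q = n by omega) x' (D.map f γ)
          = η • ε' • tmap (fun _ => (comp B D).map (Equiv.optionCongr e)) (fun _ => D.map f)
            (tmk (show n - q + q = n by omega) x γ) := by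
      rintro ε ε' η η' x _ rfl he
      rw [tmap_tmk, map_smul, LinearMap.smul_apply, smul_smul, smul_smul, he]
    refine h5 _ _ _ _ _ _ (h3.trans (congrArg _ (CompMod.map_mk _ _).symm)) ?_
    rw [← sg_add, ← sg_add]
    exact sg_congr h4
  · rw [freeVal_neg c r a y hn i h, freeVal_neg c r' a' y' hn' _ (fun h' => h (hh.1 h')), map_zero,
      smul_zero]

/-- The comodule structure `B ∘ D → B ∘ (D ∘₁ D) → (B ∘ D) ∘₁ D` of the free comodule. -/
def freeδ (c : Coaction D D) (n : ℤ) : CompMod B D (P ⊕ Q) n →ₗ[k]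
    Tens ((comp B D).obj (Option P)) (D.obj Q) n :=
  CompMod.lift (fun s => ∑ i, freeVal c s.fib s.a s.nb s.deg i)
    (by
      rintro e _ _ _ ⟨φ, p, x, y, b, hd⟩
      rw [Finset.smul_sum]
      refine Eq.trans ?_ Finset.sum_add_distrib
      exact Finset.sum_congr rfl fun i _ => freeVal_linA c
        (Sym.fib (⟨_, _, φ, ⟨p, x⟩, b, hd⟩ : Sym B D (P ⊕ Q) n)) e p x y
        (Sym.nb (⟨_, _, φ, ⟨p, x⟩, b, hd⟩ : Sym B D (P ⊕ Q) n)) hd i)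
    (by
      rintro e _ _ _ ⟨φ, a, b, b', b'', l, q, x, y, hb, hb', hb'', h', h'', hd, hd', hd''⟩
      rw [Finset.smul_sum]
      refine Eq.trans ?_ Finset.sum_add_distrib
      let s : Sym B D (P ⊕ Q) n := ⟨_, _, φ, a, b, hd⟩
      refine Finset.sum_congr rfl fun i _ => freeVal_linB c s.fib e a s.nb
        (Sym.nb (⟨_, _, φ, a, b', hd'⟩ : Sym B D (P ⊕ Q) n))
        (Sym.nb (⟨_, _, φ, a, b'', hd''⟩ : Sym B D (P ⊕ Q) n)) l q (D.map (s.fibEquiv l) x)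
        (D.map (s.fibEquiv l) y) ?_ ?_ ?_ ?_ ?_ hd hd' hd'' i
      · exact congrArg (D.mapEl (s.fibEquiv l)) hb
      · exact congrArg (D.mapEl (s.fibEquiv l)) hb'
      · rw [← map_smul, ← map_add]; exact congrArg (D.mapEl (s.fibEquiv l)) hb''
      · exact fun j hj => congrArg (D.mapEl (s.fibEquiv j)) (h' j hj)
      · exact fun j hj => congrArg (D.mapEl (s.fibEquiv j)) (h'' j hj))
    (by
      intro s t m
      rw [Finset.smul_sum, ← Equiv.sum_comp m.e]
      refine Finset.sum_congr rfl fun i _ => ?_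
      refine (freeVal_move c s.fib t.fib (Equiv.refl P) (Equiv.refl Q) m.e (fun x => ?_) s.a t.a
        m.ha s.nb t.nb (fun i => ?_) s.deg t.deg i).trans (congrArg _ ?_)
      · rw [← m.fib]; rcases x with _ | _ <;> rfl
      · refine (m.nb i).trans (congrArg (fun e => D.mapEl e (s.nb i)) ?_)
        ext ⟨_ | _, _⟩ <;> rfl
      · refine tmap_id (fun _ x => ?_) (fun _ x => D.map_refl x) _
        rw [Equiv.optionCongr_refl]; exact (comp B D).map_refl x)

/-- The free right comodule `B ∘ D` on the `𝕊`-module `B`. -/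
def Coaction.free (B : SMod.{u} k) (c : Coaction D D) : Coaction (comp B D) D where
  δ P Q _ _ n := freeδ c n
  nat {P Q P' Q'} _ _ _ _ e f n x := by
    refine LinearMap.congr_fun (f := freeδ c n ∘ₗ CompMod.map (Equiv.sumCongr e f))
      (g := tmap (fun _ => (comp B D).map (Equiv.optionCongr e)) (fun _ => D.map f) ∘ₗ freeδ c n)
      (CompMod.hom_ext fun s => ?_) x
    rw [LinearMap.comp_apply, LinearMap.comp_apply, CompMod.map_mk]
    refine (CompMod.lift_mk _ _ _ _ _).trans
      (Eq.trans ?_ (congrArg _ (CompMod.lift_mk _ _ _ _ _).symm))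
    rw [map_sum]
    have hfib : ∀ x, (s.map (Equiv.sumCongr e f)).fib (Equiv.sumCongr e f x) = s.fib x := by
      intro x
      unfold Sym.fib Sym.map
      simp
    refine Finset.sum_congr rfl fun i _ => ?_
    refine (freeVal_move c s.fib (s.map (Equiv.sumCongr e f)).fib e f (Equiv.refl _) hfib s.a s.a
      (congrArg (GrMod.El.mk _) (B.map_refl _).symm) s.nb (s.map (Equiv.sumCongr e f)).nb
      (fun i => ?_) s.deg s.deg i).trans ?_
    · unfold Sym.nb
      rw [SMod.mapEl_trans]
      refine congrArg (fun e => D.mapEl e (s.b i)) ?_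
      ext z; rfl
    · exact (congrArg (· • _) ((congrArg (sg k) (inv_refl _)).trans sg_zero)).trans (one_smul _ _)

end Free

/-- An isomorphism of right comodules. -/
structure Coaction.Iso {M : SMod.{u} k} {N : SMod.{v} k} {C : SMod.{u'} k} (c : Coaction M C)
    (c' : Coaction N C) extends SMod.Iso M N where
  app_δ : ∀ {P Q : Type} [Finite P] [Finite Q] {n : ℤ} (x : M.obj (P ⊕ Q) n),
    c'.δ P Q n (app (P ⊕ Q) x)
      = tmap (fun _ => app (Option P)) (fun _ => LinearMap.id) (c.δ P Q n x)

/-! ### Twisted composition products -/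

/-- A natural map `C → O` of degree `-1`. -/
structure Twist (C : SMod.{u} k) (O : SMod.{v} k) where
  app : ∀ (X : Type) [Finite X] {i j : ℤ}, j + 1 = i → C.obj X i →ₗ[k] O.obj X j
  nat : ∀ {X Y : Type} [Finite X] [Finite Y] (e : X ≃ Y) {i j : ℤ} (h : j + 1 = i)
    (x : C.obj X i), app Y h (C.map e x) = O.map e (app X h x)

/-- The twisting morphism of quadratic data. -/
def QuadData.twist (q : QuadData.{u} k) : Twist q.dual q.operad.S :=
  ⟨fun X _ _ _ h => q.kappa X h, fun e _ _ h x => q.kappa_map e h x⟩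

section Act

variable {O : SMod.{u} k} {A : SMod.{v} k} {C : SMod.{u'} k} (μ : (comp O A).Hom C) {I : Type}
  [Fintype I] [LinearOrder I] (Z : I → Type) [∀ i, Finite (Z i)]

/-- The value `μ(a; b)`, in a prescribed degree. -/
def actv (a : (O.obj I).El) (b : ∀ i, (A.obj (Z i)).El) {n : ℤ} (h : a.deg + ∑ i, (b i).deg = n) :
    C.obj (Σ i, Z i) n := μ.app _ (CompMod.mk ⟨I, Z, Equiv.refl _, a, b, h⟩)

theorem actv_linA (e : k) {p : ℤ} (x y : O.obj I p) (b : ∀ i, (A.obj (Z i)).El) {n : ℤ}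
    (h : p + ∑ i, (b i).deg = n) :
    actv μ Z ⟨p, x + e • y⟩ b h = actv μ Z ⟨p, x⟩ b h + e • actv μ Z ⟨p, y⟩ b h := by
  refine (congrArg (μ.app _) (CompMod.mk_linA (Sym.LinA.mk (c := e) _ p x y b h))).trans ?_
  exact (map_add _ _ _).trans (congrArg _ (map_smul _ _ _))

theorem actv_linB (e : k) (a : (O.obj I).El) (b b' b'' : ∀ i, (A.obj (Z i)).El) (l : I) (q : ℤ)
    (x y : A.obj (Z l) q) (hb : b l = ⟨q, x⟩) (hb' : b' l = ⟨q, y⟩) (hb'' : b'' l = ⟨q, x + e • y⟩)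
    (h' : ∀ j, j ≠ l → b' j = b j) (h'' : ∀ j, j ≠ l → b'' j = b j) {n : ℤ} (hd hd' hd'') :
    actv μ Z (n := n) a b'' hd'' = actv μ Z a b hd + e • actv μ Z a b' hd' := by
  refine (congrArg (μ.app _) (CompMod.mk_linB (Sym.LinB.mk (c := e) _ a b b' b'' l q x y hb hb' hb''
    h' h'' hd hd' hd''))).trans ?_
  exact (map_add _ _ _).trans (congrArg _ (map_smul _ _ _))

/-- The bijection of disjoint unions given by a bijection of index sets and bijections of the
parts. -/
def sigmaEquiv {J : Type} (Z' : J → Type) (e : I ≃ J) (h : ∀ i, Z i ≃ Z' (e i)) :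
    (Σ i, Z i) ≃ Σ j, Z' j := e.sigmaCongr h

theorem actv_move {J : Type} [Fintype J] [LinearOrder J] (Z' : J → Type) [∀ j, Finite (Z' j)]
    (e : I ≃ J) (h : ∀ i, Z i ≃ Z' (e i)) (a : (O.obj I).El) (a' : (O.obj J).El)
    (b : ∀ i, (A.obj (Z i)).El) (b' : ∀ j, (A.obj (Z' j)).El) (ha : a' = O.mapEl e a)
    (hb : ∀ i, b' (e i) = A.mapEl (h i) (b i)) {n : ℤ} (hd hd') :
    actv μ Z' (n := n) a' b' hd'
      = sg k (inv e fun i => (b i).deg) • C.map (sigmaEquiv Z Z' e h) (actv μ Z a b hd) := by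
  refine Eq.trans ?_ (congrArg _ (μ.app_map (sigmaEquiv Z Z' e h) _))
  refine Eq.trans ?_ (map_smul _ _ _)
  refine congrArg (μ.app _) ?_
  refine Eq.trans ?_ (congrArg _ (CompMod.map_mk _ _).symm)
  exact CompMod.mk_move (s := Sym.map (sigmaEquiv Z Z' e h) ⟨I, Z, Equiv.refl _, a, b, hd⟩)
    (t := ⟨J, Z', Equiv.refl _, a', b', hd'⟩) ⟨e, h, fun _ _ => rfl, ha, hb⟩

end Act

section Twisted

open scoped Classical in
/-- The decomposition of a set into the complement of a subset and this subset. -/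
def splitEquiv {I : Type} (U : Set I) : I ≃ {i // i ∉ U} ⊕ {i // i ∈ U} :=
  ((Equiv.sumComm _ _).trans (Equiv.sumCompl (· ∈ U))).symm

/-- The parts after merging those indexed by `U`. -/
def TwZ {I : Type} (Z : I → Type) (U : Set I) : Option {i // i ∉ U} → Type
  | none => Σ i : {i // i ∈ U}, Z i.1
  | some j => Z j.1

open scoped Classical in
instance {I : Type} [Finite I] (Z : I → Type) [∀ i, Finite (Z i)] (U : Set I) :
    ∀ o, Finite (TwZ Z U o)
  | none => inferInstanceAs (Finite (Σ i : {i // i ∈ U}, Z i.1))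
  | some j => inferInstanceAs (Finite (Z j.1))

/-- The merged parts have the same union. -/
def twE {I : Type} (Z : I → Type) (U : Set I) : (Σ o, TwZ Z U o) ≃ Σ i, Z i :=
  Equiv.ofBijective
    (fun
      | ⟨none, z⟩ => ⟨z.1.1, z.2⟩
      | ⟨some j, z⟩ => ⟨j.1, z⟩)
    ⟨by
      rintro ⟨_ | ⟨j, hj⟩, z⟩ ⟨_ | ⟨j', hj'⟩, z'⟩ h
      · obtain ⟨⟨i, hi⟩, z⟩ := z
        obtain ⟨⟨i', hi'⟩, z'⟩ := z'
        obtain ⟨h1, h2⟩ := Sigma.mk.inj_iff.1 h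
        dsimp only at h1
        subst h1
        obtain rfl := eq_of_heq h2
        rfl
      · obtain ⟨⟨i, hi⟩, z⟩ := z
        obtain ⟨h1, h2⟩ := Sigma.mk.inj_iff.1 h
        dsimp only at h1
        subst h1
        exact absurd hi hj'
      · obtain ⟨⟨i, hi⟩, z'⟩ := z'
        obtain ⟨h1, h2⟩ := Sigma.mk.inj_iff.1 h
        dsimp only at h1
        subst h1
        exact absurd hi hj
      · obtain ⟨h1, h2⟩ := Sigma.mk.inj_iff.1 h
        dsimp only at h1
        subst h1
        obtain rfl := eq_of_heq h2
        rfl, by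
      rintro ⟨i, z⟩
      by_cases h : i ∈ U
      · exact ⟨⟨none, ⟨⟨i, h⟩, z⟩⟩, rfl⟩
      · exact ⟨⟨some ⟨i, h⟩, z⟩, rfl⟩⟩

variable {M : SMod.{u} k} {C : SMod.{v} k} {O : SMod.{u'} k} {A : SMod.{v'} k}
  {I : Type} [Fintype I] [LinearOrder I] {Z : I → Type} [∀ i, Finite (Z i)] {X : Type}

/-- The factors after merging those indexed by `U`. -/
def twB (U : Set I) (ω : (A.obj (Σ i : {i // i ∈ U}, Z i.1)).El) (b : ∀ i, (A.obj (Z i)).El) :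
    ∀ o : Option {i // i ∉ U}, (A.obj (TwZ Z U o)).El
  | none => ω
  | some j => b j.1

open scoped Classical in
/-- The sum of the degrees over a subset. -/
def degOn (U : Set I) (q : I → ℤ) : ℤ := ∑ i : {i // i ∈ U}, q i.1

open scoped Classical in
/-- The exponent of the sign of moving the factors indexed by `U` in front of the others. -/
def shufExp (U : Set I) (q : I → ℤ) : ℤ :=
  ∑ j, ∑ i, if j ∉ U ∧ i ∈ U ∧ j < i then q j * q i else 0

open scoped Classical in
theorem degOn_compl (U : Set I) (q : I → ℤ) :
    degOn U q + ∑ j : {i // i ∉ U}, q j.1 = ∑ i, q i := by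
  unfold degOn
  rw [← Fintype.sum_subtype_add_sum_subtype (· ∈ U) q]

open scoped Classical in
/-- The generator `(m; ω, b_j, …)` with the factors indexed by `U` replaced by one factor `ω`. -/
def twSym (φ : (Σ i, Z i) ≃ X) (b : ∀ i, (A.obj (Z i)).El) (U : Set I)
    (m : (M.obj (Option {i // i ∉ U})).El) (ω : (A.obj (Σ i : {i // i ∈ U}, Z i.1)).El) {n : ℤ}
    (h : m.deg + (ω.deg + ∑ j : {i // i ∉ U}, (b j.1).deg) = n) : Sym M A X n :=
  @Sym.mk k _ M A X n (Option {i // i ∉ U}) _ (optOrd _) (TwZ Z U) _ ((twE Z U).trans φ) m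
    (twB U ω b) (by rw [Fintype.sum_option]; exact h)

open scoped Classical in
theorem twSym_linA (φ : (Σ i, Z i) ≃ X) (b : ∀ i, (A.obj (Z i)).El) (U : Set I) (e : k) {p : ℤ}
    (x y : M.obj (Option {i // i ∉ U}) p) (ω : (A.obj (Σ i : {i // i ∈ U}, Z i.1)).El) {n : ℤ}
    (h : p + (ω.deg + ∑ j : {i // i ∉ U}, (b j.1).deg) = n) :
    CompMod.mk (twSym φ b U ⟨p, x + e • y⟩ ω h)
      = CompMod.mk (twSym φ b U ⟨p, x⟩ ω h) + e • CompMod.mk (twSym φ b U ⟨p, y⟩ ω h) := by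
  refine CompMod.mk_linA ?_
  exact @Sym.LinA.mk k _ M A X n e (Option {i // i ∉ U}) _ (optOrd _) (TwZ Z U) _ _ p x y
    (twB U ω b) (by rw [Fintype.sum_option]; exact h)

open scoped Classical in
theorem twSym_linω (φ : (Σ i, Z i) ≃ X) (b : ∀ i, (A.obj (Z i)).El) (U : Set I) (e : k)
    (m : (M.obj (Option {i // i ∉ U})).El) {q : ℤ}
    (x y : A.obj (Σ i : {i // i ∈ U}, Z i.1) q) {n : ℤ}
    (h : m.deg + (q + ∑ j : {i // i ∉ U}, (b j.1).deg) = n) :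
    CompMod.mk (twSym φ b U m ⟨q, x + e • y⟩ h)
      = CompMod.mk (twSym φ b U m ⟨q, x⟩ h) + e • CompMod.mk (twSym φ b U m ⟨q, y⟩ h) := by
  refine CompMod.mk_linB ?_
  have hd : ∀ z : A.obj (Σ i : {i // i ∈ U}, Z i.1) q,
      m.deg + ∑ o, (twB U ⟨q, z⟩ b o).deg = n := fun z => by
    rw [Fintype.sum_option]; exact h
  refine @Sym.LinB.mk k _ M A X n e (Option {i // i ∉ U}) _ (optOrd _) (TwZ Z U) _ _ m
    (twB U ⟨q, x⟩ b) (twB U ⟨q, y⟩ b) (twB U ⟨q, x + e • y⟩ b) none q x y rfl rfl rfl ?_ ?_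
    (hd _) (hd _) (hd _)
  · rintro (_ | j) hj
    · exact absurd rfl hj
    · rfl
  · rintro (_ | j) hj
    · exact absurd rfl hj
    · rfl

open scoped Classical in
theorem twSym_linb (φ : (Σ i, Z i) ≃ X) (b b' b'' : ∀ i, (A.obj (Z i)).El) (U : Set I) (e : k)
    (l : I) (hl : l ∉ U) (q : ℤ) (x y : A.obj (Z l) q) (hb : b l = ⟨q, x⟩) (hb' : b' l = ⟨q, y⟩)
    (hb'' : b'' l = ⟨q, x + e • y⟩) (h' : ∀ j, j ≠ l → b' j = b j) (h'' : ∀ j, j ≠ l → b'' j = b j)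
    (m : (M.obj (Option {i // i ∉ U})).El) (ω : (A.obj (Σ i : {i // i ∈ U}, Z i.1)).El) {n : ℤ}
    (hd hd' hd'') :
    CompMod.mk (twSym (n := n) φ b'' U m ω hd'')
      = CompMod.mk (twSym φ b U m ω hd) + e • CompMod.mk (twSym φ b' U m ω hd') := by
  refine CompMod.mk_linB ?_
  refine @Sym.LinB.mk k _ M A X n e (Option {i // i ∉ U}) _ (optOrd _) (TwZ Z U) _ _ m
    (twB U ω b) (twB U ω b') (twB U ω b'') (some ⟨l, hl⟩) q x y hb hb' hb'' ?_ ?_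
    (by rw [Fintype.sum_option]; exact hd) (by rw [Fintype.sum_option]; exact hd')
    (by rw [Fintype.sum_option]; exact hd'')
  · rintro (_ | j) hj
    · rfl
    · exact h' _ fun hh => hj (congrArg some (Subtype.ext hh))
  · rintro (_ | j) hj
    · rfl
    · exact h'' _ fun hh => hj (congrArg some (Subtype.ext hh))

open scoped Classical in
/-- The element `κ(c)(b_i, i ∈ U)`. -/
def twAct (κ : Twist C O) (μ : (comp O A).Hom A) (b : ∀ i, (A.obj (Z i)).El) (U : Set I) {c N : ℤ}
    (h : c + degOn U (fun i => (b i).deg) = N + 1) (γ : C.obj {i // i ∈ U} c) :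
    A.obj (Σ i : {i // i ∈ U}, Z i.1) N :=
  actv μ (fun i : {i // i ∈ U} => Z i.1) ⟨c - 1, κ.app _ (by omega) γ⟩ (fun i => b i.1)
    (show c - 1 + degOn U (fun i => (b i).deg) = N by omega)

open scoped Classical in
theorem twAct_linC (κ : Twist C O) (μ : (comp O A).Hom A) (b : ∀ i, (A.obj (Z i)).El) (U : Set I)
    {c N : ℤ} (h : c + degOn U (fun i => (b i).deg) = N + 1) (e : k) (γ γ' : C.obj {i // i ∈ U} c) :
    twAct κ μ b U h (γ + e • γ') = twAct κ μ b U h γ + e • twAct κ μ b U h γ' := by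
  refine Eq.trans ?_ (actv_linA μ (fun i : {i // i ∈ U} => Z i.1) e _ _ _ _)
  unfold twAct
  simp only [map_add, map_smul]

open scoped Classical in
theorem twAct_linB (κ : Twist C O) (μ : (comp O A).Hom A) (b b' b'' : ∀ i, (A.obj (Z i)).El)
    (U : Set I) (e : k) (l : I) (hl : l ∈ U) (q : ℤ) (x y : A.obj (Z l) q) (hb : b l = ⟨q, x⟩)
    (hb' : b' l = ⟨q, y⟩) (hb'' : b'' l = ⟨q, x + e • y⟩) (h' : ∀ j, j ≠ l → b' j = b j)
    (h'' : ∀ j, j ≠ l → b'' j = b j) {c N : ℤ} (hd hd' hd'') (γ : C.obj {i // i ∈ U} c) :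
    twAct κ μ b'' U (N := N) hd'' γ = twAct κ μ b U hd γ + e • twAct κ μ b' U hd' γ :=
  actv_linB μ (fun i : {i // i ∈ U} => Z i.1) e _ _ _ _ ⟨l, hl⟩ q x y hb hb' hb''
    (fun j hj => h' _ fun hh => hj (Subtype.ext hh))
    (fun j hj => h'' _ fun hh => hj (Subtype.ext hh)) _ _ _

open scoped Classical in
theorem twAct_congr (κ : Twist C O) (μ : (comp O A).Hom A) (b b' : ∀ i, (A.obj (Z i)).El)
    (U : Set I) (h' : ∀ j ∈ U, b' j = b j) {c N : ℤ} (hd hd') (γ : C.obj {i // i ∈ U} c) :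
    twAct κ μ b' U (N := N) hd' γ = twAct κ μ b U hd γ := by
  unfold twAct actv
  exact congrArg (μ.app _) (congrArg CompMod.mk (Sym.eq_of _ rfl (fun j => h' _ j.2) _ _))

open scoped Classical in
/-- The bilinear map `m, c ↦ (m; κ(c)(b_i, i ∈ U), b_j, j ∉ U)`. -/
def twBil (κ : Twist C O) (μ : (comp O A).Hom A) (φ : (Σ i, Z i) ≃ X)
    (b : ∀ i, (A.obj (Z i)).El) (U : Set I) {p c D n : ℤ}
    (hD : c + degOn U (fun i => (b i).deg) = D + 1)
    (h : p + (D + ∑ j : {i // i ∉ U}, (b j.1).deg) = n) :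
    M.obj (Option {i // i ∉ U}) p →ₗ[k] C.obj {i // i ∈ U} c →ₗ[k] CompMod M A X n :=
  linOf (fun x => linOf (fun γ => CompMod.mk (twSym φ b U ⟨p, x⟩ ⟨D, twAct κ μ b U hD γ⟩ h))
      fun e γ γ' => (congrArg (fun z => CompMod.mk (twSym φ b U ⟨p, x⟩ ⟨D, z⟩ h))
        (twAct_linC κ μ b U hD e γ γ')).trans (twSym_linω φ b U e _ _ _ _))
    fun e x x' => LinearMap.ext fun γ => by
      rw [LinearMap.add_apply, LinearMap.smul_apply]
      exact twSym_linA φ b U e x x' ⟨D, twAct κ μ b U hD γ⟩ h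

open scoped Classical in
theorem tw_deg {b : ∀ i, (A.obj (Z i)).El} (U : Set I) {N n : ℤ} (hN : N + ∑ i, (b i).deg = n + 1)
    {p c : ℤ} (h : p + c = N) : p + (c - 1 + degOn U (fun i => (b i).deg)
      + ∑ j : {i // i ∉ U}, (b j.1).deg) = n := by
  have := degOn_compl U fun i => (b i).deg
  omega

/-- The map `m ⊗ c ↦ ± (m; κ(c)(b_i, i ∈ U), b_j, j ∉ U)`. -/
def twTerm (κ : Twist C O) (μ : (comp O A).Hom A) (φ : (Σ i, Z i) ≃ X)
    (b : ∀ i, (A.obj (Z i)).El) (U : Set I) {N n : ℤ} (hN : N + ∑ i, (b i).deg = n + 1) :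
    Tens (M.obj (Option {i // i ∉ U})) (C.obj {i // i ∈ U}) N →ₗ[k] CompMod M A X n :=
  tlift fun p c hpc => sg k (p + shufExp U fun i => (b i).deg) •
    twBil κ μ φ b U (D := c - 1 + degOn U (fun i => (b i).deg)) (by omega) (tw_deg U hN hpc)

open scoped Classical in
theorem twTerm_tmk (κ : Twist C O) (μ : (comp O A).Hom A) (φ : (Σ i, Z i) ≃ X)
    (b : ∀ i, (A.obj (Z i)).El) (U : Set I) {N n : ℤ} (hN : N + ∑ i, (b i).deg = n + 1) {p c D : ℤ}
    (hpc : p + c = N) (x : M.obj (Option {i // i ∉ U}) p) (γ : C.obj {i // i ∈ U} c)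
    (hD : c + degOn U (fun i => (b i).deg) = D + 1)
    (h : p + (D + ∑ j : {i // i ∉ U}, (b j.1).deg) = n) :
    twTerm κ μ φ b U hN (tmk hpc x γ) = sg k (p + shufExp U fun i => (b i).deg) •
      CompMod.mk (twSym φ b U ⟨p, x⟩ ⟨D, twAct κ μ b U hD γ⟩ h) := by
  obtain rfl : D = c - 1 + degOn U (fun i => (b i).deg) := by omega
  unfold twTerm
  rw [tlift_tmk, LinearMap.smul_apply, LinearMap.smul_apply]
  rfl

/-- The summand of the twisting term that merges the factors indexed by `U`. -/
def twVal (Δ : Coaction M C) (κ : Twist C O) (μ : (comp O A).Hom A) (φ : (Σ i, Z i) ≃ X)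
    (m : (M.obj I).El) (b : ∀ i, (A.obj (Z i)).El) {n : ℤ}
    (h : m.deg + ∑ i, (b i).deg = n + 1) (U : Set I) : CompMod M A X n :=
  twTerm κ μ φ b U h (Δ.δ _ _ _ (M.map (splitEquiv U) m.val))

theorem twVal_linA (Δ : Coaction M C) (κ : Twist C O) (μ : (comp O A).Hom A) (φ : (Σ i, Z i) ≃ X)
    (e : k) {p : ℤ} (x y : M.obj I p) (b : ∀ i, (A.obj (Z i)).El) {n : ℤ}
    (h : p + ∑ i, (b i).deg = n + 1) (U : Set I) :
    twVal Δ κ μ φ ⟨p, x + e • y⟩ b h U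
      = twVal Δ κ μ φ ⟨p, x⟩ b h U + e • twVal Δ κ μ φ ⟨p, y⟩ b h U := by
  unfold twVal
  simp only [map_add, map_smul]

theorem twVal_linB (Δ : Coaction M C) (κ : Twist C O) (μ : (comp O A).Hom A) (φ : (Σ i, Z i) ≃ X)
    (e : k) (m : (M.obj I).El) (b b' b'' : ∀ i, (A.obj (Z i)).El) (l : I) (q : ℤ)
    (x y : A.obj (Z l) q) (hb : b l = ⟨q, x⟩) (hb' : b' l = ⟨q, y⟩) (hb'' : b'' l = ⟨q, x + e • y⟩)
    (h' : ∀ j, j ≠ l → b' j = b j) (h'' : ∀ j, j ≠ l → b'' j = b j) {n : ℤ}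
    (hd : m.deg + ∑ i, (b i).deg = n + 1) (hd' : m.deg + ∑ i, (b' i).deg = n + 1)
    (hd'' : m.deg + ∑ i, (b'' i).deg = n + 1) (U : Set I) :
    twVal Δ κ μ φ m b'' hd'' U = twVal Δ κ μ φ m b hd U + e • twVal Δ κ μ φ m b' hd' U := by
  classical
  have e' : ∀ j, (b' j).deg = (b j).deg := fun j => by
    by_cases hj : j = l
    · subst hj; rw [hb, hb']
    · rw [h' j hj]
  have e'' : ∀ j, (b'' j).deg = (b j).deg := fun j => by
    by_cases hj : j = l
    · subst hj; rw [hb, hb'']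
    · rw [h'' j hj]
  unfold twVal
  generalize Δ.δ _ _ _ (M.map (splitEquiv U) m.val) = z
  refine LinearMap.congr_fun (g := twTerm κ μ φ b U hd + e • twTerm κ μ φ b' U hd')
    (tens_ext fun p c hpc β γ => ?_) z
  have hdg : p + (c - 1 + degOn U (fun i => (b i).deg) + ∑ j : {i // i ∉ U}, (b j.1).deg) = n := by
    have := degOn_compl U fun i => (b i).deg
    omega
  have s' : degOn U (fun i => (b' i).deg) = degOn U (fun i => (b i).deg) := by simp only [e']
  have s'' : degOn U (fun i => (b'' i).deg) = degOn U (fun i => (b i).deg) := by simp only [e'']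
  rw [LinearMap.add_apply, LinearMap.smul_apply,
    twTerm_tmk κ μ φ b U hd hpc β γ (D := c - 1 + degOn U (fun i => (b i).deg)) (by omega) hdg,
    twTerm_tmk κ μ φ b' U hd' hpc β γ (D := c - 1 + degOn U (fun i => (b i).deg))
      (by rw [s']; omega) (by simp only [e']; exact hdg),
    twTerm_tmk κ μ φ b'' U hd'' hpc β γ (D := c - 1 + degOn U (fun i => (b i).deg))
      (by rw [s'']; omega) (by simp only [e'']; exact hdg), smul_comm e]
  simp only [e', e'']
  refine Eq.trans (congrArg _ ?_) (smul_add _ _ _)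
  by_cases hl : l ∈ U
  · have hc : ∀ {b1 : ∀ i, (A.obj (Z i)).El} (h1 : ∀ j, j ≠ l → b1 j = b j) (ω h h0),
        twSym (n := n) φ b1 U ⟨p, β⟩ ω h = twSym φ b U ⟨p, β⟩ ω h0 := by
      intro b1 h1 ω h h0
      refine @Sym.eq_of k _ M A X n (Option {i // i ∉ U}) _ (optOrd _) (TwZ Z U) _ _ _ _ _ _ rfl
        ?_ _ _
      rintro (_ | j)
      · rfl
      · exact h1 _ fun hh => j.2 (hh ▸ hl)
    rw [hc h' _ _ hdg, hc h'' _ _ hdg,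
      twAct_linB κ μ b b' b'' U e l hl q x y hb hb' hb'' h' h'' _ (by rw [s']; omega)]
    exact twSym_linω φ b U e _ _ _ _
  · rw [twAct_congr κ μ b b' U (fun j hj => h' j fun hh => hl (hh ▸ hj)) (by omega),
      twAct_congr κ μ b b'' U (fun j hj => h'' j fun hh => hl (hh ▸ hj)) (by omega)]
    exact twSym_linb φ b b' b'' U e l hl q x y hb hb' hb'' h' h'' _ _ _ _ _

theorem inv_opt {J : Type} [LinearOrder J] (e : I ≃ J) (q : Option I → ℤ) :
    @inv (Option I) (Option J) _ (optOrd I) (optOrd J) (Equiv.optionCongr e) q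
      = inv e fun i => q (some i) := by
  have h1 : ∀ a b : I, @LT.lt (Option I) (@Preorder.toLT _ (@PartialOrder.toPreorder _
      (@LinearOrder.toPartialOrder _ (optOrd I)))) (some a) (some b) ↔ a < b := fun a b => WithBot.coe_lt_coe
  have h2 : ∀ a b : J, @LT.lt (Option J) (@Preorder.toLT _ (@PartialOrder.toPreorder _
      (@LinearOrder.toPartialOrder _ (optOrd J)))) (some a) (some b) ↔ a < b := fun a b => WithBot.coe_lt_coe
  have h3 : ∀ a : Option I, ¬ @LT.lt (Option I) (@Preorder.toLT _ (@PartialOrder.toPreorder _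
      (@LinearOrder.toPartialOrder _ (optOrd I)))) a none := fun a => WithBot.not_lt_bot a
  have h4 : ∀ a : Option J, ¬ @LT.lt (Option J) (@Preorder.toLT _ (@PartialOrder.toPreorder _
      (@LinearOrder.toPartialOrder _ (optOrd J)))) a none := fun a => WithBot.not_lt_bot a
  unfold inv
  simp only [Fintype.sum_option, Equiv.optionCongr_apply, Option.map_none, Option.map_some, h1, h2,
    h3, h4, and_false, false_and, if_false, Finset.sum_const_zero, zero_add]

theorem sum_sub_ite (p : I → Prop) [DecidablePred p] [Fintype {i // p i}] (f : I → ℤ) :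
    ∑ i : {i // p i}, f i.1 = ∑ i, if p i then f i else 0 := by
  rw [← Finset.sum_filter]
  exact (Finset.sum_subtype _ (by simp) f).symm

theorem inv_sub {J : Type} [LinearOrder J] (e : I ≃ J) (p : I → Prop) [DecidablePred p] [Fintype {i // p i}]
    (p' : J → Prop)     (hp : ∀ i, p i ↔ p' (e i)) (q : I → ℤ) :
    inv (e.subtypeEquiv hp) (fun i : {i // p i} => q i.1)
      = ∑ i, ∑ j, if p i ∧ p j ∧ i < j ∧ e j < e i then q i * q j else 0 := by
  unfold inv
  refine (sum_sub_ite p fun i => ∑ j : {j // p j}, if i < j.1 ∧ e j.1 < e i then q i * q j.1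
    else 0).trans (Finset.sum_congr rfl fun i _ => ?_)
  split_ifs with h
  · refine (sum_sub_ite p fun j => if i < j ∧ e j < e i then q i * q j else 0).trans
      (Finset.sum_congr rfl fun j _ => ?_)
    simp only [h, true_and, ite_and]
  · simp [h]

open scoped Classical in
theorem shufExp_move {J : Type} [Fintype J] [LinearOrder J] (e : I ≃ J) (U : Set I) (U' : Set J)
    (hU : ∀ i, i ∈ U ↔ e i ∈ U') (q : I → ℤ) (q' : J → ℤ) (hq : ∀ i, q' (e i) = q i) :
    shufExp U' q' = ∑ j, ∑ i, if j ∉ U ∧ i ∈ U ∧ e j < e i then q j * q i else 0 := by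
  unfold shufExp
  rw [← Equiv.sum_comp e]
  refine Finset.sum_congr rfl fun j _ => ?_
  rw [← Equiv.sum_comp e]
  simp only [hq, hU]

open scoped Classical in
theorem inv_parts {J : Type} [LinearOrder J] (e : I ≃ J) (U : Set I) (q : I → ℤ) :
    inv e q = (∑ i, ∑ j, if i ∈ U ∧ j ∈ U ∧ i < j ∧ e j < e i then q i * q j else 0)
      + (∑ i, ∑ j, if i ∉ U ∧ j ∉ U ∧ i < j ∧ e j < e i then q i * q j else 0)
      + (∑ j, ∑ i, if j ∉ U ∧ i ∈ U ∧ i < j ∧ e j < e i then q j * q i else 0)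
      + ∑ j, ∑ i, if j ∉ U ∧ i ∈ U ∧ j < i ∧ e i < e j then q j * q i else 0 := by
  rw [Finset.sum_comm (f := fun j i => if j ∉ U ∧ i ∈ U ∧ i < j ∧ e j < e i then q j * q i else 0)]
  unfold inv
  simp only [← Finset.sum_add_distrib]
  refine Finset.sum_congr rfl fun i _ => Finset.sum_congr rfl fun j _ => ?_
  by_cases hi : i ∈ U <;> by_cases hj : j ∈ U <;> simp [hi, hj, mul_comm (q j)]

open scoped Classical in
theorem cross_even {J : Type} [LinearOrder J] (e : I ≃ J) (U : Set I) (q : I → ℤ) :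
    Even ((∑ j, ∑ i, if j ∉ U ∧ i ∈ U ∧ e j < e i then q j * q i else 0)
      - (∑ j, ∑ i, if j ∉ U ∧ i ∈ U ∧ i < j ∧ e j < e i then q j * q i else 0)
      - (∑ j, ∑ i, if j ∉ U ∧ i ∈ U ∧ j < i ∧ e i < e j then q j * q i else 0)
      - ∑ j, ∑ i, if j ∉ U ∧ i ∈ U ∧ j < i then q j * q i else 0) := by
  simp only [← Finset.sum_sub_distrib]
  refine Finset.even_sum _ fun j _ => Finset.even_sum _ fun i _ => ?_
  by_cases h : j ∉ U ∧ i ∈ U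
  · obtain ⟨hj, hi⟩ := h
    simp only [hi, hj, not_false_iff, true_and]
    have hne : i ≠ j := fun hh => hj (hh ▸ hi)
    have : e j ≠ e i := fun hh => hne (e.injective hh).symm
    rcases lt_or_gt_of_ne hne with hij | hij <;> rcases lt_or_gt_of_ne this with h3 | h3
    · simp [hij, h3, hij.not_gt, h3.not_gt]
    · simp [hij, h3, hij.not_gt, h3.not_gt]
    · simp [hij, h3, hij.not_gt, h3.not_gt]
    · simp only [hij, h3, h3.not_gt, hij.not_gt, and_self, if_true, if_false, and_false]
      exact ⟨-(q j * q i), by ring⟩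
  · have h' : ∀ r : Prop, ¬ (j ∉ U ∧ i ∈ U ∧ r) := fun r hh => h ⟨hh.1, hh.2.1⟩
    rw [if_neg (h' _), if_neg (h' _), if_neg (h' _), if_neg (h' _)]
    exact ⟨0, rfl⟩

open scoped Classical in
theorem inv_split {J : Type} [Fintype J] [LinearOrder J] (e : I ≃ J) (U : Set I) (U' : Set J)
    (hU : ∀ i, i ∈ U ↔ e i ∈ U') (q : I → ℤ) (q' : J → ℤ) (hq : ∀ i, q' (e i) = q i) :
    Even (shufExp U' q' + inv (e.subtypeEquiv hU) (fun i : {i // i ∈ U} => q i.1)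
      + inv (e.subtypeEquiv (q := fun j => j ∉ U') fun i => not_congr (hU i))
        (fun i : {i // i ∉ U} => q i.1) - (inv e q + shufExp U q)) := by
  have gen : ∀ {S E A B a b c d x y : ℤ}, A = a → B = b → S = x → E = a + b + c + d →
      Even (x - c - d - y) → Even (S + A + B - (E + y)) := by
    rintro S E A B a b c d x y rfl rfl rfl rfl h
    have : S + A + B - (A + B + c + d + y) = S - c - d - y := by ring
    rwa [this]
  exact gen (inv_sub e (fun i => i ∈ U) (fun i => i ∈ U') hU q)
    (inv_sub e (fun i => i ∉ U) (fun i => i ∉ U') (fun i => not_congr (hU i)) q)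
    (shufExp_move e U U' hU q q' hq) (inv_parts e U q) (cross_even e U q)

open scoped Classical in
theorem twAct_move {J : Type} [Fintype J] [LinearOrder J] {Z' : J → Type} [∀ j, Finite (Z' j)]
    (κ : Twist C O) (μ : (comp O A).Hom A) (e : I ≃ J) (h : ∀ i, Z i ≃ Z' (e i)) (U : Set I)
    (U' : Set J) (hU : ∀ i, i ∈ U ↔ e i ∈ U') (b : ∀ i, (A.obj (Z i)).El)
    (b' : ∀ j, (A.obj (Z' j)).El) (hb : ∀ i, b' (e i) = A.mapEl (h i) (b i)) {c D : ℤ}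
    (γ : C.obj {i // i ∈ U} c) (hd hd') :
    twAct κ μ b' U' (N := D) hd' (C.map (e.subtypeEquiv hU) γ)
      = sg k (inv (e.subtypeEquiv hU) fun i : {i // i ∈ U} => (b i.1).deg) •
        A.map (sigmaEquiv (fun i : {i // i ∈ U} => Z i.1) (fun i : {i // i ∈ U'} => Z' i.1)
          (e.subtypeEquiv hU) fun i => h i.1) (twAct κ μ b U hd γ) := by
  refine actv_move μ (fun i : {i // i ∈ U} => Z i.1) (fun i : {i // i ∈ U'} => Z' i.1)
    (e.subtypeEquiv hU) (fun i => h i.1) _ _ _ _ ?_ (fun i => hb i.1) _ _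
  exact congrArg (GrMod.El.mk _) (κ.nat _ _ γ)

open scoped Classical in
theorem twSym_move {J : Type} [Fintype J] [LinearOrder J] {Z' : J → Type} [∀ j, Finite (Z' j)]
    (φ : (Σ i, Z i) ≃ X) (φ' : (Σ i, Z' i) ≃ X) (e : I ≃ J) (h : ∀ i, Z i ≃ Z' (e i))
    (hφ : ∀ i z, φ' ⟨e i, h i z⟩ = φ ⟨i, z⟩) (U : Set I)
    (U' : Set J) (hU : ∀ i, i ∈ U ↔ e i ∈ U') (b : ∀ i, (A.obj (Z i)).El)
    (b' : ∀ j, (A.obj (Z' j)).El) (hb : ∀ i, b' (e i) = A.mapEl (h i) (b i)) {p D n : ℤ}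
    (x : M.obj (Option {i // i ∉ U}) p) (ω : A.obj (Σ i : {i // i ∈ U}, Z i.1) D) (hd hd') :
    CompMod.mk (twSym (n := n) φ' b' U' ⟨p, M.map (Equiv.optionCongr
        (e.subtypeEquiv (q := fun j => j ∉ U') fun i => not_congr (hU i))) x⟩
        ⟨D, A.map (sigmaEquiv (fun i : {i // i ∈ U} => Z i.1) (fun i : {i // i ∈ U'} => Z' i.1)
          (e.subtypeEquiv hU) fun i => h i.1) ω⟩ hd')
      = sg k (inv (e.subtypeEquiv (q := fun j => j ∉ U') fun i => not_congr (hU i))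
        fun i : {i // i ∉ U} => (b i.1).deg) • CompMod.mk (twSym φ b U ⟨p, x⟩ ⟨D, ω⟩ hd) := by
  have hz : ∀ o : Option {i // i ∉ U}, TwZ Z U o ≃ TwZ Z' U' (Equiv.optionCongr
      (e.subtypeEquiv (q := fun j => j ∉ U') fun i => not_congr (hU i)) o) := fun o =>
    match o with
    | none => sigmaEquiv (fun i : {i // i ∈ U} => Z i.1) (fun i : {i // i ∈ U'} => Z' i.1)
          (e.subtypeEquiv hU) fun i => h i.1
    | some i => h i.1
  refine (CompMod.mk_move (s := twSym φ b U ⟨p, x⟩ ⟨D, ω⟩ hd) ⟨Equiv.optionCongr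
      (e.subtypeEquiv (q := fun j => j ∉ U') fun i => not_congr (hU i)), fun o =>
    match o with
    | none => sigmaEquiv (fun i : {i // i ∈ U} => Z i.1) (fun i : {i // i ∈ U'} => Z' i.1)
          (e.subtypeEquiv hU) fun i => h i.1
    | some i => h i.1, ?_, rfl, ?_⟩).trans ?_
  · rintro (_ | i) z
    · exact hφ z.1.1 z.2
    · exact hφ i.1 z
  · rintro (_ | i)
    · rfl
    · exact hb i.1
  · exact congrArg (fun z => sg k z • _) (inv_opt _ _)

theorem twSym_smul (φ : (Σ i, Z i) ≃ X) (b : ∀ i, (A.obj (Z i)).El) (U : Set I) (e : k)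
    (m : (M.obj (Option {i // i ∉ U})).El) {q : ℤ}
    (x : A.obj (Σ i : {i // i ∈ U}, Z i.1) q) {n : ℤ} (h) :
    CompMod.mk (twSym (n := n) φ b U m ⟨q, e • x⟩ h) = e • CompMod.mk (twSym φ b U m ⟨q, x⟩ h) :=
  map_smul (linOf (fun x => CompMod.mk (twSym (n := n) φ b U m ⟨q, x⟩ h))
    fun e x y => twSym_linω φ b U e m x y h) e x

theorem twTerm_move {J : Type} [Fintype J] [LinearOrder J] {Z' : J → Type} [∀ j, Finite (Z' j)]
    (κ : Twist C O) (μ : (comp O A).Hom A)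
    (φ : (Σ i, Z i) ≃ X) (φ' : (Σ i, Z' i) ≃ X) (e : I ≃ J) (h : ∀ i, Z i ≃ Z' (e i))
    (hφ : ∀ i z, φ' ⟨e i, h i z⟩ = φ ⟨i, z⟩) (U : Set I)
    (U' : Set J) (hU : ∀ i, i ∈ U ↔ e i ∈ U') (b : ∀ i, (A.obj (Z i)).El)
    (b' : ∀ j, (A.obj (Z' j)).El) (hb : ∀ i, b' (e i) = A.mapEl (h i) (b i)) {N n : ℤ}
    (hd : N + ∑ i, (b i).deg = n + 1) (hd' : N + ∑ i, (b' i).deg = n + 1)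
    (z : Tens (M.obj (Option {i // i ∉ U})) (C.obj {i // i ∈ U}) N) :
    twTerm κ μ φ' b' U' hd' (tmap (fun _ => M.map (Equiv.optionCongr
        (e.subtypeEquiv (q := fun j => j ∉ U') fun i => not_congr (hU i))))
      (fun _ => C.map (e.subtypeEquiv hU)) z)
      = sg k (inv e fun i => (b i).deg) • twTerm κ μ φ b U hd z := by
  classical
  have hdeg : ∀ j, (b' (e j)).deg = (b j).deg := fun j => by rw [hb]; rfl
  refine LinearMap.congr_fun (f := twTerm κ μ φ' b' U' hd' ∘ₗ tmap
      (fun _ => M.map (Equiv.optionCongr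
        (e.subtypeEquiv (q := fun j => j ∉ U') fun i => not_congr (hU i))))
      (fun _ => C.map (e.subtypeEquiv hU)))
    (g := sg k (inv e fun i => (b i).deg) • twTerm κ μ φ b U hd)
    (tens_ext fun p c hpc β γ => ?_) z
  have hD : c + degOn U (fun i => (b i).deg) = (c - 1 + degOn U (fun i => (b i).deg)) + 1 := by
    omega
  have s' : degOn U' (fun i => (b' i).deg) = degOn U (fun i => (b i).deg) := by
    unfold degOn
    rw [← Equiv.sum_comp (e.subtypeEquiv hU)]
    exact Finset.sum_congr rfl fun i _ => hdeg i.1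
  have hS : p + (c - 1 + degOn U (fun i => (b i).deg) + ∑ j : {i // i ∉ U'}, (b' j.1).deg) = n := by
    have h1 := degOn_compl U' fun i => (b' i).deg
    omega
  rw [LinearMap.comp_apply, tmap_tmk, LinearMap.smul_apply,
    twTerm_tmk κ μ φ' b' U' hd' hpc _ _ (D := c - 1 + degOn U (fun i => (b i).deg))
      (by rw [s']; exact hD) hS,
    twTerm_tmk κ μ φ b U hd hpc β γ hD (tw_deg U hd hpc),
    twAct_move κ μ e h U U' hU b b' hb γ hD, twSym_smul,
    twSym_move φ φ' e h hφ U U' hU b b' hb β _ (tw_deg U hd hpc)]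
  rw [smul_smul, smul_smul, smul_smul, ← sg_add, ← sg_add, ← sg_add]
  refine congrArg (· • _) (sg_congr ?_)
  have key := inv_split e U U' hU (fun i => (b i).deg) (fun j => (b' j).deg) hdeg
  have gen : ∀ {a x y z u v : ℤ}, Even (x + y + z - (u + v)) → Even (a + x + y + z - (u + (a + v))) := by
    intro a x y z u v hh
    have : a + x + y + z - (u + (a + v)) = x + y + z - (u + v) := by ring
    rwa [this]
  exact gen key

theorem twVal_move {J : Type} [Fintype J] [LinearOrder J] {Z' : J → Type} [∀ j, Finite (Z' j)]
    (Δ : Coaction M C) (κ : Twist C O) (μ : (comp O A).Hom A)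
    (φ : (Σ i, Z i) ≃ X) (φ' : (Σ i, Z' i) ≃ X) (e : I ≃ J) (h : ∀ i, Z i ≃ Z' (e i))
    (hφ : ∀ i z, φ' ⟨e i, h i z⟩ = φ ⟨i, z⟩) (U : Set I)
    (U' : Set J) (hU : ∀ i, i ∈ U ↔ e i ∈ U') (m : (M.obj I).El) (m' : (M.obj J).El)
    (hm : m' = M.mapEl e m) (b : ∀ i, (A.obj (Z i)).El)
    (b' : ∀ j, (A.obj (Z' j)).El) (hb : ∀ i, b' (e i) = A.mapEl (h i) (b i)) {n : ℤ}
    (hd : m.deg + ∑ i, (b i).deg = n + 1) (hd' : m'.deg + ∑ i, (b' i).deg = n + 1) :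
    twVal Δ κ μ φ' m' b' hd' U'
      = sg k (inv e fun i => (b i).deg) • twVal Δ κ μ φ m b hd U := by
  subst hm
  have h2 : M.map (splitEquiv U') (M.map e m.val) = M.map (Equiv.sumCongr
      (e.subtypeEquiv (q := fun j => j ∉ U') fun i => not_congr (hU i)) (e.subtypeEquiv hU))
      (M.map (splitEquiv U) m.val) := by
    rw [← M.map_trans, ← M.map_trans]
    refine congrArg (fun e => M.map e m.val) ?_
    refine Equiv.ext fun i => (splitEquiv U').symm.injective ?_
    obtain ⟨i, rfl⟩ := (splitEquiv U).symm.surjective i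
    rw [Equiv.trans_apply, Equiv.trans_apply, Equiv.symm_apply_apply, Equiv.apply_symm_apply]
    rcases i with i | i <;> rfl
  refine (congrArg (twTerm κ μ φ' b' U' hd') ((congrArg (Δ.δ _ _ _) h2).trans
    (Δ.nat _ _ _))).trans ?_
  exact twTerm_move κ μ φ φ' e h hφ U U' hU b b' hb hd hd' _

theorem twTerm_map {Y : Type} (κ : Twist C O) (μ : (comp O A).Hom A) (φ : (Σ i, Z i) ≃ X)
    (e : X ≃ Y) (b : ∀ i, (A.obj (Z i)).El) (U : Set I) {N n : ℤ}
    (hN : N + ∑ i, (b i).deg = n + 1)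
    (z : Tens (M.obj (Option {i // i ∉ U})) (C.obj {i // i ∈ U}) N) :
    twTerm κ μ (φ.trans e) b U hN z = CompMod.map e (twTerm κ μ φ b U hN z) := by
  refine LinearMap.congr_fun (g := CompMod.map e ∘ₗ twTerm κ μ φ b U hN)
    (tens_ext fun p c hpc β γ => ?_) z
  have hD : c + degOn U (fun i => (b i).deg) = (c - 1 + degOn U (fun i => (b i).deg)) + 1 := by
    omega
  rw [LinearMap.comp_apply, twTerm_tmk κ μ φ b U hN hpc β γ hD (tw_deg U hN hpc),
    twTerm_tmk κ μ (φ.trans e) b U hN hpc β γ hD (tw_deg U hN hpc), map_smul, CompMod.map_mk]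
  rfl

/-- The twisting term `d_κ` of the differential of the twisted composition product:
`M ∘ A → (M ∘₁ C) ∘ A → (M ∘₁ O) ∘ A → M ∘ A`. -/
def dTw (Δ : Coaction M C) (κ : Twist C O) (μ : (comp O A).Hom A) {X : Type} {n m : ℤ}
    (h : m + 1 = n) : CompMod M A X n →ₗ[k] CompMod M A X m :=
  CompMod.lift (fun s => ∑ U : Set s.I, twVal Δ κ μ s.φ s.a s.b (s.deg.trans h.symm) U)
    (by
      rintro e _ _ _ ⟨φ, p, x, y, b, hd⟩
      rw [Finset.smul_sum]
      refine Eq.trans ?_ Finset.sum_add_distrib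
      exact Finset.sum_congr rfl fun U _ => twVal_linA Δ κ μ φ e x y b (hd.trans h.symm) U)
    (by
      rintro e _ _ _ ⟨φ, a, b, b', b'', i, q, x, y, hb, hb', hb'', h', h'', hd, hd', hd''⟩
      rw [Finset.smul_sum]
      refine Eq.trans ?_ Finset.sum_add_distrib
      exact Finset.sum_congr rfl fun U _ => twVal_linB Δ κ μ φ e a b b' b'' i q x y hb hb' hb'' h' h''
        (hd.trans h.symm) (hd'.trans h.symm) (hd''.trans h.symm) U)
    (by
      rintro s t ⟨e, g, hφ, ha, hb⟩
      rw [Finset.smul_sum, ← Equiv.sum_comp (Equiv.Set.congr e)]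
      refine Finset.sum_congr rfl fun U _ => ?_
      refine twVal_move Δ κ μ s.φ t.φ e g hφ U (e '' U) (fun i => ?_) s.a t.a ha s.b t.b hb _ _
      exact (e.injective.mem_set_image).symm)

theorem dTw_mk (Δ : Coaction M C) (κ : Twist C O) (μ : (comp O A).Hom A) {X : Type} {n m : ℤ}
    (h : m + 1 = n) (s : Sym M A X n) : dTw Δ κ μ h (CompMod.mk s)
      = ∑ U : Set s.I, twVal Δ κ μ s.φ s.a s.b (s.deg.trans h.symm) U :=
  CompMod.lift_mk _ _ _ _ s

/-- The twisted composition product `M ∘_κ A` of a right comodule and an `𝕊`-module-algebra. -/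
def twisted (Δ : Coaction M C) (κ : Twist C O) (μ : (comp O A).Hom A) : SMod.{max 1 u v' w} k where
  obj X _ := { C := CompMod M A X, d := fun h => CompMod.d h + dTw Δ κ μ h }
  map e := CompMod.map e
  map_refl x := (comp M A).map_refl x
  map_trans e f _ x := (comp M A).map_trans e f x
  map_d {X Y} _ _ e i j h x := by
    refine (map_add _ _ _).trans (congrArg₂ _ ((comp M A).map_d e h x) ?_)
    refine LinearMap.congr_fun (f := CompMod.map e ∘ₗ dTw Δ κ μ h)
      (g := dTw Δ κ μ h ∘ₗ CompMod.map e) (CompMod.hom_ext fun s => ?_) x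
    rw [LinearMap.comp_apply, LinearMap.comp_apply, CompMod.map_mk, dTw_mk, dTw_mk, map_sum]
    exact Finset.sum_congr rfl fun U _ => (twTerm_map κ μ s.φ e s.b U _ _).symm

end Twisted

/-! ### Koszul operads and the bar complex -/

/-- The `n`-th homology of a graded module with `d` (for `d² = 0`). -/
abbrev GrMod.homology (M : GrMod.{u} k) (n : ℤ) : Type u :=
  LinearMap.ker (M.d (sub_add_cancel n 1)) ⧸
    (LinearMap.range (M.d (show n + 1 = n + 1 from rfl))).comap
      (LinearMap.ker (M.d (sub_add_cancel n 1))).subtype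

namespace QuadData

variable (q : QuadData.{u} k)

/-- The Koszul complex `C ∘_κ O`. -/
def koszulComplex : SMod.{max 1 u w} k := twisted q.coself q.twist q.operad.self.act

/-- The bar complex `B(A) = C ∘_κ A` of an algebra over the operad `O`. -/
def bar (A : SAlg.{max 1 u w, v} q.operad) : SMod.{max 1 u v w} k :=
  twisted q.coself q.twist A.act

end QuadData

namespace QuadData

variable (q : QuadData.{u} k)

/-- The quadratic operad is Koszul: the Koszul complex `C ∘_κ O` is quasi-isomorphic to `I`. (As
`I` is one-dimensional and is the part of weight `0` of the Koszul complex, it does not matter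
which maps induce the isomorphisms.) -/
def IsKoszul : Prop := ∀ (X : Type) [Finite X] (n : ℤ),
  Nonempty ((q.koszulComplex.obj X).homology n ≃ₗ[k] (unitS.{0} k).obj X n)

end QuadData

end KoszulBar

end

noncomputable section

namespace KoszulBar

variable {k : Type w} [Field k]


/-! Write `C` and `D` for the two dual cooperads, `g : C → D` for the induced map, `κ` and `κ'` for
the twisting morphisms.

In part 1 both sides have the underlying `𝕊`-module `C ∘ A`, and the isomorphism is the identity on
it. The untwisted differentials agree, so only the twisting terms have to be compared. On the left a
piece `γ ∈ C` is cut off and `f(κ(γ))` acts on elements of `A`; on the right the same piece is cut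
off and `κ'(g(γ))` acts. The two agree because `κ' g = f κ` (`QuadData.Hom.kappa_dualHom`): both
composites vanish outside weight one, where both are `sV ≅ V → V'`. The passage from this square to
the twisting terms is `twVal_hom`, packaged in `twistedIso`.

For part 2 an isomorphism of comodules over the identity of `D` induces an isomorphism of twisted
composites, again by `twistedIso`. It remains to identify `(B ∘ D) ∘_κ' A` with `B ∘ (D ∘_κ' A)`
(`assocIso`). The map is the associativity of the composition product: `((β; y_j); b_i) ↦ ± (β;
(y_j; b_i with ρ i = j))`, where `ρ` sends the index of a factor `b_i` to the index of the factor
`y_j` on which it sits. The coaction of the free comodule `B ∘ D` cuts a single factor `y_l`, and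
the piece cut off carries only factors `b_i` with `ρ i = l`. So the twisting term on the left is the
sum over `l` of the twisting term inside block `l` (`assocMap_dTw`), which is what the differential
of `B ∘ (D ∘_κ' A)` contributes besides the internal differentials of `β`, `y_j` and `b_i`; those
match one by one (`assocMap_d`).

Two things need care. First, the composition product is given by generators and relations. The
associativity map is built from two nested lifts, but its inverse must be defined on generators `(β;
x_j)` of `B ∘ (D ∘ A)` whose entries `x_j` are classes themselves. For this a function on tuples of
generators has to descend to a multilinear map on a product of quotients
(`CompMod.exists_multilinear`). Injectivity follows from the left inverse, surjectivity from the
fact that generators with generators as entries are hit.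

Second, the signs. The exponent `assocSgn` counts the degrees exchanged when each `b_i` is moved
behind its `y_j`. Compatibility with relabelling is `assocSgn_move`; with the differential of `y_l`
and of `b_i` it is `assocSgn_dY` and `assocSgn_dc`; with the merging of factors by `κ'` it is
`assocSgn_merge`. All are congruences modulo two between sums over pairs of factors, reduced to the
relative orders of a fixed pair. -/

/-! ### Multilinear maps out of products of quotients of free modules -/

section Multilinear

variable {J : Type} [Finite J] {V : Type*} [AddCommGroup V] [Module k V]

/-- Tuples of basis vectors are a basis of the tensor product of the free modules, so the values on
them are arbitrary. Each tuple contributes the product of the coordinates times its value. -/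
theorem exists_multilinear_finsupp {S : J → Type*} (f : (∀ j, S j) → V) :
    ∃ F : MultilinearMap k (fun j => S j →₀ k) V,
      ∀ s : ∀ j, S j, F (fun j => Finsupp.single (s j) 1) = f s := by
  classical
  have := Fintype.ofFinite J
  refine ⟨(MultilinearMap.fromDFinsuppEquiv S k
    (fun p => MultilinearMap.mkPiRing k J (f p))).compLinearMap
      fun j => (finsuppLequivDFinsupp k).toLinearMap, fun s => ?_⟩
  rw [MultilinearMap.compLinearMap_apply]
  have h : (fun j => (finsuppLequivDFinsupp k).toLinearMap (Finsupp.single (s j) (1 : k)))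
      = fun j => DFinsupp.single (s j) (1 : k) := by
    funext j
    simp
  refine (congrArg _ h).trans ?_
  rw [MultilinearMap.fromDFinsuppEquiv_single]
  simp

/-- With `r` fixed in the slot `j₀`, the map is multilinear in the other slots, so basis vectors
suffice to test its vanishing there. -/
theorem multilinear_finsupp_eq_zero {S : J → Type*} [DecidableEq J]
    (F : MultilinearMap k (fun j => S j →₀ k) V)
    (j₀ : J) (r : S j₀ →₀ k)
    (h : ∀ s : ∀ j, S j, F (Function.update (fun j => Finsupp.single (s j) 1) j₀ r) = 0)
    (x : ∀ j, S j →₀ k) (s₀ : S j₀) : F (Function.update x j₀ r) = 0 := by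
  -- In the slot `j₀` every basis vector is sent to `r`. Thus `F` precomposed with `l` is
  -- multilinear in all slots, and `s₀` serves only as a point where this slot takes the value `r`.
  let l : ∀ j, (S j →₀ k) →ₗ[k] (S j →₀ k) := Function.update (fun _ => LinearMap.id) j₀
    (Finsupp.linearCombination k fun _ => r)
  have hl : ∀ (x : ∀ j, S j →₀ k), (Finsupp.linearCombination k fun _ => r) (x j₀) = r →
      (fun j => l j (x j)) = Function.update x j₀ r := by
    intro x hx
    funext j
    by_cases hj : j = j₀
    · subst hj
      simpa [l] using hx
    · simp [l, hj]
  have h0 : F.compLinearMap l = 0 := by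
    refine Module.Basis.ext_multilinear (fun j => Finsupp.basisSingleOne) fun s => ?_
    rw [MultilinearMap.compLinearMap_apply, zero_apply]
    simp only [Finsupp.coe_basisSingleOne]
    rw [hl (fun j => Finsupp.single (s j) 1) (by simp)]
    exact h s
  have h1 := congrArg (fun G => G (Function.update x j₀ (Finsupp.single s₀ 1))) h0
  simp only [MultilinearMap.compLinearMap_apply, zero_apply] at h1
  rw [hl _ (by simp)] at h1
  simpa using h1

/-- Congruent tuples have equal values, so the value on classes can be computed from any choice of
representatives. -/
theorem MultilinearMap.exists_descent {M : J → Type*} [∀ j, AddCommGroup (M j)]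
    [∀ j, Module k (M j)] (N : ∀ j, Submodule k (M j)) (F : MultilinearMap k M V)
    (h : ∀ j (x : ∀ j, M j), x j ∈ N j → F x = 0) :
    ∃ G : MultilinearMap k (fun j => M j ⧸ N j) V,
      ∀ x : ∀ j, M j, G (fun j => (N j).mkQ (x j)) = F x := by
  classical
  have := Fintype.ofFinite J
  -- The entries of `y` are replaced by those of `x` one at a time; each replacement changes the
  -- value by one with an entry in `N j`.
  have hc : ∀ x y : ∀ j, M j, (∀ j, (N j).mkQ (x j) = (N j).mkQ (y j)) → F x = F y := by
    intro x y hxy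
    have : ∀ s : Finset J, F (s.piecewise x y) = F y := by
      intro s
      induction s using Finset.induction_on with
      | empty => simp
      | insert j s hj ih =>
        rw [Finset.piecewise_insert, ← ih, ← sub_eq_zero]
        have h1 : s.piecewise x y = Function.update (s.piecewise x y) j (y j) := by
          rw [Function.eq_update_iff]
          simp [hj]
        nth_rewrite 2 [h1]
        rw [← MultilinearMap.map_update_sub]
        refine h j _ ?_
        rw [Function.update_self]
        exact (Submodule.Quotient.eq _).1 (hxy j)
    simpa using this Finset.univ
  let out : ∀ j, M j ⧸ N j → M j := fun j => Function.surjInv (N j).mkQ_surjective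
  have hout : ∀ j x, (N j).mkQ (out j x) = x := fun j => Function.surjInv_eq (N j).mkQ_surjective
  refine ⟨{
    toFun := fun x => F fun j => out j (x j)
    map_update_add' := fun x j a b => ?_
    map_update_smul' := fun x j c a => ?_ }, fun x => hc _ _ fun j => hout j _⟩
  · have hu : ∀ a, F (fun i => out i (Function.update x j a i))
        = F (Function.update (fun i => out i (x i)) j (out j a)) := fun a => by
      congr 1
      funext i
      by_cases hi : i = j
      · subst hi; simp
      · simp [hi]
    convert_to F (fun i => out i (Function.update x j (a + b) i))
      = F (fun i => out i (Function.update x j a i)) + F (fun i => out i (Function.update x j b i))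
    rw [hu, hu, hu, ← MultilinearMap.map_update_add]
    refine hc _ _ fun i => ?_
    by_cases hi : i = j
    · subst hi; simp only [Function.update_self, map_add, hout]
    · simp [hi]
  · have hu : ∀ a, F (fun i => out i (Function.update x j a i))
        = F (Function.update (fun i => out i (x i)) j (out j a)) := fun a => by
      congr 1
      funext i
      by_cases hi : i = j
      · subst hi; simp
      · simp [hi]
    convert_to F (fun i => out i (Function.update x j (c • a) i))
      = c • F (fun i => out i (Function.update x j a i))
    rw [hu, hu, ← MultilinearMap.map_update_smul]
    refine hc _ _ fun i => ?_
    by_cases hi : i = j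
    · subst hi; simp only [Function.update_self, map_smul, hout]
    · simp [hi]

variable {D : SMod.{u} k} {A : SMod.{v} k} {W : J → Type} {q : J → ℤ}

/-- Multilinear maps out of a product of composition products. -/
theorem CompMod.exists_multilinear (f : (∀ j, Sym D A (W j) (q j)) → V)
    (hA : ∀ (j₀ : J) (c : k) (s s' t : ∀ j, Sym D A (W j) (q j)), (∀ j, j ≠ j₀ → s' j = s j) →
      (∀ j, j ≠ j₀ → t j = s j) → Sym.LinA c (s j₀) (s' j₀) (t j₀) → f t = f s + c • f s')
    (hB : ∀ (j₀ : J) (c : k) (s s' t : ∀ j, Sym D A (W j) (q j)), (∀ j, j ≠ j₀ → s' j = s j) →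
      (∀ j, j ≠ j₀ → t j = s j) → Sym.LinB c (s j₀) (s' j₀) (t j₀) → f t = f s + c • f s')
    (hM : ∀ (j₀ : J) (s t : ∀ j, Sym D A (W j) (q j)), (∀ j, j ≠ j₀ → t j = s j) →
      ∀ m : Sym.Move (s j₀) (t j₀), f t = sg k (inv m.e fun i => ((s j₀).b i).deg) • f s) :
    ∃ G : MultilinearMap k (fun j => CompMod D A (W j) (q j)) V,
      ∀ s : ∀ j, Sym D A (W j) (q j), G (fun j => CompMod.mk (s j)) = f s := by
  classical
  obtain ⟨F, hF⟩ := exists_multilinear_finsupp (k := k) f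
  have hS : ∀ (j₀ : J) (s : ∀ j, Sym D A (W j) (q j)) (t : Sym D A (W j₀) (q j₀)),
      F (Function.update (fun j => Finsupp.single (s j) 1) j₀ (Finsupp.single t 1))
        = f (Function.update s j₀ t) := by
    intro j₀ s t
    rw [← hF]
    congr 1
    funext j
    by_cases hj : j = j₀
    · subst hj; simp
    · simp [hj]
  have hne : ∀ (j₀ : J) (s : ∀ j, Sym D A (W j) (q j)) (t t' : Sym D A (W j₀) (q j₀)),
      ∀ j, j ≠ j₀ → Function.update s j₀ t j = Function.update s j₀ t' j := by
    intro j₀ s t t' j hj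
    rw [Function.update_of_ne hj, Function.update_of_ne hj]
  have h1 : ∀ (c : k) {S : Type _} (s : S), Finsupp.single s c = c • Finsupp.single s (1 : k) := by
    intro c S s; simp
  have hlin : ∀ (j₀ : J) (s : ∀ j, Sym D A (W j) (q j)) (t t' t'' : Sym D A (W j₀) (q j₀)) (c : k),
      f (Function.update s j₀ t'') = f (Function.update s j₀ t) + c • f (Function.update s j₀ t') →
      F (Function.update (fun j => Finsupp.single (s j) 1) j₀
        (Finsupp.single t'' 1 - Finsupp.single t 1 - Finsupp.single t' c)) = 0 := by
    intro j₀ s t t' t'' c h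
    rw [h1 c t', MultilinearMap.map_update_sub, MultilinearMap.map_update_sub,
      MultilinearMap.map_update_smul, hS, hS, hS, h]
    abel
  refine MultilinearMap.exists_descent
    (fun j => Submodule.span k {r | Sym.Rel (A := D) (B := A) (X := W j) (n := q j) r}) F ?_ |>.imp
    fun G hG s => (hG fun j => Finsupp.single (s j) 1).trans (hF s)
  intro j₀ x hx
  -- The entry at `j₀` is separated from the others, so that induction over the span of the
  -- relations applies to it alone.
  rw [← Function.update_eq_self j₀ x]
  generalize x j₀ = y at hx
  induction hx using Submodule.span_induction with
  | zero => exact F.map_update_zero _ _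
  | add a b _ _ ha hb => rw [MultilinearMap.map_update_add, ha, hb, add_zero]
  | smul c a _ ha => rw [MultilinearMap.map_update_smul, ha, smul_zero]
  | mem r hr =>
    obtain ⟨c, s, s', t, h⟩ | ⟨c, s, s', t, h⟩ | ⟨s, t, m⟩ := hr
    · refine multilinear_finsupp_eq_zero F j₀ _ (fun σ => hlin j₀ σ s s' t c ?_) x s
      exact hA j₀ c _ _ _ (hne j₀ σ _ _) (hne j₀ σ _ _) (by simpa using h)
    · refine multilinear_finsupp_eq_zero F j₀ _ (fun σ => hlin j₀ σ s s' t c ?_) x s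
      exact hB j₀ c _ _ _ (hne j₀ σ _ _) (hne j₀ σ _ _) (by simpa using h)
    · refine multilinear_finsupp_eq_zero F j₀ _ (fun σ => ?_) x s
      rw [h1 _ s, MultilinearMap.map_update_sub, MultilinearMap.map_update_smul, hS, hS, sub_eq_zero]
      -- A `Move` is data depending on its endpoints, so it has to be transported to the updated
      -- families without changing its sign.
      have key : ∀ (s₁ t₁ : Sym D A (W j₀) (q j₀)), s₁ = s → t₁ = t → ∃ m' : Sym.Move s₁ t₁,
          sg k (inv m'.e fun i => (s₁.b i).deg) = sg k (inv m.e fun i => (s.b i).deg) := by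
        rintro _ _ rfl rfl; exact ⟨m, rfl⟩
      obtain ⟨m', hm'⟩ := key (Function.update σ j₀ s j₀) (Function.update σ j₀ t j₀)
        (Function.update_self ..) (Function.update_self ..)
      rw [← hm']
      exact hM j₀ _ _ (hne j₀ σ _ _) m'

/-- After composition with the quotient maps in all slots this is the statement for free modules,
where basis vectors suffice. -/
theorem CompMod.multilinear_ext {F G : MultilinearMap k (fun j => CompMod D A (W j) (q j)) V}
    (h : ∀ s : ∀ j, Sym D A (W j) (q j),
      F (fun j => CompMod.mk (s j)) = G (fun j => CompMod.mk (s j))) : F = G := by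
  have h1 : F.compLinearMap (fun j => CompMod.proj) = G.compLinearMap fun j => CompMod.proj := by
    refine Module.Basis.ext_multilinear (fun j => Finsupp.basisSingleOne) fun s => ?_
    simp only [MultilinearMap.compLinearMap_apply, Finsupp.coe_basisSingleOne]
    exact h s
  ext x
  obtain ⟨y, rfl⟩ : ∃ y : ∀ j, Sym D A (W j) (q j) →₀ k, x = fun j => CompMod.proj (y j) := by
    choose y hy using fun j => Submodule.mkQ_surjective _ (x j)
    exact ⟨y, funext fun j => (hy j).symm⟩
  exact congrArg (fun H => H y) h1

end Multilinear

/-! ### Signs -/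

section Signs

/-- Reduces the parity of a double sum to unordered pairs: an entry and its transpose are counted
together, the diagonal separately. -/
theorem even_sum_sum {I : Type} [Fintype I] [LinearOrder I] (g : I → I → ℤ)
    (h : ∀ i j, i < j → Even (g i j + g j i)) (h0 : ∀ i, Even (g i i)) :
    Even (∑ i, ∑ j, g i j) := by
  have h1 : ∑ i, ∑ j, g i j = (∑ i, ∑ j, if i < j then g i j + g j i else 0) + ∑ i, g i i := by
    have h2 : ∀ i j, g i j = (if i < j then g i j else 0) + (if j < i then g i j else 0)
        + if i = j then g i j else 0 := by
      intro i j
      rcases lt_trichotomy i j with hij | rfl | hij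
      · simp [hij, hij.not_gt, hij.ne]
      · simp
      · simp [hij, hij.not_gt, hij.ne']
    have h3 : ∑ i, ∑ j, g i j = (∑ i, ∑ j, if i < j then g i j else 0)
        + (∑ i, ∑ j, if j < i then g i j else 0) + ∑ i, ∑ j, if i = j then g i j else 0 := by
      simp only [← Finset.sum_add_distrib, ← h2]
    have h4 : ∀ i j, (if i < j then g i j + g j i else 0)
        = (if i < j then g i j else 0) + if i < j then g j i else 0 := by
      intro i j
      split_ifs <;> rfl
    rw [h3, Finset.sum_comm (f := fun i j => if j < i then g i j else 0)]
    simp only [Finset.sum_ite_eq, Finset.mem_univ, if_true, h4, Finset.sum_add_distrib]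
  rw [h1]
  refine (Finset.even_sum _ fun i _ => Finset.even_sum _ fun j _ => ?_).add
    (Finset.even_sum _ fun i _ => h0 i)
  split_ifs with hij
  · exact h i j hij
  · exact Even.zero

variable {I J : Type} [Fintype I] [LinearOrder I] [Fintype J] [LinearOrder J]

/-- The exponent of the sign of the rearrangement of `y_j, …, c_i, …` in which the factors `c_i`
with `ρ i = j` are moved directly behind `y_j`. -/
def assocSgn (ρ : I → J) (Y : J → ℤ) (c : I → ℤ) : ℤ :=
  (∑ i, ∑ i', if i < i' ∧ ρ i' < ρ i then c i * c i' else 0)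
    + ∑ j, ∑ i, if ρ i < j then Y j * c i else 0

/-- Used to turn sums over blocks into sums over all factors, with the weight pulled back along `ρ`.
-/
theorem sum_fibre (ρ : I → J) (c : I → ℤ) (w : J → ℤ) :
    ∑ j, w j * ∑ i : {i // ρ i = j}, c i.1 = ∑ i, w (ρ i) * c i := by
  have h : ∀ j, w j * ∑ i : {i // ρ i = j}, c i.1 = ∑ i, if ρ i = j then w (ρ i) * c i else 0 := by
    intro j
    rw [sum_sub_ite (fun i => ρ i = j) c, Finset.mul_sum]
    refine Finset.sum_congr rfl fun i _ => ?_
    split_ifs with hij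
    · rw [hij]
    · rw [mul_zero]
  simp only [h]
  rw [Finset.sum_comm]
  simp

theorem sum_fibre_one (ρ : I → J) (c : I → ℤ) :
    ∑ j, ∑ i : {i // ρ i = j}, c i.1 = ∑ i, c i := by
  have := sum_fibre ρ c fun _ => 1
  simpa only [one_mul] using this

/-- A block has the degree of `y_j` plus the degrees of its `b_i`. Bilinearity splits the inversions
of blocks into inversions among the `y`, among the `b` of different blocks, and the two kinds of
mixed ones. -/
theorem inv_add_fibre {J' : Type} [LinearOrder J'] (e : J ≃ J') (ρ : I → J) (Y : J → ℤ)
    (c : I → ℤ) :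
    inv e (fun j => Y j + ∑ i : {i // ρ i = j}, c i.1) = inv e Y
      + (∑ i, ∑ i', if ρ i < ρ i' ∧ e (ρ i') < e (ρ i) then c i * c i' else 0)
      + (∑ j, ∑ i, if j < ρ i ∧ e (ρ i) < e j then Y j * c i else 0)
      + ∑ j, ∑ i, if ρ i < j ∧ e j < e (ρ i) then Y j * c i else 0 := by
  have h1 : inv e (fun j => Y j + ∑ i : {i // ρ i = j}, c i.1) = inv e Y
      + (∑ j, (∑ j', (if j < j' ∧ e j' < e j then 1 else 0) * ∑ i : {i // ρ i = j'}, c i.1)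
        * ∑ i : {i // ρ i = j}, c i.1)
      + (∑ j, ∑ j', (if j < j' ∧ e j' < e j then Y j else 0) * ∑ i : {i // ρ i = j'}, c i.1)
      + ∑ j, ∑ j', (if j' < j ∧ e j < e j' then Y j else 0) * ∑ i : {i // ρ i = j'}, c i.1 := by
    rw [Finset.sum_comm (f := fun j j' => (if j' < j ∧ e j < e j' then Y j else 0)
      * ∑ i : {i // ρ i = j'}, c i.1)]
    unfold inv
    simp only [Finset.sum_mul, ← Finset.sum_add_distrib]
    refine Finset.sum_congr rfl fun j _ => Finset.sum_congr rfl fun j' _ => ?_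
    split_ifs <;> ring
  rw [h1, sum_fibre ρ c fun j => ∑ j', (if j < j' ∧ e j' < e j then 1 else 0)
    * ∑ i : {i // ρ i = j'}, c i.1]
  have h2 : ∀ j, ∑ j', (if j < j' ∧ e j' < e j then 1 else 0) * ∑ i : {i // ρ i = j'}, c i.1
      = ∑ i, (if j < ρ i ∧ e (ρ i) < e j then 1 else 0) * c i := fun j =>
    sum_fibre ρ c fun j' => if j < j' ∧ e j' < e j then 1 else 0
  have h3 : ∀ j, ∑ j', (if j < j' ∧ e j' < e j then Y j else 0) * ∑ i : {i // ρ i = j'}, c i.1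
      = ∑ i, (if j < ρ i ∧ e (ρ i) < e j then Y j else 0) * c i := fun j =>
    sum_fibre ρ c fun j' => if j < j' ∧ e j' < e j then Y j else 0
  have h4 : ∀ j, ∑ j', (if j' < j ∧ e j < e j' then Y j else 0) * ∑ i : {i // ρ i = j'}, c i.1
      = ∑ i, (if ρ i < j ∧ e j < e (ρ i) then Y j else 0) * c i := fun j =>
    sum_fibre ρ c fun j' => if j' < j ∧ e j < e j' then Y j else 0
  simp only [h2, h3, h4]
  simp only [ite_mul, zero_mul, one_mul, Finset.sum_mul, mul_comm (c _) (c _)]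

/-- The inversions inside the blocks are the inversions of `g` between factors with the same image
under `ρ`. -/
theorem sum_inv_fibre {I' J' : Type} [LinearOrder I'] (ρ : I → J) (ρ' : I' → J') (g : I ≃ I')
    (e : J ≃ J') (h : ∀ i, ρ' (g i) = e (ρ i)) (c : I → ℤ) :
    ∑ j, inv (fibCongr ρ ρ' g e h j) (fun i => c i.1)
      = ∑ i, ∑ i', if ρ i = ρ i' ∧ i < i' ∧ g i' < g i then c i * c i' else 0 := by
  have h1 : ∀ j, inv (fibCongr ρ ρ' g e h j) (fun i => c i.1)
      = ∑ i, ∑ i', if ρ i = j ∧ ρ i' = j ∧ i < i' ∧ g i' < g i then c i * c i' else 0 := fun j =>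
    inv_sub g (fun i => ρ i = j) (fun i => ρ' i = e j) _ c
  simp only [h1]
  rw [Finset.sum_comm]
  refine Finset.sum_congr rfl fun i _ => ?_
  rw [Finset.sum_comm]
  refine Finset.sum_congr rfl fun i' _ => ?_
  simp only [ite_and, Finset.sum_ite_eq, Finset.mem_univ, if_true, eq_comm (a := ρ i')]

/-- Relabelling the list and then grouping it, or grouping it and then permuting the blocks and the
factors inside each block, produces the same arrangement, so the Koszul signs agree. The inversions
among the `y` cancel; the rest is checked for each pair. -/
theorem assocSgn_move {I' J' : Type} [Fintype I'] [LinearOrder I'] [Fintype J'] [LinearOrder J']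
    (ρ : I → J) (ρ' : I' → J') (g : I ≃ I') (e : J ≃ J') (h : ∀ i, ρ' (g i) = e (ρ i))
    (Y : J → ℤ) (Y' : J' → ℤ) (hY : ∀ j, Y' (e j) = Y j) (c : I → ℤ) (c' : I' → ℤ)
    (hc : ∀ i, c' (g i) = c i) :
    Even (assocSgn ρ' Y' c' + (inv e (fun j => Y j + ∑ i : {i // ρ i = j}, c i.1)
      + ∑ j, inv (fibCongr ρ ρ' g e h j) (fun i => c i.1))
      - (inv e Y + inv g c + assocSgn ρ Y c)) := by
  have h1 : assocSgn ρ' Y' c' = (∑ i, ∑ i', if g i < g i' ∧ e (ρ i') < e (ρ i) then c i * c i' else 0)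
      + ∑ j, ∑ i, if e (ρ i) < e j then Y j * c i else 0 := by
    unfold assocSgn
    simp only [← Equiv.sum_comp e, ← Equiv.sum_comp g, h, hY, hc]
  rw [h1, inv_add_fibre, sum_inv_fibre]
  -- The exchanges of two factors `b`: the parity depends on the orders of `i, i'`, of `g i, g i'`,
  -- and of their blocks before and after.
  have h2 : Even (∑ i, ∑ i', ((if g i < g i' ∧ e (ρ i') < e (ρ i) then c i * c i' else 0)
      + (if ρ i < ρ i' ∧ e (ρ i') < e (ρ i) then c i * c i' else 0)
      + (if ρ i = ρ i' ∧ i < i' ∧ g i' < g i then c i * c i' else 0)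
      - (if i < i' ∧ g i' < g i then c i * c i' else 0)
      - (if i < i' ∧ ρ i' < ρ i then c i * c i' else 0))) := by
    refine even_sum_sum _ (fun i i' hi => ?_) (fun i => by simp)
    have hg : g i ≠ g i' := fun hh => hi.ne (g.injective hh)
    have he : e (ρ i) = e (ρ i') ↔ ρ i = ρ i' := e.injective.eq_iff
    have hn : Even (-(c i * c i') - c i * c i') := ⟨-(c i * c i'), by ring⟩
    rw [mul_comm (c i') (c i)]
    rcases lt_trichotomy (ρ i) (ρ i') with h4 | h4 | h4
    · rcases lt_or_gt_of_ne (fun hh => h4.ne (he.1 hh)) with h6 | h6 <;>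
      rcases lt_or_gt_of_ne hg with h3 | h3 <;>
      simp [h4, h6, hi, h3, hi.not_gt, h3.not_gt, h4.not_gt, h6.not_gt, h4.ne, h4.ne']
    · rcases lt_or_gt_of_ne hg with h3 | h3 <;> simp [h4, hi, h3, hi.not_gt, h3.not_gt]
    · rcases lt_or_gt_of_ne (fun hh => h4.ne' (he.1 hh)) with h6 | h6 <;>
      rcases lt_or_gt_of_ne hg with h3 | h3 <;>
      simp [h4, h6, hi, h3, hi.not_gt, h3.not_gt, h4.not_gt, h6.not_gt, h4.ne, h4.ne', hn]
  -- The exchanges of a factor `y_j` with a factor `b_i`: only the orders of `ρ i` and `j` before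
  -- and after `e` matter.
  have h3 : Even (∑ j, ∑ i, ((if e (ρ i) < e j then Y j * c i else 0)
      + (if j < ρ i ∧ e (ρ i) < e j then Y j * c i else 0)
      + (if ρ i < j ∧ e j < e (ρ i) then Y j * c i else 0)
      - (if ρ i < j then Y j * c i else 0))) := by
    refine Finset.even_sum _ fun j _ => Finset.even_sum _ fun i _ => ?_
    rcases lt_trichotomy (ρ i) j with h4 | h4 | h4
    · have h5 : e (ρ i) ≠ e j := fun hh => h4.ne (e.injective hh)
      rcases lt_or_gt_of_ne h5 with h6 | h6 <;> simp [h4, h6, h4.not_gt, h6.not_gt]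
    · simp [h4]
    · have h5 : e (ρ i) ≠ e j := fun hh => h4.ne' (e.injective hh)
      rcases lt_or_gt_of_ne h5 with h6 | h6 <;> simp [h4, h6, h4.not_gt, h6.not_gt]
  refine (congrArg Even ?_).mpr (h2.add h3)
  unfold assocSgn
  rw [show inv g c = ∑ i, ∑ i', if i < i' ∧ g i' < g i then c i * c i' else 0 from rfl]
  simp only [Finset.sum_add_distrib, Finset.sum_sub_distrib]
  ring

theorem inv_eq_zero {I' : Type} [LinearOrder I'] (e : I ≃ I')
    (h : ∀ i j, i < j → e i < e j) (q : I → ℤ) : inv e q = 0 :=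
  Finset.sum_eq_zero fun i _ => Finset.sum_eq_zero fun j _ =>
    if_neg fun hij => (h _ _ hij.1).not_gt hij.2

end Signs


/-! ### Generators of `B ∘ (D ∘_κ A)` -/

section Blocks

variable {B : SMod.{u''} k} {D : SMod.{u} k} {O : SMod.{u'} k} {A : SMod.{v'} k}
  (c : Coaction D D) (κ : Twist D O) (μ : (comp O A).Hom A)

section Mul

variable {E : SMod.{v} k} {J : Type} [Fintype J] [LinearOrder J] {W : J → Type}
  [∀ j, Finite (W j)] {X : Type} {n : ℤ}

/-- The class of a generator of `B ∘ E`, as a multilinear map in the elements of `E`. -/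
def mkMul (φ : (Σ j, W j) ≃ X) (β : (B.obj J).El) (q : J → ℤ) (h : β.deg + ∑ j, q j = n) :
    MultilinearMap k (fun j => E.obj (W j) (q j)) (CompMod B E X n) where
  toFun x := CompMod.mk ⟨J, W, φ, β, fun j => ⟨q j, x j⟩, h⟩
  map_update_add' {_} x j a b := by
    have := CompMod.mk_linB (Sym.LinB.mk (c := (1 : k)) (n := n) φ β
      (fun i => (⟨q i, Function.update x j a i⟩ : (E.obj (W i)).El))
      (fun i => ⟨q i, Function.update x j b i⟩) (fun i => ⟨q i, Function.update x j (a + b) i⟩)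
      j (q j) a b (by simp) (by simp) (by simp) (fun i hi => by simp [hi])
      (fun i hi => by simp [hi]) h h h)
    simpa using this
  map_update_smul' {_} x j e a := by
    have h0 : ∀ i, (⟨q i, Function.update x j 0 i⟩ : (E.obj (W i)).El)
        = ⟨q i, Function.update x j (0 + (-1 : k) • 0) i⟩ := fun i => by simp
    -- The linearity relation has the form `x + c • y`, so homogeneity needs the vanishing at a zero
    -- entry first. The relation for `0 = 0 + (-1) • 0` says that the class is its own difference
    -- with itself.
    have hz : CompMod.mk ⟨J, W, φ, β, fun i => ⟨q i, Function.update x j 0 i⟩, h⟩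
        = (0 : CompMod B E X n) := by
      have := CompMod.mk_linB (Sym.LinB.mk (c := (-1 : k)) (n := n) φ β
        (fun i => (⟨q i, Function.update x j 0 i⟩ : (E.obj (W i)).El))
        (fun i => ⟨q i, Function.update x j 0 i⟩) (fun i => ⟨q i, Function.update x j 0 i⟩)
        j (q j) 0 0 (by simp) (by simp) (by simp) (fun i hi => by simp [hi])
        (fun i hi => by simp [hi]) h h h)
      simpa using this
    have := CompMod.mk_linB (Sym.LinB.mk (c := e) (n := n) φ β
      (fun i => (⟨q i, Function.update x j 0 i⟩ : (E.obj (W i)).El))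
      (fun i => ⟨q i, Function.update x j a i⟩) (fun i => ⟨q i, Function.update x j (e • a) i⟩)
      j (q j) 0 a (by simp) (by simp) (by simp) (fun i hi => by simp [hi])
      (fun i hi => by simp [hi]) h h h)
    rw [hz, zero_add] at this
    exact this

theorem sg_sum {I : Type*} (s : Finset I) (f : I → ℤ) :
    sg k (∑ i ∈ s, f i) = ∏ i ∈ s, sg k (f i) := by
  classical
  induction s using Finset.induction_on with
  | empty => simp [sg_zero]
  | insert i s hi ih => rw [Finset.sum_insert hi, Finset.prod_insert hi, sg_add, ih]

end Mul

variable {I J : Type} [Fintype I] [LinearOrder I] [Fintype J] [LinearOrder J] {Z : I → Type}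
  [∀ i, Finite (Z i)] {X : Type} {n : ℤ}

/-- The class of a generator of `D ∘_κ A` as a homogeneous element. -/
def blk (y : (D.obj I).El) (b : ∀ i, (A.obj (Z i)).El) :
    ((twisted c κ μ).obj (Σ i, Z i)).El :=
  ⟨y.deg + ∑ i, (b i).deg, (CompMod.mk ⟨I, Z, Equiv.refl _, y, b, rfl⟩ : CompMod D A _ _)⟩

/-- A homogeneous element carries its degree; this exchanges the built-in degree of a block for an
equal one. -/
theorem blk_eq {y : (D.obj I).El} {b : ∀ i, (A.obj (Z i)).El} (h : y.deg + ∑ i, (b i).deg = n) :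
    blk c κ μ y b = ⟨n, (CompMod.mk ⟨I, Z, Equiv.refl _, y, b, h⟩ : CompMod D A _ n)⟩ := by
  subst h; rfl

/-- This is the equivariance relation inside one block. The sign multiplies the underlying value, as
homogeneous elements with their degrees do not form a module. -/
theorem blk_move {I' : Type} [Fintype I'] [LinearOrder I'] {Z' : I' → Type} [∀ i, Finite (Z' i)]
    (g : I ≃ I') (h : ∀ i, Z i ≃ Z' (g i)) {y : (D.obj I).El} {y' : (D.obj I').El}
    {b : ∀ i, (A.obj (Z i)).El} {b' : ∀ i, (A.obj (Z' i)).El} (hy : y' = D.mapEl g y)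
    (hb : ∀ i, b' (g i) = A.mapEl (h i) (b i)) :
    blk c κ μ y' b' = (twisted c κ μ).mapEl (sigmaEquiv Z Z' g h)
      ⟨(blk c κ μ y b).deg, sg k (inv g fun i => (b i).deg) • (blk c κ μ y b).val⟩ := by
  have hd : y'.deg + ∑ i, (b' i).deg = y.deg + ∑ i, (b i).deg := by
    rw [hy, ← Equiv.sum_comp g]
    simp only [hb]
    rfl
  rw [blk_eq c κ μ hd]
  refine congrArg (GrMod.El.mk _) ?_
  refine Eq.trans ?_ (map_smul _ _ _).symm
  refine Eq.trans ?_ (congrArg _ (CompMod.map_mk _ _).symm)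
  exact CompMod.mk_move (s := Sym.map (sigmaEquiv Z Z' g h) ⟨I, Z, Equiv.refl _, y, b, rfl⟩)
    (t := ⟨I', Z', Equiv.refl _, y', b', hd⟩) ⟨g, h, fun _ _ => rfl, hy, hb⟩

/-- Grouping the parts along a map of index sets. -/
def fibSigma (ρ : I → J) (Z : I → Type) : (Σ j, Σ i : {i // ρ i = j}, Z i.1) ≃ Σ i, Z i where
  toFun x := ⟨x.2.1.1, x.2.2⟩
  invFun x := ⟨ρ x.1, ⟨x.1, rfl⟩, x.2⟩
  left_inv := by rintro ⟨_, ⟨i, rfl⟩, z⟩; rfl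
  right_inv _ := rfl

/-- The generator `(β; (y_j; b_i, i ∈ ρ⁻¹(j)), j ∈ J)` of `B ∘ (D ∘_κ A)`. -/
def asym (φ : (Σ i, Z i) ≃ X) (ρ : I → J) (β : (B.obj J).El)
    (y : ∀ j, (D.obj {i // ρ i = j}).El) (b : ∀ i, (A.obj (Z i)).El)
    (h : β.deg + ∑ j, (y j).deg + ∑ i, (b i).deg = n) : Sym B (twisted c κ μ) X n where
  I := J
  Z j := Σ i : {i // ρ i = j}, Z i.1
  φ := (fibSigma ρ Z).trans φ
  a := β
  b j := blk c κ μ (y j) fun i => b i.1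
  deg := by
    have := sum_fibre_one ρ fun i => (b i).deg
    simp only [blk, Finset.sum_add_distrib, this]
    omega

/-- The class of a generator with its sign. -/
def amk (φ : (Σ i, Z i) ≃ X) (ρ : I → J) (β : (B.obj J).El)
    (y : ∀ j, (D.obj {i // ρ i = j}).El) (b : ∀ i, (A.obj (Z i)).El)
    (h : β.deg + ∑ j, (y j).deg + ∑ i, (b i).deg = n) : CompMod B (twisted c κ μ) X n :=
  sg k (assocSgn ρ (fun j => (y j).deg) fun i => (b i).deg) • CompMod.mk (asym c κ μ φ ρ β y b h)

theorem amk_congr (φ : (Σ i, Z i) ≃ X) (ρ : I → J) {β β' : (B.obj J).El}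
    {y y' : ∀ j, (D.obj {i // ρ i = j}).El} {b b' : ∀ i, (A.obj (Z i)).El} (hβ : β = β')
    (hy : ∀ j, y j = y' j) (hb : ∀ i, b i = b' i) (h h') :
    amk (n := n) c κ μ φ ρ β y b h = amk c κ μ φ ρ β' y' b' h' := by
  obtain rfl := funext hy
  obtain rfl := funext hb
  subst hβ
  rfl

/-- The signed generator transforms under a simultaneous relabelling exactly like `((β; y_j); b_i)`:
one sign for the permutation of the `y`, one for that of the `b`. This makes both nested lifts below
well defined. -/
theorem amk_move {I' J' : Type} [Fintype I'] [LinearOrder I'] [Fintype J'] [LinearOrder J']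
    {Z' : I' → Type} [∀ i, Finite (Z' i)] {φ : (Σ i, Z i) ≃ X} {φ' : (Σ i, Z' i) ≃ X}
    {ρ : I → J} {ρ' : I' → J'} {β : (B.obj J).El} {β' : (B.obj J').El}
    {y : ∀ j, (D.obj {i // ρ i = j}).El} {y' : ∀ j, (D.obj {i // ρ' i = j}).El}
    {b : ∀ i, (A.obj (Z i)).El} {b' : ∀ i, (A.obj (Z' i)).El}
    (g : I ≃ I') (h : ∀ i, Z i ≃ Z' (g i)) (e : J ≃ J') (hρ : ∀ i, ρ' (g i) = e (ρ i))
    (hφ : ∀ i z, φ' ⟨g i, h i z⟩ = φ ⟨i, z⟩) (hβ : β' = B.mapEl e β)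
    (hy : ∀ j, y' (e j) = D.mapEl (fibCongr ρ ρ' g e hρ j) (y j))
    (hb : ∀ i, b' (g i) = A.mapEl (h i) (b i)) (hd hd') :
    amk c κ μ (n := n) φ' ρ' β' y' b' hd' = sg k (inv e fun j => (y j).deg) •
      sg k (inv g fun i => (b i).deg) • amk c κ μ φ ρ β y b hd := by
  let W : J → Type := fun j => Σ i : {i // ρ i = j}, Z i.1
  let bl : ∀ j, ((twisted c κ μ).obj (W j)).El := fun j => blk c κ μ (y j) fun i => b i.1
  let ε : J → k := fun j => sg k (inv (fibCongr ρ ρ' g e hρ j) fun i => (b i.1).deg)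
  have hdeg : β.deg + ∑ j, (bl j).deg = n := (asym c κ μ φ ρ β y b hd).deg
  -- The signs of the reorderings inside the blocks are first inserted into all blocks, so that the
  -- passage to the new generator is a single outer move; multilinearity then extracts their
  -- product.
  let t : Sym B (twisted c κ μ) X n :=
    ⟨J, W, (fibSigma ρ Z).trans φ, β, fun j => ⟨(bl j).deg, ε j • (bl j).val⟩, hdeg⟩
  have h1 : CompMod.mk t = (∏ j, ε j) • CompMod.mk (asym c κ μ φ ρ β y b hd) :=
    (mkMul ((fibSigma ρ Z).trans φ) β (fun j => (bl j).deg) hdeg).map_smul_univ ε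
      fun j => (bl j).val
  have hbl : ∀ j, blk c κ μ (y' (e j)) (fun i : {i // ρ' i = e j} => b' i.1)
      = (twisted c κ μ).mapEl (sigmaEquiv (fun i : {i // ρ i = j} => Z i.1)
        (fun i : {i // ρ' i = e j} => Z' i.1) (fibCongr ρ ρ' g e hρ j) fun i => h i.1)
        ⟨(bl j).deg, ε j • (bl j).val⟩ := fun j =>
    blk_move c κ μ (Z := fun i : {i // ρ i = j} => Z i.1) (Z' := fun i : {i // ρ' i = e j} => Z' i.1)
      (b := fun i => b i.1) (b' := fun i => b' i.1)
      (fibCongr ρ ρ' g e hρ j) (fun i => h i.1) (hy j) fun i => hb i.1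
  have h2 := CompMod.mk_move (s := t) (t := asym c κ μ φ' ρ' β' y' b' hd') {
    e := e
    h := fun j => sigmaEquiv (fun i : {i // ρ i = j} => Z i.1)
      (fun i : {i // ρ' i = e j} => Z' i.1) (fibCongr ρ ρ' g e hρ j) (fun i => h i.1)
    hφ := by
      rintro j ⟨i, z⟩
      exact hφ i.1 z
    ha := hβ
    hb := hbl }
  unfold amk
  rw [h2, h1, ← sg_sum, smul_smul, smul_smul, smul_smul, smul_smul, ← sg_add, ← sg_add, ← sg_add,
    ← sg_add]
  refine congrArg (· • _) (sg_congr ?_)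
  have key := assocSgn_move ρ ρ' g e hρ (fun j => (y j).deg) (fun j => (y' j).deg)
    (fun j => by rw [hy]; rfl) (fun i => (b i).deg) (fun i => (b' i).deg) (fun i => by rw [hb]; rfl)
  rw [← add_assoc] at key
  exact key

end Blocks

/-! ### The map `(B ∘ D) ∘ A → B ∘ (D ∘_κ A)` -/

section Assoc

variable {B : SMod.{u''} k} {D : SMod.{u} k} {O : SMod.{u'} k} {A : SMod.{v'} k}
  (c : Coaction D D) (κ : Twist D O) (μ : (comp O A).Hom A)
  {I J : Type} [Fintype I] [LinearOrder I] [Fintype J] [LinearOrder J] {Z : I → Type}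
  [∀ i, Finite (Z i)] {X : Type} {n : ℤ}

theorem amk_linβ (φ : (Σ i, Z i) ≃ X) (ρ : I → J) (e : k) {p : ℤ} (x x' : B.obj J p)
    (y : ∀ j, (D.obj {i // ρ i = j}).El) (b : ∀ i, (A.obj (Z i)).El)
    (h : p + ∑ j, (y j).deg + ∑ i, (b i).deg = n) :
    amk c κ μ φ ρ ⟨p, x + e • x'⟩ y b h
      = amk c κ μ φ ρ ⟨p, x⟩ y b h + e • amk c κ μ φ ρ ⟨p, x'⟩ y b h := by
  unfold amk
  rw [smul_comm e, ← smul_add]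
  exact congrArg _ (CompMod.mk_linA (Sym.LinA.mk (c := e) _ p x x' _ _))

/-- Common part of linearity in `y` and in `b`: one block varies linearly, the others are constant,
and the sign depends on degrees only. -/
theorem amk_lin (φ : (Σ i, Z i) ≃ X) (ρ : I → J) (e : k) (β : (B.obj J).El)
    (y y' y'' : ∀ j, (D.obj {i // ρ i = j}).El) (b b' b'' : ∀ i, (A.obj (Z i)).El) (l : J) {q : ℤ}
    (x x' : (twisted c κ μ).obj (Σ i : {i // ρ i = l}, Z i.1) q)
    (hx : blk c κ μ (y l) (fun i : {i // ρ i = l} => b i.1) = ⟨q, x⟩)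
    (hx' : blk c κ μ (y' l) (fun i : {i // ρ i = l} => b' i.1) = ⟨q, x'⟩)
    (hx'' : blk c κ μ (y'' l) (fun i : {i // ρ i = l} => b'' i.1) = ⟨q, x + e • x'⟩)
    (hy' : ∀ j, (y' j).deg = (y j).deg) (hy'' : ∀ j, (y'' j).deg = (y j).deg)
    (hb' : ∀ i, (b' i).deg = (b i).deg) (hb'' : ∀ i, (b'' i).deg = (b i).deg)
    (h' : ∀ j, j ≠ l → blk c κ μ (y' j) (fun i : {i // ρ i = j} => b' i.1)
      = blk c κ μ (y j) fun i => b i.1)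
    (h'' : ∀ j, j ≠ l → blk c κ μ (y'' j) (fun i : {i // ρ i = j} => b'' i.1)
      = blk c κ μ (y j) fun i => b i.1) (hd hd' hd'') :
    amk (n := n) c κ μ φ ρ β y'' b'' hd''
      = amk c κ μ φ ρ β y b hd + e • amk c κ μ φ ρ β y' b' hd' := by
  unfold amk
  simp only [hy', hy'', hb', hb'']
  rw [smul_comm e, ← smul_add]
  refine congrArg _ (CompMod.mk_linB ?_)
  exact Sym.LinB.mk (c := e) _ β _ _ _ l q x x' hx hx' hx'' h' h'' _ _ _

theorem amk_linY (φ : (Σ i, Z i) ≃ X) (ρ : I → J) (e : k) (β : (B.obj J).El)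
    (y y' y'' : ∀ j, (D.obj {i // ρ i = j}).El) (b : ∀ i, (A.obj (Z i)).El) (l : J) (q : ℤ)
    (x x' : D.obj {i // ρ i = l} q) (hx : y l = ⟨q, x⟩) (hx' : y' l = ⟨q, x'⟩)
    (hx'' : y'' l = ⟨q, x + e • x'⟩) (h' : ∀ j, j ≠ l → y' j = y j)
    (h'' : ∀ j, j ≠ l → y'' j = y j) (hd hd' hd'') :
    amk (n := n) c κ μ φ ρ β y'' b hd''
      = amk c κ μ φ ρ β y b hd + e • amk c κ μ φ ρ β y' b hd' := by
  have e' : ∀ j, (y' j).deg = (y j).deg := fun j => by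
    by_cases hj : j = l
    · subst hj; rw [hx, hx']
    · rw [h' j hj]
  have e'' : ∀ j, (y'' j).deg = (y j).deg := fun j => by
    by_cases hj : j = l
    · subst hj; rw [hx, hx'']
    · rw [h'' j hj]
  refine amk_lin c κ μ φ ρ e β y y' y'' b b b l
    (q := q + ∑ i : {i // ρ i = l}, (b i.1).deg) _ _
    (congrArg (fun z => blk c κ μ z fun i : {i // ρ i = l} => b i.1) hx)
    (congrArg (fun z => blk c κ μ z fun i : {i // ρ i = l} => b i.1) hx')
    ((congrArg (fun z => blk c κ μ z fun i : {i // ρ i = l} => b i.1) hx'').trans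
      (congrArg (GrMod.El.mk _) (CompMod.mk_linA (Sym.LinA.mk (c := e) _ q x x' _ _))))
    e' e'' (fun _ => rfl) (fun _ => rfl) (fun j hj => by rw [h' j hj])
    (fun j hj => by rw [h'' j hj]) hd hd' hd''

/-- The factor `b_l` occurs only in the block `ρ l`, and that block is linear in it. -/
theorem amk_linb (φ : (Σ i, Z i) ≃ X) (ρ : I → J) (e : k) (β : (B.obj J).El)
    (y : ∀ j, (D.obj {i // ρ i = j}).El) (b b' b'' : ∀ i, (A.obj (Z i)).El) (l : I) (q : ℤ)
    (x x' : A.obj (Z l) q) (hx : b l = ⟨q, x⟩) (hx' : b' l = ⟨q, x'⟩)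
    (hx'' : b'' l = ⟨q, x + e • x'⟩) (h' : ∀ j, j ≠ l → b' j = b j)
    (h'' : ∀ j, j ≠ l → b'' j = b j) (hd hd' hd'') :
    amk (n := n) c κ μ φ ρ β y b'' hd''
      = amk c κ μ φ ρ β y b hd + e • amk c κ μ φ ρ β y b' hd' := by
  have e' : ∀ j, (b' j).deg = (b j).deg := fun j => by
    by_cases hj : j = l
    · subst hj; rw [hx, hx']
    · rw [h' j hj]
  have e'' : ∀ j, (b'' j).deg = (b j).deg := fun j => by
    by_cases hj : j = l
    · subst hj; rw [hx, hx'']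
    · rw [h'' j hj]
  have hs' : (y (ρ l)).deg + ∑ i : {i // ρ i = ρ l}, (b' i.1).deg
      = (y (ρ l)).deg + ∑ i : {i // ρ i = ρ l}, (b i.1).deg := by simp only [e']
  have hs'' : (y (ρ l)).deg + ∑ i : {i // ρ i = ρ l}, (b'' i.1).deg
      = (y (ρ l)).deg + ∑ i : {i // ρ i = ρ l}, (b i.1).deg := by simp only [e'']
  have hc : ∀ (b₁ : ∀ i, (A.obj (Z i)).El), (∀ j, j ≠ l → b₁ j = b j) → ∀ j, j ≠ ρ l →
      blk c κ μ (y j) (fun i : {i // ρ i = j} => b₁ i.1) = blk c κ μ (y j) fun i => b i.1 :=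
    fun b₁ h₁ j hj => by
      refine congrArg (blk c κ μ (y j)) (funext fun i => h₁ i.1 fun hi => hj ?_)
      rw [← hi, i.2]
  refine amk_lin c κ μ φ ρ e β y y y b b' b'' (ρ l) _ _ rfl (blk_eq c κ μ hs')
    ((blk_eq c κ μ hs'').trans (congrArg (GrMod.El.mk _) (CompMod.mk_linB ?_)))
    (fun _ => rfl) (fun _ => rfl) e' e'' (hc b' h') (hc b'' h'') hd hd' hd''
  exact Sym.LinB.mk (c := e) _ _ _ _ _ (⟨l, rfl⟩ : {i // ρ i = ρ l}) q x x' hx hx' hx''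
    (fun j hj => h' _ fun hh => hj (Subtype.ext hh))
    (fun j hj => h'' _ fun hh => hj (Subtype.ext hh)) _ _ _

theorem amk_deg {p : ℤ} (r : Sym B D I p) {b : ∀ i, (A.obj (Z i)).El}
    (h : p + ∑ i, (b i).deg = n) : r.a.deg + ∑ j, (r.nb j).deg + ∑ i, (b i).deg = n :=
  (congrArg (· + ∑ i, (b i).deg) r.deg).trans h

/-- The map `x ↦ (x; b_i, …)` from `B ∘ D` to `B ∘ (D ∘_κ A)`. -/
def assocInner (φ : (Σ i, Z i) ≃ X) (b : ∀ i, (A.obj (Z i)).El) {p : ℤ}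
    (h : p + ∑ i, (b i).deg = n) : CompMod B D I p →ₗ[k] CompMod B (twisted c κ μ) X n :=
  CompMod.lift (fun r => amk c κ μ φ r.fib r.a r.nb b (amk_deg r h))
    (by
      rintro e _ _ _ ⟨χ, q, x, x', y, hd⟩
      exact amk_linβ c κ μ φ _ e x x' _ b _)
    (by
      rintro e _ _ _ ⟨χ, β, y, y', y'', l, q, x, x', hb, hb', hb'', h', h'', hd, hd', hd''⟩
      let s : Sym B D I p := ⟨_, _, χ, β, y, hd⟩
      refine amk_linY c κ μ φ s.fib e β s.nb (Sym.nb (⟨_, _, χ, β, y', hd'⟩ : Sym B D I p))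
        (Sym.nb (⟨_, _, χ, β, y'', hd''⟩ : Sym B D I p)) b l q (D.map (s.fibEquiv l) x)
        (D.map (s.fibEquiv l) x') ?_ ?_ ?_ ?_ ?_ _ _ _
      · exact congrArg (D.mapEl (s.fibEquiv l)) hb
      · exact congrArg (D.mapEl (s.fibEquiv l)) hb'
      · rw [← map_smul, ← map_add]; exact congrArg (D.mapEl (s.fibEquiv l)) hb''
      · exact fun j hj => congrArg (D.mapEl (s.fibEquiv j)) (h' j hj)
      · exact fun j hj => congrArg (D.mapEl (s.fibEquiv j)) (h'' j hj))
    (by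
      intro s t m
      -- Relabelling `(β; y_j)` leaves the index set of the `b_i` and its order fixed, so only the
      -- sign for the `y_j` remains.
      refine (amk_move c κ μ (φ := φ) (φ' := φ) (b := b) (b' := b) (Equiv.refl I)
        (fun i => Equiv.refl _) m.e (fun i => m.fib i) (fun _ _ => rfl) m.ha (fun j => m.nb j)
        (fun i => congrArg (GrMod.El.mk _) (A.map_refl _).symm) (amk_deg s h) _).trans ?_
      rw [inv_refl, sg_zero, one_smul]
      rfl)

theorem assocInner_mk (φ : (Σ i, Z i) ≃ X) (b : ∀ i, (A.obj (Z i)).El) {p : ℤ}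
    (h : p + ∑ i, (b i).deg = n) (r : Sym B D I p) :
    assocInner c κ μ φ b h (CompMod.mk r) = amk c κ μ φ r.fib r.a r.nb b (amk_deg r h) :=
  CompMod.lift_mk _ _ _ _ r

/-- Here the `b_i` are relabelled while the index set of the `y_j` stays fixed; only the sign for
the `b_i` remains. -/
theorem assocInner_move {I' : Type} [Fintype I'] [LinearOrder I'] {Z' : I' → Type}
    [∀ i, Finite (Z' i)] {φ : (Σ i, Z i) ≃ X} {φ' : (Σ i, Z' i) ≃ X}
    {b : ∀ i, (A.obj (Z i)).El} {b' : ∀ i, (A.obj (Z' i)).El} (g : I ≃ I')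
    (z : ∀ i, Z i ≃ Z' (g i)) (hφ : ∀ i x, φ' ⟨g i, z i x⟩ = φ ⟨i, x⟩)
    (hb : ∀ i, b' (g i) = A.mapEl (z i) (b i)) {p : ℤ} (h : p + ∑ i, (b i).deg = n)
    (h' : p + ∑ i, (b' i).deg = n) (x : CompMod B D I p) :
    assocInner c κ μ φ' b' h' (CompMod.map g x)
      = sg k (inv g fun i => (b i).deg) • assocInner c κ μ φ b h x := by
  refine LinearMap.congr_fun (f := assocInner c κ μ φ' b' h' ∘ₗ CompMod.map g)
    (g := sg k (inv g fun i => (b i).deg) • assocInner c κ μ φ b h)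
    (CompMod.hom_ext fun r => ?_) x
  rw [LinearMap.comp_apply, LinearMap.smul_apply, CompMod.map_mk, assocInner_mk, assocInner_mk]
  have hf : ∀ i, (r.map g).fib (g i) = r.fib i := fun i => by
    unfold Sym.fib Sym.map
    simp
  refine (amk_move c κ μ g z (Equiv.refl r.I) hf hφ
    (congrArg (GrMod.El.mk _) (B.map_refl _).symm) (fun j => ?_) hb (amk_deg r h) _).trans ?_
  · refine Eq.trans ?_ (SMod.mapEl_trans (B := D) (r.fibEquiv j) (fibCongr r.fib (r.map g).fib g (Equiv.refl r.I) hf j) (r.b j)).symm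
    refine congrArg (fun e => D.mapEl e (r.b j)) ?_
    ext t; rfl
  · refine (congrArg (fun t => sg k t • _) (inv_refl _)).trans ?_
    rw [sg_zero, one_smul]
    rfl

/-- The associativity map `(B ∘ D) ∘ A → B ∘ (D ∘_κ A)`. -/
def assocMap : CompMod (comp B D) A X n →ₗ[k] CompMod B (twisted c κ μ) X n :=
  CompMod.lift (fun s => assocInner c κ μ s.φ s.b s.deg s.a.val)
    (by
      rintro e _ _ _ ⟨φ, p, x, y, b, hd⟩
      exact (map_add _ _ _).trans (congrArg _ (map_smul _ _ _)))
    (by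
      rintro e _ _ _ ⟨φ, ⟨p, a⟩, b, b', b'', l, q, x, y, hb, hb', hb'', h', h'', hd, hd', hd''⟩
      -- The first factor is an arbitrary class of `B ∘ D`; all three terms are linear in it, so a
      -- generator may be taken.
      refine LinearMap.congr_fun (f := assocInner c κ μ φ b'' hd'')
        (g := assocInner c κ μ φ b hd + e • assocInner c κ μ φ b' hd')
        (CompMod.hom_ext fun r => ?_) a
      rw [LinearMap.add_apply, LinearMap.smul_apply, assocInner_mk, assocInner_mk, assocInner_mk]
      exact amk_linb c κ μ φ r.fib e r.a r.nb b b' b'' l q x y hb hb' hb'' h' h'' _ _ _)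
    (by
      rintro ⟨I, Z, φ, a, b, hd⟩ ⟨I', Z', φ', a', b', hd'⟩ ⟨g, z, hφ, ha, hb⟩
      -- The equality of first factors includes their degrees; it is substituted for a variable `α`
      -- so that degree and value change together.
      have key : ∀ (α : ((comp B D).obj I').El) (h : α.deg + ∑ i, (b' i).deg = n),
          α = ⟨a.deg, (CompMod.map g a.val : CompMod B D I' a.deg)⟩ →
          assocInner c κ μ φ' b' h α.val
            = sg k (inv g fun i => (b i).deg) • assocInner c κ μ φ b hd a.val := by
        rintro _ h rfl
        exact assocInner_move c κ μ g z hφ hb hd h a.val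
      exact key a' hd' ha)

theorem assocMap_mk (s : Sym (comp B D) A X n) :
    assocMap c κ μ (CompMod.mk s) = assocInner c κ μ s.φ s.b s.deg s.a.val :=
  CompMod.lift_mk _ _ _ _ s

theorem assocMap_mk_mk (φ : (Σ i, Z i) ≃ X) (b : ∀ i, (A.obj (Z i)).El) {p : ℤ}
    (h : p + ∑ i, (b i).deg = n) (r : Sym B D I p) :
    assocMap c κ μ (CompMod.mk ⟨I, Z, φ, ⟨p, (CompMod.mk r : CompMod B D I p)⟩, b, h⟩)
      = amk c κ μ φ r.fib r.a r.nb b (amk_deg r h) :=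
  (assocMap_mk c κ μ _).trans (assocInner_mk c κ μ φ b h r)

/-- The class of a generator of `(B ∘ D) ∘ A` is linear in its first factor, so this factor may be a
generator of `B ∘ D`. -/
theorem compMod_ext {W : Type*} [AddCommGroup W] [Module k W]
    {F G : CompMod (comp B D) A X n →ₗ[k] W}
    (h : ∀ {I : Type} [Fintype I] [LinearOrder I] {Z : I → Type} [∀ i, Finite (Z i)]
      (φ : (Σ i, Z i) ≃ X) (b : ∀ i, (A.obj (Z i)).El) {p : ℤ} (hd : p + ∑ i, (b i).deg = n)
      (r : Sym B D I p),
      F (CompMod.mk ⟨I, Z, φ, ⟨p, (CompMod.mk r : CompMod B D I p)⟩, b, hd⟩)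
        = G (CompMod.mk ⟨I, Z, φ, ⟨p, (CompMod.mk r : CompMod B D I p)⟩, b, hd⟩)) : F = G := by
  refine CompMod.hom_ext fun s => ?_
  obtain ⟨I, Z, φ, ⟨p, a⟩, b, hd⟩ := s
  let L : CompMod B D I p →ₗ[k] CompMod (comp B D) A X n :=
    linOf (fun x => CompMod.mk ⟨I, Z, φ, ⟨p, x⟩, b, hd⟩) fun e x y =>
      CompMod.mk_linA (Sym.LinA.mk (A := comp B D) (c := e) φ p x y b hd)
  exact LinearMap.congr_fun (f := F ∘ₗ L) (g := G ∘ₗ L) (CompMod.hom_ext fun r => h φ b hd r) a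

end Assoc

/-! ### The inverse map `B ∘ (D ∘_κ A) → (B ∘ D) ∘ A` -/

/-- The inversion count depends only on the two orders, hence is invariant under order isomorphisms
on both sides. -/
theorem inv_transport {I I' K K' : Type} [Fintype I] [LinearOrder I] [LinearOrder I'] [Fintype K]
    [LinearOrder K] [LinearOrder K'] (a : I ≃ K) (a' : I' ≃ K')
    (ha : ∀ i j, a i < a j ↔ i < j) (ha' : ∀ i j, a' i < a' j ↔ i < j) (e : I ≃ I') (f : K ≃ K')
    (h : ∀ i, f (a i) = a' (e i)) (q : K → ℤ) : inv f q = inv e fun i => q (a i) := by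
  unfold inv
  simp only [← Equiv.sum_comp a, h, ha, ha']

theorem map_add_smul_of_eq {M N : Type*} [AddCommGroup M] [Module k M] [AddCommGroup N]
    [Module k N] (L : M →ₗ[k] N) {e : k} {x y z : M} (h : z = x + e • y) :
    L z = L x + e • L y := by
  rw [h, map_add, map_smul]

/-! ### Generators of `(B ∘ D) ∘ A` indexed by lexicographic sums -/

section Flat

variable {B : SMod.{u''} k} {D : SMod.{u} k} {O : SMod.{u'} k} {A : SMod.{v'} k}
  {J : Type} [Fintype J] [LinearOrder J] {T : J → Type} [∀ j, Fintype (T j)]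
  [∀ j, LinearOrder (T j)] {Z : ∀ j, T j → Type} [∀ j t, Finite (Z j t)] {X : Type} {n p : ℤ}

/-- The fibres of the projection of a lexicographic sum. -/
def lexFibre (T : J → Type) (j : J) : T j ≃ {x : Σₗ j, T j // (ofLex x).1 = j} where
  toFun t := ⟨toLex ⟨j, t⟩, rfl⟩
  invFun x := x.2 ▸ (ofLex x.1).2
  left_inv _ := rfl
  right_inv := by rintro ⟨⟨_, _⟩, rfl⟩; rfl

/-- Grouping a lexicographic sum by its first coordinate recovers the order of each summand, so it
causes no sign inside a block. -/
theorem lexFibre_lt (j : J) (t t' : T j) : lexFibre T j t < lexFibre T j t' ↔ t < t' := by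
  refine (Sigma.lex_iff (r := (· < ·)) (s := fun _ => (· < ·))).trans ?_
  change (j < j ∨ ∃ _ : j = j, t < t') ↔ _
  simp

/-- Associativity of disjoint unions. -/
def lexAssoc (Z : ∀ j, T j → Type) :
    (Σ x : Σₗ j, T j, Z (ofLex x).1 (ofLex x).2) ≃ Σ j, Σ t, Z j t := Equiv.sigmaAssoc Z

theorem sum_lex (f : (Σₗ j, T j) → ℤ) : ∑ x, f x = ∑ j, ∑ t, f (toLex ⟨j, t⟩) := by
  rw [← Fintype.sum_sigma' fun j t => f (toLex ⟨j, t⟩)]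
  exact (Equiv.sum_comp (toLex : (Σ j, T j) ≃ _) f).symm

theorem lmk_deg {β : ℤ} {y : J → ℤ} {b : ∀ j, T j → ℤ} (hp : β + ∑ j, y j = p)
    (h : β + ∑ j, (y j + ∑ t, b j t) = n) :
    p + ∑ x : Σₗ j, T j, b (ofLex x).1 (ofLex x).2 = n := by
  rw [sum_lex]
  rw [Finset.sum_add_distrib] at h
  simp only [ofLex_toLex]
  omega

/-- The map `a ↦ (a; b_i, …)`. -/
def mkA {I : Type} [Fintype I] [LinearOrder I] {Z : I → Type} [∀ i, Finite (Z i)]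
    (φ : (Σ i, Z i) ≃ X) (b : ∀ i, (D.obj (Z i)).El) (h : p + ∑ i, (b i).deg = n) :
    B.obj I p →ₗ[k] CompMod B D X n :=
  linOf (fun x => CompMod.mk ⟨I, Z, φ, ⟨p, x⟩, b, h⟩) fun e x y =>
    CompMod.mk_linA (Sym.LinA.mk (c := e) φ p x y b h)

/-- The class of the generator `(β; y_j, …)` of `B ∘ D`. -/
def lin (β : (B.obj J).El) (y : ∀ j, (D.obj (T j)).El) (hp : β.deg + ∑ j, (y j).deg = p) :
    (comp B D).obj (Σₗ j, T j) p := (CompMod.mk ⟨J, T, toLex, β, y, hp⟩ : CompMod B D _ p)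

/-- The class of the generator `((β; y_j, …); b_{jt}, …)` with its sign. -/
def lmk (φ : (Σ j, Σ t, Z j t) ≃ X) (β : (B.obj J).El) (y : ∀ j, (D.obj (T j)).El)
    (b : ∀ j t, (A.obj (Z j t)).El) (hp : β.deg + ∑ j, (y j).deg = p)
    (h : β.deg + ∑ j, ((y j).deg + ∑ t, (b j t).deg) = n) : CompMod (comp B D) A X n :=
  sg k (assocSgn (fun x : Σₗ j, T j => (ofLex x).1) (fun j => (y j).deg)
    fun x => (b (ofLex x).1 (ofLex x).2).deg) •
  mkA (B := comp B D) ((lexAssoc Z).trans φ) (fun x : Σₗ j, T j => b (ofLex x).1 (ofLex x).2)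
    (lmk_deg hp h) (lin β y hp)

theorem lmk_linβ (φ : (Σ j, Σ t, Z j t) ≃ X) (e : k) {q : ℤ} (x x' : B.obj J q)
    (y : ∀ j, (D.obj (T j)).El) (b : ∀ j t, (A.obj (Z j t)).El) (hp h) :
    lmk (p := p) (n := n) φ ⟨q, x + e • x'⟩ y b hp h
      = lmk φ ⟨q, x⟩ y b hp h + e • lmk φ ⟨q, x'⟩ y b hp h := by
  unfold lmk
  rw [smul_comm e, ← smul_add]
  exact congrArg _ (map_add_smul_of_eq _
    (CompMod.mk_linA (Sym.LinA.mk (c := e) (B := D) (Z := T) toLex q x x' y hp)))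

theorem lmk_linY (φ : (Σ j, Σ t, Z j t) ≃ X) (e : k) (β : (B.obj J).El)
    (y y' y'' : ∀ j, (D.obj (T j)).El) (b : ∀ j t, (A.obj (Z j t)).El) (l : J) (q : ℤ)
    (x x' : D.obj (T l) q) (hx : y l = ⟨q, x⟩) (hx' : y' l = ⟨q, x'⟩) (hx'' : y'' l = ⟨q, x + e • x'⟩)
    (h' : ∀ j, j ≠ l → y' j = y j) (h'' : ∀ j, j ≠ l → y'' j = y j) (hp : β.deg + ∑ j, (y j).deg = p)
    (hp' : β.deg + ∑ j, (y' j).deg = p) (hp'' : β.deg + ∑ j, (y'' j).deg = p) (hd hd' hd'') :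
    lmk (p := p) (n := n) φ β y'' b hp'' hd''
      = lmk φ β y b hp hd + e • lmk φ β y' b hp' hd' := by
  have e' : ∀ j, (y' j).deg = (y j).deg := fun j => by
    by_cases hj : j = l
    · subst hj; rw [hx, hx']
    · rw [h' j hj]
  have e'' : ∀ j, (y'' j).deg = (y j).deg := fun j => by
    by_cases hj : j = l
    · subst hj; rw [hx, hx'']
    · rw [h'' j hj]
  unfold lmk
  simp only [e', e'']
  rw [smul_comm e, ← smul_add]
  exact congrArg _ (map_add_smul_of_eq _ (CompMod.mk_linB (Sym.LinB.mk (c := e) (B := D) (Z := T)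
    toLex β y y' y'' l q x x' hx hx' hx'' h' h'' hp hp' hp'')))

theorem lmk_linb (φ : (Σ j, Σ t, Z j t) ≃ X) (e : k) (β : (B.obj J).El)
    (y : ∀ j, (D.obj (T j)).El) (b b' b'' : ∀ j t, (A.obj (Z j t)).El) (l : J) (m : T l) (q : ℤ)
    (x x' : A.obj (Z l m) q) (hx : b l m = ⟨q, x⟩) (hx' : b' l m = ⟨q, x'⟩)
    (hx'' : b'' l m = ⟨q, x + e • x'⟩) (hl' : ∀ j, j ≠ l → b' j = b j)
    (hl'' : ∀ j, j ≠ l → b'' j = b j) (hm' : ∀ t, t ≠ m → b' l t = b l t)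
    (hm'' : ∀ t, t ≠ m → b'' l t = b l t) (hp hd hd' hd'') :
    lmk (p := p) (n := n) φ β y b'' hp hd''
      = lmk φ β y b hp hd + e • lmk φ β y b' hp hd' := by
  -- Constancy off `l`, and off `m` within `l`, becomes constancy off a single point of the
  -- lexicographic sum.
  have h' : ∀ j t, toLex (⟨j, t⟩ : Σ j, T j) ≠ toLex ⟨l, m⟩ → b' j t = b j t := fun j t hjt => by
    by_cases hj : j = l
    · subst hj; exact hm' t fun ht => hjt (by rw [ht])
    · rw [hl' j hj]
  have h'' : ∀ j t, toLex (⟨j, t⟩ : Σ j, T j) ≠ toLex ⟨l, m⟩ → b'' j t = b j t := fun j t hjt => by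
    by_cases hj : j = l
    · subst hj; exact hm'' t fun ht => hjt (by rw [ht])
    · rw [hl'' j hj]
  have e' : ∀ j t, (b' j t).deg = (b j t).deg := fun j t => by
    by_cases hj : toLex (⟨j, t⟩ : Σ j, T j) = toLex ⟨l, m⟩
    · obtain ⟨rfl, h1⟩ := Sigma.mk.inj_iff.1 hj
      obtain rfl := eq_of_heq h1
      rw [hx, hx']
    · rw [h' j t hj]
  have e'' : ∀ j t, (b'' j t).deg = (b j t).deg := fun j t => by
    by_cases hj : toLex (⟨j, t⟩ : Σ j, T j) = toLex ⟨l, m⟩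
    · obtain ⟨rfl, h1⟩ := Sigma.mk.inj_iff.1 hj
      obtain rfl := eq_of_heq h1
      rw [hx, hx'']
    · rw [h'' j t hj]
  unfold lmk
  simp only [e', e'']
  rw [smul_comm e, ← smul_add]
  exact congrArg _ (CompMod.mk_linB (Sym.LinB.mk (I := Σₗ j, T j)
    (Z := fun x => Z (ofLex x).1 (ofLex x).2) (A := comp B D) (B := A) (c := e) _ _ _ _ _
    (toLex (⟨l, m⟩ : Σ j, T j)) q x x' hx hx' hx''
    (fun j hj => h' _ _ hj) (fun j hj => h'' _ _ hj) _ _ _))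

/-- Mirror image of `amk_move`: the flattened generator transforms like `(β; (y_j; b_jt))`, with the
blocks permuted by their total degrees and the factors inside each block permuted separately. -/
theorem lmk_move {J' : Type} [Fintype J'] [LinearOrder J'] {T' : J' → Type} [∀ j, Fintype (T' j)]
    [∀ j, LinearOrder (T' j)] {Z' : ∀ j, T' j → Type} [∀ j t, Finite (Z' j t)]
    {φ : (Σ j, Σ t, Z j t) ≃ X} {φ' : (Σ j, Σ t, Z' j t) ≃ X} {β : (B.obj J).El}
    {β' : (B.obj J').El} {y : ∀ j, (D.obj (T j)).El} {y' : ∀ j, (D.obj (T' j)).El}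
    {b : ∀ j t, (A.obj (Z j t)).El} {b' : ∀ j t, (A.obj (Z' j t)).El}
    (e : J ≃ J') (g : ∀ j, T j ≃ T' (e j)) (z : ∀ j t, Z j t ≃ Z' (e j) (g j t))
    (hφ : ∀ j t x, φ' ⟨e j, g j t, z j t x⟩ = φ ⟨j, t, x⟩) (hβ : β' = B.mapEl e β)
    (hy : ∀ j, y' (e j) = D.mapEl (g j) (y j)) (hb : ∀ j t, b' (e j) (g j t) = A.mapEl (z j t) (b j t))
    (hp : β.deg + ∑ j, (y j).deg = p)
    (hp' : β'.deg + ∑ j, (y' j).deg = p) (hd hd') :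
    lmk (p := p) (n := n) φ' β' y' b' hp' hd' =
      sg k (inv e fun j => (y j).deg + ∑ t, (b j t).deg) •
      sg k (∑ j, inv (g j) fun t => (b j t).deg) • lmk φ β y b hp hd := by
  let G : (Σₗ j, T j) ≃ Σₗ j, T' j := e.sigmaCongr g
  have h1 : lin β' y' hp' = sg k (inv e fun j => (y j).deg) • (comp B D).map G (lin β y hp) := by
    refine Eq.trans ?_ (congrArg (_ • ·) (CompMod.map_mk _ _).symm)
    exact CompMod.mk_move (s := Sym.map G ⟨J, T, toLex, β, y, hp⟩) (t := ⟨J', T', toLex, β', y', hp'⟩)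
      ⟨e, g, fun _ _ => rfl, hβ, hy⟩
  have h2 : mkA (B := comp B D) ((lexAssoc Z').trans φ')
      (fun x : Σₗ j, T' j => b' (ofLex x).1 (ofLex x).2) (lmk_deg hp' hd')
      ((comp B D).map G (lin β y hp)) = sg k (inv G fun x => (b (ofLex x).1 (ofLex x).2).deg) •
      mkA (B := comp B D) ((lexAssoc Z).trans φ)
      (fun x : Σₗ j, T j => b (ofLex x).1 (ofLex x).2) (lmk_deg hp hd) (lin β y hp) :=
    CompMod.mk_move (A := comp B D)
      (s := ⟨Σₗ j, T j, fun x => Z (ofLex x).1 (ofLex x).2, (lexAssoc Z).trans φ,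
        ⟨p, lin β y hp⟩, fun x => b (ofLex x).1 (ofLex x).2, lmk_deg hp hd⟩)
      (t := ⟨Σₗ j, T' j, fun x => Z' (ofLex x).1 (ofLex x).2, (lexAssoc Z').trans φ',
        ⟨p, (comp B D).map G (lin β y hp)⟩, fun x => b' (ofLex x).1 (ofLex x).2, lmk_deg hp' hd'⟩)
      ⟨G, fun x => z (ofLex x).1 (ofLex x).2, fun x w => hφ _ _ _, rfl, fun x => hb _ _⟩
  unfold lmk
  rw [h1, map_smul, h2]
  simp only [smul_smul, ← sg_add]
  refine congrArg (· • _) (sg_congr ?_)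
  -- The sign identity is applied to the projection of the lexicographic sum; its fibres are the
  -- given index sets `T j` with their orders.
  have key := assocSgn_move (fun x : Σₗ j, T j => (ofLex x).1) (fun x : Σₗ j, T' j => (ofLex x).1)
    G e (fun _ => rfl) (fun j => (y j).deg) (fun j => (y' j).deg) (fun j => by rw [hy]; rfl)
    (fun x => (b (ofLex x).1 (ofLex x).2).deg) (fun x => (b' (ofLex x).1 (ofLex x).2).deg)
    (fun x => congrArg GrMod.El.deg (hb _ _))
  have h3 : ∀ j, ∑ i : {x : Σₗ j, T j // (ofLex x).1 = j}, (b (ofLex i.1).1 (ofLex i.1).2).deg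
      = ∑ t, (b j t).deg := fun j =>
    (Equiv.sum_comp (lexFibre T j) fun i => (b (ofLex i.1).1 (ofLex i.1).2).deg).symm
  have h4 : ∀ j, inv (fibCongr (fun x : Σₗ j, T j => (ofLex x).1)
      (fun x : Σₗ j, T' j => (ofLex x).1) G e (fun _ => rfl) j)
      (fun i => (b (ofLex i.1).1 (ofLex i.1).2).deg) = inv (g j) fun t => (b j t).deg := fun j =>
    inv_transport (lexFibre T j) (lexFibre T' (e j)) (lexFibre_lt j) (lexFibre_lt (e j)) _ _
      (fun _ => rfl) _
  simp only [h3, h4] at key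
  have gen : ∀ {a b c d f g : ℤ}, Even (a + (b + c) - (d + f + g)) →
      Even (a + (d + f) - (b + (c + g))) := by
    rintro a b c d f g ⟨r, hr⟩
    exact ⟨r + d + f - b - c, by omega⟩
  exact gen key

end Flat

theorem GrMod.El.eq_val {M : GrMod.{u} k} {x : M.El} {v : M x.deg} (h : x = ⟨x.deg, v⟩) :
    v = x.val := by
  obtain ⟨d, w⟩ := x
  exact (eq_of_heq (GrMod.El.mk.inj h).2).symm

/-! ### Descent of the flattened generator to classes of blocks -/

section Inverse

variable {B : SMod.{u''} k} {D : SMod.{u} k} {O : SMod.{u'} k} {A : SMod.{v'} k}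
  {J : Type} [Fintype J] [LinearOrder J] {W : J → Type} {q : J → ℤ} {X : Type} {n : ℤ}

/-- Describes the other two generators as variants of `s` without destructing `s`, so that in a
family all slots can be treated alike. -/
theorem Sym.LinA.exists_eq {c : k} {s s' t : Sym D A X n} (h : Sym.LinA c s s' t) :
    ∃ (y' y'' : (D.obj s.I).El) (h' : y'.deg + ∑ i, (s.b i).deg = n)
      (h'' : y''.deg + ∑ i, (s.b i).deg = n), s' = ⟨s.I, s.Z, s.φ, y', s.b, h'⟩ ∧
      t = ⟨s.I, s.Z, s.φ, y'', s.b, h''⟩ ∧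
      ∃ q x x', s.a = ⟨q, x⟩ ∧ y' = ⟨q, x'⟩ ∧ y'' = ⟨q, x + c • x'⟩ := by
  obtain ⟨φ, p, x, y, b, hd⟩ := h
  exact ⟨⟨p, y⟩, ⟨p, x + c • y⟩, hd, hd, rfl, rfl, p, x, y, rfl, rfl, rfl⟩

theorem Sym.LinB.exists_eq {c : k} {s s' t : Sym D A X n} (h : Sym.LinB c s s' t) :
    ∃ (b' b'' : ∀ i, (A.obj (s.Z i)).El) (h' : s.a.deg + ∑ i, (b' i).deg = n)
      (h'' : s.a.deg + ∑ i, (b'' i).deg = n), s' = ⟨s.I, s.Z, s.φ, s.a, b', h'⟩ ∧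
      t = ⟨s.I, s.Z, s.φ, s.a, b'', h''⟩ ∧
      ∃ l q x x', s.b l = ⟨q, x⟩ ∧ b' l = ⟨q, x'⟩ ∧ b'' l = ⟨q, x + c • x'⟩ ∧
        (∀ i, i ≠ l → b' i = s.b i) ∧ ∀ i, i ≠ l → b'' i = s.b i := by
  obtain ⟨φ, a, b, b', b'', l, q, x, y, hb, hb', hb'', h', h'', hd, hd', hd''⟩ := h
  exact ⟨b', b'', hd', hd'', rfl, rfl, l, q, x, y, hb, hb', hb'', h', h''⟩

/-- The identity. -/
def Sym.Move.refl (s : Sym D A X n) : Sym.Move s s where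
  e := Equiv.refl _
  h _ := Equiv.refl _
  hφ _ _ := rfl
  ha := congrArg (GrMod.El.mk _) (D.map_refl _).symm
  hb i := congrArg (GrMod.El.mk _) (A.map_refl _).symm

theorem lmkS_deg {β : ℤ} (h : β + ∑ j, q j = n) (s : ∀ j, Sym D A (W j) (q j)) :
    β + ∑ j, ((s j).a.deg + ∑ t, ((s j).b t).deg) = n := by
  simp only [(s _).deg, h]

/-- The generator of `(B ∘ D) ∘ A` given by generators of `D ∘ A`. -/
def lmkS (φ : (Σ j, W j) ≃ X) (β : (B.obj J).El) (h : β.deg + ∑ j, q j = n)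
    (s : ∀ j, Sym D A (W j) (q j)) : CompMod (comp B D) A X n :=
  lmk (Z := fun j t => (s j).Z t) ((Equiv.sigmaCongrRight fun j => (s j).φ).trans φ) β
    (fun j => (s j).a) (fun j t => (s j).b t) rfl (lmkS_deg h s)

/-- The degree of `(β; y_j)` depends on the chosen representatives; this lets it be replaced by an
equal degree before comparing. -/
theorem lmk_eq {T : J → Type} [∀ j, Fintype (T j)]
    [∀ j, LinearOrder (T j)] {Z : ∀ j, T j → Type} [∀ j t, Finite (Z j t)] {p : ℤ}
    (φ : (Σ j, Σ t, Z j t) ≃ X) (β : (B.obj J).El) (y : ∀ j, (D.obj (T j)).El)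
    (b : ∀ j t, (A.obj (Z j t)).El) (hp : β.deg + ∑ j, (y j).deg = p) (h) :
    lmk (n := n) φ β y b rfl h = lmk φ β y b hp h := by
  subst hp; rfl

/-- A relation in one block `D ∘ A` changes only one `y_j`, or one `b_jt`, or permutes the factors
of one block; `lmk_linY`, `lmk_linb` and `lmk_move` show that the flattened generator respects it.
-/
theorem exists_lmul (φ : (Σ j, W j) ≃ X) (β : (B.obj J).El) (h : β.deg + ∑ j, q j = n) :
    ∃ G : MultilinearMap k (fun j => CompMod D A (W j) (q j)) (CompMod (comp B D) A X n),
      ∀ s : ∀ j, Sym D A (W j) (q j), G (fun j => CompMod.mk (s j)) = lmkS φ β h s := by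
  refine CompMod.exists_multilinear _ ?_ ?_ ?_
  · intro j₀ c s s' t hs' ht hl
    -- In every slot the two other generators share the index sets and the `b` of `s j`, trivially
    -- so for `j ≠ j₀`. After substitution the three tuples differ only in the factors `y`.
    have key : ∀ j, ∃ (y' y'' : (D.obj (s j).I).El) (h' : y'.deg + ∑ i, ((s j).b i).deg = q j)
        (h'' : y''.deg + ∑ i, ((s j).b i).deg = q j),
        s' j = ⟨(s j).I, (s j).Z, (s j).φ, y', (s j).b, h'⟩ ∧
        t j = ⟨(s j).I, (s j).Z, (s j).φ, y'', (s j).b, h''⟩ ∧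
        (j ≠ j₀ → y' = (s j).a) ∧ (j ≠ j₀ → y'' = (s j).a) ∧
        (j = j₀ → ∃ q x x', (s j).a = ⟨q, x⟩ ∧ y' = ⟨q, x'⟩ ∧ y'' = ⟨q, x + c • x'⟩) := by
      intro j
      by_cases hj : j = j₀
      · subst hj
        obtain ⟨y', y'', h', h'', e', e'', hx⟩ := hl.exists_eq
        exact ⟨y', y'', h', h'', e', e'', absurd rfl, absurd rfl, fun _ => hx⟩
      · exact ⟨(s j).a, (s j).a, (s j).deg, (s j).deg, hs' j hj, ht j hj, fun _ => rfl,
          fun _ => rfl, fun hh => absurd hh hj⟩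
    choose y' y'' h' h'' e' e'' n' n'' hx using key
    obtain rfl := funext e'
    obtain rfl := funext e''
    obtain ⟨q₀, x, x', hx, hx', hx''⟩ := hx j₀ rfl
    -- The total degree of a block is prescribed and its `b` are unchanged, so the degree of its `y`
    -- is determined.
    have d' : ∀ j, (y' j).deg = (s j).a.deg := fun j => by
      have h1 := h' j; have h2 := (s j).deg; omega
    have d'' : ∀ j, (y'' j).deg = (s j).a.deg := fun j => by
      have h1 := h'' j; have h2 := (s j).deg; omega
    have p' : β.deg + ∑ j, (y' j).deg = β.deg + ∑ j, (s j).a.deg := by simp only [d']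
    have p'' : β.deg + ∑ j, (y'' j).deg = β.deg + ∑ j, (s j).a.deg := by simp only [d'']
    refine (lmk_eq _ _ _ _ p'' _).trans (Eq.trans ?_
      (congrArg (fun z => _ + c • z) (lmk_eq _ _ _ _ p' _)).symm)
    exact lmk_linY _ c β (fun j => (s j).a) y' y'' _ j₀ q₀ x x' hx hx' hx'' n' n'' _ _ _ _ _ _
  · intro j₀ c s s' t hs' ht hl
    have key : ∀ j, ∃ (b' b'' : ∀ i, (A.obj ((s j).Z i)).El)
        (h' : (s j).a.deg + ∑ i, (b' i).deg = q j) (h'' : (s j).a.deg + ∑ i, (b'' i).deg = q j),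
        s' j = ⟨(s j).I, (s j).Z, (s j).φ, (s j).a, b', h'⟩ ∧
        t j = ⟨(s j).I, (s j).Z, (s j).φ, (s j).a, b'', h''⟩ ∧
        (j ≠ j₀ → b' = (s j).b) ∧ (j ≠ j₀ → b'' = (s j).b) ∧
        (j = j₀ → ∃ l q x x', (s j).b l = ⟨q, x⟩ ∧ b' l = ⟨q, x'⟩ ∧ b'' l = ⟨q, x + c • x'⟩ ∧
          (∀ i, i ≠ l → b' i = (s j).b i) ∧ ∀ i, i ≠ l → b'' i = (s j).b i) := by
      intro j
      by_cases hj : j = j₀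
      · subst hj
        obtain ⟨y', y'', h', h'', e', e'', hx⟩ := hl.exists_eq
        exact ⟨y', y'', h', h'', e', e'', absurd rfl, absurd rfl, fun _ => hx⟩
      · exact ⟨(s j).b, (s j).b, (s j).deg, (s j).deg, hs' j hj, ht j hj, fun _ => rfl,
          fun _ => rfl, fun hh => absurd hh hj⟩
    choose b' b'' h' h'' e' e'' n' n'' hx using key
    obtain rfl := funext e'
    obtain rfl := funext e''
    obtain ⟨l, q₀, x, x', hx, hx', hx'', hm', hm''⟩ := hx j₀ rfl
    exact lmk_linb _ c β (fun j => (s j).a) (fun j t => (s j).b t) b' b'' j₀ l q₀ x x' hx hx' hx''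
      n' n'' hm' hm'' _ _ _ _
  · intro j₀ s t ht m
    -- The move in the slot `j₀` is completed by identities elsewhere, which have no inversions.
    have key : ∀ j, ∃ m' : Sym.Move (s j) (t j), inv m'.e (fun i => ((s j).b i).deg)
        = if j = j₀ then inv m.e fun i => ((s j₀).b i).deg else 0 := by
      intro j
      by_cases hj : j = j₀
      · subst hj; exact ⟨m, by simp⟩
      · rw [ht j hj, if_neg hj]
        exact ⟨Sym.Move.refl _, inv_refl _⟩
    choose m' hm' using key
    have hp : β.deg + ∑ j, (t j).a.deg = β.deg + ∑ j, (s j).a.deg :=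
      congrArg (β.deg + ·) (Finset.sum_congr rfl fun j _ => congrArg GrMod.El.deg (m' j).ha)
    refine (lmk_eq _ _ _ _ hp _).trans ?_
    refine (lmk_move (Z := fun j i => (s j).Z i) (Z' := fun j i => (t j).Z i)
      (φ := (Equiv.sigmaCongrRight fun j => (s j).φ).trans φ)
      (φ' := (Equiv.sigmaCongrRight fun j => (t j).φ).trans φ) (b := fun j i => (s j).b i)
      (b' := fun j i => (t j).b i) (Equiv.refl J) (fun j => (m' j).e) (fun j => (m' j).h) ?_
      (congrArg (GrMod.El.mk _) (B.map_refl _).symm) (fun j => (m' j).ha) (fun j => (m' j).hb)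
      rfl hp (lmkS_deg h s) (lmkS_deg h t)).trans ?_
    · intro j i x
      exact congrArg (fun w => φ ⟨j, w⟩) ((m' j).hφ i x)
    · rw [inv_refl, sg_zero, one_smul]
      refine congrArg (fun z => sg k z • _) ?_
      exact (Finset.sum_congr rfl fun j _ => hm' j).trans (by simp)

/-- The class of the generator `(β; x_j, …)` of `B ∘ (D ∘ A)` in `(B ∘ D) ∘ A`. -/
def lmul (φ : (Σ j, W j) ≃ X) (β : (B.obj J).El) (h : β.deg + ∑ j, q j = n) :
    MultilinearMap k (fun j => CompMod D A (W j) (q j)) (CompMod (comp B D) A X n) :=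
  (exists_lmul φ β h).choose

theorem lmul_mk (φ : (Σ j, W j) ≃ X) (β : (B.obj J).El) (h : β.deg + ∑ j, q j = n)
    (s : ∀ j, Sym D A (W j) (q j)) : lmul φ β h (fun j => CompMod.mk (s j)) = lmkS φ β h s :=
  (exists_lmul φ β h).choose_spec s

theorem lmul_linA (φ : (Σ j, W j) ≃ X) (e : k) {p : ℤ} (x x' : B.obj J p)
    (h : p + ∑ j, q j = n) (v : ∀ j, CompMod D A (W j) (q j)) :
    lmul φ ⟨p, x + e • x'⟩ h v = lmul φ ⟨p, x⟩ h v + e • lmul φ ⟨p, x'⟩ h v := by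
  refine congrArg (fun F : MultilinearMap k (fun j => CompMod D A (W j) (q j))
    (CompMod (comp B D) A X n) => F v) (CompMod.multilinear_ext (F := lmul φ ⟨p, x + e • x'⟩ h)
      (G := lmul φ ⟨p, x⟩ h + e • lmul φ ⟨p, x'⟩ h) fun s => ?_)
  rw [add_apply, smul_apply, lmul_mk, lmul_mk, lmul_mk]
  exact lmk_linβ _ e x x' _ _ _ _

theorem lmul_update (φ : (Σ j, W j) ≃ X) (e : k) (β : (B.obj J).El) (h : β.deg + ∑ j, q j = n)
    (v : ∀ j, CompMod D A (W j) (q j)) (i : J) (x : CompMod D A (W i) (q i)) :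
    lmul φ β h (Function.update v i (v i + e • x))
      = lmul φ β h v + e • lmul φ β h (Function.update v i x) := by
  rw [MultilinearMap.map_update_add, MultilinearMap.map_update_smul, Function.update_eq_self]

/-- Covers outer relabellings of `B ∘ (D ∘ A)`. Both sides are multilinear in the blocks, so the
blocks may be generators; then it is `lmk_move` with identities on the inner index sets. -/
theorem lmul_move {J' : Type} [Fintype J'] [LinearOrder J'] {W' : J' → Type} {q' : J' → ℤ}
    {φ : (Σ j, W j) ≃ X} {φ' : (Σ j, W' j) ≃ X} {β : (B.obj J).El} {β' : (B.obj J').El}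
    (e : J ≃ J') (z : ∀ j, W j ≃ W' (e j)) (hφ : ∀ j x, φ' ⟨e j, z j x⟩ = φ ⟨j, x⟩)
    (hβ : β' = B.mapEl e β) (h : β.deg + ∑ j, q' (e j) = n) (h' : β'.deg + ∑ j, q' j = n)
    (x : ∀ j, CompMod D A (W' j) (q' j)) :
    lmul φ' β' h' x = sg k (inv e fun j => q' (e j)) •
      lmul φ β h fun j => CompMod.map (z j).symm (x (e j)) := by
  let L : MultilinearMap k (fun j => CompMod D A (W' (e j)) (q' (e j)))
      (CompMod (comp B D) A X n) := (lmul φ β h).compLinearMap fun j => CompMod.map (z j).symm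
  -- The right-hand side as a multilinear map in the blocks indexed by `J'`; only in this form can
  -- it be compared with the left-hand side on generators.
  let L' : MultilinearMap k (fun j => CompMod D A (W' j) (q' j)) (CompMod (comp B D) A X n) :=
    (MultilinearMap.domDomCongrLinearEquiv' k k (fun j => CompMod D A (W' j) (q' j)) _ e.symm).symm L
  have hL : ∀ x, L' x = lmul φ β h fun j => CompMod.map (z j).symm (x (e j)) := fun x => rfl
  rw [← hL, ← smul_apply]
  refine congrArg (fun F : MultilinearMap k (fun j => CompMod D A (W' j) (q' j))
    (CompMod (comp B D) A X n) => F x) (CompMod.multilinear_ext fun s => ?_)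
  rw [smul_apply, hL]
  simp only [CompMod.map_mk]
  rw [lmul_mk, lmul_mk]
  have hp : β'.deg + ∑ j, (s j).a.deg = β.deg + ∑ j, (s (e j)).a.deg := by
    rw [hβ, Equiv.sum_comp e fun j => (s j).a.deg]; rfl
  refine (lmk_eq _ _ _ _ hp _).trans ?_
  refine (lmk_move (Z := fun j i => (s (e j)).Z i) (Z' := fun j i => (s j).Z i)
      (φ := (Equiv.sigmaCongrRight fun j => (s (e j)).φ.trans (z j).symm).trans φ)
      (φ' := (Equiv.sigmaCongrRight fun j => (s j).φ).trans φ') (b := fun j i => (s (e j)).b i)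
      (b' := fun j i => (s j).b i) (y := fun j => (s (e j)).a) (y' := fun j => (s j).a)
      e (fun j => Equiv.refl _) (fun j i => Equiv.refl _) ?_ hβ
      (fun j => congrArg (GrMod.El.mk _) (D.map_refl _).symm)
      (fun j i => congrArg (GrMod.El.mk _) (A.map_refl _).symm) rfl hp
      (lmkS_deg h fun j => s (e j)) (lmkS_deg h' s)).trans ?_
  · intro j i w
    refine Eq.trans (congrArg (fun v => φ' ⟨e j, v⟩) ?_) (hφ j _)
    exact ((z j).apply_symm_apply _).symm
  · simp only [inv_refl, Finset.sum_const_zero, sg_zero, one_smul]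
    refine congrArg (fun f => sg k (inv e f) • _) (funext fun j => ?_)
    exact (s (e j)).deg

variable (c : Coaction D D) (κ : Twist D O) (μ : (comp O A).Hom A)

/-- The inverse of the associativity map. -/
def assocInv : CompMod B (twisted c κ μ) X n →ₗ[k] CompMod (comp B D) A X n :=
  CompMod.lift (fun s => lmul s.φ s.a s.deg fun j => (s.b j).val)
    (by
      rintro e _ _ _ ⟨φ, p, x, y, b, hd⟩
      exact lmul_linA (D := D) (A := A) φ e x y hd fun j => (b j).val)
    (by
      rintro e _ _ _ ⟨φ, a, b, b', b'', i, q, x, y, hb, hb', hb'', h', h'', hd, hd', hd''⟩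
      have hq : (b i).deg = q := congrArg GrMod.El.deg hb
      subst hq
      -- The varied families are rewritten as updates of the values of `b`, with literally the
      -- degrees of `b`, so that one multilinear map applies to all three.
      have key : ∀ b₁ : ∀ j, ((twisted c κ μ).obj _).El, (∀ j, j ≠ i → b₁ j = b j) →
          ∀ w, b₁ i = ⟨(b i).deg, w⟩ → b₁ = fun j => ⟨(b j).deg,
            Function.update (fun j => (b j).val) i w j⟩ := by
        intro b₁ h₁ w hw
        funext j
        by_cases hj : j = i
        · subst hj; simpa using hw
        · simpa [hj] using h₁ j hj
      obtain rfl := key b' h' y hb'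
      obtain rfl := key b'' h'' _ hb''
      obtain rfl := GrMod.El.eq_val hb
      exact lmul_update (D := D) (A := A) φ e a hd (fun j => (b j).val) i y)
    (by
      rintro ⟨J, W, φ, β, b, hd⟩ ⟨J', W', φ', β', b', hd'⟩ ⟨e, z, hφ, hβ, hb⟩
      -- The family `b` is recovered from `b'` through the inverse bijections of the parts, which is
      -- the form in which `lmul_move` has it.
      have key : ∀ (b₁ : ∀ j, ((twisted c κ μ).obj (W j)).El) (h₁ : β.deg + ∑ j, (b₁ j).deg = n),
          (b₁ = fun j => (twisted c κ μ).mapEl (z j).symm (b' (e j))) →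
          lmul φ' β' hd' (fun j => (b' j).val) = sg k (inv e fun j => (b₁ j).deg) •
            lmul φ β h₁ fun j => (b₁ j).val := by
        rintro _ h₁ rfl
        exact lmul_move (D := D) (A := A) e z hφ hβ h₁ hd' fun j => (b' j).val
      refine key b hd (funext fun j => ?_)
      refine Eq.trans ?_ (congrArg _ (hb j).symm)
      refine Eq.trans ?_ (SMod.mapEl_trans (B := twisted c κ μ) _ _ _).symm
      rw [Equiv.self_trans_symm]
      exact congrArg (GrMod.El.mk _) ((twisted c κ μ).map_refl _).symm)

theorem assocInv_mk (φ : (Σ j, W j) ≃ X) (β : (B.obj J).El) (h : β.deg + ∑ j, q j = n)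
    [∀ j, Finite (W j)] (x : ∀ j, CompMod D A (W j) (q j)) :
    assocInv c κ μ (CompMod.mk ⟨J, W, φ, β, fun j => ⟨q j, x j⟩, h⟩) = lmul φ β h x :=
  CompMod.lift_mk _ _ _ _ _

end Inverse

/-! ### Bijectivity of the associativity map -/

section Bijective

variable {B : SMod.{u''} k} {D : SMod.{u} k} {O : SMod.{u'} k} {A : SMod.{v'} k}
  (c : Coaction D D) (κ : Twist D O) (μ : (comp O A).Hom A)
  {I J : Type} [Fintype I] [LinearOrder I] [Fintype J] [LinearOrder J] {Z : I → Type}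
  [∀ i, Finite (Z i)] {X : Type} {n p : ℤ}

theorem sg_mul_self (n : ℤ) : sg k n * sg k n = 1 := by
  rw [← sg_add, ← sg_zero]
  exact sg_congr ⟨n, by ring⟩

/-- The class of `(β; y_j, …)` in `B ∘ D`, the parts being the fibres of a map. -/
def fmk {K : Type} [Finite K] (ρ : K → J) (β : (B.obj J).El) (y : ∀ j, (D.obj {i : K // ρ i = j}).El)
    (h : β.deg + ∑ j, (y j).deg = p) : CompMod B D K p :=
  CompMod.mk ⟨J, fun j => {i : K // ρ i = j}, Equiv.sigmaFiberEquiv ρ, β, y, h⟩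

/-- Normal form of generators: the parts may be taken to be the fibres of a map to the index set.
The index set and its order do not change, so there is no sign. -/
theorem fmk_fib {K : Type} [Finite K] (r : Sym B D K p) : fmk r.fib r.a r.nb r.deg = CompMod.mk r := by
  refine (CompMod.mk_move (s := r) (t := ⟨r.I, fun j => {i // r.fib i = j},
    Equiv.sigmaFiberEquiv r.fib, r.a, r.nb, r.deg⟩) ⟨Equiv.refl _, fun j => r.fibEquiv j,
    fun _ _ => rfl, congrArg (GrMod.El.mk _) (B.map_refl _).symm, fun _ => rfl⟩).trans ?_
  refine (congrArg (fun z => sg k z • _) (inv_refl _)).trans ?_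
  rw [sg_zero, one_smul]

/-- The disjoint union of the fibres, with the lexicographic order. -/
def lexFib (ρ : I → J) : (Σₗ j, {i // ρ i = j}) ≃ I := Equiv.sigmaFiberEquiv ρ

/-- Flattening returns the original factors with the index set in lexicographic order of its fibres.
The sign in `amk`, the sign in `lmk` and the sign of sorting the `b_i` back into the order of `I`
cancel. -/
theorem assocInv_amk (φ : (Σ i, Z i) ≃ X) (ρ : I → J) (β : (B.obj J).El)
    (y : ∀ j, (D.obj {i // ρ i = j}).El) (b : ∀ i, (A.obj (Z i)).El)
    (h : β.deg + ∑ j, (y j).deg + ∑ i, (b i).deg = n) :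
    assocInv c κ μ (amk c κ μ φ ρ β y b h)
      = CompMod.mk ⟨I, Z, φ, ⟨_, fmk ρ β y rfl⟩, b, h⟩ := by
  let s : ∀ j, Sym D A (Σ i : {i // ρ i = j}, Z i.1) ((y j).deg + ∑ i : {i // ρ i = j}, (b i.1).deg) :=
    fun j => ⟨{i // ρ i = j}, fun i => Z i.1, Equiv.refl _, y j, fun i => b i.1, rfl⟩
  have hd : β.deg + ∑ j, ((y j).deg + ∑ i : {i // ρ i = j}, (b i.1).deg) = n :=
    (asym c κ μ φ ρ β y b h).deg
  have h1 : assocInv c κ μ (CompMod.mk (asym c κ μ φ ρ β y b h))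
      = lmkS ((fibSigma ρ Z).trans φ) β hd s :=
    (assocInv_mk c κ μ _ β hd fun j => CompMod.mk (s j)).trans (lmul_mk _ β hd s)
  have h2 : (comp B D).map (lexFib ρ) (lin β y rfl) = fmk ρ β y rfl := CompMod.map_mk _ _
  have h3 := CompMod.mk_move (A := comp B D) (n := n)
    (s := ⟨Σₗ j, {i // ρ i = j}, fun x => Z (ofLex x).2.1,
      (lexAssoc fun j (i : {i // ρ i = j}) => Z i.1).trans
        ((Equiv.sigmaCongrRight fun j => (s j).φ).trans ((fibSigma ρ Z).trans φ)),
      ⟨_, lin β y rfl⟩, fun x => b (ofLex x).2.1, lmk_deg rfl (lmkS_deg hd s)⟩)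
    (t := ⟨I, Z, φ, ⟨_, fmk ρ β y rfl⟩, b, h⟩)
    ⟨lexFib ρ, fun x => Equiv.refl _, fun _ _ => rfl, congrArg (GrMod.El.mk _) h2.symm,
      fun x => congrArg (GrMod.El.mk _) (A.map_refl _).symm⟩
  rw [h3]
  unfold amk
  rw [map_smul, h1]
  refine (smul_smul _ _ _).trans (congrArg (· • _) ?_)
  rw [← sg_add]
  refine sg_congr ?_
  have key := assocSgn_move (fun x : Σₗ j, {i // ρ i = j} => (ofLex x).1) ρ (lexFib ρ)
    (Equiv.refl J) (fun x => (ofLex x).2.2) (fun j => (y j).deg) (fun j => (y j).deg)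
    (fun _ => rfl) (fun x => (b (ofLex x).2.1).deg) (fun i => (b i).deg) (fun _ => rfl)
  -- The blocks keep their order, and so do the factors inside each block; of the permutation signs
  -- only that of `lexFib ρ` survives.
  rw [inv_refl, inv_refl, Finset.sum_eq_zero (fun j _ => inv_eq_zero _ (fun x x' hx => ?_) _)] at key
  · have gen : ∀ {a d i : ℤ}, Even (a + (0 + 0) - (0 + i + d)) → Even (a + d - i) := by
      rintro a d i ⟨r, hr⟩
      exact ⟨r + d, by omega⟩
    exact gen key
  · obtain ⟨t, rfl⟩ := (lexFibre (fun j => {i // ρ i = j}) j).surjective x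
    obtain ⟨t', rfl⟩ := (lexFibre (fun j => {i // ρ i = j}) j).surjective x'
    exact (lexFibre_lt (T := fun j => {i // ρ i = j}) j t t').1 hx

theorem assocInv_assocMap (x : CompMod (comp B D) A X n) :
    assocInv c κ μ (assocMap c κ μ x) = x := by
  refine LinearMap.congr_fun (f := assocInv c κ μ ∘ₗ assocMap c κ μ) (g := LinearMap.id)
    (compMod_ext fun φ b p hd r => ?_) x
  rw [LinearMap.comp_apply, LinearMap.id_apply, assocMap_mk_mk, assocInv_amk]
  obtain ⟨I', W, χ, β, y, rfl⟩ := r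
  refine congrArg CompMod.mk (Sym.eq_of φ ?_ (fun _ => rfl) _ _)
  exact congrArg (GrMod.El.mk _) (fmk_fib _)

/-- Modulo the range, a generator of `B ∘ (D ∘_κ A)` is multilinear in its blocks and vanishes when
all of them are generators, so it vanishes. Together with the left inverse this gives bijectivity.
-/
theorem assocMap_surjective :
    Function.Surjective (assocMap c κ μ : CompMod (comp B D) A X n →ₗ[k] _) := by
  rw [← LinearMap.range_eq_top, eq_top_iff]
  have key : ∀ {J : Type} [Fintype J] [LinearOrder J] {W : J → Type} [∀ j, Finite (W j)]
      {q : J → ℤ} (φ : (Σ j, W j) ≃ X) (β : (B.obj J).El) (h : β.deg + ∑ j, q j = n)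
      (s : ∀ j, Sym D A (W j) (q j)), assocMap c κ μ (lmkS φ β h s)
        = CompMod.mk ⟨J, W, φ, β, fun j => ⟨q j, (CompMod.mk (s j) : CompMod D A _ _)⟩, h⟩ := by
    intro J _ _ W _ q φ β h s
    let r : Sym B D (Σₗ j, (s j).I) (β.deg + ∑ j, (s j).a.deg) :=
      ⟨J, fun j => (s j).I, toLex, β, fun j => (s j).a, rfl⟩
    have hd := lmk_deg (n := n) (p := β.deg + ∑ j, (s j).a.deg) rfl (lmkS_deg h s)
    have h1 := assocMap_mk_mk c κ μ (Z := fun x : Σₗ j, (s j).I => (s (ofLex x).1).Z (ofLex x).2)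
      ((lexAssoc fun j i => (s j).Z i).trans ((Equiv.sigmaCongrRight fun j => (s j).φ).trans φ))
      (fun x => (s (ofLex x).1).b (ofLex x).2) hd r
    refine (map_smul _ _ _).trans ((congrArg (_ • ·) h1).trans ?_)
    refine (smul_smul _ _ _).trans ?_
    -- The same exponent `assocSgn` enters once through `lmk` and once through `amk`, so the two
    -- signs cancel.
    refine (congrArg (· • _) (sg_mul_self _)).trans ((one_smul _ _).trans ?_)
    -- It remains to identify the index set of each block with a fibre of the lexicographic sum;
    -- this preserves the order and costs no sign.
    let g : ∀ j, (s j).I ≃ {x // r.fib x = j} := lexFibre fun j => (s j).I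
    let e : ∀ j, (Σ i, (s j).Z i) ≃
        Σ i : {x // r.fib x = j}, (s (ofLex i.1).1).Z (ofLex i.1).2 := fun j =>
      sigmaEquiv (s j).Z (fun i : {x // r.fib x = j} => (s (ofLex i.1).1).Z (ofLex i.1).2) (g j)
        fun i => Equiv.refl _
    refine (CompMod.mk_move (s := ⟨J, W, φ, β,
      fun j => ⟨q j, (CompMod.mk (s j) : CompMod D A _ _)⟩, h⟩) (t := asym c κ μ
        ((lexAssoc fun j i => (s j).Z i).trans ((Equiv.sigmaCongrRight fun j => (s j).φ).trans φ))
        r.fib r.a r.nb (fun x => (s (ofLex x).1).b (ofLex x).2) (amk_deg r hd))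
      ⟨Equiv.refl _, fun j => (s j).φ.symm.trans (e j), fun j x => ?_,
        congrArg (GrMod.El.mk _) (B.map_refl _).symm, fun j => ?_⟩).trans ?_
    · exact congrArg (fun w => φ ⟨j, w⟩) ((s j).φ.apply_symm_apply x)
    · have h2 : blk c κ μ (r.nb j) (fun i : {x // r.fib x = j} => (s (ofLex i.1).1).b (ofLex i.1).2)
          = (twisted c κ μ).mapEl (e j) (blk c κ μ (s j).a (s j).b) := by
        refine (blk_move c κ μ (y := (s j).a) (b := (s j).b)
          (b' := fun i : {x // r.fib x = j} => (s (ofLex i.1).1).b (ofLex i.1).2) (g j)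
          (fun i => Equiv.refl _) ?_ fun i => congrArg (GrMod.El.mk _) (A.map_refl _).symm).trans ?_
        · refine congrArg (fun e => D.mapEl e (s j).a) (Equiv.ext fun i => Subtype.ext ?_)
          rfl
        · rw [inv_eq_zero (g j) fun i i' hi => (lexFibre_lt (T := fun j => (s j).I) j i i').2 hi,
            sg_zero, one_smul]
          rfl
      have h3 : (⟨q j, (CompMod.mk (s j) : CompMod D A _ _)⟩ : ((twisted c κ μ).obj (W j)).El)
          = (twisted c κ μ).mapEl (s j).φ (blk c κ μ (s j).a (s j).b) := by
        rw [blk_eq c κ μ (s j).deg]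
        exact congrArg (GrMod.El.mk _) (CompMod.map_mk (s j).φ
          (⟨(s j).I, (s j).Z, Equiv.refl _, (s j).a, (s j).b, (s j).deg⟩ : Sym D A _ _)).symm
      refine h2.trans (Eq.trans ?_ (congrArg _ h3.symm))
      refine Eq.trans ?_ (SMod.mapEl_trans (B := twisted c κ μ) _ _ _).symm
      refine congrArg (fun e => (twisted c κ μ).mapEl e _) (Equiv.ext fun x => ?_)
      exact congrArg (e j) ((s j).φ.symm_apply_apply x).symm
    · refine (congrArg (fun z => sg k z • _) (inv_refl _)).trans ?_
      rw [sg_zero, one_smul]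
  rintro x -
  refine LinearMap.congr_fun (f := (LinearMap.range (assocMap c κ μ)).mkQ) (g := 0)
    (CompMod.hom_ext fun σ => ?_) x |> (Submodule.Quotient.mk_eq_zero _).1
  obtain ⟨J, W, φ, β, b, h⟩ := σ
  let F := (LinearMap.range (assocMap c κ μ : CompMod (comp B D) A X n →ₗ[k] _)).mkQ.compMultilinearMap
    (mkMul φ β (fun j => (b j).deg) h)
  have hF : F = 0 := CompMod.multilinear_ext (D := D) (A := A) fun s =>
    (Submodule.Quotient.mk_eq_zero _).2 ⟨_, key φ β h s⟩
  exact congrArg (fun G : MultilinearMap k _ _ => G fun j => (b j).val) hF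

end Bijective

/-! ### The internal differentials, block by block -/

section Differential

variable {B : SMod.{u''} k} {D : SMod.{u} k} {O : SMod.{u'} k} {A : SMod.{v'} k}
  (c : Coaction D D) (κ : Twist D O) (μ : (comp O A).Hom A)
  {I J : Type} [Fintype I] [LinearOrder I] [Fintype J] [LinearOrder J] {Z : I → Type}
  [∀ i, Finite (Z i)] {X : Type} {n m p : ℤ}

/-- For a generator in normal form the passage to fibres changes nothing, so no relabelling is left
in the value. -/
theorem assocMap_fmk (φ : (Σ i, Z i) ≃ X) (ρ : I → J) (β : (B.obj J).El)
    (y : ∀ j, (D.obj {i // ρ i = j}).El) (b : ∀ i, (A.obj (Z i)).El)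
    (h : β.deg + ∑ j, (y j).deg = p) (hd : p + ∑ i, (b i).deg = n) (hd') :
    assocMap c κ μ (CompMod.mk ⟨I, Z, φ, ⟨p, fmk ρ β y h⟩, b, hd⟩) = amk c κ μ φ ρ β y b hd' := by
  refine (assocMap_mk_mk c κ μ φ b hd (⟨J, fun j => {i // ρ i = j}, Equiv.sigmaFiberEquiv ρ, β, y, h⟩ :
    Sym B D I p)).trans ?_
  refine amk_congr c κ μ φ ρ rfl (fun j => ?_) (fun _ => rfl) _ _
  refine Eq.trans (congrArg (fun e => D.mapEl e (y j)) ?_) (congrArg (GrMod.El.mk _) (D.map_refl _))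
  exact Equiv.ext fun x => Subtype.ext rfl

/-- Normal forms suffice to compare linear maps; all differentials below are computed on them. -/
theorem fmk_ext {W : Type*} [AddCommGroup W] [Module k W]
    {F G : CompMod (comp B D) A X n →ₗ[k] W}
    (h : ∀ {I J : Type} [Fintype I] [LinearOrder I] [Fintype J] [LinearOrder J] {Z : I → Type}
      [∀ i, Finite (Z i)] (φ : (Σ i, Z i) ≃ X) (ρ : I → J) (β : (B.obj J).El)
      (y : ∀ j, (D.obj {i // ρ i = j}).El) (b : ∀ i, (A.obj (Z i)).El)
      {p : ℤ} (hp : β.deg + ∑ j, (y j).deg = p) (hd : p + ∑ i, (b i).deg = n),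
      F (CompMod.mk ⟨I, Z, φ, ⟨p, fmk ρ β y hp⟩, b, hd⟩)
        = G (CompMod.mk ⟨I, Z, φ, ⟨p, fmk ρ β y hp⟩, b, hd⟩)) : F = G := by
  refine compMod_ext fun φ b p hd r => ?_
  rw [← fmk_fib r]
  exact h φ r.fib r.a r.nb b r.deg hd

/-- Apply `d` to one element of a family. -/
def dAt {E : SMod.{v} k} {W : J → Type} [∀ j, Finite (W j)] (b : ∀ j, (E.obj (W j)).El) (l : J)
    (j : J) : (E.obj (W j)).El := if j = l then (b j).d else b j

theorem dAt_deg {E : SMod.{v} k} {W : J → Type} [∀ j, Finite (W j)] (b : ∀ j, (E.obj (W j)).El)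
    (l j : J) : (dAt b l j).deg = (b j).deg + if j = l then -1 else 0 := by
  unfold dAt
  split_ifs <;> simp [GrMod.El.d, sub_eq_add_neg]

theorem sum_dAt_deg {E : SMod.{v} k} {W : J → Type} [∀ j, Finite (W j)]
    (b : ∀ j, (E.obj (W j)).El) (l : J) :
    ∑ j, (dAt b l j).deg = ∑ j, (b j).deg - 1 := by
  simp only [dAt_deg, Finset.sum_add_distrib, Finset.sum_ite_eq', Finset.mem_univ, if_true]
  ring

theorem d_fmk (h : m + 1 = p) (ρ : I → J) (β : (B.obj J).El)
    (y : ∀ j, (D.obj {i // ρ i = j}).El) (hp : β.deg + ∑ j, (y j).deg = p) :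
    CompMod.d h (fmk ρ β y hp) = fmk ρ β.d y (by simp only [GrMod.El.d]; omega)
      + ∑ j, sg k (β.deg + ∑ j', if j' < j then (y j').deg else 0) •
        fmk ρ β (dAt y j) (by rw [sum_dAt_deg]; omega) :=
  CompMod.d_mk h _

/-- The map `w ↦ (β; x_1, …, w, …)`, where `w` takes the place of `x_l`. -/
def ins {E : SMod.{v} k} {W : J → Type} [∀ j, Finite (W j)] (φ : (Σ j, W j) ≃ X) (β : (B.obj J).El)
    (x : ∀ j, (E.obj (W j)).El) (l : J) (h : β.deg + ∑ j, (x j).deg = n) (q : ℤ)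
    (hm : n - (x l).deg + q = m) : E.obj (W l) q →ₗ[k] CompMod B E X m :=
  have hd : ∀ w : E.obj (W l) q, β.deg + ∑ j, (Function.update x l ⟨q, w⟩ j).deg = m := fun w => by
    have : ∀ j, (Function.update x l ⟨q, w⟩ j).deg
        = (x j).deg + if j = l then q - (x l).deg else 0 := fun j => by
      by_cases hj : j = l
      · subst hj; simp
      · simp [hj]
    simp only [this, Finset.sum_add_distrib, Finset.sum_ite_eq', Finset.mem_univ, if_true]
    omega
  linOf (fun w => CompMod.mk ⟨J, W, φ, β, Function.update x l ⟨q, w⟩, hd w⟩) fun e w w' =>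
    CompMod.mk_linB (Sym.LinB.mk (c := e) φ β _ _ _ l q w w' (Function.update_self ..)
      (Function.update_self ..) (Function.update_self ..)
      (fun j hj => by rw [Function.update_of_ne hj, Function.update_of_ne hj])
      (fun j hj => by rw [Function.update_of_ne hj, Function.update_of_ne hj]) _ _ _)

/-- Recognizes a generator that differs from a given one in a single factor. This brings the terms
of a differential into the form of a linear map applied to the changed factor. -/
theorem mk_eq_ins {E : SMod.{v} k} {W : J → Type} [∀ j, Finite (W j)] (φ : (Σ j, W j) ≃ X)
    (β : (B.obj J).El) (x x' : ∀ j, (E.obj (W j)).El) (l : J) (h : β.deg + ∑ j, (x j).deg = n)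
    {q : ℤ} (hm : n - (x l).deg + q = m) (w : E.obj (W l) q) (hx : ∀ j, j ≠ l → x' j = x j)
    (hw : x' l = ⟨q, w⟩) (h') :
    CompMod.mk (⟨J, W, φ, β, x', h'⟩ : Sym B E X m) = ins φ β x l h q hm w := by
  refine congrArg CompMod.mk (Sym.eq_of φ rfl (fun j => ?_) _ _)
  by_cases hj : j = l
  · subst hj; rw [hw, Function.update_self]
  · rw [hx j hj, Function.update_of_ne hj]

theorem ains_deg (hm : m + 1 = n) (q : ℤ) : n - q + (q - 1) = m := by omega

/-- Replace one block of a generator of `B ∘ (D ∘_κ A)`. -/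
def ains (φ : (Σ i, Z i) ≃ X) (ρ : I → J) (β : (B.obj J).El)
    (y : ∀ j, (D.obj {i // ρ i = j}).El) (b : ∀ i, (A.obj (Z i)).El)
    (h : β.deg + ∑ j, (y j).deg + ∑ i, (b i).deg = n) (hm : m + 1 = n) (l : J) :
    CompMod D A (Σ i : {i // ρ i = l}, Z i.1) ((y l).deg + ∑ i : {i // ρ i = l}, (b i.1).deg - 1)
      →ₗ[k] CompMod B (twisted c κ μ) X m :=
  ins (E := twisted c κ μ) ((fibSigma ρ Z).trans φ) β
    (fun j => blk c κ μ (y j) fun i : {i // ρ i = j} => b i.1) l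
    (asym c κ μ φ ρ β y b h).deg ((y l).deg + ∑ i : {i // ρ i = l}, (b i.1).deg - 1) (ains_deg hm _)

theorem mk_asym_eq_ains (φ : (Σ i, Z i) ≃ X) (ρ : I → J) (β : (B.obj J).El)
    (y y' : ∀ j, (D.obj {i // ρ i = j}).El) (b b' : ∀ i, (A.obj (Z i)).El)
    (h : β.deg + ∑ j, (y j).deg + ∑ i, (b i).deg = n) (hm : m + 1 = n) (l : J)
    (hy : ∀ j, j ≠ l → y' j = y j) (hb : ∀ i, ρ i ≠ l → b' i = b i) (h')
    (hl : (y' l).deg + ∑ i : {i // ρ i = l}, (b' i.1).deg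
      = (y l).deg + ∑ i : {i // ρ i = l}, (b i.1).deg - 1) :
    CompMod.mk (asym (n := m) c κ μ φ ρ β y' b' h') = ains c κ μ φ ρ β y b h hm l
      (CompMod.mk ⟨{i // ρ i = l}, fun i => Z i.1, Equiv.refl _, y' l, fun i => b' i.1, hl⟩) :=
  mk_eq_ins (E := twisted c κ μ) ((fibSigma ρ Z).trans φ) β
    (fun j => blk c κ μ (y j) fun i : {i // ρ i = j} => b i.1) _ l (asym c κ μ φ ρ β y b h).deg _ _
    (fun j hj => by
      have : (fun i : {i // ρ i = j} => b' i.1) = fun i : {i // ρ i = j} => b i.1 :=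
        funext fun i => hb i.1 fun hi => hj (i.2.symm.trans hi)
      exact congrArg₂ (blk c κ μ) (hy j hj) this)
    (blk_eq c κ μ hl) _

/-- The class of one block. -/
def bmk (ρ : I → J) (y : ∀ j, (D.obj {i // ρ i = j}).El) (b : ∀ i, (A.obj (Z i)).El) (l : J) :
    CompMod D A (Σ i : {i // ρ i = l}, Z i.1) ((y l).deg + ∑ i : {i // ρ i = l}, (b i.1).deg) :=
  CompMod.mk ⟨{i // ρ i = l}, fun i => Z i.1, Equiv.refl _, y l, fun i => b i.1, rfl⟩

/-- The differential of `B ∘ (D ∘_κ A)` acts on `β` or on one block, and in a block it is the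
internal differential plus the twisting term. With `ains` linear in the block, the two parts can be
matched separately with the two parts of the differential of `(B ∘ D) ∘_κ A`. -/
theorem d_amk (hm : m + 1 = n) (φ : (Σ i, Z i) ≃ X) (ρ : I → J) (β : (B.obj J).El)
    (y : ∀ j, (D.obj {i // ρ i = j}).El) (b : ∀ i, (A.obj (Z i)).El)
    (h : β.deg + ∑ j, (y j).deg + ∑ i, (b i).deg = n) :
    CompMod.d hm (amk c κ μ φ ρ β y b h)
      = amk c κ μ φ ρ β.d y b (by simp only [GrMod.El.d]; omega)
      + ∑ l, sg k (assocSgn ρ (fun j => (y j).deg) (fun i => (b i).deg) + (β.deg + ∑ j, if j < l then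
          (y j).deg + ∑ i : {i // ρ i = j}, (b i.1).deg else 0)) •
        ains c κ μ φ ρ β y b h hm l (CompMod.d (sub_add_cancel _ 1) (bmk ρ y b l)
          + dTw c κ μ (sub_add_cancel _ 1) (bmk ρ y b l)) := by
  refine (map_smul _ _ _).trans ?_
  rw [CompMod.d_mk, smul_add, Finset.smul_sum]
  refine congrArg₂ (· + ·) rfl (Finset.sum_congr rfl fun l _ => ?_)
  refine (smul_smul _ _ _).trans (congrArg₂ (fun (e : k) (z : CompMod B (twisted c κ μ) X m) => e • z)
    (sg_add _ _).symm ?_)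
  refine mk_eq_ins (E := twisted c κ μ) ((fibSigma ρ Z).trans φ) β
    (fun j => blk c κ μ (y j) fun i : {i // ρ i = j} => b i.1) _ l (asym c κ μ φ ρ β y b h).deg _ _ (fun j hj => if_neg hj) ?_ _
  exact if_pos rfl

/-- Inside block `l` the internal differential meets either `y_l` or one of the `b_t` with `ρ t =
l`. -/
theorem ains_d (hm : m + 1 = n) (φ : (Σ i, Z i) ≃ X) (ρ : I → J) (β : (B.obj J).El)
    (y : ∀ j, (D.obj {i // ρ i = j}).El) (b : ∀ i, (A.obj (Z i)).El)
    (h : β.deg + ∑ j, (y j).deg + ∑ i, (b i).deg = n) (l : J) :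
    ains c κ μ φ ρ β y b h hm l (CompMod.d (sub_add_cancel _ 1) (bmk ρ y b l))
      = CompMod.mk (asym (n := m) c κ μ φ ρ β (dAt y l) b (by rw [sum_dAt_deg]; omega))
      + ∑ t : {i // ρ i = l}, sg k ((y l).deg + ∑ i : {i // ρ i = l}, if i < t then (b i.1).deg else 0) •
        CompMod.mk (asym (n := m) c κ μ φ ρ β y (dAt b t.1) (by rw [sum_dAt_deg]; omega)) := by
  unfold bmk
  rw [CompMod.d_mk, map_add, map_sum]
  refine congrArg₂ (· + ·) ?_ (Finset.sum_congr rfl fun t _ => ?_)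
  · refine Eq.symm ((mk_asym_eq_ains c κ μ φ ρ β y (dAt y l) b b h hm l (fun j hj => if_neg hj)
      (fun _ _ => rfl) _ ?_).trans (congrArg _ (congrArg CompMod.mk (Sym.eq_of _ (if_pos rfl)
        (fun _ => rfl) _ _))))
    rw [dAt_deg, if_pos rfl]; omega
  · rw [map_smul]
    refine congrArg (_ • ·) (Eq.symm ((mk_asym_eq_ains c κ μ φ ρ β y y b (dAt b t.1) h hm l
      (fun j hj => rfl) (fun i hi => if_neg fun hh => hi ((congrArg ρ hh).trans t.2)) _ ?_).trans
        (congrArg _ (congrArg CompMod.mk (Sym.eq_of _ rfl (fun i => ?_) _ _)))))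
    · simp only [dAt_deg, Finset.sum_add_distrib, Subtype.val_inj]
      simp
      omega
    · unfold dAt
      simp only [Subtype.val_inj]

end Differential

/-! ### Signs of the internal differentials -/

section Signs

variable {I J : Type} [Fintype I] [LinearOrder I] [Fintype J] [LinearOrder J]

theorem sum_lt_fibre (ρ : I → J) (c : I → ℤ) (l : J) :
    (∑ j, if j < l then ∑ i : {i // ρ i = j}, c i.1 else 0) = ∑ i, if ρ i < l then c i else 0 := by
  have := sum_fibre ρ c fun j => if j < l then 1 else 0
  simpa only [ite_mul, one_mul, zero_mul] using this

theorem sum_lt_add (Y C : J → ℤ) (l : J) : (∑ j, if j < l then Y j + C j else 0)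
    = (∑ j, if j < l then Y j else 0) + ∑ j, if j < l then C j else 0 := by
  rw [← Finset.sum_add_distrib]
  refine Finset.sum_congr rfl fun j _ => ?_
  split_ifs <;> simp

/-- In the grouped order the differential also passes the `b_i` of the blocks before `l`. Lowering
the degree of `y_l` by one changes `assocSgn` by precisely their total degree, as these are the
`b_i` that cross `y_l`. -/
theorem assocSgn_dY (ρ : I → J) (Y Y' : J → ℤ) (c : I → ℤ) (l : J) (β : ℤ)
    (hY : ∀ j, Y' j = Y j + if j = l then -1 else 0) :
    Even (β + (∑ j, if j < l then Y j else 0) + assocSgn ρ Y' c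
      - (assocSgn ρ Y c + (β + ∑ j, if j < l then Y j + ∑ i : {i // ρ i = j}, c i.1 else 0))) := by
  have h1 : assocSgn ρ Y' c = assocSgn ρ Y c - ∑ i, if ρ i < l then c i else 0 := by
    unfold assocSgn
    have h2 : ∀ j i, (if ρ i < j then Y' j * c i else 0) = (if ρ i < j then Y j * c i else 0)
        - if j = l then (if ρ i < l then c i else 0) else 0 := fun j i => by
      rw [hY]
      by_cases hj : j = l
      · subst hj; simp only [if_true]; split_ifs <;> ring
      · simp [hj]
    simp only [h2, Finset.sum_sub_distrib]
    rw [Finset.sum_comm (f := fun j i => if j = l then (if ρ i < l then c i else 0) else 0)]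
    simp only [Finset.sum_ite_eq', Finset.mem_univ, if_true]
    ring
  rw [h1, sum_lt_add, sum_lt_fibre]
  exact ⟨-∑ i, if ρ i < l then c i else 0, by ring⟩

/-- Ungrouped, the differential passes `β`, all `y_j` and the `b_a` with `a < i`; grouped, it passes
`β`, the earlier blocks, and inside block `l` the factor `y_l` and the `b_a` with `a < i`. The
difference is the total degree of the factors that `b_i` crosses. -/
theorem assocSgn_dc (ρ : I → J) (Y : J → ℤ) (c c' : I → ℤ) (l : J) (i : I) (hi : ρ i = l) (β p : ℤ)
    (hp : β + ∑ j, Y j = p) (hc : ∀ a, c' a = c a + if a = i then -1 else 0) :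
    Even (p + (∑ a, if a < i then c a else 0) + assocSgn ρ Y c'
      - (assocSgn ρ Y c + (β + ∑ j, if j < l then Y j + ∑ i : {i // ρ i = j}, c i.1 else 0)
        + (Y l + ∑ a : {a // ρ a = l}, if a.1 < i then c a.1 else 0))) := by
  subst hi hp
  have h1 : assocSgn ρ Y c' = assocSgn ρ Y c - (∑ a, if i < a ∧ ρ a < ρ i then c a else 0)
      - (∑ a, if a < i ∧ ρ i < ρ a then c a else 0) - ∑ j, if ρ i < j then Y j else 0 := by
    unfold assocSgn
    have h2 : ∀ a b, (if a < b ∧ ρ b < ρ a then c' a * c' b else 0)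
        = (if a < b ∧ ρ b < ρ a then c a * c b else 0)
          - (if a = i then (if i < b ∧ ρ b < ρ i then c b else 0) else 0)
          - if b = i then (if a < i ∧ ρ i < ρ a then c a else 0) else 0 := fun a b => by
      rw [hc, hc]
      by_cases ha : a = i <;> by_cases hb : b = i <;> simp [ha, hb] <;> split_ifs <;> ring
    have h3 : ∀ j a, (if ρ a < j then Y j * c' a else 0) = (if ρ a < j then Y j * c a else 0)
        - if a = i then (if ρ i < j then Y j else 0) else 0 := fun j a => by
      rw [hc]
      by_cases ha : a = i <;> simp [ha]
      split_ifs <;> ring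
    simp only [h2, h3, Finset.sum_sub_distrib]
    rw [Finset.sum_comm (f := fun a b => if a = i then (if i < b ∧ ρ b < ρ i then c b else 0) else 0)]
    simp only [Finset.sum_ite_eq', Finset.mem_univ, if_true]
    ring
  rw [h1, sum_lt_add, sum_lt_fibre, sum_sub_ite (fun a => ρ a = ρ i) fun a => if a < i then c a else 0]
  -- The contributions of the `b_a` agree modulo two, and those of the `y_j` cancel exactly, since
  -- each `j` is before, equal to or after `ρ i`.
  have h4 : Y (ρ i) = ∑ j, if j = ρ i then Y j else 0 := by simp
  have h5 : Even (∑ a, ((if a < i then c a else 0) - (if i < a ∧ ρ a < ρ i then c a else 0)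
      - (if a < i ∧ ρ i < ρ a then c a else 0) - (if ρ a < ρ i then c a else 0)
      - if ρ a = ρ i then if a < i then c a else 0 else 0)) := by
    refine Finset.even_sum _ fun a _ => ?_
    rcases lt_trichotomy a i with h | h | h
    · rcases lt_trichotomy (ρ a) (ρ i) with h' | h' | h'
      · simp [h, h', h.not_gt, h'.not_gt, h'.ne]
      · simp [h, h', h.not_gt]
      · simp [h, h', h.not_gt, h'.not_gt, h'.ne']
    · subst h; simp
    · rcases lt_trichotomy (ρ a) (ρ i) with h' | h' | h'
      · simp only [h, h', h.not_gt, h'.not_gt, h'.ne, if_true, if_false, and_self]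
        exact ⟨-c a, by ring⟩
      · simp [h, h', h.not_gt]
      · simp [h, h', h.not_gt, h'.not_gt, h'.ne']
  have h6 : ∑ j, (Y j - (if ρ i < j then Y j else 0) - (if j < ρ i then Y j else 0)
      - if j = ρ i then Y j else 0) = 0 := by
    refine Finset.sum_eq_zero fun j _ => ?_
    rcases lt_trichotomy j (ρ i) with h' | h' | h'
    · simp [h', h'.not_gt, h'.ne]
    · subst h'; simp
    · simp [h', h'.not_gt, h'.ne']
  obtain ⟨r, hr⟩ := h5
  refine ⟨r, ?_⟩
  simp only [Finset.sum_sub_distrib] at hr h6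
  rw [← hr, h4]
  linear_combination h6

end Signs

/-! ### The associativity map and the internal differentials -/

section Differential

variable {B : SMod.{u''} k} {D : SMod.{u} k} {O : SMod.{u'} k} {A : SMod.{v'} k}
  (c : Coaction D D) (κ : Twist D O) (μ : (comp O A).Hom A)
  {I J : Type} [Fintype I] [LinearOrder I] [Fintype J] [LinearOrder J] {Z : I → Type}
  [∀ i, Finite (Z i)] {X : Type} {n m p : ℤ}

theorem sum_fibrewise {V : Type*} [AddCommMonoid V] (ρ : I → J) (f : I → V) :
    ∑ i, f i = ∑ j, ∑ t : {i // ρ i = j}, f t.1 := by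
  rw [← Equiv.sum_comp (Equiv.sigmaFiberEquiv ρ), Fintype.sum_sigma]
  rfl

/-- The differential hits `β`, some `y_l` or some `b_i` on either side. Sorting the `b_i` by blocks
gives the part of `d_amk` without twisting terms. -/
theorem assocMap_d (hm : m + 1 = n) (φ : (Σ i, Z i) ≃ X) (ρ : I → J) (β : (B.obj J).El)
    (y : ∀ j, (D.obj {i // ρ i = j}).El) (b : ∀ i, (A.obj (Z i)).El)
    (hp : β.deg + ∑ j, (y j).deg = p) (hd : p + ∑ i, (b i).deg = n)
    (h : β.deg + ∑ j, (y j).deg + ∑ i, (b i).deg = n) :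
    assocMap c κ μ (CompMod.d hm (CompMod.mk ⟨I, Z, φ, ⟨p, fmk ρ β y hp⟩, b, hd⟩))
      = amk c κ μ φ ρ β.d y b (by simp only [GrMod.El.d]; omega)
      + ∑ l, sg k (assocSgn ρ (fun j => (y j).deg) (fun i => (b i).deg) + (β.deg + ∑ j, if j < l then
          (y j).deg + ∑ i : {i // ρ i = j}, (b i.1).deg else 0)) •
        ains c κ μ φ ρ β y b h hm l (CompMod.d (sub_add_cancel _ 1) (bmk ρ y b l)) := by
  -- The terms in which the first factor is differentiated are the value of this linear map on the
  -- differential of `(β; y_j)` in `B ∘ D`.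
  let L : CompMod B D I (p - 1) →ₗ[k] CompMod B (twisted c κ μ) X m :=
    assocMap c κ μ ∘ₗ mkA (B := comp B D) φ b (p := p - 1) (by omega)
  have h1 : assocMap c κ μ (CompMod.mk (Sym.dA hm ⟨I, Z, φ, ⟨p, fmk ρ β y hp⟩, b, hd⟩))
      = L (CompMod.d (sub_add_cancel p 1) (fmk ρ β y hp)) := rfl
  have h2 : ∀ i, assocMap c κ μ (CompMod.mk (Sym.dB hm ⟨I, Z, φ, ⟨p, fmk ρ β y hp⟩, b, hd⟩ i))
      = amk c κ μ φ ρ β y (dAt b i) (by rw [sum_dAt_deg]; omega) := fun i =>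
    assocMap_fmk c κ μ φ ρ β y (dAt b i) hp (by rw [sum_dAt_deg]; omega) _
  have h3 : ∀ (β' : (B.obj J).El) (y' : ∀ j, (D.obj {i // ρ i = j}).El) (h' h''),
      L (fmk ρ β' y' h') = amk c κ μ φ ρ β' y' b h'' := fun β' y' h' h'' =>
    assocMap_fmk c κ μ φ ρ β' y' b h' _ h''
  rw [CompMod.d_mk, map_add, map_sum, h1, d_fmk, map_add, map_sum, h3 β.d y _
    (by simp only [GrMod.El.d]; omega), add_assoc]
  congr 1
  simp only [ains_d, smul_add, Finset.sum_add_distrib, Finset.smul_sum]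
  refine congrArg₂ (· + ·) (Finset.sum_congr rfl fun l _ => ?_) ?_
  · rw [map_smul, h3 β (dAt y l) _ (by rw [sum_dAt_deg]; omega)]
    unfold amk
    rw [smul_smul, ← sg_add]
    exact congrArg (· • _) (sg_congr (assocSgn_dY ρ _ _ _ l β.deg (dAt_deg y l)))
  · rw [sum_fibrewise ρ]
    refine Finset.sum_congr rfl fun l _ => Finset.sum_congr rfl fun t _ => ?_
    rw [map_smul, h2]
    unfold amk
    rw [smul_smul, smul_smul, ← sg_add, ← sg_add]
    exact congrArg (· • _) (sg_congr (assocSgn_dc ρ _ _ _ l t.1 t.2 β.deg p hp (dAt_deg b t.1)))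

end Differential

/-! ### Signs of merging factors by the twisting morphism -/

section Signs

variable {I J : Type} [Fintype I] [LinearOrder I] [Fintype J] [LinearOrder J]

open scoped Classical in
-- Rewrites the shuffle inside one block over all of `I`, where it can be compared with the global
-- shuffle.
theorem shufExp_fibre (ρ : I → J) (l : J) (V : Set {i // ρ i = l}) (c : I → ℤ) :
    shufExp V (fun t => c t.1) = ∑ a, ∑ b, if a ∉ Subtype.val '' V ∧ b ∈ Subtype.val '' V ∧ a < b ∧
      ρ a = l then c a * c b else 0 := by
  unfold shufExp
  have hm : ∀ t : {i // ρ i = l}, t ∈ V ↔ t.1 ∈ Subtype.val '' V := fun t =>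
    ⟨fun h => ⟨t, h, rfl⟩, fun ⟨s, hs, h⟩ => Subtype.ext h ▸ hs⟩
  have h1 : ∀ t : {i // ρ i = l}, (∑ s : {i // ρ i = l}, if t ∉ V ∧ s ∈ V ∧ t < s then
      c t.1 * c s.1 else 0) = ∑ b, if t.1 ∉ Subtype.val '' V ∧ b ∈ Subtype.val '' V ∧ t.1 < b then
      c t.1 * c b else 0 := fun t => by
    simp only [hm]
    refine (sum_sub_ite (fun i => ρ i = l) fun b => if t.1 ∉ Subtype.val '' V ∧
      b ∈ Subtype.val '' V ∧ t.1 < b then c t.1 * c b else 0).trans (Finset.sum_congr rfl fun b _ => ?_)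
    by_cases hb : ρ b = l
    · rw [if_pos hb]
    · have : b ∉ Subtype.val '' V := fun ⟨t, _, h⟩ => hb (h ▸ t.2)
      simp [hb]
  simp only [h1]
  refine (sum_sub_ite (fun i => ρ i = l) fun a => ∑ b, if a ∉ Subtype.val '' V ∧
      b ∈ Subtype.val '' V ∧ a < b then c a * c b else 0).trans (Finset.sum_congr rfl fun a _ => ?_)
  by_cases ha : ρ a = l <;> simp [ha]

open scoped Classical in
theorem degOn_eq (U : Set I) (c : I → ℤ) : degOn U c = ∑ a, if a ∈ U then c a else 0 :=
  sum_sub_ite (fun a => a ∈ U) c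

open scoped Classical in
-- The merged factor stands first among the `b`. To reach block `l` it crosses the remaining `b` of
-- earlier blocks and the `y_j` with `j > l`; all other crossings do not involve it.
theorem assocSgn_option (l : J) (U : Set I) (Y : J → ℤ) (c : Option {i // i ∉ U} → ℤ)
    (ρ : Option {i // i ∉ U} → J) (hl : ρ none = l) :
    @assocSgn (Option {i // i ∉ U}) J _ (optOrd _) _ _ ρ Y c
      = c none * (∑ b : {i // i ∉ U}, if ρ (some b) < l then c (some b) else 0)
      + c none * (∑ j, if l < j then Y j else 0)
      + assocSgn (fun a => ρ (some a)) Y fun a => c (some a) := by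
  have h1 : ∀ a b : {i // i ∉ U}, @LT.lt (Option {i // i ∉ U}) (@Preorder.toLT _
      (@PartialOrder.toPreorder _ (@LinearOrder.toPartialOrder _ (optOrd _)))) (some a) (some b)
      ↔ a < b := fun a b => WithBot.coe_lt_coe
  have h2 : ∀ a : {i // i ∉ U}, @LT.lt (Option {i // i ∉ U}) (@Preorder.toLT _
      (@PartialOrder.toPreorder _ (@LinearOrder.toPartialOrder _ (optOrd _)))) none (some a) :=
    fun a => WithBot.bot_lt_coe a
  have h3 : ∀ a : Option {i // i ∉ U}, ¬ @LT.lt (Option {i // i ∉ U}) (@Preorder.toLT _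
      (@PartialOrder.toPreorder _ (@LinearOrder.toPartialOrder _ (optOrd _)))) a none :=
    fun a => WithBot.not_lt_bot a
  unfold assocSgn
  simp only [Fintype.sum_option, h1, h2, h3, hl, false_and, true_and, if_false, zero_add,
    Finset.sum_add_distrib, Finset.mul_sum, mul_ite, mul_zero, mul_comm (c none) (Y _)]
  ring

open scoped Classical in
-- Here `y_l` is split into factors of degrees `q` and `g`, and `U` lies in the fibre over `l`.
-- Before grouping, the second factor passes the `y_j` with `j > l`, the twisting morphism passes
-- the first factor `(β; y_j)` of new degree `p - g`, and the `b_i` with `i ∈ U` are shuffled to the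
-- front. After grouping, the same happens inside block `l`, preceded by the passage over `β` and
-- the earlier blocks. The two routes have the same sign.
theorem assocSgn_merge (ρ : I → J) (l : J) (U : Set I) (hU : ∀ i ∈ U, ρ i = l) (Y Y' : J → ℤ)
    (c : I → ℤ) (g q β p : ℤ) (hl : Y l = q + g) (hY : ∀ j, Y' j = Y j + if j = l then q - Y l else 0)
    (c' : Option {i // i ∉ U} → ℤ) (ρ' : Option {i // i ∉ U} → J)
    (hn : c' none = g - 1 + degOn U c) (hs : ∀ a, c' (some a) = c a.1) (hn' : ρ' none = l)
    (hs' : ∀ a, ρ' (some a) = ρ a.1) (hp : β + ∑ j, Y j = p) :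
    Even (g * post Y l + (p - g + shufExp U c)
      + @assocSgn (Option {i // i ∉ U}) J _ (optOrd _) _ _ ρ' Y' c'
      - (assocSgn ρ Y c + (β + ∑ j, if j < l then Y j + ∑ i : {i // ρ i = j}, c i.1 else 0)
        + (q + ∑ a, ∑ b, if a ∉ U ∧ b ∈ U ∧ a < b ∧ ρ a = l then c a * c b else 0))) := by
  rw [assocSgn_option l U Y' c' ρ' hn', sum_lt_add, sum_lt_fibre, degOn_eq] at *
  simp only [hn, hs, hs']
  set L := ∑ i, if ρ i < l then c i else 0 with hL
  set C := ∑ a, if a ∈ U then c a else 0 with hC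
  set X1 := ∑ a, ∑ b, if a ∈ U ∧ b ∉ U ∧ a < b ∧ ρ b < l then c a * c b else 0 with hX1
  set X2 := ∑ a, ∑ b, if a ∉ U ∧ b ∈ U ∧ a < b ∧ l < ρ a then c a * c b else 0 with hX2
  set A1 := ∑ a, ∑ b, if a ∉ U ∧ b ∈ U ∧ a < b ∧ ρ a < l then c a * c b else 0 with hA1
  set A2 := ∑ a, ∑ b, if a ∉ U ∧ b ∈ U ∧ a < b ∧ ρ a = l then c a * c b else 0 with hA2
  have e1 : (∑ b : {i // i ∉ U}, if ρ b.1 < l then c b.1 else 0) = L := by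
    refine (sum_sub_ite (fun i => i ∉ U) fun b => if ρ b < l then c b else 0).trans
      (Finset.sum_congr rfl fun b _ => ?_)
    by_cases hb : b ∈ U
    · simp [hU b hb]
    · simp [hb]
  have e2 : (∑ j, if l < j then Y' j else 0) = post Y l := by
    refine Finset.sum_congr rfl fun j _ => ?_
    split_ifs with h
    · rw [hY, if_neg h.ne', add_zero]
    · rfl
  -- The global shuffle splits by the block of the factor passed: earlier than `l`, equal to `l`, or
  -- later. The middle part is the shuffle inside block `l`.
  have e3 : shufExp U c = A1 + A2 + X2 := by
    simp only [shufExp, hA1, hA2, hX2, ← Finset.sum_add_distrib]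
    refine Finset.sum_congr rfl fun a _ => Finset.sum_congr rfl fun b _ => ?_
    rcases lt_trichotomy (ρ a) l with h | h | h
    · simp [h, h.not_gt, h.ne]
    · simp [h]
    · simp [h, h.not_gt, h.ne']
  -- A factor indexed by `U` and a factor of an earlier block are counted once, according to which
  -- of the two comes first.
  have e4 : A1 + X1 = C * L := by
    rw [hA1, Finset.sum_comm, hX1, hC, hL, Finset.sum_mul_sum, ← Finset.sum_add_distrib]
    refine Finset.sum_congr rfl fun a _ => ?_
    rw [← Finset.sum_add_distrib]
    refine Finset.sum_congr rfl fun b _ => ?_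
    by_cases ha : a ∈ U
    · by_cases hb : b ∈ U
      · simp [hb, hU b hb]
      · have hab : a ≠ b := fun h => hb (h ▸ ha)
        rcases lt_or_gt_of_ne hab with h | h <;> simp [ha, hb, h, h.not_gt, mul_comm (c b)]
    · simp [ha]
  -- The crossings in which no factor indexed by `U` takes part are those of the merged list, except
  -- that the degree of `y_l` drops by `g`; this accounts for the summand `g * L`.
  have e5 : assocSgn ρ Y c = assocSgn (fun a : {i // i ∉ U} => ρ a.1) Y' (fun a => c a.1)
      + X1 + X2 + C * post Y l + g * L := by
    have f1 : ∀ a : {i // i ∉ U}, (∑ b : {i // i ∉ U}, if a < b ∧ ρ b.1 < ρ a.1 then c a.1 * c b.1 else 0)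
        = ∑ b, if b ∉ U ∧ a.1 < b ∧ ρ b < ρ a.1 then c a.1 * c b else 0 := fun a =>
      (sum_sub_ite (fun i => i ∉ U) fun b => if a.1 < b ∧ ρ b < ρ a.1 then c a.1 * c b else 0).trans
        (Finset.sum_congr rfl fun b _ => by simp only [ite_and])
    have f2 := sum_sub_ite (fun i => i ∉ U) fun a => ∑ b, if b ∉ U ∧ a < b ∧ ρ b < ρ a then
      c a * c b else 0
    have f3 : ∀ j, (∑ a : {i // i ∉ U}, if ρ a.1 < j then Y' j * c a.1 else 0)
        = ∑ a, if a ∉ U then if ρ a < j then Y' j * c a else 0 else 0 := fun j =>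
      sum_sub_ite (fun i => i ∉ U) fun a => if ρ a < j then Y' j * c a else 0
    have f4 : (∑ a, ∑ b, if a < b ∧ ρ b < ρ a then c a * c b else 0)
        = (∑ a, if a ∉ U then ∑ b, if b ∉ U ∧ a < b ∧ ρ b < ρ a then c a * c b else 0 else 0)
          + X1 + X2 := by
      rw [hX1, hX2, ← Finset.sum_add_distrib, ← Finset.sum_add_distrib]
      refine Finset.sum_congr rfl fun a _ => ?_
      by_cases ha : a ∈ U
      · simp only [ha, not_true, if_false, false_and, true_and, hU a ha, Finset.sum_const_zero, zero_add, add_zero]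
        refine Finset.sum_congr rfl fun b _ => ?_
        by_cases hb : b ∈ U
        · simp [hb, hU b hb]
        · simp [hb]
      · simp only [ha, not_false_iff, if_true, false_and, if_false, true_and,
          Finset.sum_const_zero, add_zero, ← Finset.sum_add_distrib]
        refine Finset.sum_congr rfl fun b _ => ?_
        by_cases hb : b ∈ U
        · simp [hb, hU b hb]
        · simp [hb]
    have f5 : (∑ j, ∑ a, if ρ a < j then Y j * c a else 0)
        = (∑ j, ∑ a, if a ∉ U then if ρ a < j then Y' j * c a else 0 else 0)
          + C * post Y l + g * L := by
      have f6 : ∀ j, (∑ a, if ρ a < j then Y j * c a else 0)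
          = (∑ a, if a ∉ U then if ρ a < j then Y' j * c a else 0 else 0)
            + C * (if l < j then Y j else 0) + if j = l then g * L else 0 := fun j => by
        have f7 : (if j = l then g * L else 0)
            = ∑ a, if j = l then if ρ a < l then g * c a else 0 else 0 := by
          split_ifs
          · rw [hL, Finset.mul_sum]
            exact Finset.sum_congr rfl fun a _ => by split_ifs <;> simp
          · simp
        rw [f7, hC, Finset.sum_mul, ← Finset.sum_add_distrib, ← Finset.sum_add_distrib]
        refine Finset.sum_congr rfl fun a _ => ?_
        by_cases ha : a ∈ U
        · simp only [ha, hU a ha, not_true, if_false, if_true, lt_irrefl]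
          split_ifs <;> ring
        · simp only [ha, not_false_iff, if_true, if_false, zero_mul, add_zero, hY]
          by_cases hj : j = l
          · subst hj
            simp only [if_true, hl]
            split_ifs <;> ring
          · simp [hj]
      simp only [f6, Finset.sum_add_distrib, ← Finset.mul_sum, Finset.sum_ite_eq', Finset.mem_univ,
        if_true]
      rfl
    unfold assocSgn
    simp only [f1, f3]
    rw [f2, f4, f5]
    ring
  have e6 : ∑ j, Y j = (∑ j, if j < l then Y j else 0) + Y l + post Y l := by
    have f1 : Y l = ∑ j, if j = l then Y j else 0 := by simp
    rw [f1]
    unfold post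
    rw [← Finset.sum_add_distrib, ← Finset.sum_add_distrib]
    refine Finset.sum_congr rfl fun j _ => ?_
    rcases lt_trichotomy j l with h | h | h
    · simp [h, h.ne, h.not_gt]
    · subst h; simp
    · simp [h, h.ne', h.not_gt]
  rw [e1, e2, e3, e5]
  -- Half of the difference of the exponents, after `C * L - X1` has been replaced by `A1`.
  refine ⟨g * post Y l + A1 - L, ?_⟩
  rw [← hp, e6, hl]
  linear_combination (-1) * e4

end Signs

/-! ### The associativity map and the twisting term -/

section Twisting

variable {B : SMod.{u''} k} {D : SMod.{u} k} {O : SMod.{u'} k} {A : SMod.{v'} k}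
  (c : Coaction D D) (κ : Twist D O) (μ : (comp O A).Hom A)
  {I J : Type} [Fintype I] [LinearOrder I] [Fintype J] [LinearOrder J] {Z : I → Type}
  [∀ i, Finite (Z i)] {X : Type} {n m p : ℤ}

/-- The map induced by `ρ` on a decomposition of its source. -/
def splitFib (ρ : I → J) (U : Set I) : {i // i ∉ U} ⊕ {i // i ∈ U} → J :=
  fun x => ρ ((splitEquiv U).symm x)

/-- The fibres of `splitFib`. -/
def splitFibEquiv (ρ : I → J) (U : Set I) (j : J) :
    {i // ρ i = j} ≃ {x // splitFib ρ U x = j} :=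
  (splitEquiv U).subtypeEquiv fun i => by
    unfold splitFib; rw [Equiv.symm_apply_apply]

/-- The factors `y`, relabelled along a decomposition. -/
def splitY (ρ : I → J) (U : Set I) (y : ∀ j, (D.obj {i // ρ i = j}).El) (j : J) :
    (D.obj {x // splitFib ρ U x = j}).El := D.mapEl (splitFibEquiv ρ U j) (y j)

/-- Decomposing `I` along `U` relabels the fibres only; the index set `J` and its order stay the
same, so there is no sign. -/
theorem map_split_fmk (ρ : I → J) (U : Set I) (β : (B.obj J).El)
    (y : ∀ j, (D.obj {i // ρ i = j}).El) (hp : β.deg + ∑ j, (y j).deg = p) :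
    CompMod.map (splitEquiv U) (fmk ρ β y hp) = fmk (splitFib ρ U) β (splitY ρ U y) hp := by
  refine (CompMod.map_mk _ _).trans ?_
  refine Eq.symm ((CompMod.mk_move (s := (⟨J, fun j => {i // ρ i = j}, Equiv.sigmaFiberEquiv ρ, β, y,
    hp⟩ : Sym B D I p).map (splitEquiv U)) (t := ⟨J, fun j => {x // splitFib ρ U x = j},
      Equiv.sigmaFiberEquiv (splitFib ρ U), β, splitY ρ U y, hp⟩) ⟨Equiv.refl J,
        fun j => splitFibEquiv ρ U j, fun _ _ => rfl, congrArg (GrMod.El.mk _) (B.map_refl _).symm,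
          fun _ => rfl⟩).trans ?_)
  refine (congrArg (fun z => sg k z • _) (inv_refl _)).trans ?_
  rw [sg_zero, one_smul]

theorem freeδ_fmk {P Q : Type} [Finite P] [Finite Q] (r : P ⊕ Q → J) (β : (B.obj J).El)
    (y : ∀ j, (D.obj {x // r x = j}).El) (hn : β.deg + ∑ j, (y j).deg = n) :
    freeδ c n (fmk r β y hn) = ∑ j, freeVal c r β y hn j := by
  refine (CompMod.lift_mk _ _ _ _ _).trans ?_
  have : ∀ j, Sym.nb (⟨J, fun j => {x // r x = j}, Equiv.sigmaFiberEquiv r, β, y, hn⟩ :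
      Sym B D (P ⊕ Q) n) j = y j := fun j => by
    refine Eq.trans (congrArg (fun e => D.mapEl e (y j)) ?_) (congrArg (GrMod.El.mk _) (D.map_refl _))
    exact Equiv.ext fun x => Subtype.ext rfl
  have gen : ∀ (y' : ∀ j, (D.obj {x // r x = j}).El) (h : y' = y) (hn'),
      ∑ j, freeVal c r β y' hn' j = ∑ j, freeVal c r β y hn j := by
    rintro _ rfl _; rfl
  exact gen _ (funext this) _

/-- The coaction of the free comodule cuts one `y_l` at a time, so the summand for `U` splits over
`l`; by `freeVal_neg` only those `l` count whose fibre contains `U`. -/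
theorem twVal_fmk (φ : (Σ i, Z i) ≃ X) (ρ : I → J) (β : (B.obj J).El)
    (y : ∀ j, (D.obj {i // ρ i = j}).El) (b : ∀ i, (A.obj (Z i)).El)
    (hp : β.deg + ∑ j, (y j).deg = p) (hd : p + ∑ i, (b i).deg = n + 1) (U : Set I) :
    twVal (Coaction.free B c) κ μ φ ⟨p, fmk ρ β y hp⟩ b hd U
      = ∑ l, twTerm κ μ φ b U hd (freeVal c (splitFib ρ U) β (splitY ρ U y) hp l) := by
  refine (congrArg (twTerm κ μ φ b U hd) ((congrArg (freeδ c p) (map_split_fmk ρ U β y hp)).trans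
    (freeδ_fmk c _ β _ hp))).trans ?_
  exact map_sum _ _ _

variable (ρ : I → J) (l : J) (U : Set I) (V : Set {i // ρ i = l})

/-- The complement of a subset of a fibre. -/
def fibOut (hV : ∀ t, t ∈ V ↔ t.1 ∈ U) : {t // t ∉ V} ≃ {x : {i // i ∉ U} // splitFib ρ U (Sum.inl x) = l} where
  toFun t := ⟨⟨t.1.1, fun h => t.2 ((hV t.1).2 h)⟩, t.1.2⟩
  invFun x := ⟨⟨x.1.1, x.2⟩, fun h => x.1.2 ((hV _).1 h)⟩
  left_inv _ := rfl
  right_inv _ := rfl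

/-- A subset contained in a fibre. -/
def fibIn (hU : ∀ i ∈ U, ρ i = l) (hV : ∀ t, t ∈ V ↔ t.1 ∈ U) : {t // t ∈ V} ≃ {i // i ∈ U} where
  toFun t := ⟨t.1.1, (hV t.1).1 t.2⟩
  invFun i := ⟨⟨i.1, hU i.1 i.2⟩, (hV _).2 i.2⟩
  left_inv _ := rfl
  right_inv _ := rfl

theorem splitFib_inr (hU : ∀ i ∈ U, ρ i = l) (q : {i // i ∈ U}) : splitFib ρ U (Sum.inr q) = l := hU q.1 q.2

/-- Cutting `I` along `U` and restricting to the fibre over `l` is the same as cutting this fibre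
along `V`. By naturality of the coaction, the cut of `y_l` on either side is then the same tensor up
to relabelling. -/
theorem fib_split (hU : ∀ i ∈ U, ρ i = l) (hV : ∀ t, t ∈ V ↔ t.1 ∈ U) : (splitFibEquiv ρ U l).trans (eqI (splitFib ρ U) l (splitFib_inr ρ l U hU))
    = (splitEquiv V).trans (Equiv.sumCongr (fibOut ρ l U V hV) (fibIn ρ l U V hU hV)) := by
  -- The inverse of `splitEquiv` computes on the two summands; the map itself involves a decision
  -- whether a point lies in the subset.
  refine Equiv.symm_bijective.injective (Equiv.ext ?_)
  rintro (x | x) <;> rfl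

/-- The other fibres. -/
def fibOther (hU : ∀ i ∈ U, ρ i = l) (j : J) (hj : j ≠ l) : {i // ρ i = j} ≃ {o // rO (splitFib ρ U) l o = j} where
  toFun i := ⟨some ⟨i.1, fun h => hj (i.2.symm.trans (hU i.1 h))⟩, i.2⟩
  invFun
    | ⟨none, h⟩ => absurd h.symm hj
    | ⟨some i, h⟩ => ⟨i.1, h⟩
  left_inv _ := rfl
  right_inv := by
    rintro ⟨_ | _, h⟩
    · exact absurd h.symm hj
    · rfl

theorem fibOther_eq (hU : ∀ i ∈ U, ρ i = l) (j : J) (hj : j ≠ l) : (splitFibEquiv ρ U j).trans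
    (eqJ (splitFib ρ U) l (splitFib_inr ρ l U hU) j hj) = fibOther ρ l U hU j hj := by
  refine Equiv.symm_bijective.injective (Equiv.ext ?_)
  rintro ⟨_ | i, h⟩
  · exact absurd h.symm hj
  · rfl

/-- The fibre with the points of `V` merged. -/
def fibMerge (hV : ∀ t, t ∈ V ↔ t.1 ∈ U) : Option {t // t ∉ V} ≃ {o // rO (splitFib ρ U) l o = l} :=
  (Equiv.optionCongr (fibOut ρ l U V hV)).trans (eqN (splitFib ρ U) l l rfl)

open scoped Classical in
-- The merged element `κ(γ)(b_i)` uses only factors of block `l`. The order on `V` is induced from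
-- that of `I`, so no sign occurs.
theorem twAct_fibIn (hU : ∀ i ∈ U, ρ i = l) (hV : ∀ t, t ∈ V ↔ t.1 ∈ U)
    (b : ∀ i, (A.obj (Z i)).El) {g N : ℤ} (γ : D.obj {t // t ∈ V} g) (hd hd') :
    twAct κ μ b U (N := N) hd' (D.map (fibIn ρ l U V hU hV) γ)
      = A.map (sigmaEquiv (fun t : {t // t ∈ V} => Z t.1.1) (fun i : {i // i ∈ U} => Z i.1)
          (fibIn ρ l U V hU hV) fun t => Equiv.refl (Z t.1.1))
        (twAct κ μ (fun i : {i // ρ i = l} => b i.1) V hd γ) := by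
  refine (actv_move μ (fun t : {t // t ∈ V} => Z t.1.1) (fun i : {i // i ∈ U} => Z i.1)
    (fibIn ρ l U V hU hV) (fun t => Equiv.refl (Z t.1.1)) ⟨g - 1, κ.app _ (by omega) γ⟩ _
      (fun t => b t.1.1) _
      (congrArg (GrMod.El.mk _) (κ.nat _ _ γ)) (fun t => congrArg (GrMod.El.mk _) (A.map_refl _).symm)
      (show g - 1 + degOn V (fun i => (b i.1).deg) = N by omega) _).trans ?_
  rw [inv_eq_zero (fibIn ρ l U V hU hV) (fun t t' h => h), sg_zero, one_smul]
  rfl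

open scoped Classical in
theorem degOn_fibIn (hU : ∀ i ∈ U, ρ i = l) (hV : ∀ t, t ∈ V ↔ t.1 ∈ U)
    (q : I → ℤ) : degOn U q = degOn V fun t => q t.1 :=
  (Equiv.sum_comp (fibIn ρ l U V hU hV) fun i => q i.1).symm

end Twisting

/-! ### The blocks after merging -/

section TwistingTerm

variable {B : SMod.{u''} k} {D : SMod.{u} k} {O : SMod.{u'} k} {A : SMod.{v'} k}
  (c : Coaction D D) (κ : Twist D O) (μ : (comp O A).Hom A)
  {I J : Type} [Fintype I] [LinearOrder I] [Fintype J] [LinearOrder J] {Z : I → Type}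
  [∀ i, Finite (Z i)] {X : Type} {n m p : ℤ}
  (ρ : I → J) (l : J) (U : Set I) (V : Set {i // ρ i = l})

theorem blk_move_of_lt {I' : Type} [Fintype I'] [LinearOrder I'] {Z' : I' → Type}
    [∀ i, Finite (Z' i)] (g : I ≃ I') (hg : ∀ i i', i < i' → g i < g i') (h : ∀ i, Z i ≃ Z' (g i))
    {y : (D.obj I).El} {y' : (D.obj I').El} {b : ∀ i, (A.obj (Z i)).El}
    {b' : ∀ i, (A.obj (Z' i)).El} (hy : y' = D.mapEl g y)
    (hb : ∀ i, b' (g i) = A.mapEl (h i) (b i)) :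
    blk c κ μ y' b' = (twisted c κ μ).mapEl (sigmaEquiv Z Z' g h) (blk c κ μ y b) := by
  rw [blk_move c κ μ g h hy hb, inv_eq_zero g hg, sg_zero, one_smul]

open scoped Classical in
-- As `U` lies over `l`, a block `j ≠ l` keeps its factors and their order; only the labels change.
theorem blk_fibOther (hU : ∀ i ∈ U, ρ i = l) (y : ∀ j, (D.obj {i // ρ i = j}).El)
    (b : ∀ i, (A.obj (Z i)).El) (ω : (A.obj (Σ i : {i // i ∈ U}, Z i.1)).El)
    (x : D.obj (Option {i : {i // i ∉ U} // splitFib ρ U (Sum.inl i) = l}) p) (j : J)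
    (hj : j ≠ l) :
    letI := optOrd {i // i ∉ U}
    blk c κ μ (freeB (splitFib ρ U) (splitY ρ U y) l (splitFib_inr ρ l U hU) x j)
        (fun o : {o // rO (splitFib ρ U) l o = j} => twB U ω b o.1)
      = (twisted c κ μ).mapEl (sigmaEquiv (fun i : {i // ρ i = j} => Z i.1)
          (fun o : {o // rO (splitFib ρ U) l o = j} => TwZ Z U o.1) (fibOther ρ l U hU j hj)
          fun i => Equiv.refl (Z i.1))
        (blk c κ μ (y j) fun i : {i // ρ i = j} => b i.1) := by
  let _ := optOrd {i // i ∉ U}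
  refine blk_move_of_lt c κ μ (Z := fun i : {i // ρ i = j} => Z i.1)
    (Z' := fun o : {o // rO (splitFib ρ U) l o = j} => TwZ Z U o.1) (fibOther ρ l U hU j hj)
    (fun i i' h => WithBot.coe_lt_coe.2 h) (fun i => Equiv.refl (Z i.1)) ?_
    (fun i => congrArg (GrMod.El.mk _) (A.map_refl _).symm)
  rw [freeB_ne _ _ _ _ _ j hj, ← fibOther_eq]
  exact SMod.mapEl_trans (B := D) _ _ (y j)

/-- The bijection of the parts of a fibre and of the fibre with the points of `V` merged. -/
def fibMergeZ (hU : ∀ i ∈ U, ρ i = l) (hV : ∀ t, t ∈ V ↔ t.1 ∈ U) (Z : I → Type) :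
    ∀ o : Option {t // t ∉ V}, TwZ (fun t : {i // ρ i = l} => Z t.1) V o
      ≃ TwZ Z U (fibMerge ρ l U V hV o).1
  | none => sigmaEquiv (fun t : {t // t ∈ V} => Z t.1.1) (fun i : {i // i ∈ U} => Z i.1)
      (fibIn ρ l U V hU hV) fun t => Equiv.refl (Z t.1.1)
  | some t => Equiv.refl (Z t.1.1)

open scoped Classical in
-- Merging globally and restricting to block `l` gives the same block as merging inside block `l`.
theorem blk_fibMerge (hU : ∀ i ∈ U, ρ i = l) (hV : ∀ t, t ∈ V ↔ t.1 ∈ U)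
    (y : ∀ j, (D.obj {i // ρ i = j}).El) (b : ∀ i, (A.obj (Z i)).El) {N q : ℤ}
    (ω : A.obj (Σ t : {t // t ∈ V}, Z t.1.1) N) (x : D.obj (Option {t // t ∉ V}) p)
    (h : p + (N + ∑ t : {t // t ∉ V}, (b t.1.1).deg) = q) :
    letI := optOrd {i // i ∉ U}
    blk c κ μ (freeB (splitFib ρ U) (splitY ρ U y) l (splitFib_inr ρ l U hU)
          (D.map (Equiv.optionCongr (fibOut ρ l U V hV)) x) l)
        (fun o : {o // rO (splitFib ρ U) l o = l} => twB U
          ⟨N, A.map (sigmaEquiv (fun t : {t // t ∈ V} => Z t.1.1) (fun i : {i // i ∈ U} => Z i.1)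
            (fibIn ρ l U V hU hV) fun t => Equiv.refl (Z t.1.1)) ω⟩ b o.1)
      = (twisted c κ μ).mapEl ((twE (fun t : {i // ρ i = l} => Z t.1) V).symm.trans
          (sigmaEquiv (TwZ (fun t : {i // ρ i = l} => Z t.1) V)
          (fun o : {o // rO (splitFib ρ U) l o = l} => TwZ Z U o.1) (fibMerge ρ l U V hV)
          (fibMergeZ ρ l U V hU hV Z)))
        ⟨q, CompMod.mk (twSym (A := A) (Equiv.refl (Σ t : {i // ρ i = l}, Z t.1)) (fun t => b t.1) V
          ⟨p, x⟩ ⟨N, ω⟩ h)⟩ := by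
  let _ := optOrd {i // i ∉ U}
  let _ := optOrd {t // t ∉ V}
  rw [← SMod.mapEl_trans]
  -- Relabelling back along `twE` turns the merged generator into one whose decomposition is the
  -- identity, that is, into a `blk`.
  have h1 : (twisted c κ μ).mapEl (twE (fun t : {i // ρ i = l} => Z t.1) V).symm
      ⟨q, CompMod.mk (twSym (A := A) (Equiv.refl (Σ t : {i // ρ i = l}, Z t.1)) (fun t => b t.1) V
          ⟨p, x⟩ ⟨N, ω⟩ h)⟩
      = blk c κ μ (Z := TwZ (fun t : {i // ρ i = l} => Z t.1) V) ⟨p, x⟩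
        (twB V ⟨N, ω⟩ fun t : {i // ρ i = l} => b t.1) := by
    refine Eq.trans ?_ (blk_eq c κ μ (n := q) (by rw [Fintype.sum_option]; exact h)).symm
    refine congrArg (GrMod.El.mk q) ((CompMod.map_mk _ _).trans ?_)
    refine congrArg CompMod.mk ?_
    unfold Sym.map twSym
    congr 1
    exact Equiv.ext fun z => Equiv.symm_apply_apply (twE (fun t : {i // ρ i = l} => Z t.1) V) z
  rw [h1]
  refine blk_move_of_lt c κ μ (Z := TwZ (fun t : {i // ρ i = l} => Z t.1) V)
    (Z' := fun o : {o // rO (splitFib ρ U) l o = l} => TwZ Z U o.1) (fibMerge ρ l U V hV)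
    ?_ (fibMergeZ ρ l U V hU hV Z) ?_ ?_
  · rintro (_ | o) (_ | o') h
    · exact absurd h (WithBot.not_lt_bot (α := {t // t ∉ V}) _)
    · exact WithBot.bot_lt_coe (α := {i // i ∉ U}) _
    · exact absurd h (WithBot.not_lt_bot (α := {t // t ∉ V}) _)
    · exact WithBot.coe_lt_coe.2 ((WithBot.coe_lt_coe (α := {t // t ∉ V})).1 h)
  · rw [freeB_self]
    exact congrArg (GrMod.El.mk p) (D.map_trans _ _ x).symm
  · rintro (_ | t)
    · rfl
    · exact congrArg (GrMod.El.mk _) (A.map_refl _).symm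

end TwistingTerm

/-! ### One merging term as a change of one block -/

section TwistingSum

variable {B : SMod.{u''} k} {D : SMod.{u} k} {O : SMod.{u'} k} {A : SMod.{v'} k}
  (c : Coaction D D) (κ : Twist D O) (μ : (comp O A).Hom A)
  {I J : Type} [Fintype I] [LinearOrder I] [Fintype J] [LinearOrder J] {Z : I → Type}
  [∀ i, Finite (Z i)] {X : Type} {n m p : ℤ}
  (ρ : I → J) (l : J) (U : Set I) (V : Set {i // ρ i = l})

open scoped Classical in
-- Combines the two previous descriptions of blocks into an equality of generators of `B ∘ (D ∘_κ
-- A)`. The index set `J` is fixed, so the outer relabelling has no sign.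
theorem mk_asym_merge (hU : ∀ i ∈ U, ρ i = l) (hV : ∀ t, t ∈ V ↔ t.1 ∈ U)
    (φ : (Σ i, Z i) ≃ X) (β : (B.obj J).El) (y : ∀ j, (D.obj {i // ρ i = j}).El)
    (b : ∀ i, (A.obj (Z i)).El) (hd : β.deg + ∑ j, (y j).deg + ∑ i, (b i).deg = n) (hm : m + 1 = n)
    {N : ℤ} (ω : A.obj (Σ t : {t // t ∈ V}, Z t.1.1) N) (x : D.obj (Option {t // t ∉ V}) p)
    (h : p + (N + ∑ t : {t // t ∉ V}, (b t.1.1).deg)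
      = (y l).deg + ∑ i : {i // ρ i = l}, (b i.1).deg - 1) (hd') :
    letI := optOrd {i // i ∉ U}
    CompMod.mk (asym (n := m) c κ μ ((twE Z U).trans φ) (rO (splitFib ρ U) l) β
        (freeB (splitFib ρ U) (splitY ρ U y) l (splitFib_inr ρ l U hU)
          (D.map (Equiv.optionCongr (fibOut ρ l U V hV)) x))
        (twB U ⟨N, A.map (sigmaEquiv (fun t : {t // t ∈ V} => Z t.1.1)
          (fun i : {i // i ∈ U} => Z i.1) (fibIn ρ l U V hU hV) fun t => Equiv.refl (Z t.1.1)) ω⟩ b)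
          hd')
      = ains c κ μ φ ρ β y b hd hm l (CompMod.mk (twSym (A := A)
          (Equiv.refl (Σ t : {i // ρ i = l}, Z t.1)) (fun t => b t.1) V ⟨p, x⟩ ⟨N, ω⟩ h)) := by
  let _ := optOrd {i // i ∉ U}
  set w : CompMod D A (Σ t : {i // ρ i = l}, Z t.1) _ := CompMod.mk (twSym (A := A)
          (Equiv.refl (Σ t : {i // ρ i = l}, Z t.1)) (fun t => b t.1) V ⟨p, x⟩ ⟨N, ω⟩ h) with hw
  let Y := freeB (splitFib ρ U) (splitY ρ U y) l (splitFib_inr ρ l U hU)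
          (D.map (Equiv.optionCongr (fibOut ρ l U V hV)) x)
  let b' := twB U ⟨N, A.map (sigmaEquiv (fun t : {t // t ∈ V} => Z t.1.1)
          (fun i : {i // i ∈ U} => Z i.1) (fibIn ρ l U V hU hV) fun t => Equiv.refl (Z t.1.1)) ω⟩ b
  let x' : ∀ j, ((twisted c κ μ).obj (Σ i : {i // ρ i = j}, Z i.1)).El :=
    Function.update (fun j => blk c κ μ (y j) fun i : {i // ρ i = j} => b i.1) l
      ⟨(y l).deg + ∑ i : {i // ρ i = l}, (b i.1).deg - 1, w⟩
  -- For each `j` a bijection of the parts over `X` and the matching equality of blocks; the cases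
  -- `j = l` and `j ≠ l` differ in both.
  have key : ∀ j, ∃ H : (Σ i : {i // ρ i = j}, Z i.1)
        ≃ Σ o : {o // rO (splitFib ρ U) l o = j}, TwZ Z U o.1,
      (∀ z, twE Z U ⟨(H z).1.1, (H z).2⟩ = ⟨z.1.1, z.2⟩) ∧
      blk c κ μ (Y j) (fun o : {o // rO (splitFib ρ U) l o = j} => b' o.1)
        = (twisted c κ μ).mapEl H (x' j) := fun j => by
    by_cases hj : j = l
    · subst hj
      refine ⟨(twE (fun t : {i // ρ i = j} => Z t.1) V).symm.trans
        (sigmaEquiv (TwZ (fun t : {i // ρ i = j} => Z t.1) V)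
          (fun o : {o // rO (splitFib ρ U) j o = j} => TwZ Z U o.1) (fibMerge ρ j U V hV)
          (fibMergeZ ρ j U V hU hV Z)), ?_, (blk_fibMerge c κ μ ρ j U V hU hV y b ω x h).trans ?_⟩
      · intro z
        obtain ⟨z, rfl⟩ := (twE (fun t : {i // ρ i = j} => Z t.1) V).surjective z
        rw [Equiv.trans_apply, Equiv.symm_apply_apply]
        rcases z with ⟨_ | t, z⟩ <;> rfl
      · exact congrArg _ (Function.update_self (f := fun j =>
          blk c κ μ (y j) fun i : {i // ρ i = j} => b i.1) j _).symm
    · refine ⟨sigmaEquiv (fun i : {i // ρ i = j} => Z i.1)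
          (fun o : {o // rO (splitFib ρ U) l o = j} => TwZ Z U o.1) (fibOther ρ l U hU j hj)
          fun i => Equiv.refl (Z i.1), ?_, (blk_fibOther c κ μ ρ l U hU y b _ _ j hj).trans ?_⟩
      · rintro ⟨i, z⟩
        rfl
      · exact congrArg _ (Function.update_of_ne hj _ (fun j =>
          blk c κ μ (y j) fun i : {i // ρ i = j} => b i.1)).symm
  choose H hH hb using key
  let t : Sym B (twisted c κ μ) X m := asym c κ μ ((twE Z U).trans φ) (rO (splitFib ρ U) l) β Y b' hd'
  have hx : β.deg + ∑ j, (x' j).deg = m := by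
    refine Eq.trans (congrArg (β.deg + ·) (Finset.sum_congr rfl fun j _ => ?_)) t.deg
    exact (congrArg GrMod.El.deg (hb j)).symm
  let s : Sym B (twisted c κ μ) X m :=
    ⟨J, fun j => Σ i : {i // ρ i = j}, Z i.1, (fibSigma ρ Z).trans φ, β, x', hx⟩
  refine (CompMod.mk_move (s := s) (t := t) ⟨Equiv.refl J, H, fun j z => congrArg φ (hH j z),
    congrArg (GrMod.El.mk _) (B.map_refl _).symm, hb⟩).trans ?_
  refine (congrArg (fun z => sg k z • _) (inv_refl _)).trans ?_
  rw [sg_zero, one_smul]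
  rfl

end TwistingSum

/-! ### The associativity map and the twisting term -/

section TwistingMap

variable {B : SMod.{u''} k} {D : SMod.{u} k} {O : SMod.{u'} k} {A : SMod.{v'} k}
  (c : Coaction D D) (κ : Twist D O) (μ : (comp O A).Hom A)
  {I J : Type} [Fintype I] [LinearOrder I] [Fintype J] [LinearOrder J] {Z : I → Type}
  [∀ i, Finite (Z i)] {X : Type} {n m p : ℤ}

open scoped Classical in
-- The value on one term of the twisting differential, for a pure tensor `x ⊗ γ` in the cut of
-- `y_l`, with the grouping sign of the merged list still explicit.
theorem assocMap_merge (ρ : I → J) (l : J) (U : Set I) (V : Set {i // ρ i = l})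
    (hU : ∀ i ∈ U, ρ i = l) (hV : ∀ t, t ∈ V ↔ t.1 ∈ U)
    (φ : (Σ i, Z i) ≃ X) (β : (B.obj J).El) (y : ∀ j, (D.obj {i // ρ i = j}).El)
    (b : ∀ i, (A.obj (Z i)).El) (hd : β.deg + ∑ j, (y j).deg + ∑ i, (b i).deg = n) (hm : m + 1 = n)
    {a g q N : ℤ} (x : D.obj (Option {t // t ∉ V}) a) (γ : D.obj {t // t ∈ V} g) (hN hN' h1 h2 h3) :
    assocMap c κ μ (CompMod.mk (twSym (M := comp B D) (A := A) (n := m) φ b U ⟨q, (CompMod.mk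
        (freeSym (splitFib ρ U) β (splitY ρ U y) l (splitFib_inr ρ l U hU) h1
          (D.map (Equiv.optionCongr (fibOut ρ l U V hV)) x)) : CompMod B D _ q)⟩
        ⟨N, twAct κ μ b U hN' (D.map (fibIn ρ l U V hU hV) γ)⟩ h2))
      = sg k (@assocSgn (Option {i // i ∉ U}) J _ (optOrd _) _ _ (rO (splitFib ρ U) l)
          (fun j => (freeB (splitFib ρ U) (splitY ρ U y) l (splitFib_inr ρ l U hU)
            (D.map (Equiv.optionCongr (fibOut ρ l U V hV)) x) j).deg)
          fun o => (twB U ⟨N, twAct κ μ b U hN' (D.map (fibIn ρ l U V hU hV) γ)⟩ b o).deg) •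
        ains c κ μ φ ρ β y b hd hm l (CompMod.mk (twSym (A := A)
          (Equiv.refl (Σ t : {i // ρ i = l}, Z t.1)) (fun t => b t.1) V ⟨a, x⟩
          ⟨N, twAct κ μ (fun t : {i // ρ i = l} => b t.1) V hN γ⟩ h3)) := by
  let _ := optOrd {i // i ∉ U}
  have hdeg : q + ∑ o, (twB U ⟨N, twAct κ μ b U hN' (D.map (fibIn ρ l U V hU hV) γ)⟩ b o).deg = m := by
    rw [Fintype.sum_option]; exact h2
  have hf : β.deg + ∑ j, (freeB (splitFib ρ U) (splitY ρ U y) l (splitFib_inr ρ l U hU)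
            (D.map (Equiv.optionCongr (fibOut ρ l U V hV)) x) j).deg = q := (freeSym (splitFib ρ U) β
      (splitY ρ U y) l (splitFib_inr ρ l U hU) h1 (D.map (Equiv.optionCongr (fibOut ρ l U V hV)) x)).deg
  refine (assocMap_fmk c κ μ (Z := TwZ Z U) ((twE Z U).trans φ) (rO (splitFib ρ U) l) β _ _ hf hdeg
    ((congrArg (· + _) hf).trans hdeg)).trans ?_
  refine congrArg (_ • ·) ?_
  have key := mk_asym_merge c κ μ ρ l U V hU hV φ β y b hd hm
    (twAct κ μ (fun t : {i // ρ i = l} => b t.1) V hN γ) x h3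
  rw [← twAct_fibIn κ μ ρ l U V hU hV b γ hN hN'] at key
  exact key _

open scoped Classical in
-- Both sides depend linearly on the cut of `y_l` along `V`, so this cut may be a pure tensor. Then
-- the generators agree by `assocMap_merge` and the signs by `assocSgn_merge`.
theorem assocMap_twTerm (ρ : I → J) (l : J) (U : Set I) (V : Set {i // ρ i = l})
    (hU : ∀ i ∈ U, ρ i = l) (hV : ∀ t, t ∈ V ↔ t.1 ∈ U) (hUV : U = Subtype.val '' V)
    (φ : (Σ i, Z i) ≃ X) (β : (B.obj J).El) (y : ∀ j, (D.obj {i // ρ i = j}).El)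
    (b : ∀ i, (A.obj (Z i)).El) (h : β.deg + ∑ j, (y j).deg + ∑ i, (b i).deg = n) (hm : m + 1 = n)
    (hp : β.deg + ∑ j, (y j).deg = p) (hd : p + ∑ i, (b i).deg = m + 1) (hl) :
    assocMap c κ μ (twTerm κ μ φ b U hd (freeVal c (splitFib ρ U) β (splitY ρ U y) hp l))
      = sg k (assocSgn ρ (fun j => (y j).deg) (fun i => (b i).deg) + (β.deg + ∑ j, if j < l then
          (y j).deg + ∑ i : {i // ρ i = j}, (b i.1).deg else 0)) •
        ains c κ μ φ ρ β y b h hm l (twVal c κ μ (Equiv.refl (Σ t : {i // ρ i = l}, Z t.1)) (y l)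
          (fun t => b t.1) hl V) := by
  have h0 : D.map (eqI (splitFib ρ U) l (splitFib_inr ρ l U hU)) (splitY ρ U y l).val
      = D.map (Equiv.sumCongr (fibOut ρ l U V hV) (fibIn ρ l U V hU hV))
        (D.map (splitEquiv V) (y l).val) := by
    refine (D.map_trans _ _ _).symm.trans (Eq.trans ?_ (D.map_trans _ _ _))
    rw [fib_split ρ l U V hU hV]
  rw [freeVal_pos c _ β _ hp l (splitFib_inr ρ l U hU) rfl rfl, h0]
  -- Naturality of the coaction moves the relabelling of the fibre past the cut, so that both sides
  -- start from the same element.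
  refine (congrArg (fun z => assocMap c κ μ (twTerm κ μ φ b U hd (freeTerm _ β _ l _ hp rfl z)))
    (c.nat _ _ _)).trans ?_
  unfold twVal
  refine LinearMap.congr_fun (f := assocMap c κ μ ∘ₗ twTerm κ μ φ b U hd ∘ₗ
      freeTerm (splitFib ρ U) β (splitY ρ U y) l (splitFib_inr ρ l U hU) hp (N := (y l).deg) rfl ∘ₗ
      tmap (fun _ => D.map (Equiv.optionCongr (fibOut ρ l U V hV)))
        (fun _ => D.map (fibIn ρ l U V hU hV)))
    (g := sg k (assocSgn ρ (fun j => (y j).deg) (fun i => (b i).deg) + (β.deg + ∑ j, if j < l then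
          (y j).deg + ∑ i : {i // ρ i = j}, (b i.1).deg else 0)) •
      (ains c κ μ φ ρ β y b h hm l ∘ₗ twTerm κ μ (Equiv.refl (Σ t : {i // ρ i = l}, Z t.1))
        (fun t => b t.1) V hl)) (tens_ext fun a g hag x γ => ?_)
    (c.δ _ _ _ (D.map (splitEquiv V) (y l).val))
  have hVU := degOn_fibIn ρ l U V hU hV fun i => (b i).deg
  have hN : g + degOn V (fun t => (b t.1).deg) = g - 1 + degOn V (fun t => (b t.1).deg) + 1 := by
    omega
  have hN' : g + degOn U (fun i => (b i).deg) = g - 1 + degOn V (fun t => (b t.1).deg) + 1 := by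
    omega
  rw [LinearMap.comp_apply, LinearMap.comp_apply, LinearMap.comp_apply, LinearMap.smul_apply,
    LinearMap.comp_apply, tmap_tmk]
  rw [twTerm_tmk κ μ _ (fun t : {i // ρ i = l} => b t.1) V hl hag x γ hN (tw_deg V hl hag)]
  have hf := freeTerm_tmk (splitFib ρ U) β (splitY ρ U y) l (splitFib_inr ρ l U hU) hp (N := (y l).deg)
    rfl hag (D.map (Equiv.optionCongr (fibOut ρ l U V hV)) x) (D.map (fibIn ρ l U V hU hV) γ)
  have ht := fun F => twTerm_tmk (M := comp B D) κ μ φ b U hd (show p - g + g = p by omega) F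
    (D.map (fibIn ρ l U V hU hV) γ) hN' (by
      have := tw_deg U hd (p := p - g) (c := g) (by omega)
      omega)
  refine (congrArg (fun z => assocMap c κ μ (twTerm κ μ φ b U hd z)) hf).trans ?_
  refine (congrArg (assocMap c κ μ) ((map_smul (twTerm κ μ φ b U hd) _ _).trans
    (congrArg (_ • ·) (ht _)))).trans ?_
  refine (map_smul (assocMap c κ μ) _ _).trans ((congrArg (_ • ·)
    (map_smul (assocMap c κ μ) _ _)).trans ?_)
  refine (congrArg (fun z => _ • _ • z) (assocMap_merge c κ μ ρ l U V hU hV φ β y b h hm x γ hN hN' _ _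
    (tw_deg V hl hag))).trans ?_
  rw [map_smul, smul_smul, smul_smul, smul_smul, ← sg_add, ← sg_add, ← sg_add]
  refine congrArg (· • _) (sg_congr ?_)
  have key := assocSgn_merge ρ l U hU (fun j => (y j).deg) (fun j => (freeB (splitFib ρ U)
    (splitY ρ U y) l (splitFib_inr ρ l U hU) (D.map (Equiv.optionCongr (fibOut ρ l U V hV)) x) j).deg)
    (fun i => (b i).deg) g a β.deg p hag.symm (fun j => freeB_deg ..)
    (fun o => (twB U ⟨_, twAct κ μ b U hN' (D.map (fibIn ρ l U V hU hV) γ)⟩ b o).deg)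
    (rO (splitFib ρ U) l) (congrArg (g - 1 + ·) hVU.symm) (fun _ => rfl) rfl (fun _ => rfl) hp
  have hsh := shufExp_fibre ρ l V fun i => (b i).deg
  rw [← hUV] at hsh
  rw [← hsh, ← add_assoc] at key
  rw [← add_assoc]
  exact key

open scoped Classical in
-- The twisting term runs over pairs of a subset `U` of `I` and an index `l` whose factor is cut;
-- only pairs with `U` in the fibre over `l` survive. These correspond to pairs of `l` and a subset
-- `V` of the fibre, which index the twisting terms inside the blocks.
theorem assocMap_dTw (ρ : I → J) (φ : (Σ i, Z i) ≃ X) (β : (B.obj J).El)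
    (y : ∀ j, (D.obj {i // ρ i = j}).El) (b : ∀ i, (A.obj (Z i)).El)
    (h : β.deg + ∑ j, (y j).deg + ∑ i, (b i).deg = n) (hm : m + 1 = n)
    (hp : β.deg + ∑ j, (y j).deg = p) (hd : p + ∑ i, (b i).deg = n) :
    assocMap c κ μ (dTw (Coaction.free B c) κ μ hm
        (CompMod.mk ⟨I, Z, φ, ⟨p, fmk ρ β y hp⟩, b, hd⟩))
      = ∑ l, sg k (assocSgn ρ (fun j => (y j).deg) (fun i => (b i).deg) + (β.deg + ∑ j, if j < l then
          (y j).deg + ∑ i : {i // ρ i = j}, (b i.1).deg else 0)) •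
        ains c κ μ φ ρ β y b h hm l (dTw c κ μ (sub_add_cancel _ 1) (bmk ρ y b l)) := by
  have h1 : dTw (Coaction.free B c) κ μ hm (CompMod.mk ⟨I, Z, φ, ⟨p, fmk ρ β y hp⟩, b, hd⟩)
      = ∑ U : Set I, ∑ l, twTerm (M := comp B D) κ μ φ b U (hd.trans hm.symm)
        (freeVal c (splitFib ρ U) β (splitY ρ U y) hp l) :=
    (dTw_mk _ κ μ hm _).trans (Finset.sum_congr rfl fun U _ => twVal_fmk c κ μ φ ρ β y b hp _ U)
  rw [h1, Finset.sum_comm, map_sum]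
  refine Finset.sum_congr rfl fun l _ => ?_
  unfold bmk
  rw [dTw_mk, map_sum, map_sum, Finset.smul_sum]
  -- For fixed `l`, subsets of the fibre are identified with their images in `I`. The empty set
  -- belongs to every `l` and is counted once for each on both sides.
  refine Eq.symm (Fintype.sum_of_injective (fun V : Set {i // ρ i = l} => Subtype.val '' V)
    (Set.image_injective.2 Subtype.val_injective) _ _ (fun U hU => ?_) fun V => ?_)
  -- A subset that is not such an image is not contained in the fibre over `l`, so the piece cut off
  -- from `y_l` cannot carry it.
  · have h0 : ¬ ∀ q, splitFib ρ U (Sum.inr q) = l := fun hq => hU ⟨Subtype.val ⁻¹' U,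
      (Subtype.image_preimage_coe _ _).trans (Set.inter_eq_right.2 fun i hi => hq ⟨i, hi⟩)⟩
    exact (congrArg (fun z => assocMap c κ μ (twTerm κ μ φ b U _ z)) (freeVal_neg c (splitFib ρ U) β
      (splitY ρ U y) hp l h0)).trans ((congrArg _ (map_zero _)).trans (map_zero _))
  · exact (assocMap_twTerm c κ μ ρ l (Subtype.val '' V) V (fun i ⟨t, _, ht⟩ => ht ▸ t.2)
      (fun t => ⟨fun ht => ⟨t, ht, rfl⟩, fun ⟨s, hs, hst⟩ => Subtype.ext hst ▸ hs⟩) rfl φ β y b h hm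
      hp _ _).symm

end TwistingMap

/-! ### The isomorphism `(B ∘ D) ∘_κ A ≅ B ∘ (D ∘_κ A)` -/

section AssocIso

variable {B : SMod.{u''} k} {D : SMod.{u} k} {O : SMod.{u'} k} {A : SMod.{v'} k}
  (c : Coaction D D) (κ : Twist D O) (μ : (comp O A).Hom A)

theorem assocMap_map {X Y : Type} [Finite X] [Finite Y] (e : X ≃ Y) {n : ℤ}
    (x : CompMod (comp B D) A X n) :
    assocMap c κ μ (CompMod.map e x) = CompMod.map e (assocMap c κ μ x) := by
  refine LinearMap.congr_fun (f := assocMap c κ μ ∘ₗ CompMod.map e)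
    (g := CompMod.map e ∘ₗ assocMap c κ μ) (compMod_ext fun φ b p hd r => ?_) x
  rw [LinearMap.comp_apply, LinearMap.comp_apply, CompMod.map_mk, assocMap_mk_mk]
  refine (assocMap_mk_mk c κ μ (φ.trans e) b hd r).trans ?_
  refine ((map_smul (CompMod.map e) _ _).trans ?_).symm
  exact congrArg _ (CompMod.map_mk e _)

/-- On normal forms the internal part and the twisting part are both sums over blocks with the same
signs, and their sum is the expansion of `d_amk`. -/
theorem assocMap_twisted_d {X : Type} [Finite X] {n m : ℤ} (hm : m + 1 = n)
    (x : CompMod (comp B D) A X n) :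
    assocMap c κ μ (CompMod.d hm x + dTw (Coaction.free B c) κ μ hm x)
      = CompMod.d hm (assocMap c κ μ x) := by
  refine LinearMap.congr_fun (f := assocMap c κ μ ∘ₗ (CompMod.d hm + dTw (Coaction.free B c) κ μ hm))
    (g := CompMod.d hm ∘ₗ assocMap c κ μ) (fmk_ext fun φ ρ β y b p hp hd => ?_) x
  have h := (congrArg (· + _) hp).trans hd
  rw [LinearMap.comp_apply, LinearMap.add_apply, LinearMap.comp_apply, map_add,
    assocMap_d c κ μ hm φ ρ β y b hp hd h, assocMap_dTw c κ μ ρ φ β y b h hm hp hd,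
    assocMap_fmk c κ μ φ ρ β y b hp hd h, d_amk, add_assoc, ← Finset.sum_add_distrib]
  refine congrArg (_ + ·) (Finset.sum_congr rfl fun l _ => ?_)
  rw [map_add, smul_add]

/-- The isomorphism `(B ∘ D) ∘_κ A ≅ B ∘ (D ∘_κ A)`. -/
def assocIso (B : SMod.{u''} k) : SMod.Iso (twisted (Coaction.free B c) κ μ) (comp B (twisted c κ μ)) where
  app X _ n := assocMap c κ μ
  app_map e n x := assocMap_map c κ μ e x
  app_d h x := assocMap_twisted_d c κ μ h x
  bijective X _ n := ⟨Function.LeftInverse.injective (assocInv_assocMap c κ μ), assocMap_surjective c κ μ⟩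

end AssocIso

/-! ### Functoriality of the twisted composition product -/

section TwistedHom

variable {M : SMod.{u} k} {N : SMod.{u''} k} {C : SMod.{v} k} {C' : SMod.{v''} k} {O : SMod.{u'} k}
  {O' : SMod.{w'} k} {A : SMod.{v'} k}

/-- The inverse of an isomorphism. -/
def SMod.Iso.symm (ψ : SMod.Iso M N) : SMod.Iso N M where
  app X _ n := (LinearEquiv.ofBijective (ψ.app X (n := n)) (ψ.bijective X)).symm
  app_map {X Y} _ _ e n x := by
    refine (LinearEquiv.symm_apply_eq _).2 (Eq.symm ((ψ.app_map e _).trans (congrArg _ ?_)))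
    exact (LinearEquiv.ofBijective (ψ.app X (n := n)) (ψ.bijective X)).apply_symm_apply x
  app_d {X} _ i j h x := by
    refine (LinearEquiv.symm_apply_eq _).2 (Eq.symm ((ψ.app_d h _).trans (congrArg _ ?_)))
    exact (LinearEquiv.ofBijective (ψ.app X (n := i)) (ψ.bijective X)).apply_symm_apply x
  bijective X _ n := (LinearEquiv.ofBijective (ψ.app X (n := n)) (ψ.bijective X)).symm.bijective

/-- Composition of isomorphisms. -/
def SMod.Iso.trans (ψ : SMod.Iso M N) (χ : SMod.Iso N C) : SMod.Iso M C where
  toHom := χ.toHom.after ψ.toHom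
  bijective X _ _ := (χ.bijective X).comp (ψ.bijective X)

/-- The identity isomorphism. -/
def SMod.Iso.refl (M : SMod.{u} k) : SMod.Iso M M := ⟨SMod.Hom.id M, fun _ _ _ => Function.bijective_id⟩

theorem CompMod.hom_hom_id (ψ : M.Hom N) (χ : N.Hom M)
    (h : ∀ (X : Type) [Finite X] {n : ℤ} (x : M.obj X n), χ.app X (ψ.app X x) = x) {X : Type} {n : ℤ}
    (x : CompMod M A X n) :
    CompMod.hom χ (SMod.Hom.id A) (CompMod.hom ψ (SMod.Hom.id A) x) = x := by
  refine LinearMap.congr_fun (f := CompMod.hom χ (SMod.Hom.id A) ∘ₗ CompMod.hom ψ (SMod.Hom.id A))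
    (g := LinearMap.id) (CompMod.hom_ext fun s => ?_) x
  rw [LinearMap.comp_apply, LinearMap.id_apply, CompMod.hom_mk, CompMod.hom_mk]
  exact congrArg CompMod.mk (Sym.eq_of s.φ (congrArg (GrMod.El.mk _) (h _ _)) (fun _ => rfl) _ _)

theorem CompMod.hom_bijective (ψ : SMod.Iso M N) {X : Type} {n : ℤ} :
    Function.Bijective (CompMod.hom (X := X) (n := n) ψ.toHom (SMod.Hom.id A)) :=
  ⟨Function.LeftInverse.injective (CompMod.hom_hom_id ψ.toHom ψ.symm.toHom fun X _ n =>
      (LinearEquiv.ofBijective (ψ.app X (n := n)) (ψ.bijective X)).symm_apply_apply),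
    Function.RightInverse.surjective (CompMod.hom_hom_id ψ.symm.toHom ψ.toHom fun X _ n =>
      (LinearEquiv.ofBijective (ψ.app X (n := n)) (ψ.bijective X)).apply_symm_apply)⟩

variable (c : Coaction M C) (κ : Twist C O) (μ : (comp O A).Hom A) (c' : Coaction N C')
  (κ' : Twist C' O') (μ' : (comp O' A).Hom A)

/-- The twisting term sees the twisting morphism only through the action on `A`. So `hκ` compares
the actions rather than values in the operads, which allows two different operads acting on the same
`A`. -/
theorem twVal_hom (ψ : M.Hom N) (g : C.Hom C')
    (hδ : ∀ {P Q : Type} [Finite P] [Finite Q] {n : ℤ} (x : M.obj (P ⊕ Q) n),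
      c'.δ P Q n (ψ.app (P ⊕ Q) x) = tmap (fun _ => ψ.app (Option P)) (fun _ => g.app Q) (c.δ P Q n x))
    (hκ : ∀ {I : Type} [Fintype I] [LinearOrder I] {Z : I → Type} [∀ i, Finite (Z i)]
      (b : ∀ i, (A.obj (Z i)).El) {i j n : ℤ} (h : j + 1 = i) (γ : C.obj I i)
      (hd : j + ∑ i, (b i).deg = n), actv μ' Z ⟨j, κ'.app I h (g.app I γ)⟩ b hd
        = actv μ Z ⟨j, κ.app I h γ⟩ b hd)
    {I : Type} [Fintype I] [LinearOrder I] {Z : I → Type} [∀ i, Finite (Z i)] {X : Type}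
    (φ : (Σ i, Z i) ≃ X) (m : (M.obj I).El) (b : ∀ i, (A.obj (Z i)).El) {n : ℤ}
    (h : m.deg + ∑ i, (b i).deg = n + 1) (U : Set I) :
    twVal c' κ' μ' φ (ψ.el m) b h U
      = CompMod.hom ψ (SMod.Hom.id A) (twVal c κ μ φ m b h U) := by
  classical
  have h1 : N.map (splitEquiv U) (ψ.app _ m.val) = ψ.app _ (M.map (splitEquiv U) m.val) :=
    (ψ.app_map _ _).symm
  refine (congrArg (twTerm κ' μ' φ b U h) ((congrArg (c'.δ _ _ _) h1).trans (hδ _))).trans ?_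
  refine LinearMap.congr_fun (f := twTerm κ' μ' φ b U h ∘ₗ
      tmap (fun _ => ψ.app (Option {i // i ∉ U})) (fun _ => g.app {i // i ∈ U}))
    (g := CompMod.hom ψ (SMod.Hom.id A) ∘ₗ twTerm κ μ φ b U h) (tens_ext fun p q hpq x γ => ?_)
    (c.δ _ _ _ (M.map (splitEquiv U) m.val))
  have hD : q + degOn U (fun i => (b i).deg) = (q - 1 + degOn U (fun i => (b i).deg)) + 1 := by
    omega
  rw [LinearMap.comp_apply, LinearMap.comp_apply, tmap_tmk,
    twTerm_tmk κ' μ' φ b U h hpq _ _ hD (tw_deg U h hpq),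
    twTerm_tmk κ μ φ b U h hpq x γ hD (tw_deg U h hpq), map_smul, CompMod.hom_mk]
  refine congrArg (_ • ·) (congrArg CompMod.mk ?_)
  refine @Sym.eq_of k _ N A X n (Option {i // i ∉ U}) _ (optOrd _) (TwZ Z U) _ _ _ _ _ _ rfl ?_ _ _
  -- Only the merged factor involves the twisting morphisms; the remaining factors are literally
  -- equal.
  rintro (_ | i)
  · exact congrArg (GrMod.El.mk _) (hκ (fun i : {i // i ∈ U} => b i.1) _ γ _)
  · rfl

/-- The isomorphism of twisted composition products given by an isomorphism of the comodules that is
compatible with the twisting morphisms. -/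
def twistedIso (ψ : SMod.Iso M N) (g : C.Hom C')
    (hδ : ∀ {P Q : Type} [Finite P] [Finite Q] {n : ℤ} (x : M.obj (P ⊕ Q) n),
      c'.δ P Q n (ψ.app (P ⊕ Q) x) = tmap (fun _ => ψ.app (Option P)) (fun _ => g.app Q) (c.δ P Q n x))
    (hκ : ∀ {I : Type} [Fintype I] [LinearOrder I] {Z : I → Type} [∀ i, Finite (Z i)]
      (b : ∀ i, (A.obj (Z i)).El) {i j n : ℤ} (h : j + 1 = i) (γ : C.obj I i)
      (hd : j + ∑ i, (b i).deg = n), actv μ' Z ⟨j, κ'.app I h (g.app I γ)⟩ b hd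
        = actv μ Z ⟨j, κ.app I h γ⟩ b hd) :
    SMod.Iso (twisted c κ μ) (twisted c' κ' μ') where
  app X _ n := CompMod.hom ψ.toHom (SMod.Hom.id A)
  app_map e n x := (compMap ψ.toHom (SMod.Hom.id A)).app_map e x
  app_d {X} _ i j h x := by
    refine (map_add _ _ _).trans (congrArg₂ _ ((compMap ψ.toHom (SMod.Hom.id A)).app_d h x) ?_)
    refine LinearMap.congr_fun (f := CompMod.hom ψ.toHom (SMod.Hom.id A) ∘ₗ dTw c κ μ h)
      (g := dTw c' κ' μ' h ∘ₗ CompMod.hom ψ.toHom (SMod.Hom.id A)) (CompMod.hom_ext fun s => ?_) x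
    rw [LinearMap.comp_apply, LinearMap.comp_apply, CompMod.hom_mk, dTw_mk, dTw_mk, map_sum]
    exact Finset.sum_congr rfl fun U _ => (twVal_hom c κ μ c' κ' μ' ψ.toHom g hδ hκ s.φ s.a s.b _ U).symm
  bijective X _ _ := CompMod.hom_bijective ψ

end TwistedHom

/-! ### The twisting morphisms and morphisms of quadratic data -/

/-- The twisting morphisms see only weight one, where the map of dual cooperads is the suspension of
the map of generators; on generators the map of operads is this same map. What remains is naturality
of `cap`. -/
theorem QuadData.Hom.kappa_dualHom {q q' : QuadData.{u} k} (f : q.Hom q') {X : Type} [Finite X]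
    {i j : ℤ} (h : j + 1 = i) (x : q.dual.obj X i) :
    q'.kappa X h (f.dualHom.app X x) = f.operadHom.app X (q.kappa X h x) := by
  -- With this degree the transport in the definition of `kappa` is along a trivial equality and
  -- disappears.
  obtain rfl : j = i - 1 := by omega
  exact congrArg (q'.gen.app X) (cap_hom (suspMap f.toHom) (trOut (susp q.V) 1 (q.incl.app X x)))

/-- The bar complex of the restriction of an algebra along a morphism of operads. -/
def barPullbackIso {q q' : QuadData.{u} k} (f : q.Hom q') (A : SAlg.{max 1 u w, v} q'.operad) :
    SMod.Iso (q.bar (A.pullback f.operadHom)) (twisted (q.coself.push f.dualHom) q'.twist A.act) :=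
  twistedIso _ _ _ _ _ _ (SMod.Iso.refl _) f.dualHom (fun _ => rfl) fun {I} _ _ {Z} _ b i j n h γ hd => by
    -- The action on the restricted algebra is, on generators, the old action after applying the map
    -- of operads, so the square of twisting morphisms gives equality of actions.
    have h1 : q'.twist.app I h (f.dualHom.app I γ) = f.operadHom.app I (q.twist.app I h γ) :=
      f.kappa_dualHom h γ
    rw [h1]
    exact congrArg (A.act.app _) (CompMod.hom_mk f.operadHom.toHom (SMod.Hom.id _)
      ⟨I, Z, Equiv.refl _, ⟨j, q.twist.app I h γ⟩, b, hd⟩).symm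

end KoszulBar

end

/-! ### The theorem -/

theorem mainTheorem4 {k : Type w} [Field k] {q : KoszulBar.QuadData.{u} k}
    {q' : KoszulBar.QuadData.{u} k} (hq : q.IsKoszul) (hq' : q'.IsKoszul)
    (f : KoszulBar.QuadData.Hom q q') (A : KoszulBar.Alg.{max 1 u w, v} q'.operad) :
    Nonempty (KoszulBar.SMod.Iso (q.bar (A.pullback f.operadHom).toSAlg)
      (KoszulBar.twisted (q.coself.push f.dualHom) q'.twist A.act)) ∧
    ∀ B : KoszulBar.SMod.{u'} k, B.IsDG →
      Nonempty (KoszulBar.Coaction.Iso (q.coself.push f.dualHom)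
        (KoszulBar.Coaction.free B q'.coself)) →
      Nonempty (KoszulBar.SMod.Iso (q.bar (A.pullback f.operadHom).toSAlg)
        (KoszulBar.comp B (q'.bar A.toSAlg))) := by
  refine ⟨⟨KoszulBar.barPullbackIso f A.toSAlg⟩, fun B _ ⟨ψ⟩ => ⟨?_⟩⟩
  refine (KoszulBar.barPullbackIso f A.toSAlg).trans (KoszulBar.SMod.Iso.trans ?_
    (KoszulBar.assocIso q'.coself q'.twist A.act B))
  -- The comodule isomorphism lies over the identity of the cooperad, and both sides use the same
  -- twisting morphism and action, so the compatibility of actions is definitional.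
  exact KoszulBar.twistedIso _ _ _ _ _ _ ψ.toIso (KoszulBar.SMod.Hom.id _) ψ.app_δ
    fun _ _ _ _ _ _ _ => rfl
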